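/- **Setting.** Let $\Theta=\{x\in\mathbb R^2:|x|<1\}$ with the measure $dL=\frac1{4\pi}\,r\,d\theta\,dr$, let $0<z_1<z_2<\cdots$ be the positive zeros of the Bessel function $J_0$, and let $e_n(x)=J_0(z_n|x|)/\|J_0(z_n|\cdot|)\|_{L^2(\Theta)}$ be the radial Dirichlet eigenfunctions of $-\Delta$, with eigenvalues $z_n^2$. For radial $u=\sum_n c_ne_n$ set $\|u\|_{H^\sigma}^2=\sum_n z_n^{2\sigma}|c_n|^2$ and $(-\Delta)^\alpha u=\sum_n z_n^{2\alpha}c_ne_n$. For $u(t)=\sum_n c_n(t)e_n$ and $\sigma,b\ge 0$ set $$\|u\|_{X^{\sigma,b}}^2=\sum_n\big\|\langle\tau+z_n^{2\alpha}\rangle^{b}\langle z_n\rangle^{\sigma}\,\widehat{c_n}(\tau)\big\|_{L^2(\mathbb R_\tau)}^2,\qquad \langle y\rangle=(1+y^2)^{1/2},$$ and, for a set $J$ of times, let $\|u\|_{X^{\sigma,b}(J)}$ be the infimum of $\|\tilde u\|_{X^{\sigma,b}}$ over all $\tilde u$ on $\mathbb R\times\Theta$ with $\tilde u=u$ on $J\times\Theta$;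 put $X^{\sigma,b}_T=X^{\sigma,b}((-T,T))$. Let $\frac12<s<\alpha\le1$. For $N\ge1$ let $I=I_N$ be given by $I\big(\sum_n c_ne_n\big)=\sum_n m(z_n)c_ne_n$, where $m=m_N$ is smooth, $m(\xi)=1$ for $|\xi|\le N$, $m(\xi)=|\xi/N|^{s-\alpha}$ for $|\xi|\ge2N$, and $2^{s-\alpha}\le m(\xi)\le1$ for $N\le|\xi|\le2N$. Consider radial solutions of $$(i\partial_t-(-\Delta)^\alpha)Iu=I(|u|^2u),\qquad Iu(0)=Iu_0. \tag{1}$$ A solution on a time interval $J$ is a $u$ with $Iu\in C(J,H^\alpha)$ and $u(t)\in L^3(\Theta)$ for all $t\in J$ that satisfies the initial condition and, for every $t\in J$, the equation in the coefficient of each $e_n$. **Proposition (local well-posedness of the $I$-modified equation).** Let $b(s)\in\big(\frac14+\frac12(1-s),\frac12\big)$. There is $b_0>\frac12$, depending only on $\alpha,s,b(s)$, such that for every $b\in(\frac12,b_0)$, with $$p=\frac{2}{1+2b-4b(s)}>0,$$ there are constants $c,C>0$, depending only on $\alpha,s,b(s),b$, such that the following holds for all $N\ge1$ and all $m_N$ as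 above. 1. Let $Iu_0\in H^\alpha$ and $\delta=c\,\max\{1,\|Iu_0\|_{H^\alpha}\}^{-p}$. Then $u_0\in H^s$, $$\|Iu_0\|_{H^\alpha}\le CN^{\alpha-s}\|u_0\|_{H^s},\qquad \delta\ge C^{-1}\max\{1,\|u_0\|_{H^s}\}^{-p}\,N^{-\frac{2(\alpha-s)}{1+2b-4b(s)}},$$ and (1) has a solution $u$ on $[-\delta,\delta]$, in particular on $[0,\delta]$, with $$\|Iu\|_{X^{\alpha,b}_\delta}\le C\|Iu_0\|_{H^\alpha}.$$ Moreover every solution $v$ of (1) on $[0,\delta]$ with $\|Iv\|_{X^{\alpha,b}([0,\delta])}<\infty$ equals $u$ on $[0,\delta]$. 2. The solution depends Lipschitz continuously on the data: if $R\ge1$, $\delta=cR^{-p}$, $\|Iu_0\|_{H^\alpha},\|Iv_0\|_{H^\alpha}\le R$, and $u,v$ are solutions on $[-\delta,\delta]$ with data $u_0,v_0$ and with $\|Iu\|_{X^{\alpha,b}_\delta},\|Iv\|_{X^{\alpha,b}_\delta}<\infty$, then $$\|Iu-Iv\|_{X^{\alpha,b}_\delta}\le C\|Iu_0-Iv_0\|_{H^\alpha},\qquad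 \sup_{|t|\le\delta}\|Iu(t)-Iv(t)\|_{H^\alpha}\le C\|Iu_0-Iv_0\|_{H^\alpha}.$$ -/

import Mathlib

open MeasureTheory Set Filter Topology
open scoped ENNReal NNReal ContDiff FourierTransform

noncomputable section

namespace DiskFNLS

/-! ### Bessel function, its zeros, and the radial Dirichlet eigenfunctions of the unit disk -/

/-- The Bessel function `J₀`, by Bessel's integral
`J₀(x) = (1/π) ∫_0^π cos (x sin θ) dθ`. -/
def besselJ0 (x : ℝ) : ℝ := Real.pi⁻¹ * ∫ θ in (0 : ℝ)..Real.pi, Real.cos (x * Real.sin θ)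

/-- The positive zeros of `J₀` in increasing order; `besselZero n` is the `(n+1)`-st one
(indices start at `0` here). -/
def besselZero : ℕ → ℝ
  | 0 => sInf {x : ℝ | 0 < x ∧ besselJ0 x = 0}
  | n + 1 => sInf {x : ℝ | besselZero n < x ∧ besselJ0 x = 0}

/-- The plane, with its Euclidean norm. -/
abbrev Plane : Type := EuclideanSpace ℝ (Fin 2)

/-- The measure `dL = (1/4π) r dθ dr` on the unit disk `Θ`. -/
def discMeasure : Measure Plane :=
  ENNReal.ofReal (1 / (4 * Real.pi)) • (volume : Measure Plane).restrict (Metric.ball 0 1)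

instance : IsFiniteMeasure discMeasure := by
  have : IsFiniteMeasure ((volume : Measure Plane).restrict (Metric.ball 0 1)) :=
    ⟨by rw [Measure.restrict_apply_univ]; exact measure_ball_lt_top⟩
  exact Measure.smul_finite _ ENNReal.ofReal_ne_top

/-- The function `x ↦ J₀(zₙ |x|)` on the disk. -/
def radialMode (n : ℕ) (x : Plane) : ℂ := (besselJ0 (besselZero n * ‖x‖) : ℂ)

/-- The normalized eigenfunction `eₙ = J₀(zₙ |x|) / ‖J₀(zₙ |·|)‖_{L²(Θ)}`. -/
def eigenfun (n : ℕ) (x : Plane) : ℂ :=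
  (((eLpNorm (radialMode n) 2 discMeasure).toReal : ℂ))⁻¹ * radialMode n x

theorem continuous_besselJ0 : Continuous besselJ0 := by
  unfold besselJ0
  refine continuous_const.mul ?_
  apply intervalIntegral.continuous_parametric_intervalIntegral_of_continuous'
  fun_prop

theorem abs_besselJ0_le (x : ℝ) : |besselJ0 x| ≤ 1 := by
  have h : ‖∫ θ in (0 : ℝ)..Real.pi, Real.cos (x * Real.sin θ)‖ ≤ 1 * |Real.pi - 0| :=
    intervalIntegral.norm_integral_le_of_norm_le_const
      fun θ _ => by simpa using Real.abs_cos_le_one _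
  rw [Real.norm_eq_abs, sub_zero, abs_of_pos Real.pi_pos, one_mul] at h
  rw [besselJ0, abs_mul, abs_of_pos (inv_pos.2 Real.pi_pos), inv_mul_le_iff₀ Real.pi_pos]
  simpa using h

theorem memLp_eigenfun (n : ℕ) : MemLp (eigenfun n) 2 discMeasure := by
  unfold eigenfun
  refine MemLp.const_mul ?_ _
  refine MemLp.of_bound ?_ 1 ?_
  · refine Continuous.aestronglyMeasurable ?_
    unfold radialMode
    exact Complex.continuous_ofReal.comp
      (continuous_besselJ0.comp (continuous_const.mul continuous_norm))
  · refine Eventually.of_forall fun x => ?_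
    rw [radialMode, Complex.norm_real]
    exact abs_besselJ0_le _

/-- `eₙ` as an element of `L²(Θ)`. -/
def eigenLp (n : ℕ) : Lp ℂ 2 discMeasure := (memLp_eigenfun n).toLp _

/-! ### Radial functions through their expansions `∑ cₙ eₙ`

A radial function (or distribution) `∑ cₙ eₙ` on the disk is given by its coefficients `c`. -/

/-- The function `∑ cₙ eₙ ∈ L²(Θ)`, for square summable `c`. -/
def synth (c : ℕ → ℂ) : Lp ℂ 2 discMeasure := ∑' n, c n • eigenLp n

/-- The norm of `∑ cₙ eₙ` in `H^s_rad(Θ)`, `(∑ zₙ^{2s} |cₙ|²)^{1/2} ∈ [0, ∞]`. -/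
def hsNorm (s : ℝ) (c : ℕ → ℂ) : ℝ≥0∞ :=
  (∑' n, ENNReal.ofReal (besselZero n ^ (2 * s)) * ‖c n‖ₑ ^ 2) ^ (1 / 2 : ℝ)

/-- The coefficients `⟨|w|² w, eₙ⟩` of the cubic nonlinearity, where `w = ∑ cₙ eₙ`. -/
def cubic (c : ℕ → ℂ) (n : ℕ) : ℂ :=
  ∫ x, ((‖synth c x‖ ^ 2 : ℝ) : ℂ) * synth c x * (starRingEnd ℂ) (eigenfun n x) ∂discMeasure

/-! ### The spaces `X^{s,b}` -/

/-- The Japanese bracket. -/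
def bracket (x : ℝ) : ℝ := Real.sqrt (1 + x ^ 2)

open scoped Classical in
/-- The norm of `u(t) = ∑ cₙ(t) eₙ` in `X^{s,b}_rad(ℝ × Θ)`, for `b ≥ 0` (all elements of the space
then have coefficients `cₙ ∈ L²(ℝ)`; the norm of any other `u` is `∞`):
the square root of `∑ₙ ‖⟨τ + zₙ^{2α}⟩^b ⟨zₙ⟩^s ĉₙ(τ)‖²_{L²}`.
`𝓕` is the Fourier transform on `L²(ℝ)` with phase `exp (-2πi t ξ)`, so that `τ = 2πξ`. -/
def xsbNorm (α s b : ℝ) (u : ℝ → ℕ → ℂ) : ℝ≥0∞ :=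
  if h : ∀ n, MemLp (fun t => u t n) 2 (volume : Measure ℝ) then
    (∑' n, ∫⁻ ξ : ℝ,
      ENNReal.ofReal
        (bracket (2 * Real.pi * ξ + besselZero n ^ (2 * α)) ^ (2 * b) *
          bracket (besselZero n) ^ (2 * s)) *
        ‖(𝓕 ((h n).toLp (fun t => u t n)) : Lp ℂ 2 (volume : Measure ℝ)) ξ‖ₑ ^ 2) ^ (1 / 2 : ℝ)
  else ⊤

/-- The restriction norm: the infimum of the `X^{s,b}` norms of the extensions to `ℝ × Θ` of
`u` restricted to the times in `J`. The space `X_T^{s,b}` is the case `J = (-T, T)`. -/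
def xsbNormOn (J : Set ℝ) (α s b : ℝ) (u : ℝ → ℕ → ℂ) : ℝ≥0∞ :=
  ⨅ (v : ℝ → ℕ → ℂ) (_ : EqOn v u J), xsbNorm α s b v

/-! ### The operator `I_N` and the modified equation -/

/-- `m = m_N` is an admissible symbol for `I_N`: smooth, equal to `1` on `|ξ| ≤ N` and to
`|ξ/N|^{s-α}` on `|ξ| ≥ 2N`, and between these two values in the transition region. -/
structure IsIMultiplier (α s N : ℝ) (m : ℝ → ℝ) : Prop where
  smooth : ContDiff ℝ ∞ m
  low : ∀ ξ, |ξ| ≤ N → m ξ = 1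
  high : ∀ ξ, 2 * N ≤ |ξ| → m ξ = |ξ / N| ^ (s - α)
  mid : ∀ ξ, N ≤ |ξ| → |ξ| ≤ 2 * N → 2 ^ (s - α) ≤ m ξ ∧ m ξ ≤ 1

/-- `I (∑ cₙ eₙ) = ∑ m(zₙ) cₙ eₙ`. -/
def iOp (m : ℝ → ℝ) (c : ℕ → ℂ) (n : ℕ) : ℂ := (m (besselZero n) : ℂ) * c n

/-- `u(t) = ∑ cₙ(t) eₙ` solves `(i∂ₜ - (-Δ)^α) I u = I (|u|² u)`, `I u(0) = I u₀` on the time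
interval `J`, with `I u ∈ C(J, H^α)`. The equation holds in the coefficient of every `eₙ`;
`|u|² u` is integrable on the disk at each time. -/
structure IsSolution (α : ℝ) (m : ℝ → ℝ) (u₀ : ℕ → ℂ) (J : Set ℝ) (u : ℝ → ℕ → ℂ) : Prop where
  finite : ∀ t ∈ J, hsNorm α (iOp m (u t)) < ⊤
  continuous : ∀ t ∈ J,
    Tendsto (fun t' => hsNorm α (iOp m (u t') - iOp m (u t))) (𝓝[J] t) (𝓝 0)
  integrable : ∀ t ∈ J, MemLp (synth (u t)) 3 discMeasure
  equation : ∀ t ∈ J, ∀ n, ∃ d : ℂ, HasDerivWithinAt (fun t' => iOp m (u t') n) d J t ∧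
    Complex.I * d - ((besselZero n ^ (2 * α) : ℝ) : ℂ) * iOp m (u t) n = iOp m (cubic (u t)) n
  initial : iOp m (u 0) = iOp m u₀

end DiskFNLS

end

open DiskFNLS

/-!
The proof works entirely in `L^q` in time of spatial norms; no bilinear estimate in spaces `X^{σ,b'}`
is used. A radial function is its sequence of coefficients `c : ℕ → ℂ`, and `‖I u‖_{H^α}` is, up to a
factor two, the weighted `ℓ²` norm `wNorm w` for `w = iWeight α m`, that is `wₙ = m(zₙ) ⟨zₙ⟩^α`. The
parameter `N` enters only through this weight, and the weight satisfies the growth conditions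
`IsWeight s C₀` with a constant `C₀` which does not depend on `N` (`isWeight_iWeight`): it grows at
least like `n^s` and at most like `n`. All later estimates use only `IsWeight`, hence are uniform
in `N`.

A function with finite `X^{w,b}` norm, `b > 1/2`, is a superposition `evol α h` of modulated free
solutions with a profile `h`, and its norm is the weighted `L²` norm `modNorm b w h` of the profile
(`xsbNorm_eq_modNorm`, `exists_represented_of_xsbNormOn`).

*Local smoothing.* The normalized eigenfunctions satisfy `eₙ(r)² ≤ C zₙ^ε r^{ε-1}`, and likewise for
their scaled derivatives (`exists_eig_sq_le`), which is barely integrable for the measure `dr`; the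
zeros of `J₀` have gaps bounded below, and so have the frequencies `zₙ^{2α}`, as `α ≥ 1/2`
(`besselZero_rpow_gap`). The large sieve `integral_norm_sq_sum_exp_le` at fixed `r`, integrated in `r`,
shows that the supremum over the disk of a dyadic block of `evol α h` costs only `1/2 + ε`
derivatives in `L²` of time (`lintegral_blockSq_evol_le`), whereas at a fixed time it costs one
(`blockSq_le`). Interpolating the two gives the bound `lqNorm_blockNorm_evol_le` for the `L^{2q}` norm
in time over a set `E`, with a gain `|E|^{θ/(2q)}`.

*Product estimate.* `wNorm_tri_le` bounds the norm of `U V̄ W` by the norm of one factor and the uniform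
norms of the other two. The product is telescoped over dyadic frequencies; Bessel's inequality for
each piece and for its Laplacian shows that a piece of frequency `2^j` has coefficients which decay
like `(n/2^j)^{-2}` for `n > 2^j` (`tsum_coef_mul_mul_le`), and the pieces are almost orthogonal because
the growth of `w` lies strictly between `0` and `2` (`IsWeight.wNorm_sum_sq_le`). With local smoothing
and Hölder's inequality this gives `lqNorm_tri_evol_le`: the nonlinearity is in `L^q(E)` with values in
the weighted space, with a factor `|E|^{θ/q}`.

*Duhamel's formula.* For `1/q = 2 - 2b`, forcing in `L^q` of time lies in the dual space `X^{w,b-1}`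
(`lintegral_modWeight_sum_fourier_le`), so the solution of the forced linear equation, cut off in time,
lies in `X^{w,b}` (`modNorm_duhamel_le`). The condition on `b(s)` leaves room for `θ/q = 1 + 2b - 4b(s)`
(`exists_exponents`), and this exponent determines the time of existence `c R^{-p}`.

Existence follows by Picard iteration (`exists_isMild`), uniqueness by absorption on successive short
intervals (`IsMild.unique`), and the Lipschitz bound by absorption on the whole interval
(`represented_sub`). The differential equation for the coefficients and its integral form are
equivalent (`IsSolution.isMild`, `IsMild.isSolution`).
-/

open MeasureTheory Set Filter Topology
open scoped ENNReal NNReal ContDiff FourierTransform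

noncomputable section

namespace DiskFNLS

/-! ### The Bessel function: derivatives, differential equation, decay -/

/-- The derivative of `J₀`. -/
def besselD (x : ℝ) : ℝ :=
  Real.pi⁻¹ * ∫ θ in (0 : ℝ)..Real.pi, -(Real.sin (x * Real.sin θ) * Real.sin θ)

/-- The second derivative of `J₀`. -/
def besselDD (x : ℝ) : ℝ :=
  Real.pi⁻¹ * ∫ θ in (0 : ℝ)..Real.pi, -(Real.cos (x * Real.sin θ) * Real.sin θ * Real.sin θ)

theorem abs_inv_pi_mul_integral_le {f : ℝ → ℝ} (hf : ∀ θ, |f θ| ≤ 1) :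
    |Real.pi⁻¹ * ∫ θ in (0 : ℝ)..Real.pi, f θ| ≤ 1 := by
  have h : ‖∫ θ in (0 : ℝ)..Real.pi, f θ‖ ≤ 1 * |Real.pi - 0| :=
    intervalIntegral.norm_integral_le_of_norm_le_const fun θ _ => by simpa using hf θ
  rw [Real.norm_eq_abs, sub_zero, abs_of_pos Real.pi_pos, one_mul] at h
  rw [abs_mul, abs_of_pos (inv_pos.2 Real.pi_pos), inv_mul_le_iff₀ Real.pi_pos]
  simpa using h

theorem abs_besselD_le (x : ℝ) : |besselD x| ≤ 1 :=
  abs_inv_pi_mul_integral_le fun θ => by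
    rw [abs_neg, abs_mul]
    exact mul_le_one₀ (Real.abs_sin_le_one _) (abs_nonneg _) (Real.abs_sin_le_one _)

theorem abs_besselDD_le (x : ℝ) : |besselDD x| ≤ 1 :=
  abs_inv_pi_mul_integral_le fun θ => by
    rw [abs_neg, abs_mul, abs_mul]
    exact mul_le_one₀ (mul_le_one₀ (Real.abs_cos_le_one _) (abs_nonneg _) (Real.abs_sin_le_one _))
      (abs_nonneg _) (Real.abs_sin_le_one _)

/-- Differentiation under an integral over `[0, π]`, for jointly continuous integrands with
derivative bounded by `1`. -/
theorem hasDerivAt_inv_pi_mul_integral {F F' : ℝ → ℝ → ℝ} (hF : ∀ x, Continuous (F x))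
    (hF' : ∀ x, Continuous (F' x)) (hb : ∀ x θ, |F' x θ| ≤ 1)
    (hd : ∀ x θ, HasDerivAt (fun y => F y θ) (F' x θ) x) (x : ℝ) :
    HasDerivAt (fun y => Real.pi⁻¹ * ∫ θ in (0 : ℝ)..Real.pi, F y θ)
      (Real.pi⁻¹ * ∫ θ in (0 : ℝ)..Real.pi, F' x θ) x := by
  refine HasDerivAt.const_mul _ ?_
  refine (intervalIntegral.hasDerivAt_integral_of_dominated_loc_of_deriv_le (s := univ)
    (bound := fun _ => 1) univ_mem ?_ ?_ ?_ ?_ ?_ ?_).2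
  · exact Eventually.of_forall fun y => (hF y).aestronglyMeasurable
  · exact (hF x).intervalIntegrable _ _
  · exact (hF' x).aestronglyMeasurable
  · exact Eventually.of_forall fun θ _ y _ => by simpa using hb y θ
  · exact intervalIntegrable_const
  · exact Eventually.of_forall fun θ _ y _ => hd y θ

theorem hasDerivAt_besselJ0 (x : ℝ) : HasDerivAt besselJ0 (besselD x) x := by
  refine hasDerivAt_inv_pi_mul_integral (F := fun x θ => Real.cos (x * Real.sin θ))
    (F' := fun x θ => -(Real.sin (x * Real.sin θ) * Real.sin θ)) (fun x => by fun_prop)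
    (fun x => by fun_prop) (fun x θ => ?_) (fun x θ => ?_) x
  · rw [abs_neg, abs_mul]
    exact mul_le_one₀ (Real.abs_sin_le_one _) (abs_nonneg _) (Real.abs_sin_le_one _)
  · have := (Real.hasDerivAt_cos (x * Real.sin θ)).comp x ((hasDerivAt_id x).mul_const (Real.sin θ))
    refine this.congr_deriv ?_
    simp

theorem hasDerivAt_besselD (x : ℝ) : HasDerivAt besselD (besselDD x) x := by
  refine hasDerivAt_inv_pi_mul_integral (F := fun x θ => -(Real.sin (x * Real.sin θ) * Real.sin θ))
    (F' := fun x θ => -(Real.cos (x * Real.sin θ) * Real.sin θ * Real.sin θ)) (fun x => by fun_prop)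
    (fun x => by fun_prop) (fun x θ => ?_) (fun x θ => ?_) x
  · rw [abs_neg, abs_mul, abs_mul]
    exact mul_le_one₀ (mul_le_one₀ (Real.abs_cos_le_one _) (abs_nonneg _) (Real.abs_sin_le_one _))
      (abs_nonneg _) (Real.abs_sin_le_one _)
  · have := (((Real.hasDerivAt_sin (x * Real.sin θ)).comp x
      ((hasDerivAt_id x).mul_const (Real.sin θ))).mul_const (Real.sin θ)).neg
    refine this.congr_deriv ?_
    simp

theorem continuous_besselD : Continuous besselD :=
  continuous_iff_continuousAt.2 fun x => (hasDerivAt_besselD x).continuousAt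

/-- Bessel's equation `x J₀'' + J₀' + x J₀ = 0`. -/
theorem bessel_ode (x : ℝ) : x * besselDD x + besselD x + x * besselJ0 x = 0 := by
  have key : ∫ θ in (0 : ℝ)..Real.pi, (Real.cos (x * Real.sin θ) * (x * Real.cos θ) * Real.cos θ
      + Real.sin (x * Real.sin θ) * (-Real.sin θ)) = 0 := by
    rw [intervalIntegral.integral_deriv_mul_eq_sub (u := fun θ => Real.sin (x * Real.sin θ))
      (v := Real.cos)]
    · simp
    · intro θ _
      exact (Real.hasDerivAt_sin _).comp θ ((Real.hasDerivAt_sin θ).const_mul x)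
    · intro θ _
      exact Real.hasDerivAt_cos θ
    · exact Continuous.intervalIntegrable (by fun_prop) _ _
    · exact Continuous.intervalIntegrable (by fun_prop) _ _
  have : x * besselDD x + besselD x + x * besselJ0 x = Real.pi⁻¹ *
      ∫ θ in (0 : ℝ)..Real.pi, (Real.cos (x * Real.sin θ) * (x * Real.cos θ) * Real.cos θ
      + Real.sin (x * Real.sin θ) * (-Real.sin θ)) := by
    rw [besselDD, besselD, besselJ0]
    rw [mul_left_comm, mul_left_comm x, ← mul_add, ← mul_add, ← intervalIntegral.integral_const_mul,
      ← intervalIntegral.integral_const_mul, ← intervalIntegral.integral_add,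
      ← intervalIntegral.integral_add]
    · congr 1
      refine intervalIntegral.integral_congr fun θ _ => ?_
      have := Real.sin_sq_add_cos_sq θ
      linear_combination (-x * Real.cos (x * Real.sin θ)) * this
    all_goals exact Continuous.intervalIntegrable (by fun_prop) _ _
  rw [this, key, mul_zero]

theorem besselDD_eq {x : ℝ} (hx : x ≠ 0) : besselDD x = -besselJ0 x - besselD x / x := by
  have := bessel_ode x
  field_simp
  linarith

theorem besselD_zero : besselD 0 = 0 := by simp [besselD]

theorem cos_one_le_besselJ0 {x : ℝ} (h0 : 0 ≤ x) (h1 : x ≤ 1) : Real.cos 1 ≤ besselJ0 x := by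
  have h : ∫ θ in (0 : ℝ)..Real.pi, Real.cos 1 ≤ ∫ θ in (0 : ℝ)..Real.pi, Real.cos (x * Real.sin θ) := by
    refine intervalIntegral.integral_mono_on Real.pi_pos.le (by simp)
      (Continuous.intervalIntegrable (by fun_prop) _ _) fun θ hθ => ?_
    have hs := Real.sin_nonneg_of_mem_Icc hθ
    refine Real.cos_le_cos_of_nonneg_of_le_pi (by positivity) ?_ ?_
    · linarith [Real.pi_gt_three]
    · exact mul_le_one₀ h1 hs (Real.sin_le_one θ)
  rw [besselJ0, le_inv_mul_iff₀ Real.pi_pos]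
  simpa using h

/-- The energy `(v')² + (1 + 1/(4x²)) v²` of `v(x) = √x J₀(x)`. -/
def besselEnergy (x : ℝ) : ℝ :=
  x * (besselJ0 x ^ 2 + besselD x ^ 2) + besselJ0 x * besselD x + besselJ0 x ^ 2 / (2 * x)

theorem hasDerivAt_besselEnergy {x : ℝ} (hx : x ≠ 0) :
    HasDerivAt besselEnergy (-(besselJ0 x ^ 2 / (2 * x ^ 2))) x := by
  have h0 := hasDerivAt_besselJ0 x
  have h1 := hasDerivAt_besselD x
  have h := (((hasDerivAt_id x).mul ((h0.pow 2).add (h1.pow 2))).add (h0.mul h1)).add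
    ((h0.pow 2).div ((hasDerivAt_id x).const_mul 2) (by simpa using hx))
  refine h.congr_deriv ?_
  rw [besselDD_eq hx]
  simp
  field_simp
  ring

theorem besselEnergy_le {x : ℝ} (hx : 1 ≤ x) : besselEnergy x ≤ 7 / 2 := by
  have hanti : AntitoneOn besselEnergy (Ici 1) := by
    refine antitoneOn_of_hasDerivWithinAt_nonpos (convex_Ici 1)
      (f' := fun x => -(besselJ0 x ^ 2 / (2 * x ^ 2))) ?_ ?_ ?_
    · intro y hy
      exact (hasDerivAt_besselEnergy (by have : (1 : ℝ) ≤ y := hy; positivity)).continuousAt.continuousWithinAt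
    · intro y hy
      rw [interior_Ici] at hy
      exact (hasDerivAt_besselEnergy (by have : (1 : ℝ) < y := hy; positivity)).hasDerivWithinAt
    · intro y _
      have : 0 ≤ besselJ0 y ^ 2 / (2 * y ^ 2) := by positivity
      simpa using this
  have h := hanti (self_mem_Ici) hx hx
  have hJ : besselJ0 1 ^ 2 ≤ 1 := by rw [sq_le_one_iff_abs_le_one]; exact abs_besselJ0_le 1
  have hD : besselD 1 ^ 2 ≤ 1 := by rw [sq_le_one_iff_abs_le_one]; exact abs_besselD_le 1
  have : besselEnergy 1 ≤ 7 / 2 := by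
    unfold besselEnergy
    nlinarith [sq_nonneg (besselJ0 1 - besselD 1)]
  linarith

theorem mul_sq_add_sq_le {x : ℝ} (hx : 1 ≤ x) : x * (besselJ0 x ^ 2 + besselD x ^ 2) ≤ 7 := by
  have h := besselEnergy_le hx
  unfold besselEnergy at h
  have h2 : 0 ≤ besselJ0 x ^ 2 / (2 * x) := by positivity
  nlinarith [sq_nonneg (besselJ0 x + besselD x), mul_nonneg (sub_nonneg.2 hx)
    (add_nonneg (sq_nonneg (besselJ0 x)) (sq_nonneg (besselD x)))]

/-- `J₀`, `J₀'` and `J₀''` are `O(x^{-1/2})`. -/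
theorem mul_sq_le (x : ℝ) (hx : 0 ≤ x) :
    x * besselJ0 x ^ 2 ≤ 28 ∧ x * besselD x ^ 2 ≤ 28 ∧ x * besselDD x ^ 2 ≤ 28 := by
  have hJ : besselJ0 x ^ 2 ≤ 1 := by rw [sq_le_one_iff_abs_le_one]; exact abs_besselJ0_le x
  have hD : besselD x ^ 2 ≤ 1 := by rw [sq_le_one_iff_abs_le_one]; exact abs_besselD_le x
  have hDD : besselDD x ^ 2 ≤ 1 := by rw [sq_le_one_iff_abs_le_one]; exact abs_besselDD_le x
  rcases le_total x 1 with h | h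
  · refine ⟨?_, ?_, ?_⟩ <;> nlinarith
  · have h7 := mul_sq_add_sq_le h
    refine ⟨by nlinarith [mul_nonneg hx (sq_nonneg (besselD x))],
      by nlinarith [mul_nonneg hx (sq_nonneg (besselJ0 x))], ?_⟩
    have e : besselDD x ^ 2 ≤ 2 * (besselJ0 x ^ 2 + besselD x ^ 2) := by
      rw [besselDD_eq (by positivity)]
      have : (besselD x / x) ^ 2 ≤ besselD x ^ 2 := by
        rw [div_pow]
        exact div_le_self (sq_nonneg _) (one_le_pow₀ h)
      nlinarith [sq_nonneg (besselJ0 x - besselD x / x)]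
    nlinarith

theorem besselJ0_sq_le_energy {x : ℝ} (hx : 0 < x) : x * besselJ0 x ^ 2 ≤ besselEnergy x := by
  have : besselEnergy x - x * besselJ0 x ^ 2 =
      x * (besselD x + besselJ0 x / (2 * x)) ^ 2 + besselJ0 x ^ 2 / (4 * x) := by
    unfold besselEnergy
    field_simp
    ring
  have h2 : 0 ≤ x * (besselD x + besselJ0 x / (2 * x)) ^ 2 + besselJ0 x ^ 2 / (4 * x) := by
    positivity
  linarith

/-- The energy is bounded below: `E(x) exp (-1/(4x²))` is increasing since `E' ≥ -E/(2x³)`. -/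
theorem exists_le_besselEnergy : ∃ c, 0 < c ∧ ∀ x, 1 ≤ x → c ≤ besselEnergy x := by
  have hd : ∀ x : ℝ, 0 < x → HasDerivAt (fun x => besselEnergy x * Real.exp (-(x ^ 2)⁻¹ / 4))
      (-(besselJ0 x ^ 2 / (2 * x ^ 2)) * Real.exp (-(x ^ 2)⁻¹ / 4) +
        besselEnergy x * (Real.exp (-(x ^ 2)⁻¹ / 4) * ((2 * x ^ 3)⁻¹))) x := by
    intro x hx
    refine (hasDerivAt_besselEnergy hx.ne').mul (HasDerivAt.exp ?_)
    have := (((hasDerivAt_id x).pow 2).inv (by simpa using hx.ne')).neg.div_const 4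
    refine this.congr_deriv ?_
    simp
    field_simp
    norm_num
  have hmono : MonotoneOn (fun x => besselEnergy x * Real.exp (-(x ^ 2)⁻¹ / 4)) (Ici 1) := by
    refine monotoneOn_of_hasDerivWithinAt_nonneg (convex_Ici 1) ?_
      (fun y hy => (hd y ?_).hasDerivWithinAt) ?_
    · intro y hy
      exact (hd y (lt_of_lt_of_le one_pos hy)).continuousAt.continuousWithinAt
    · rw [interior_Ici] at hy
      exact lt_trans one_pos hy
    · intro y hy
      rw [interior_Ici] at hy
      have hy : (1 : ℝ) < y := hy
      have h := besselJ0_sq_le_energy (show 0 < y by linarith)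
      have : -(besselJ0 y ^ 2 / (2 * y ^ 2)) * Real.exp (-(y ^ 2)⁻¹ / 4) +
        besselEnergy y * (Real.exp (-(y ^ 2)⁻¹ / 4) * ((2 * y ^ 3)⁻¹)) =
        (besselEnergy y - y * besselJ0 y ^ 2) * (2 * y ^ 3)⁻¹ * Real.exp (-(y ^ 2)⁻¹ / 4) := by
        field_simp
        ring
      rw [this]
      have : 0 ≤ besselEnergy y - y * besselJ0 y ^ 2 := by linarith
      positivity
  refine ⟨besselEnergy 1 * Real.exp (-1 / 4), ?_, fun x hx => ?_⟩
  · have h1 : 0 < besselJ0 1 := Real.cos_one_pos.trans_le (cos_one_le_besselJ0 zero_le_one le_rfl)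
    have := besselJ0_sq_le_energy one_pos
    have : 0 < besselEnergy 1 := by nlinarith [pow_pos h1 2]
    positivity
  · have h := hmono self_mem_Ici hx hx
    simp only [one_pow, inv_one] at h
    refine h.trans ?_
    have hE : 0 ≤ besselEnergy x := (by positivity : 0 ≤ x * besselJ0 x ^ 2).trans
      (besselJ0_sq_le_energy (by linarith))
    refine mul_le_of_le_one_right hE (Real.exp_le_one_iff.2 ?_)
    have : 0 ≤ (x ^ 2)⁻¹ := by positivity
    linarith

/-- At the zeros of `J₀` the derivative is at least of size `x^{-1/2}`. -/
theorem exists_le_mul_besselD_sq :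
    ∃ c, 0 < c ∧ ∀ x, 1 ≤ x → besselJ0 x = 0 → c ≤ x * besselD x ^ 2 := by
  obtain ⟨c, hc, h⟩ := exists_le_besselEnergy
  refine ⟨c, hc, fun x hx h0 => ?_⟩
  have := h x hx
  simpa [besselEnergy, h0] using this

/-! ### The zeros of the Bessel function -/

/-- Sturm comparison of `√x J₀(x)` with `sin (x - a)`: `J₀` has no constant sign on an interval
of length `π`. -/
theorem not_forall_pos_mul_besselJ0 {a : ℝ} (ha : 0 < a) (ε : ℝ) :
    ¬ ∀ x ∈ Icc a (a + Real.pi), 0 < ε * besselJ0 x := by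
  intro h
  set v : ℝ → ℝ := fun x => √x * besselJ0 x with hv
  set v' : ℝ → ℝ := fun x => √x * besselD x + besselJ0 x / (2 * √x) with hv'
  have hdv : ∀ x, 0 < x → HasDerivAt v (v' x) x := by
    intro x hx
    have := (Real.hasDerivAt_sqrt hx.ne').mul (hasDerivAt_besselJ0 x)
    refine this.congr_deriv ?_
    simp only [hv']
    ring
  have hdv' : ∀ x, 0 < x → HasDerivAt v' (-(1 + 1 / (4 * x ^ 2)) * v x) x := by
    intro x hx
    have hs := Real.hasDerivAt_sqrt hx.ne'
    have hs0 : 0 < √x := Real.sqrt_pos.2 hx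
    have := (hs.mul (hasDerivAt_besselD x)).add
      ((hasDerivAt_besselJ0 x).div (hs.const_mul 2) (by positivity))
    refine this.congr_deriv ?_
    rw [besselDD_eq hx.ne']
    simp only [hv]
    have e : x = √x ^ 2 := (Real.sq_sqrt hx.le).symm
    set y := √x
    rw [e]
    field_simp
    ring
  set W : ℝ → ℝ := fun x => ε * (v' x * Real.sin (x - a) - v x * Real.cos (x - a)) with hW
  have hdW : ∀ x, 0 < x → HasDerivAt W (-(1 / (4 * x ^ 2)) * √x * (ε * besselJ0 x) *
      Real.sin (x - a)) x := by
    intro x hx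
    have h1 : HasDerivAt (fun x => Real.sin (x - a)) (Real.cos (x - a)) x := by
      simpa using ((hasDerivAt_id x).sub_const a).sin
    have h2 : HasDerivAt (fun x => Real.cos (x - a)) (-Real.sin (x - a)) x := by
      simpa using ((hasDerivAt_id x).sub_const a).cos
    have := (((hdv' x hx).mul h1).sub ((hdv x hx).mul h2)).const_mul ε
    refine this.congr_deriv ?_
    simp only [hv]
    ring
  have hanti : AntitoneOn W (Icc a (a + Real.pi)) := by
    refine antitoneOn_of_hasDerivWithinAt_nonpos (convex_Icc _ _) ?_
      (fun y hy => (hdW y ?_).hasDerivWithinAt) ?_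
    · intro y hy
      exact (hdW y (ha.trans_le hy.1)).continuousAt.continuousWithinAt
    · rw [interior_Icc] at hy
      exact ha.trans hy.1
    · intro y hy
      rw [interior_Icc] at hy
      have hp := h y ⟨hy.1.le, hy.2.le⟩
      have hsin : 0 ≤ Real.sin (y - a) :=
        Real.sin_nonneg_of_nonneg_of_le_pi (by linarith [hy.1]) (by linarith [hy.2])
      have : 0 ≤ 1 / (4 * y ^ 2) * √y * (ε * besselJ0 y) * Real.sin (y - a) := by positivity
      linarith
  have hpi := Real.pi_pos
  have h1 := hanti (left_mem_Icc.2 (by linarith)) (right_mem_Icc.2 (by linarith)) (by linarith)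
  have e1 : W (a + Real.pi) = √(a + Real.pi) * (ε * besselJ0 (a + Real.pi)) := by
    simp only [hW, hv, add_sub_cancel_left, Real.sin_pi, Real.cos_pi]
    ring
  have e2 : W a = -(√a * (ε * besselJ0 a)) := by
    simp only [hW, hv, sub_self, Real.sin_zero, Real.cos_zero]
    ring
  have p1 : 0 < W (a + Real.pi) := by
    rw [e1]
    exact mul_pos (Real.sqrt_pos.2 (by linarith)) (h _ (right_mem_Icc.2 (by linarith)))
  have p2 : W a < 0 := by
    rw [e2, neg_lt_zero]
    exact mul_pos (Real.sqrt_pos.2 ha) (h _ (left_mem_Icc.2 (by linarith)))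
  linarith

theorem exists_besselJ0_eq_zero {a : ℝ} (ha : 0 < a) :
    ∃ x ∈ Icc a (a + Real.pi), besselJ0 x = 0 := by
  by_contra! hne
  have hpi := Real.pi_pos
  have hc : IsPreconnected (Icc a (a + Real.pi)) := isPreconnected_Icc
  have key : ∀ x ∈ Icc a (a + Real.pi), 0 < besselJ0 a * besselJ0 x := by
    intro x hx
    by_contra! hle
    have ha' : a ∈ Icc a (a + Real.pi) := left_mem_Icc.2 (by linarith)
    have h1 : 0 < besselJ0 a * besselJ0 a := mul_self_pos.2 (hne a ha')
    obtain ⟨y, hy, h0⟩ := hc.intermediate_value hx ha'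
      (f := fun x => besselJ0 a * besselJ0 x)
      (continuous_const.mul continuous_besselJ0).continuousOn ⟨hle, h1.le⟩
    rcases mul_eq_zero.1 h0 with h | h
    · exact hne a ha' h
    · exact hne y hy h
  exact not_forall_pos_mul_besselJ0 ha _ key

/-- Consecutive zeros of `J₀` are separated: between them `J₀'` vanishes, whereas at the first of
them it is of the same size as the bound for `J₀''`. -/
theorem exists_besselJ0_gap : ∃ g, 0 < g ∧ g ≤ 1 ∧
    ∀ x y, 1 ≤ x → x < y → besselJ0 x = 0 → besselJ0 y = 0 → x + g ≤ y := by
  obtain ⟨c, hc, h⟩ := exists_le_mul_besselD_sq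
  refine ⟨min 1 √(c / 28), lt_min one_pos (Real.sqrt_pos.2 (by positivity)), min_le_left _ _, ?_⟩
  intro x y hx hxy h0 h1
  obtain ⟨ξ, hξ, hξ0⟩ := exists_hasDerivAt_eq_zero hxy continuous_besselJ0.continuousOn
    (h0.trans h1.symm) (fun t _ => hasDerivAt_besselJ0 t)
  have hb : ∀ t ∈ Icc x y, ‖besselDD t‖ ≤ √(28 / x) := by
    intro t ht
    have htx := ht.1
    have h2 := (mul_sq_le t (by linarith)).2.2
    rw [Real.norm_eq_abs]
    refine Real.abs_le_sqrt ?_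
    rw [le_div_iff₀ (by linarith)]
    nlinarith [sq_nonneg (besselDD t)]
  have hM := Convex.norm_image_sub_le_of_norm_hasDerivWithin_le
    (fun t _ => (hasDerivAt_besselD t).hasDerivWithinAt) hb (convex_Icc x y)
    ⟨hξ.1.le, hξ.2.le⟩ (left_mem_Icc.2 hxy.le)
  rw [hξ0, sub_zero, Real.norm_eq_abs, Real.norm_eq_abs, abs_of_nonpos (by linarith [hξ.1] : x - ξ ≤ 0)] at hM
  have h3 : |besselD x| ≤ √(28 / x) * (y - x) :=
    hM.trans (mul_le_mul_of_nonneg_left (by linarith [hξ.2]) (Real.sqrt_nonneg _))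
  have h4 : besselD x ^ 2 ≤ 28 / x * (y - x) ^ 2 := by
    have := pow_le_pow_left₀ (abs_nonneg _) h3 2
    rwa [sq_abs, mul_pow, Real.sq_sqrt (by positivity)] at this
  have h5 := h x hx h0
  have h6 : c / 28 ≤ (y - x) ^ 2 := by
    have : x * besselD x ^ 2 ≤ 28 * (y - x) ^ 2 := by
      calc x * besselD x ^ 2 ≤ x * (28 / x * (y - x) ^ 2) := by gcongr
        _ = _ := by field_simp
    linarith
  have h7 := Real.sqrt_le_sqrt h6
  rw [Real.sqrt_sq (by linarith)] at h7
  linarith [min_le_right 1 √(c / 28)]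

/-- A lower bound for the distance of two zeros of `J₀`. -/
def zeroGap : ℝ := exists_besselJ0_gap.choose

theorem zeroGap_pos : 0 < zeroGap := exists_besselJ0_gap.choose_spec.1

theorem zeroGap_le_one : zeroGap ≤ 1 := exists_besselJ0_gap.choose_spec.2.1

theorem sInf_zeros_spec {x : ℝ} (hx : 0 ≤ x) (hx0 : x = 0 ∨ (1 ≤ x ∧ besselJ0 x = 0)) :
    besselJ0 (sInf {y | x < y ∧ besselJ0 y = 0}) = 0 ∧
    x + zeroGap ≤ sInf {y | x < y ∧ besselJ0 y = 0} ∧ 1 ≤ sInf {y | x < y ∧ besselJ0 y = 0} ∧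
    sInf {y | x < y ∧ besselJ0 y = 0} ≤ x + 7 := by
  have hgap : ∀ y, x < y → besselJ0 y = 0 → x + zeroGap ≤ y ∧ 1 ≤ y := by
    intro y hy h0
    rcases hx0 with rfl | ⟨h1, h2⟩
    · have : 1 < y := by
        by_contra! hle
        have := cos_one_le_besselJ0 hy.le hle
        linarith [Real.cos_one_pos]
      exact ⟨by linarith [zeroGap_le_one], this.le⟩
    · exact ⟨exists_besselJ0_gap.choose_spec.2.2 x y h1 hy h2 h0, by linarith⟩
  have hset : {y | x < y ∧ besselJ0 y = 0} = Ici (x + zeroGap) ∩ besselJ0 ⁻¹' {0} := by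
    ext y
    constructor
    · rintro ⟨h1, h2⟩
      exact ⟨(hgap y h1 h2).1, h2⟩
    · rintro ⟨h1, h2⟩
      exact ⟨by have : x + zeroGap ≤ y := h1
                linarith [zeroGap_pos], h2⟩
  have hclosed : IsClosed {y | x < y ∧ besselJ0 y = 0} := by
    rw [hset]
    exact isClosed_Ici.inter (isClosed_singleton.preimage continuous_besselJ0)
  have hbdd : BddBelow {y | x < y ∧ besselJ0 y = 0} := ⟨x, fun y hy => hy.1.le⟩
  obtain ⟨y, hy, hy0⟩ := exists_besselJ0_eq_zero (a := x + 1 / 2) (by linarith)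
  have hyS : y ∈ {y | x < y ∧ besselJ0 y = 0} := ⟨by linarith [hy.1], hy0⟩
  have hmem := hclosed.csInf_mem ⟨y, hyS⟩ hbdd
  refine ⟨hmem.2, (hgap _ hmem.1 hmem.2).1, (hgap _ hmem.1 hmem.2).2, ?_⟩
  refine (csInf_le hbdd hyS).trans ?_
  linarith [hy.2, Real.pi_lt_four]

theorem besselJ0_besselZero_and_one_le (n : ℕ) :
    besselJ0 (besselZero n) = 0 ∧ 1 ≤ besselZero n := by
  induction n with
  | zero =>
    have := sInf_zeros_spec le_rfl (Or.inl rfl)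
    exact ⟨this.1, this.2.2.1⟩
  | succ n ih =>
    have := sInf_zeros_spec (by linarith [ih.2]) (Or.inr ⟨ih.2, ih.1⟩)
    exact ⟨this.1, this.2.2.1⟩

theorem besselJ0_besselZero (n : ℕ) : besselJ0 (besselZero n) = 0 :=
  (besselJ0_besselZero_and_one_le n).1

theorem one_le_besselZero (n : ℕ) : 1 ≤ besselZero n := (besselJ0_besselZero_and_one_le n).2

theorem besselZero_pos (n : ℕ) : 0 < besselZero n := one_pos.trans_le (one_le_besselZero n)

theorem besselZero_add_gap_le (n : ℕ) : besselZero n + zeroGap ≤ besselZero (n + 1) :=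
  (sInf_zeros_spec (besselZero_pos n).le
    (Or.inr ⟨one_le_besselZero n, besselJ0_besselZero n⟩)).2.1

theorem besselZero_le (n : ℕ) : besselZero n ≤ 7 * (n + 1) := by
  induction n with
  | zero =>
    have := (sInf_zeros_spec le_rfl (Or.inl rfl)).2.2.2
    simpa [besselZero] using this
  | succ n ih =>
    have := (sInf_zeros_spec (besselZero_pos n).le
      (Or.inr ⟨one_le_besselZero n, besselJ0_besselZero n⟩)).2.2.2
    rw [besselZero]
    push_cast
    linarith

theorem besselZero_add_mul_le (n k : ℕ) :
    besselZero n + zeroGap * k ≤ besselZero (n + k) := by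
  induction k with
  | zero => simp
  | succ k ih =>
    have := besselZero_add_gap_le (n + k)
    rw [← add_assoc]
    push_cast
    linarith

theorem strictMono_besselZero : StrictMono besselZero :=
  strictMono_nat_of_lt_succ fun n => by linarith [besselZero_add_gap_le n, zeroGap_pos]

theorem mul_le_besselZero (n : ℕ) : zeroGap * (n + 1) ≤ besselZero n := by
  have h := besselZero_add_mul_le 0 n
  rw [zero_add] at h
  linarith [one_le_besselZero 0, zeroGap_le_one]

/-- The frequencies `zₙ^p`, `p ≥ 1`, are separated. -/
theorem besselZero_rpow_gap {p : ℝ} (hp : 1 ≤ p) (n k : ℕ) :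
    besselZero n ^ p + zeroGap * k ≤ besselZero (n + k) ^ p := by
  have hz := one_le_besselZero n
  have hz0 := besselZero_pos n
  have hg := zeroGap_pos
  have h1 : besselZero n ^ p + zeroGap * k ≤ (besselZero n + zeroGap * k) ^ p := by
    have e : besselZero n + zeroGap * k = besselZero n * (1 + zeroGap * k / besselZero n) := by
      field_simp
    rw [e, Real.mul_rpow hz0.le (by positivity)]
    have hB := one_add_mul_self_le_rpow_one_add (s := zeroGap * k / besselZero n)
      (by linarith [show 0 ≤ zeroGap * k / besselZero n by positivity]) hp
    have h2 : besselZero n ^ p * (1 + p * (zeroGap * k / besselZero n)) ≤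
        besselZero n ^ p * (1 + zeroGap * k / besselZero n) ^ p := by gcongr
    refine le_trans ?_ h2
    have h3 : besselZero n ≤ besselZero n ^ p := by
      simpa using Real.rpow_le_rpow_of_exponent_le hz hp
    have h4 : zeroGap * k ≤ besselZero n ^ p * (p * (zeroGap * k / besselZero n)) := by
      calc zeroGap * k = besselZero n * (1 * (zeroGap * k / besselZero n)) := by field_simp
        _ ≤ _ := by gcongr
    linarith
  exact h1.trans (Real.rpow_le_rpow (by positivity) (besselZero_add_mul_le n k) (by linarith))

/-! ### Radial integrals and the orthonormal system of eigenfunctions -/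

theorem integral_radial {F : Type*} [NormedAddCommGroup F] [NormedSpace ℝ F] (f : ℝ → F) :
    ∫ x, f ‖x‖ ∂discMeasure = (1 / 2 : ℝ) • ∫ r in (0 : ℝ)..1, r • f r := by
  have hpi := Real.pi_pos
  have h1 : ∫ x in Metric.ball (0 : Plane) 1, f ‖x‖ = ∫ x : Plane, (Iio 1).indicator f ‖x‖ := by
    rw [← integral_indicator Metric.isOpen_ball.measurableSet]
    refine integral_congr_ae (Eventually.of_forall fun x => ?_)
    by_cases h : ‖x‖ < 1 <;> simp [indicator, h]
  have h2 : ∫ y in Ioi (0 : ℝ), y • (Iio 1).indicator f y = ∫ r in (0 : ℝ)..1, r • f r := by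
    rw [intervalIntegral.integral_of_le zero_le_one, integral_Ioc_eq_integral_Ioo,
      ← integral_indicator measurableSet_Ioi, ← integral_indicator measurableSet_Ioo]
    refine integral_congr_ae (Eventually.of_forall fun x => ?_)
    by_cases h0 : 0 < x <;> by_cases h1 : x < 1 <;> simp [indicator_apply, h0, h1]
  rw [discMeasure, integral_smul_measure, h1, integral_fun_norm_addHaar]
  simp only [finrank_euclideanSpace, Fintype.card_fin, Nat.add_one_sub_one, pow_one]
  rw [h2, Measure.real, EuclideanSpace.volume_ball_fin_two]
  simp only [ENNReal.ofReal_one, one_pow, one_mul]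
  rw [ENNReal.toReal_ofReal (by positivity), ← Nat.cast_smul_eq_nsmul ℝ, smul_smul, smul_smul]
  congr 1
  rw [ENNReal.toReal_ofReal hpi.le]
  push_cast
  field_simp
  norm_num

/-- The Bessel part of the Lommel integral: `J₀(a r)` and `J₀(b r)` are orthogonal on `[0, 1]`
for distinct zeros `a`, `b`. -/
theorem integral_mul_besselJ0_mul_besselJ0 {a b : ℝ} (ha : besselJ0 a = 0) (hb : besselJ0 b = 0)
    (h : a ^ 2 ≠ b ^ 2) :
    ∫ r in (0 : ℝ)..1, r * (besselJ0 (a * r) * besselJ0 (b * r)) = 0 := by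
  have hd : ∀ r ∈ uIcc (0 : ℝ) 1, HasDerivAt
      (fun r => r * (a * besselD (a * r) * besselJ0 (b * r) - b * besselJ0 (a * r) * besselD (b * r)))
      ((b ^ 2 - a ^ 2) * (r * (besselJ0 (a * r) * besselJ0 (b * r)))) r := by
    intro r _
    have l : ∀ c : ℝ, HasDerivAt (fun r => c * r) c r := fun c => by
      simpa using (hasDerivAt_id r).const_mul c
    have j : ∀ c : ℝ, HasDerivAt (fun r => besselJ0 (c * r)) (besselD (c * r) * c) r := fun c =>
      (hasDerivAt_besselJ0 (c * r)).comp r (l c)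
    have d : ∀ c : ℝ, HasDerivAt (fun r => besselD (c * r)) (besselDD (c * r) * c) r := fun c =>
      (hasDerivAt_besselD (c * r)).comp r (l c)
    have := (hasDerivAt_id r).mul ((((d a).const_mul a).mul (j b)).sub (((j a).const_mul b).mul (d b)))
    refine this.congr_deriv ?_
    have oa := bessel_ode (a * r)
    have ob := bessel_ode (b * r)
    simp only [id, Pi.sub_apply, Pi.mul_apply]
    linear_combination a * besselJ0 (b * r) * oa - b * besselJ0 (a * r) * ob
  have hi := intervalIntegral.integral_eq_sub_of_hasDerivAt hd
    (Continuous.intervalIntegrable (by have := continuous_besselJ0; fun_prop) _ _)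
  rw [intervalIntegral.integral_const_mul] at hi
  simp only [mul_one, ha, hb, mul_zero, zero_mul, sub_self] at hi
  exact (mul_eq_zero.1 hi).resolve_left (sub_ne_zero.2 h.symm)

theorem integral_mul_besselJ0_sq {a : ℝ} (ha : besselJ0 a = 0) :
    ∫ r in (0 : ℝ)..1, r * (besselJ0 (a * r) * besselJ0 (a * r)) = besselD a ^ 2 / 2 := by
  have hd : ∀ r ∈ uIcc (0 : ℝ) 1, HasDerivAt
      (fun r => r ^ 2 * (besselJ0 (a * r) ^ 2 + besselD (a * r) ^ 2) / 2)
      (r * (besselJ0 (a * r) * besselJ0 (a * r))) r := by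
    intro r _
    have l : HasDerivAt (fun r => a * r) a r := by
      simpa using (hasDerivAt_id r).const_mul a
    have j : HasDerivAt (fun r => besselJ0 (a * r)) (besselD (a * r) * a) r :=
      (hasDerivAt_besselJ0 (a * r)).comp r l
    have d : HasDerivAt (fun r => besselD (a * r)) (besselDD (a * r) * a) r :=
      (hasDerivAt_besselD (a * r)).comp r l
    have := (((hasDerivAt_id r).pow 2).mul ((j.pow 2).add (d.pow 2))).div_const 2
    refine this.congr_deriv ?_
    have oa := bessel_ode (a * r)
    simp
    linear_combination r * besselD (a * r) * oa
  have hi := intervalIntegral.integral_eq_sub_of_hasDerivAt hd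
    (Continuous.intervalIntegrable (by have := continuous_besselJ0; fun_prop) _ _)
  rw [hi]
  simp [ha]

theorem memLp_radialMode (n : ℕ) : MemLp (radialMode n) 2 discMeasure := by
  refine MemLp.of_bound ?_ 1 ?_
  · refine Continuous.aestronglyMeasurable ?_
    unfold radialMode
    exact Complex.continuous_ofReal.comp
      (continuous_besselJ0.comp (continuous_const.mul continuous_norm))
  · refine Eventually.of_forall fun x => ?_
    rw [radialMode, Complex.norm_real]
    exact abs_besselJ0_le _

theorem inner_radialMode (n k : ℕ) :
    inner ℂ ((memLp_radialMode n).toLp _) ((memLp_radialMode k).toLp _) =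
      if n = k then ((besselD (besselZero n) ^ 2 / 4 : ℝ) : ℂ) else 0 := by
  have h1 : inner ℂ ((memLp_radialMode n).toLp _) ((memLp_radialMode k).toLp _) =
      ∫ x : Plane, (fun r => ((besselJ0 (besselZero n * r) * besselJ0 (besselZero k * r) : ℝ) : ℂ)) ‖x‖
        ∂discMeasure := by
    rw [L2.inner_def]
    refine integral_congr_ae ?_
    filter_upwards [(memLp_radialMode n).coeFn_toLp, (memLp_radialMode k).coeFn_toLp] with x h1 h2
    rw [h1, h2]
    simp [radialMode, mul_comm]
  rw [h1, integral_radial (fun r =>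
    ((besselJ0 (besselZero n * r) * besselJ0 (besselZero k * r) : ℝ) : ℂ))]
  have h2 : ∫ r in (0 : ℝ)..1, r • ((besselJ0 (besselZero n * r) * besselJ0 (besselZero k * r) : ℝ) : ℂ)
      = ((∫ r in (0 : ℝ)..1, r * (besselJ0 (besselZero n * r) * besselJ0 (besselZero k * r)) : ℝ) : ℂ) := by
    rw [← intervalIntegral.integral_ofReal]
    refine intervalIntegral.integral_congr fun r _ => ?_
    simp
  rw [h2]
  split_ifs with h
  · subst h
    rw [integral_mul_besselJ0_sq (besselJ0_besselZero n)]
    simp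
    ring
  · rw [integral_mul_besselJ0_mul_besselJ0 (besselJ0_besselZero n) (besselJ0_besselZero k)]
    · simp
    · intro he
      have := (pow_left_inj₀ (besselZero_pos n).le (besselZero_pos k).le two_ne_zero).1 he
      exact h (strictMono_besselZero.injective this)

theorem besselD_besselZero_ne_zero (n : ℕ) : besselD (besselZero n) ≠ 0 := by
  obtain ⟨c, hc, h⟩ := exists_le_mul_besselD_sq
  intro h0
  have := h _ (one_le_besselZero n) (besselJ0_besselZero n)
  rw [h0] at this
  simp at this
  linarith

theorem eLpNorm_radialMode (n : ℕ) :
    (eLpNorm (radialMode n) 2 discMeasure).toReal = |besselD (besselZero n)| / 2 := by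
  rw [← Lp.norm_toLp _ (memLp_radialMode n)]
  have h := inner_self_eq_norm_sq_to_K (𝕜 := ℂ) ((memLp_radialMode n).toLp _)
  rw [inner_radialMode, if_pos rfl] at h
  have h2 : besselD (besselZero n) ^ 2 / 4 = ‖(memLp_radialMode n).toLp _‖ ^ 2 := by
    exact Complex.ofReal_injective (h.trans (by push_cast; rfl))
  have h3 : (|besselD (besselZero n)| / 2) ^ 2 = ‖(memLp_radialMode n).toLp _‖ ^ 2 := by
    rw [← h2, div_pow, sq_abs]; norm_num
  exact ((pow_left_inj₀ (by positivity) (norm_nonneg _) two_ne_zero).1 h3).symm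

/-- The normalizing constant of `eₙ`. -/
def eigConst (n : ℕ) : ℝ := (|besselD (besselZero n)| / 2)⁻¹

/-- The radial profile of `eₙ`. -/
def eig (n : ℕ) (r : ℝ) : ℝ := eigConst n * besselJ0 (besselZero n * r)

/-- The derivative of the profile of `eₙ`. -/
def eigD (n : ℕ) (r : ℝ) : ℝ := eigConst n * (besselZero n * besselD (besselZero n * r))

/-- The second derivative of the profile of `eₙ`. -/
def eigDD (n : ℕ) (r : ℝ) : ℝ :=
  eigConst n * (besselZero n * (besselZero n * besselDD (besselZero n * r)))

theorem eigenfun_eq (n : ℕ) (x : Plane) : eigenfun n x = (eig n ‖x‖ : ℂ) := by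
  rw [eigenfun, eLpNorm_radialMode, radialMode, eig, eigConst]
  push_cast
  rfl

theorem orthonormal_eigenLp : Orthonormal ℂ eigenLp := by
  have he : ∀ n, eigenLp n = (eigConst n : ℂ) • (memLp_radialMode n).toLp _ := by
    intro n
    refine Lp.ext ?_
    filter_upwards [(memLp_radialMode n).coeFn_toLp, (memLp_eigenfun n).coeFn_toLp,
      Lp.coeFn_smul (eigConst n : ℂ) ((memLp_radialMode n).toLp _)] with x h1 h2 h3
    rw [eigenLp, h2, h3, Pi.smul_apply, h1, eigenfun_eq, eig, radialMode]
    simp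
  rw [orthonormal_iff_ite]
  intro n k
  rw [he, he, inner_smul_left, inner_smul_right, inner_radialMode]
  split_ifs with h
  · subst h
    have h0 := besselD_besselZero_ne_zero n
    rw [Complex.conj_ofReal, eigConst]
    norm_cast
    field_simp
    rw [sq_abs]
    field_simp
    norm_num
  · simp

theorem hasDerivAt_eig (n : ℕ) (r : ℝ) : HasDerivAt (eig n) (eigD n r) r := by
  have l : HasDerivAt (fun r => besselZero n * r) (besselZero n) r := by
    simpa using (hasDerivAt_id r).const_mul (besselZero n)
  have := ((hasDerivAt_besselJ0 (besselZero n * r)).comp r l).const_mul (eigConst n)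
  exact this.congr_deriv (by rw [eigD]; ring)

theorem hasDerivAt_eigD (n : ℕ) (r : ℝ) : HasDerivAt (eigD n) (eigDD n r) r := by
  have l : HasDerivAt (fun r => besselZero n * r) (besselZero n) r := by
    simpa using (hasDerivAt_id r).const_mul (besselZero n)
  have := (((hasDerivAt_besselD (besselZero n * r)).comp r l).const_mul
    (besselZero n)).const_mul (eigConst n)
  exact this.congr_deriv (by rw [eigDD]; ring)

theorem continuous_besselDD : Continuous besselDD := by
  unfold besselDD
  refine continuous_const.mul ?_
  apply intervalIntegral.continuous_parametric_intervalIntegral_of_continuous'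
  fun_prop

@[fun_prop]
theorem continuous_eig (n : ℕ) : Continuous (eig n) := by
  have := continuous_besselJ0; unfold eig; fun_prop

@[fun_prop]
theorem continuous_eigD (n : ℕ) : Continuous (eigD n) := by
  have := continuous_besselD; unfold eigD; fun_prop

@[fun_prop]
theorem continuous_eigDD (n : ℕ) : Continuous (eigDD n) := by
  have := continuous_besselDD; unfold eigDD; fun_prop

theorem eig_one (n : ℕ) : eig n 1 = 0 := by simp [eig, besselJ0_besselZero]

theorem eigD_zero (n : ℕ) : eigD n 0 = 0 := by simp [eigD, besselD_zero]

/-- The radial eigenvalue equation `(r eₙ')' = - zₙ² r eₙ`. -/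
theorem hasDerivAt_mul_eigD (n : ℕ) (r : ℝ) :
    HasDerivAt (fun r => r * eigD n r) (r * (-(besselZero n ^ 2) * eig n r)) r := by
  refine ((hasDerivAt_id r).mul (hasDerivAt_eigD n r)).congr_deriv ?_
  have := bessel_ode (besselZero n * r)
  simp only [id, eig, eigD, eigDD]
  linear_combination eigConst n * besselZero n * this

/-- The pointwise bounds for the eigenfunctions. They combine the bound `eₙ² = O(zₙ)`, relevant
near the origin, with the decay `eₙ² = O(1/r)`, up to a power `ε`. -/
theorem exists_eig_sq_le : ∃ C, 0 < C ∧ ∀ ε : ℝ, 0 ≤ ε → ε ≤ 1 → ∀ n r, 0 < r →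
    eig n r ^ 2 ≤ C * besselZero n ^ ε * r ^ (ε - 1) ∧
    (eigD n r / besselZero n) ^ 2 ≤ C * besselZero n ^ ε * r ^ (ε - 1) ∧
    (eigDD n r / besselZero n ^ 2) ^ 2 ≤ C * besselZero n ^ ε * r ^ (ε - 1) := by
  obtain ⟨c, hc, h⟩ := exists_le_mul_besselD_sq
  refine ⟨4 / c * 28, by positivity, fun ε h0 h1 n r hr => ?_⟩
  have hz := besselZero_pos n
  have hK : eigConst n ^ 2 ≤ 4 / c * besselZero n := by
    have h2 := h _ (one_le_besselZero n) (besselJ0_besselZero n)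
    have h3 := besselD_besselZero_ne_zero n
    rw [eigConst, inv_pow, div_pow, sq_abs]
    have h4 : 0 < besselD (besselZero n) ^ 2 := by positivity
    rw [inv_le_comm₀ (by positivity) (by positivity), mul_inv, inv_div, ← div_eq_mul_inv, div_div, div_le_div_iff₀ (by positivity) (by positivity)]
    nlinarith
  have hx : 0 < besselZero n * r := by positivity
  have gen : ∀ y : ℝ, |y| ≤ 1 → besselZero n * r * y ^ 2 ≤ 28 →
      (eigConst n * y) ^ 2 ≤ 4 / c * 28 * besselZero n ^ ε * r ^ (ε - 1) := by
    intro y hy1 hy2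
    have hy : y ^ 2 ≤ 28 * (besselZero n * r) ^ (ε - 1) := by
      -- `y² ≤ min(1, 28/x) ≤ 28 x^{ε-1}` at `x = zₙ r`
      rcases le_total (besselZero n * r) 1 with hle | hle
      · have : 1 ≤ (besselZero n * r) ^ (ε - 1) :=
          Real.one_le_rpow_of_pos_of_le_one_of_nonpos hx hle (by linarith)
        have : y ^ 2 ≤ 1 := by rwa [sq_le_one_iff_abs_le_one]
        linarith
      · have h5 : (besselZero n * r)⁻¹ ≤ (besselZero n * r) ^ (ε - 1) := by
          rw [← Real.rpow_neg_one]
          exact Real.rpow_le_rpow_of_exponent_le hle (by linarith)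
        calc y ^ 2 ≤ 28 / (besselZero n * r) := by rw [le_div_iff₀ hx]; linarith
          _ ≤ _ := by rw [div_eq_mul_inv]; gcongr
    calc (eigConst n * y) ^ 2 = eigConst n ^ 2 * y ^ 2 := by ring
      _ ≤ (4 / c * besselZero n) * (28 * (besselZero n * r) ^ (ε - 1)) := by gcongr
      _ = 4 / c * 28 * (besselZero n * besselZero n ^ (ε - 1)) * r ^ (ε - 1) := by
          rw [Real.mul_rpow hz.le hr.le]; ring
      _ = _ := by
          congr 2
          rw [Real.rpow_sub_one hz.ne']; field_simp
  have hb := mul_sq_le (besselZero n * r) hx.le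
  refine ⟨gen _ (abs_besselJ0_le _) hb.1, ?_, ?_⟩
  · convert gen _ (abs_besselD_le _) hb.2.1 using 2
    rw [eigD]; field_simp
  · convert gen _ (abs_besselDD_le _) hb.2.2 using 2
    rw [eigDD]; field_simp

/-! ### A large sieve inequality for separated frequencies -/

theorem sum_pow_comp_le {ρ : ℝ} (h0 : 0 ≤ ρ) (h1 : ρ < 1) {F : Finset ℕ} {f : ℕ → ℕ}
    (hf : Set.InjOn f F) : ∑ k ∈ F, ρ ^ f k ≤ (1 - ρ)⁻¹ := by
  rw [← Finset.sum_image (f := fun d => ρ ^ d) hf, ← tsum_geometric_of_lt_one h0 h1]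
  exact (summable_geometric_of_lt_one h0 h1).sum_le_tsum _ fun i _ => pow_nonneg h0 i

/-- The row sums of `ρ^|n - k|`. -/
theorem sum_pow_dist_le {ρ : ℝ} (h0 : 0 ≤ ρ) (h1 : ρ < 1) (F : Finset ℕ) (n : ℕ) :
    ∑ k ∈ F, ρ ^ (max n k - min n k) ≤ 2 * (1 - ρ)⁻¹ := by
  rw [← Finset.sum_filter_add_sum_filter_not F (· ≤ n), two_mul]
  refine add_le_add (sum_pow_comp_le h0 h1 ?_) (sum_pow_comp_le h0 h1 ?_)
  all_goals
    intro x hx y hy hxy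
    simp at hx hy hxy
    omega

theorem exp_gap_le {x y g : ℝ} (hg : 0 < g) (h : g ≤ |x - y|) (k : ℕ) (hk : g * k ≤ |x - y|) :
    Real.exp (-(x - y) ^ 2 / 4) ≤ Real.exp (-g ^ 2 / 4) ^ k := by
  rw [← Real.exp_nat_mul]
  refine Real.exp_le_exp.2 ?_
  have h1 : g * (g * k) ≤ (x - y) ^ 2 := by
    rw [← sq_abs]
    nlinarith [mul_nonneg hg.le (Nat.cast_nonneg (α := ℝ) k)]
  nlinarith

/-- The row sums of the matrix `exp (-(λₙ - λₘ)²/4)` are bounded for separated `λ`. -/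
theorem sum_exp_gap_le {l : ℕ → ℝ} {g : ℝ} (hg : 0 < g)
    (hl : ∀ n k : ℕ, l n + g * k ≤ l (n + k)) (F : Finset ℕ) (n : ℕ) :
    ∑ k ∈ F, Real.exp (-(l n - l k) ^ 2 / 4) ≤ 2 * (1 - Real.exp (-g ^ 2 / 4))⁻¹ := by
  set ρ := Real.exp (-g ^ 2 / 4) with hρ
  have hρ0 : 0 ≤ ρ := (Real.exp_pos _).le
  have hρ1 : ρ < 1 := Real.exp_lt_one_iff.2 (by nlinarith)
  have hb : ∀ k, Real.exp (-(l n - l k) ^ 2 / 4) ≤ ρ ^ (max n k - min n k) := by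
    intro k
    rcases le_total n k with h | h
    · obtain ⟨d, rfl⟩ := Nat.exists_eq_add_of_le h
      have h1 := hl n d
      have h2 : g * d ≤ |l n - l (n + d)| := by rw [abs_sub_comm]; exact le_trans (by linarith) (le_abs_self _)
      rcases Nat.eq_zero_or_pos d with rfl | hd
      · simp
      · have : g ≤ g * d := by
          have : (1 : ℝ) ≤ d := by exact_mod_cast hd
          nlinarith
        simpa using exp_gap_le hg (this.trans h2) d h2
    · obtain ⟨d, rfl⟩ := Nat.exists_eq_add_of_le h
      have h1 := hl k d
      have h2 : g * d ≤ |l (k + d) - l k| := le_trans (by linarith) (le_abs_self _)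
      rcases Nat.eq_zero_or_pos d with rfl | hd
      · simp
      · have : g ≤ g * d := by
          have : (1 : ℝ) ≤ d := by exact_mod_cast hd
          nlinarith
        simpa using exp_gap_le hg (this.trans h2) d h2
  exact (Finset.sum_le_sum fun k _ => hb k).trans (sum_pow_dist_le hρ0 hρ1 F n)

/-- The large sieve: exponentials with separated frequencies are almost orthogonal on `[-1, 1]`. -/
theorem integral_norm_sq_sum_exp_le {l : ℕ → ℝ} {g : ℝ} (hg : 0 < g)
    (hl : ∀ n k : ℕ, l n + g * k ≤ l (n + k)) (F : Finset ℕ) (a : ℕ → ℂ) :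
    ∫ t in Icc (-1 : ℝ) 1, ‖∑ n ∈ F, a n * Complex.exp (-(Complex.I * l n * t))‖ ^ 2 ≤
      2 * Real.exp 1 * √Real.pi * (1 - Real.exp (-g ^ 2 / 4))⁻¹ * ∑ n ∈ F, ‖a n‖ ^ 2 := by
  set S : ℝ → ℂ := fun t => ∑ n ∈ F, a n * Complex.exp (-(Complex.I * l n * t)) with hS
  have hexp : ∀ n (t : ℝ), ‖Complex.exp (-(Complex.I * l n * t))‖ = 1 := fun n t => by
    rw [Complex.norm_exp]; simp
  have hSc : Continuous S := by fun_prop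
  have hSb : ∀ t, ‖S t‖ ≤ ∑ n ∈ F, ‖a n‖ := fun t => by
    refine (norm_sum_le _ _).trans_eq ?_
    simp [hexp]
  have hgi : Integrable fun t : ℝ => Real.exp (-1 * t ^ 2) := integrable_exp_neg_mul_sq one_pos
  have hint : Integrable fun t : ℝ => Real.exp (-1 * t ^ 2) * ‖S t‖ ^ 2 := by
    refine hgi.mul_bdd (c := (∑ n ∈ F, ‖a n‖) ^ 2) (by fun_prop) (Eventually.of_forall fun t => ?_)
    rw [norm_pow, norm_norm]
    exact pow_le_pow_left₀ (norm_nonneg _) (hSb t) 2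
  have h1 : ∫ t in Icc (-1 : ℝ) 1, ‖S t‖ ^ 2 ≤
      Real.exp 1 * ∫ t : ℝ, Real.exp (-1 * t ^ 2) * ‖S t‖ ^ 2 := by
    rw [← integral_const_mul]
    calc ∫ t in Icc (-1 : ℝ) 1, ‖S t‖ ^ 2
        ≤ ∫ t in Icc (-1 : ℝ) 1, Real.exp 1 * (Real.exp (-1 * t ^ 2) * ‖S t‖ ^ 2) := by
          refine setIntegral_mono_on ?_ (hint.const_mul _).integrableOn measurableSet_Icc ?_
          · exact (by fun_prop : Continuous fun t => ‖S t‖ ^ 2).continuousOn.integrableOn_Icc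
          · intro t ht
            rw [← mul_assoc, ← Real.exp_add]
            refine le_mul_of_one_le_left (by positivity) (Real.one_le_exp ?_)
            nlinarith [ht.1, ht.2]
      _ ≤ _ := setIntegral_le_integral (hint.const_mul _) (Eventually.of_forall fun t => by positivity)
  have h2 : ((∫ t : ℝ, Real.exp (-1 * t ^ 2) * ‖S t‖ ^ 2 : ℝ) : ℂ) =
      ∑ n ∈ F, ∑ k ∈ F, a n * (starRingEnd ℂ) (a k) *
        ((Real.pi / 1 : ℂ) ^ (1 / 2 : ℂ) * Complex.exp (-(-(l n - l k : ℂ)) ^ 2 / (4 * 1))) := by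
    rw [← integral_complex_ofReal]
    have hpt : ∀ t : ℝ, ((Real.exp (-1 * t ^ 2) * ‖S t‖ ^ 2 : ℝ) : ℂ) =
        ∑ n ∈ F, ∑ k ∈ F, a n * (starRingEnd ℂ) (a k) *
          (Complex.exp (Complex.I * (-(l n - l k : ℂ)) * t) * Complex.exp (-1 * (t : ℂ) ^ 2)) := by
      intro t
      have : ((‖S t‖ ^ 2 : ℝ) : ℂ) = S t * (starRingEnd ℂ) (S t) := by
        rw [Complex.mul_conj, Complex.normSq_eq_norm_sq]
      rw [Complex.ofReal_mul, this, hS, map_sum, Finset.sum_mul_sum, Finset.mul_sum]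
      refine Finset.sum_congr rfl fun n _ => ?_
      rw [Finset.mul_sum]
      refine Finset.sum_congr rfl fun k _ => ?_
      rw [map_mul, ← Complex.exp_conj]
      have : Complex.exp (Complex.I * (-(l n - l k : ℂ)) * t) =
          Complex.exp (-(Complex.I * l n * t)) *
            Complex.exp ((starRingEnd ℂ) (-(Complex.I * l k * t))) := by
        rw [← Complex.exp_add]
        congr 1
        simp
        ring
      rw [this]
      push_cast
      ring
    simp_rw [hpt]
    have hi : ∀ n k, Integrable fun t : ℝ => a n * (starRingEnd ℂ) (a k) *
          (Complex.exp (Complex.I * (-(l n - l k : ℂ)) * t) * Complex.exp (-1 * (t : ℂ) ^ 2)) := by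
      intro n k
      refine Integrable.const_mul ?_ _
      have : Integrable fun t : ℝ => Complex.exp (-1 * (t : ℂ) ^ 2) :=
        integrable_cexp_neg_mul_sq (by simp)
      refine this.bdd_mul (c := 1) (by fun_prop) (Eventually.of_forall fun t => ?_)
      rw [Complex.norm_exp]
      simp
    rw [integral_finsetSum _ fun n _ => integrable_finsetSum _ fun k _ => hi n k]
    refine Finset.sum_congr rfl fun n _ => ?_
    rw [integral_finsetSum _ fun k _ => hi n k]
    refine Finset.sum_congr rfl fun k _ => ?_
    rw [integral_const_mul, fourierIntegral_gaussian (by simp)]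
  have h3 : ∫ t : ℝ, Real.exp (-1 * t ^ 2) * ‖S t‖ ^ 2 ≤
      √Real.pi * ∑ n ∈ F, ∑ k ∈ F, ‖a n‖ * ‖a k‖ * Real.exp (-(l n - l k) ^ 2 / 4) := by
    have hn : ∫ t : ℝ, Real.exp (-1 * t ^ 2) * ‖S t‖ ^ 2 ≤
        ‖((∫ t : ℝ, Real.exp (-1 * t ^ 2) * ‖S t‖ ^ 2 : ℝ) : ℂ)‖ := by
      rw [Complex.norm_real]; exact le_abs_self _
    refine hn.trans ?_
    rw [h2, Finset.mul_sum]
    refine (norm_sum_le _ _).trans (Finset.sum_le_sum fun n _ => ?_)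
    rw [Finset.mul_sum]
    refine (norm_sum_le _ _).trans (Finset.sum_le_sum fun k _ => le_of_eq ?_)
    have e1 : ‖(Real.pi / 1 : ℂ) ^ (1 / 2 : ℂ)‖ = √Real.pi := by
      rw [div_one, Complex.norm_cpow_eq_rpow_re_of_pos Real.pi_pos, Real.sqrt_eq_rpow]
      norm_num
    have e2 : ‖Complex.exp (-(-(l n - l k : ℂ)) ^ 2 / (4 * 1))‖ = Real.exp (-(l n - l k) ^ 2 / 4) := by
      rw [Complex.norm_exp]
      congr 1
      have : (-(-(l n - l k : ℂ)) ^ 2 / (4 * 1)) = ((-(l n - l k) ^ 2 / 4 : ℝ) : ℂ) := by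
        push_cast; ring
      rw [this, Complex.ofReal_re]
    rw [norm_mul, norm_mul, norm_mul, RCLike.norm_conj, e1, e2]
    ring
  have h4 : ∑ n ∈ F, ∑ k ∈ F, ‖a n‖ * ‖a k‖ * Real.exp (-(l n - l k) ^ 2 / 4) ≤
      2 * (1 - Real.exp (-g ^ 2 / 4))⁻¹ * ∑ n ∈ F, ‖a n‖ ^ 2 := by
    have hs : ∀ n k, ‖a n‖ * ‖a k‖ * Real.exp (-(l n - l k) ^ 2 / 4) ≤
        1 / 2 * (‖a n‖ ^ 2 * Real.exp (-(l n - l k) ^ 2 / 4)) +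
        1 / 2 * (‖a k‖ ^ 2 * Real.exp (-(l k - l n) ^ 2 / 4)) := by
      intro n k
      rw [show (l k - l n) ^ 2 = (l n - l k) ^ 2 by ring]
      have := (Real.exp_pos (-(l n - l k) ^ 2 / 4)).le
      nlinarith [mul_nonneg this (sq_nonneg (‖a n‖ - ‖a k‖))]
    have hr : ∑ n ∈ F, ∑ k ∈ F, ‖a n‖ ^ 2 * Real.exp (-(l n - l k) ^ 2 / 4) ≤
        2 * (1 - Real.exp (-g ^ 2 / 4))⁻¹ * ∑ n ∈ F, ‖a n‖ ^ 2 := by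
      rw [Finset.mul_sum]
      refine Finset.sum_le_sum fun n _ => ?_
      rw [← Finset.mul_sum, mul_comm]
      exact mul_le_mul_of_nonneg_right (sum_exp_gap_le hg hl F n) (sq_nonneg _)
    calc _ ≤ ∑ n ∈ F, ∑ k ∈ F, (1 / 2 * (‖a n‖ ^ 2 * Real.exp (-(l n - l k) ^ 2 / 4)) +
        1 / 2 * (‖a k‖ ^ 2 * Real.exp (-(l k - l n) ^ 2 / 4))) :=
          Finset.sum_le_sum fun n _ => Finset.sum_le_sum fun k _ => hs n k
      _ = ∑ n ∈ F, ∑ k ∈ F, ‖a n‖ ^ 2 * Real.exp (-(l n - l k) ^ 2 / 4) := by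
          simp_rw [Finset.sum_add_distrib, ← Finset.mul_sum]
          rw [Finset.sum_comm (f := fun n k => ‖a k‖ ^ 2 * Real.exp (-(l k - l n) ^ 2 / 4))]
          simp_rw [← Finset.mul_sum]
          ring
      _ ≤ _ := hr
  calc _ ≤ Real.exp 1 * ∫ t : ℝ, Real.exp (-1 * t ^ 2) * ‖S t‖ ^ 2 := h1
    _ ≤ Real.exp 1 * (√Real.pi * (2 * (1 - Real.exp (-g ^ 2 / 4))⁻¹ * ∑ n ∈ F, ‖a n‖ ^ 2)) := by
        gcongr
        exact h3.trans (by gcongr)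
    _ = _ := by ring

theorem lintegral_enorm_sq_sum_exp_le {l : ℕ → ℝ} {g : ℝ} (hg : 0 < g)
    (hl : ∀ n k : ℕ, l n + g * k ≤ l (n + k)) (F : Finset ℕ) (a : ℕ → ℂ) :
    ∫⁻ t in Icc (-1 : ℝ) 1, ‖∑ n ∈ F, a n * Complex.exp (-(Complex.I * l n * t))‖ₑ ^ 2 ≤
      ENNReal.ofReal (2 * Real.exp 1 * √Real.pi * (1 - Real.exp (-g ^ 2 / 4))⁻¹) *
        ∑ n ∈ F, ‖a n‖ₑ ^ 2 := by
  have hρ1 : Real.exp (-g ^ 2 / 4) < 1 := Real.exp_lt_one_iff.2 (by nlinarith)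
  have h := ENNReal.ofReal_le_ofReal (integral_norm_sq_sum_exp_le hg hl F a)
  rw [ofReal_integral_eq_lintegral_ofReal, ENNReal.ofReal_mul,
    ENNReal.ofReal_sum_of_nonneg fun n _ => by positivity] at h
  · simpa only [ENNReal.ofReal_pow (norm_nonneg _), ofReal_norm] using h
  · have : 0 ≤ (1 - Real.exp (-g ^ 2 / 4))⁻¹ := inv_nonneg.2 (by linarith)
    positivity
  · exact (by fun_prop : Continuous fun t : ℝ =>
      ‖∑ n ∈ F, a n * Complex.exp (-(Complex.I * l n * t))‖ ^ 2).continuousOn.integrableOn_Icc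
  · exact Eventually.of_forall fun t => by positivity

/-! ### Square roots, Cauchy-Schwarz and Minkowski in `[0, ∞]` -/

theorem rpow_half_sq (a : ℝ≥0∞) : (a ^ (1 / 2 : ℝ)) ^ 2 = a := by
  rw [← ENNReal.rpow_two, ← ENNReal.rpow_mul]; norm_num

theorem sq_rpow_half (a : ℝ≥0∞) : (a ^ 2) ^ (1 / 2 : ℝ) = a := by
  rw [← ENNReal.rpow_two, ← ENNReal.rpow_mul]; norm_num

theorem sq_le_sq_enn {a b : ℝ≥0∞} : a ^ 2 ≤ b ^ 2 ↔ a ≤ b :=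
  ENNReal.pow_le_pow_left_iff two_ne_zero

theorem le_rpow_half {a b : ℝ≥0∞} (h : a ^ 2 ≤ b) : a ≤ b ^ (1 / 2 : ℝ) := by
  rw [← sq_le_sq_enn, rpow_half_sq]; exact h

theorem rpow_half_le {a b : ℝ≥0∞} (h : a ≤ b ^ 2) : a ^ (1 / 2 : ℝ) ≤ b := by
  rw [← sq_le_sq_enn, rpow_half_sq]; exact h

theorem lintegral_mul_le_sqrt {α : Type*} [MeasurableSpace α] (μ : Measure α) {f g : α → ℝ≥0∞}
    (hf : AEMeasurable f μ) (hg : AEMeasurable g μ) :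
    ∫⁻ x, f x * g x ∂μ ≤ (∫⁻ x, f x ^ 2 ∂μ) ^ (1 / 2 : ℝ) * (∫⁻ x, g x ^ 2 ∂μ) ^ (1 / 2 : ℝ) := by
  have := ENNReal.lintegral_mul_le_Lp_mul_Lq μ Real.HolderConjugate.two_two hf hg
  simpa [ENNReal.rpow_two] using this

theorem sq_lintegral_mul_le {α : Type*} [MeasurableSpace α] (μ : Measure α) {f g : α → ℝ≥0∞}
    (hf : AEMeasurable f μ) (hg : AEMeasurable g μ) :
    (∫⁻ x, f x * g x ∂μ) ^ 2 ≤ (∫⁻ x, f x ^ 2 ∂μ) * ∫⁻ x, g x ^ 2 ∂μ := by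
  have := pow_le_pow_left' (lintegral_mul_le_sqrt μ hf hg) 2
  rwa [mul_pow, rpow_half_sq, rpow_half_sq] at this

theorem sq_tsum_mul_le {ι : Type*} (f g : ι → ℝ≥0∞) :
    (∑' x, f x * g x) ^ 2 ≤ (∑' x, f x ^ 2) * ∑' x, g x ^ 2 := by
  let _ : MeasurableSpace ι := ⊤
  have := sq_lintegral_mul_le (Measure.count : Measure ι) (f := f) (g := g)
    (measurable_from_top).aemeasurable (measurable_from_top).aemeasurable
  simpa [lintegral_count' measurable_from_top] using this

theorem sq_sum_mul_le {ι : Type*} (F : Finset ι) (f g : ι → ℝ≥0∞) :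
    (∑ x ∈ F, f x * g x) ^ 2 ≤ (∑ x ∈ F, f x ^ 2) * ∑ x ∈ F, g x ^ 2 := by
  classical
  have := sq_tsum_mul_le (fun x : F => f x) (fun x : F => g x)
  simpa [tsum_fintype, Finset.sum_attach F (fun x => f x * g x),
    Finset.sum_attach F (fun x => f x ^ 2), Finset.sum_attach F (fun x => g x ^ 2)] using this

theorem add_sq_le_enn (a b : ℝ≥0∞) : (a + b) ^ 2 ≤ 2 * (a ^ 2 + b ^ 2) := by
  have := sq_sum_mul_le (Finset.univ : Finset (Fin 2)) (fun _ => 1) ![a, b]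
  simpa [one_add_one_eq_two] using this

/-- Minkowski's integral inequality between `ℓ²` and `L¹`. -/
theorem tsum_sq_lintegral_le {α ι : Type*} [Countable ι] [MeasurableSpace α] {μ : Measure α}
    [SFinite μ] {f : ι → α → ℝ≥0∞} (hf : ∀ i, AEMeasurable (f i) μ) :
    ∑' i, (∫⁻ x, f i x ∂μ) ^ 2 ≤ (∫⁻ x, (∑' i, f i x ^ 2) ^ (1 / 2 : ℝ) ∂μ) ^ 2 := by
  have e : ∀ g : α → ℝ≥0∞, AEMeasurable g μ → (∫⁻ x, g x ∂μ) ^ 2 = ∫⁻ x, ∫⁻ y, g x * g y ∂μ ∂μ := by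
    intro g hg
    rw [sq, ← lintegral_mul_const'' _ hg]
    refine lintegral_congr fun x => ?_
    rw [lintegral_const_mul'' _ hg]
  calc ∑' i, (∫⁻ x, f i x ∂μ) ^ 2 = ∑' i, ∫⁻ x, ∫⁻ y, f i x * f i y ∂μ ∂μ :=
        tsum_congr fun i => e _ (hf i)
    _ = ∫⁻ x, ∑' i, ∫⁻ y, f i x * f i y ∂μ ∂μ := by
        rw [lintegral_tsum]
        intro i
        simp_rw [lintegral_const_mul'' _ (hf i)]
        exact (hf i).mul_const _
    _ = ∫⁻ x, ∫⁻ y, ∑' i, f i x * f i y ∂μ ∂μ := by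
        refine lintegral_congr fun x => ?_
        rw [lintegral_tsum]
        exact fun i => (hf i).const_mul _
    _ ≤ ∫⁻ x, ∫⁻ y, (∑' i, f i x ^ 2) ^ (1 / 2 : ℝ) * (∑' i, f i y ^ 2) ^ (1 / 2 : ℝ) ∂μ ∂μ := by
        gcongr with x y
        rw [← ENNReal.mul_rpow_of_nonneg _ _ (by norm_num)]
        exact le_rpow_half (sq_tsum_mul_le _ _)
    _ = _ := (e _ ((AEMeasurable.tsum fun i => (hf i).pow_const 2).pow_const _)).symm

/-! ### Weighted `ℓ²` norms -/

/-- The weighted norm `(∑ wₙ² |cₙ|²)^{1/2}`. -/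
def wNorm (w : ℕ → ℝ) (c : ℕ → ℂ) : ℝ≥0∞ := eLpNorm (fun n => (w n : ℂ) * c n) 2 Measure.count

theorem wNorm_sq (w : ℕ → ℝ) (c : ℕ → ℂ) :
    wNorm w c ^ 2 = ∑' n, ENNReal.ofReal (w n ^ 2) * ‖c n‖ₑ ^ 2 := by
  rw [wNorm, eLpNorm_eq_lintegral_rpow_enorm_toReal two_ne_zero ENNReal.ofNat_ne_top]
  simp only [ENNReal.toReal_ofNat, ENNReal.rpow_two]
  rw [rpow_half_sq, lintegral_count]
  refine tsum_congr fun n => ?_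
  rw [enorm_mul, mul_pow]
  congr 1
  rw [← ofReal_norm, Complex.norm_real, ← ENNReal.ofReal_pow (norm_nonneg _), Real.norm_eq_abs, sq_abs]

theorem wNorm_eq (w : ℕ → ℝ) (c : ℕ → ℂ) :
    wNorm w c = (∑' n, ENNReal.ofReal (w n ^ 2) * ‖c n‖ₑ ^ 2) ^ (1 / 2 : ℝ) := by
  rw [← wNorm_sq, sq_rpow_half]

theorem wNorm_add_le (w : ℕ → ℝ) (a b : ℕ → ℂ) : wNorm w (a + b) ≤ wNorm w a + wNorm w b := by
  have := eLpNorm_add_le (μ := Measure.count) (f := fun n => (w n : ℂ) * a n)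
    (g := fun n => (w n : ℂ) * b n) (p := 2)
    measurable_from_top.aestronglyMeasurable measurable_from_top.aestronglyMeasurable (by norm_num)
  refine le_trans (le_of_eq ?_) this
  rw [wNorm]
  congr 1
  ext n
  simp [mul_add]

theorem wNorm_mono {w : ℕ → ℝ} {a b : ℕ → ℂ} (h : ∀ n, ‖a n‖ ≤ ‖b n‖) : wNorm w a ≤ wNorm w b :=
  eLpNorm_mono fun n => by
    rw [norm_mul, norm_mul]
    exact mul_le_mul_of_nonneg_left (h n) (norm_nonneg _)

theorem wNorm_congr_norm {w : ℕ → ℝ} {a b : ℕ → ℂ} (h : ∀ n, ‖a n‖ = ‖b n‖) :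
    wNorm w a = wNorm w b :=
  le_antisymm (wNorm_mono fun n => (h n).le) (wNorm_mono fun n => (h n).ge)

theorem wNorm_neg (w : ℕ → ℝ) (a : ℕ → ℂ) : wNorm w (-a) = wNorm w a :=
  wNorm_congr_norm fun n => by simp

theorem wNorm_sub_le (w : ℕ → ℝ) (a b : ℕ → ℂ) : wNorm w (a - b) ≤ wNorm w a + wNorm w b := by
  rw [sub_eq_add_neg, ← wNorm_neg w b]
  exact wNorm_add_le w a (-b)

theorem wNorm_sub_comm (w : ℕ → ℝ) (a b : ℕ → ℂ) : wNorm w (a - b) = wNorm w (b - a) := by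
  rw [← wNorm_neg, neg_sub]

@[simp] theorem wNorm_zero (w : ℕ → ℝ) : wNorm w 0 = 0 := by
  rw [wNorm_eq]; simp

theorem enorm_le_wNorm (w : ℕ → ℝ) (c : ℕ → ℂ) (n : ℕ) : ‖(w n : ℂ) * c n‖ₑ ≤ wNorm w c := by
  rw [← sq_le_sq_enn, wNorm_sq]
  refine le_trans (le_of_eq ?_) (ENNReal.le_tsum n)
  rw [enorm_mul, mul_pow]
  congr 1
  rw [← ofReal_norm, Complex.norm_real, ← ENNReal.ofReal_pow (norm_nonneg _), Real.norm_eq_abs, sq_abs]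

theorem wNorm_le_liminf {w : ℕ → ℝ} {a : ℕ → ℕ → ℂ} {b : ℕ → ℂ}
    (h : ∀ n, Tendsto (fun k => a k n) atTop (𝓝 (b n))) :
    wNorm w b ≤ liminf (fun k => wNorm w (a k)) atTop :=
  Lp.eLpNorm_lim_le_liminf_eLpNorm (fun _ => measurable_from_top.aestronglyMeasurable) _
    (Eventually.of_forall fun n => (h n).const_mul _)

theorem wNorm_le_of_tendsto {w : ℕ → ℝ} {a : ℕ → ℕ → ℂ} {b : ℕ → ℂ} {M : ℝ≥0∞}
    (h : ∀ n, Tendsto (fun k => a k n) atTop (𝓝 (b n))) (hM : ∀ᶠ k in atTop, wNorm w (a k) ≤ M) :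
    wNorm w b ≤ M := by
  refine (wNorm_le_liminf h).trans ?_
  exact liminf_le_of_frequently_le' hM.frequently

/-- Minkowski's inequality for integrals, in the weighted `ℓ²` space. -/
theorem wNorm_integral_le {α : Type*} [MeasurableSpace α] {μ : Measure α} [SFinite μ] {w : ℕ → ℝ}
    {f : α → ℕ → ℂ} (hf : ∀ n, AEStronglyMeasurable (fun x => f x n) μ) :
    wNorm w (fun n => ∫ x, f x n ∂μ) ≤ ∫⁻ x, wNorm w (f x) ∂μ := by
  rw [← sq_le_sq_enn, wNorm_sq]
  have h := tsum_sq_lintegral_le (μ := μ) (f := fun n x => ‖(w n : ℂ) * f x n‖ₑ)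
    fun n => ((hf n).const_mul _).enorm
  refine (ENNReal.tsum_le_tsum fun n => ?_).trans (h.trans (le_of_eq ?_))
  · have : ENNReal.ofReal (w n ^ 2) * ‖∫ x, f x n ∂μ‖ₑ ^ 2 = ‖∫ x, (w n : ℂ) * f x n ∂μ‖ₑ ^ 2 := by
      rw [integral_const_mul, enorm_mul, mul_pow]
      congr 1
      rw [← ofReal_norm, Complex.norm_real, ← ENNReal.ofReal_pow (norm_nonneg _), Real.norm_eq_abs,
        sq_abs]
    rw [this]
    gcongr
    exact enorm_integral_le_lintegral_enorm _
  · congr 1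
    refine lintegral_congr fun x => ?_
    rw [wNorm_eq]
    congr 1
    refine tsum_congr fun n => ?_
    rw [enorm_mul, mul_pow]
    congr 1
    rw [← ofReal_norm, Complex.norm_real, ← ENNReal.ofReal_pow (norm_nonneg _), Real.norm_eq_abs,
      sq_abs]

theorem measurable_wNorm {α : Type*} [MeasurableSpace α] {μ : Measure α} {w : ℕ → ℝ}
    {f : α → ℕ → ℂ} (hf : ∀ n, AEStronglyMeasurable (fun x => f x n) μ) :
    AEMeasurable (fun x => wNorm w (f x)) μ := by
  simp_rw [wNorm_eq]
  exact (AEMeasurable.tsum fun n => ((hf n).enorm.pow_const 2).const_mul _).pow_const _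

/-! ### Dyadic blocks of frequencies -/

/-- The `j`-th dyadic block of indices: `2^j ≤ n + 1 < 2^(j+1)`. -/
def block (j : ℕ) : Finset ℕ := Finset.Ico (2 ^ j - 1) (2 ^ (j + 1) - 1)

theorem mem_block {j n : ℕ} : n ∈ block j ↔ 2 ^ j ≤ n + 1 ∧ n + 1 < 2 ^ (j + 1) := by
  have h1 : 1 ≤ 2 ^ j := Nat.one_le_two_pow
  have h2 : 1 ≤ 2 ^ (j + 1) := Nat.one_le_two_pow
  rw [block, Finset.mem_Ico]
  omega

theorem card_block (j : ℕ) : (block j).card = 2 ^ j := by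
  have h1 : 1 ≤ 2 ^ j := Nat.one_le_two_pow
  rw [block, Nat.card_Ico, pow_succ]
  omega

theorem sum_range_eq_sum_block {M : Type*} [AddCommMonoid M] (f : ℕ → M) (J : ℕ) :
    ∑ n ∈ Finset.range (2 ^ J - 1), f n = ∑ j ∈ Finset.range J, ∑ n ∈ block j, f n := by
  induction J with
  | zero => simp
  | succ J ih =>
    have h1 : 1 ≤ 2 ^ J := Nat.one_le_two_pow
    rw [Finset.sum_range_succ, ← ih, block]
    exact (Finset.sum_range_add_sum_Ico f (by rw [pow_succ]; omega)).symm

theorem besselZero_le_block {j n : ℕ} (h : n ∈ block j) : besselZero n ≤ 14 * 2 ^ j := by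
  have h1 := besselZero_le n
  have h2 : ((n : ℝ) + 1) ≤ 2 ^ (j + 1) := by exact_mod_cast (mem_block.1 h).2.le
  rw [pow_succ] at h2
  linarith

/-- The profiles `eₙ`, `eₙ'`, `eₙ''`, `zₙ² eₙ`, `zₙ² eₙ'`, scaled to the frequency `2^j`. -/
def mode (j : ℕ) (i : Fin 5) (n : ℕ) (r : ℝ) : ℝ :=
  ![eig n r, eigD n r / 2 ^ j, eigDD n r / 4 ^ j, besselZero n ^ 2 / 4 ^ j * eig n r,
    besselZero n ^ 2 / 8 ^ j * eigD n r] i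

@[fun_prop]
theorem continuous_mode (j : ℕ) (i : Fin 5) (n : ℕ) : Continuous (mode j i n) := by
  unfold mode
  fin_cases i <;> simp <;> fun_prop

/-- A bound for the scaled profiles which, for `ε > 0`, is integrable for `dr`, with a loss of `2^(jε)`. -/
theorem exists_mode_sq_le : ∃ C, 0 < C ∧ ∀ ε : ℝ, 0 ≤ ε → ε ≤ 1 → ∀ j i, ∀ n ∈ block j, ∀ r, 0 < r →
    mode j i n r ^ 2 ≤ C * 2 ^ (j * ε) * r ^ (ε - 1) := by
  obtain ⟨C, hC, h⟩ := exists_eig_sq_le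
  refine ⟨C * 14 * 14 ^ 6, by positivity, fun ε h0 h1 j i n hn r hr => ?_⟩
  have hz := besselZero_pos n
  have hzj := besselZero_le_block hn
  have h2j : (0 : ℝ) < 2 ^ j := by positivity
  have hq : besselZero n / 2 ^ j ≤ 14 := by rwa [div_le_iff₀ h2j]
  have hε : besselZero n ^ ε ≤ 14 * 2 ^ (j * ε) := by
    calc besselZero n ^ ε ≤ (14 * 2 ^ j) ^ ε := Real.rpow_le_rpow hz.le hzj h0
      _ = 14 ^ ε * 2 ^ (j * ε) := by
          rw [Real.mul_rpow (by norm_num) h2j.le, Real.rpow_mul (by norm_num), Real.rpow_natCast]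
      _ ≤ 14 ^ (1 : ℝ) * 2 ^ (j * ε) := by
          gcongr
          norm_num
      _ = _ := by rw [Real.rpow_one]
  have hB : C * besselZero n ^ ε * r ^ (ε - 1) ≤ C * 14 * 2 ^ (j * ε) * r ^ (ε - 1) := by
    have : 0 ≤ r ^ (ε - 1) := by positivity
    nlinarith [mul_le_mul_of_nonneg_right hε (mul_nonneg hC.le this)]
  have gen : ∀ y : ℝ, ∀ k : ℕ, k ≤ 3 → y ^ 2 ≤ C * besselZero n ^ ε * r ^ (ε - 1) →
      (y * (besselZero n / 2 ^ j) ^ k) ^ 2 ≤ C * 14 * 14 ^ 6 * 2 ^ (j * ε) * r ^ (ε - 1) := by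
    intro y k hk hy
    have h5 : ((besselZero n / 2 ^ j) ^ k) ^ 2 ≤ 14 ^ 6 := by
      rw [← pow_mul]
      calc (besselZero n / 2 ^ j) ^ (k * 2) ≤ 14 ^ (k * 2) :=
            pow_le_pow_left₀ (by positivity) hq _
        _ ≤ 14 ^ 6 := pow_le_pow_right₀ (by norm_num) (by omega)
    calc (y * (besselZero n / 2 ^ j) ^ k) ^ 2 = y ^ 2 * ((besselZero n / 2 ^ j) ^ k) ^ 2 := by ring
      _ ≤ (C * 14 * 2 ^ (j * ε) * r ^ (ε - 1)) * 14 ^ 6 := by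
          gcongr
          exact hy.trans hB
      _ = _ := by ring
  obtain ⟨b0, b1, b2⟩ := h ε h0 h1 n r hr
  have e4 : (4 : ℝ) ^ j = 2 ^ j * 2 ^ j := by rw [← mul_pow]; norm_num
  have e8 : (8 : ℝ) ^ j = 2 ^ j * 2 ^ j * 2 ^ j := by rw [← mul_pow, ← mul_pow]; norm_num
  fin_cases i
  · simpa [mode] using gen _ 0 (by norm_num) b0
  · convert gen _ 1 (by norm_num) b1 using 2
    simp [mode]; field_simp
  · convert gen _ 2 (by norm_num) b2 using 2
    simp [mode, e4]; field_simp
  · convert gen _ 2 (by norm_num) b0 using 2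
    simp [mode, e4]; field_simp
  · convert gen _ 3 (by norm_num) b1 using 2
    simp [mode, e8]; field_simp

/-- The square of the block norm `β_j(c)`: it is `2^j` times the `L²(0,1)` norm, for the measure `dr`
rather than `r dr`, of the block `u_j = ∑ cₙ eₙ`, `n ∈ block j`, and of its scaled derivatives. It
controls the scaled uniform norms of `u_j`, `u_j'` and `Δ u_j`; as a quadratic form in `c` it can be
integrated in time exactly. -/
def blockSq (j : ℕ) (c : ℕ → ℂ) : ℝ≥0∞ :=
  2 ^ j * ∑ i : Fin 5, ∫⁻ r in Ioo (0 : ℝ) 1, ‖∑ n ∈ block j, c n * mode j i n r‖ₑ ^ 2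

/-- The block norm `β_j(c)`. -/
def blockNorm (j : ℕ) (c : ℕ → ℂ) : ℝ≥0∞ := blockSq j c ^ (1 / 2 : ℝ)

theorem blockNorm_sq (j : ℕ) (c : ℕ → ℂ) : blockNorm j c ^ 2 = blockSq j c := rpow_half_sq _

/-- One-dimensional Sobolev inequality for a function with a zero in `[0, 1]`. -/
theorem enorm_sq_le_of_hasDerivAt {F G : ℝ → ℂ} {K : ℝ} (hK : 0 ≤ K)
    (hF : ∀ x, HasDerivAt F (K * G x) x) (hG : Continuous G) {a r : ℝ} (ha : a ∈ Icc (0 : ℝ) 1)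
    (h0 : F a = 0) (hr : r ∈ Icc (0 : ℝ) 1) :
    ‖F r‖ₑ ^ 2 ≤ ENNReal.ofReal K * ((∫⁻ x in Ioo (0 : ℝ) 1, ‖F x‖ₑ ^ 2) +
      ∫⁻ x in Ioo (0 : ℝ) 1, ‖G x‖ₑ ^ 2) := by
  have hFc : Continuous F := continuous_iff_continuousAt.2 fun x => (hF x).continuousAt
  have h1 : ∫ x in a..r, 2 * F x * (K * G x) = F r ^ 2 := by
    rw [intervalIntegral.integral_eq_sub_of_hasDerivAt (f := fun x => F x ^ 2)]
    · simp [h0]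
    · intro x _
      refine ((hF x).pow 2).congr_deriv ?_
      simp
    · exact Continuous.intervalIntegrable (by fun_prop) _ _
  have h2 : ‖F r‖ₑ ^ 2 ≤ ∫⁻ x in Icc (0 : ℝ) 1, ‖2 * F x * (K * G x)‖ₑ := by
    rw [← enorm_pow, ← h1, ← ofReal_norm, intervalIntegral.norm_intervalIntegral_eq, ofReal_norm]
    refine (enorm_integral_le_lintegral_enorm _).trans (lintegral_mono_set ?_)
    exact uIoc_subset_uIcc.trans (uIcc_subset_Icc ha hr)
  refine h2.trans ?_
  rw [← lintegral_add_left (by fun_prop), ← lintegral_const_mul _ (by fun_prop),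
    restrict_Ioo_eq_restrict_Icc]
  refine lintegral_mono fun x => ?_
  rw [← ofReal_norm, ← ofReal_norm, ← ofReal_norm, ← ENNReal.ofReal_pow (norm_nonneg _),
    ← ENNReal.ofReal_pow (norm_nonneg _), ← ENNReal.ofReal_add (by positivity) (by positivity),
    ← ENNReal.ofReal_mul hK]
  refine ENNReal.ofReal_le_ofReal ?_
  simp only [norm_mul, Complex.norm_real, Real.norm_eq_abs, abs_of_nonneg hK, RCLike.norm_ofNat]
  nlinarith [mul_nonneg hK (sq_nonneg (‖F x‖ - ‖G x‖))]

/-- The sum `∑ cₙ eₙ` over a set of indices, as a function of the radius. -/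
def radSum (F : Finset ℕ) (c : ℕ → ℂ) (r : ℝ) : ℂ := ∑ n ∈ F, c n * eig n r

/-- The radial derivative of `∑ cₙ eₙ`. -/
def radSumD (F : Finset ℕ) (c : ℕ → ℂ) (r : ℝ) : ℂ := ∑ n ∈ F, c n * eigD n r

/-- The Laplacian of `∑ cₙ eₙ`. -/
def radSumL (F : Finset ℕ) (c : ℕ → ℂ) (r : ℝ) : ℂ :=
  ∑ n ∈ F, c n * (-(besselZero n ^ 2) * eig n r : ℝ)

theorem hasDerivAt_radSum (F : Finset ℕ) (c : ℕ → ℂ) (r : ℝ) :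
    HasDerivAt (radSum F c) (radSumD F c r) r :=
  HasDerivAt.fun_sum fun n _ => ((hasDerivAt_eig n r).ofReal_comp).const_mul (c n)

theorem hasDerivAt_mul_radSumD (F : Finset ℕ) (c : ℕ → ℂ) (r : ℝ) :
    HasDerivAt (fun r => r * radSumD F c r) (r * radSumL F c r) r := by
  have : HasDerivAt (fun r => ∑ n ∈ F, c n * ((r * eigD n r : ℝ) : ℂ))
      (∑ n ∈ F, c n * ((r * (-(besselZero n ^ 2) * eig n r) : ℝ) : ℂ)) r :=
    HasDerivAt.fun_sum fun n _ => ((hasDerivAt_mul_eigD n r).ofReal_comp).const_mul (c n)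
  refine (this.congr_deriv ?_).congr_of_eventuallyEq (Eventually.of_forall fun r => ?_)
  · rw [radSumL, Finset.mul_sum]
    exact Finset.sum_congr rfl fun n _ => by push_cast; ring
  · simp only [radSumD]
    rw [Finset.mul_sum]
    exact Finset.sum_congr rfl fun n _ => by push_cast; ring

@[fun_prop]
theorem continuous_radSum (F : Finset ℕ) (c : ℕ → ℂ) : Continuous (radSum F c) := by
  unfold radSum; fun_prop

@[fun_prop]
theorem continuous_radSumD (F : Finset ℕ) (c : ℕ → ℂ) : Continuous (radSumD F c) := by
  unfold radSumD; fun_prop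

@[fun_prop]
theorem continuous_radSumL (F : Finset ℕ) (c : ℕ → ℂ) : Continuous (radSumL F c) := by
  unfold radSumL; fun_prop

theorem radSum_one (F : Finset ℕ) (c : ℕ → ℂ) : radSum F c 1 = 0 := by simp [radSum, eig_one]

/-- The block norm controls the block and its scaled derivatives uniformly. -/
theorem enorm_le_blockNorm (j : ℕ) (c : ℕ → ℂ) {r : ℝ} (hr : r ∈ Icc (0 : ℝ) 1) :
    ‖radSum (block j) c r‖ₑ ≤ blockNorm j c ∧ ‖radSumD (block j) c r‖ₑ ≤ 2 ^ j * blockNorm j c ∧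
      ‖radSumL (block j) c r‖ₑ ≤ 4 ^ j * blockNorm j c := by
  set S : Fin 5 → ℝ → ℂ := fun i r => ∑ n ∈ block j, c n * mode j i n r with hS
  have hSc : ∀ i, Continuous (S i) := fun i => by fun_prop
  have key : ∀ i k : Fin 5, i ≠ k → ∀ a ∈ Icc (0 : ℝ) 1, S i a = 0 →
      (∀ x, HasDerivAt (S i) (((2 ^ j : ℝ) : ℂ) * S k x) x) → ‖S i r‖ₑ ≤ blockNorm j c := by
    intro i k hik a ha h0 hd
    refine le_rpow_half ?_
    have := enorm_sq_le_of_hasDerivAt (by positivity) hd (hSc k) ha h0 hr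
    refine this.trans ?_
    rw [blockSq, ENNReal.ofReal_pow (by norm_num), ENNReal.ofReal_ofNat]
    gcongr
    rw [← Finset.sum_pair (f := fun i => ∫⁻ x in Ioo (0 : ℝ) 1, ‖S i x‖ₑ ^ 2) hik]
    exact Finset.sum_le_sum_of_subset (Finset.subset_univ _)
  have h2j : (2 : ℂ) ^ j ≠ 0 := pow_ne_zero _ two_ne_zero
  have e4 : (4 : ℂ) ^ j = 2 ^ j * 2 ^ j := by rw [← mul_pow]; norm_num
  have e8 : (8 : ℂ) ^ j = 2 ^ j * 2 ^ j * 2 ^ j := by rw [← mul_pow, ← mul_pow]; norm_num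
  have hd : ∀ i x (f f' : ℕ → ℝ), (∀ n, HasDerivAt (mode j i n) (f n) x) →
      HasDerivAt (S i) (∑ n ∈ block j, c n * f n) x := fun i x f f' h =>
    HasDerivAt.fun_sum fun n _ => ((h n).ofReal_comp).const_mul (c n)
  refine ⟨?_, ?_, ?_⟩
  · have h := key 0 1 (by decide) 1 (by simp) (by simp [hS, mode, eig_one]) ?_
    · simpa [hS, mode, radSum] using h
    · intro x
      refine (hd 0 x _ (fun _ => 0) fun n => hasDerivAt_eig n x).congr_deriv ?_
      simp only [hS, Finset.mul_sum]
      refine Finset.sum_congr rfl fun n _ => ?_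
      simp [mode]
      field_simp
  · have h := key 1 2 (by decide) 0 (by simp) (by simp [hS, mode, eigD_zero]) ?_
    · have e : radSumD (block j) c r = 2 ^ j * S 1 r := by
        simp only [hS, Finset.mul_sum, radSumD]
        refine Finset.sum_congr rfl fun n _ => ?_
        simp [mode]
        field_simp
      rw [e, enorm_mul, enorm_pow, ← ofReal_norm (2 : ℂ)]
      gcongr
      simp
    · intro x
      refine (hd 1 x _ (fun _ => 0) fun n => (hasDerivAt_eigD n x).div_const (2 ^ j)).congr_deriv ?_
      simp only [hS, Finset.mul_sum]
      refine Finset.sum_congr rfl fun n _ => ?_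
      simp [mode, e4]
      field_simp
  · have h := key 3 4 (by decide) 1 (by simp) (by simp [hS, mode, eig_one]) ?_
    · have e : radSumL (block j) c r = -4 ^ j * S 3 r := by
        simp only [hS, Finset.mul_sum, radSumL]
        refine Finset.sum_congr rfl fun n _ => ?_
        simp [mode]
        field_simp
      rw [e, enorm_mul, enorm_neg, enorm_pow, ← ofReal_norm (4 : ℂ)]
      gcongr
      simp
    · intro x
      refine (hd 3 x _ (fun _ => 0) fun n => (hasDerivAt_eig n x).const_mul (besselZero n ^ 2 / 4 ^ j)).congr_deriv ?_
      simp only [hS, Finset.mul_sum]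
      refine Finset.sum_congr rfl fun n _ => ?_
      simp [mode, e4, e8]
      field_simp

/-! ### The block norm and local smoothing -/

theorem lintegral_rpow_Ioo {ε : ℝ} (hε : 0 < ε) :
    ∫⁻ r in Ioo (0 : ℝ) 1, ENNReal.ofReal (r ^ (ε - 1)) = ENNReal.ofReal (1 / ε) := by
  have h1 : IntervalIntegrable (fun r : ℝ => r ^ (ε - 1)) volume 0 1 :=
    intervalIntegral.intervalIntegrable_rpow' (by linarith)
  have h2 : IntegrableOn (fun r : ℝ => r ^ (ε - 1)) (Ioo 0 1) :=
    ((intervalIntegrable_iff_integrableOn_Ioc_of_le zero_le_one).1 h1).mono_set Ioo_subset_Ioc_self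
  rw [← ofReal_integral_eq_lintegral_ofReal h2]
  · congr 1
    rw [← integral_Ioc_eq_integral_Ioo, ← intervalIntegral.integral_of_le zero_le_one,
      integral_rpow (Or.inl (by linarith))]
    simp [hε.ne']
  · filter_upwards [ae_restrict_mem measurableSet_Ioo] with r hr
    exact Real.rpow_nonneg hr.1.le _

/-- The constant in the bounds for the scaled profiles. -/
def modeConst : ℝ := exists_mode_sq_le.choose

theorem modeConst_pos : 0 < modeConst := exists_mode_sq_le.choose_spec.1

theorem enorm_mode_sq_le {ε : ℝ} (h0 : 0 ≤ ε) (h1 : ε ≤ 1) {j n : ℕ} (i : Fin 5)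
    (hn : n ∈ block j) {r : ℝ} (hr : 0 < r) :
    ‖(mode j i n r : ℂ)‖ₑ ^ 2 ≤
      ENNReal.ofReal (modeConst * 2 ^ (j * ε)) * ENNReal.ofReal (r ^ (ε - 1)) := by
  have hC := modeConst_pos
  rw [← ofReal_norm, ← ENNReal.ofReal_pow (norm_nonneg _), Complex.norm_real, Real.norm_eq_abs,
    sq_abs, ← ENNReal.ofReal_mul (by positivity)]
  exact ENNReal.ofReal_le_ofReal (exists_mode_sq_le.choose_spec.2 ε h0 h1 j i n hn r hr)

/-- Integrates bounds for the quadratic forms that make up `blockSq`. -/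
theorem blockSq_bound {ε : ℝ} (h0 : 0 < ε) (j : ℕ) (X : Fin 5 → ℝ → ℝ≥0∞) (Y : ℝ≥0∞)
    (hX : ∀ i, ∀ r ∈ Ioo (0 : ℝ) 1, X i r ≤
      ENNReal.ofReal (modeConst * 2 ^ (j * ε)) * ENNReal.ofReal (r ^ (ε - 1)) * Y) :
    2 ^ j * ∑ i, ∫⁻ r in Ioo (0 : ℝ) 1, X i r ≤
      ENNReal.ofReal (5 * modeConst / ε * 2 ^ (j * (1 + ε))) * Y := by
  have hC := modeConst_pos
  have h : ∀ i, ∫⁻ r in Ioo (0 : ℝ) 1, X i r ≤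
      ENNReal.ofReal (modeConst * 2 ^ (j * ε)) * ENNReal.ofReal (1 / ε) * Y := by
    intro i
    rw [← lintegral_rpow_Ioo h0, ← lintegral_const_mul _ (by fun_prop), ← lintegral_mul_const _ (by fun_prop)]
    exact setLIntegral_mono' measurableSet_Ioo (hX i)
  calc 2 ^ j * ∑ i, ∫⁻ r in Ioo (0 : ℝ) 1, X i r
      ≤ 2 ^ j * ∑ _i : Fin 5, ENNReal.ofReal (modeConst * 2 ^ (j * ε)) * ENNReal.ofReal (1 / ε) * Y := by
        gcongr with i; exact h i
    _ = ENNReal.ofReal (2 ^ j * (5 * (modeConst * 2 ^ (j * ε) * (1 / ε)))) * Y := by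
        rw [Finset.sum_const, Finset.card_univ, Fintype.card_fin, nsmul_eq_mul,
          ← ENNReal.ofReal_mul (by positivity), ENNReal.ofReal_mul (p := 2 ^ j) (by positivity),
          ENNReal.ofReal_mul (p := 5) (by positivity), ENNReal.ofReal_pow (by norm_num)]
        simp only [ENNReal.ofReal_ofNat, Nat.cast_ofNat]
        ring
    _ = _ := by
        congr 2
        rw [mul_add, mul_one, Real.rpow_add (by norm_num), Real.rpow_natCast]
        ring

/-- At a fixed time the block norm costs one derivative (up to `ε`). -/
theorem blockSq_le {ε : ℝ} (h0 : 0 < ε) (h1 : ε ≤ 1) (j : ℕ) (c : ℕ → ℂ) :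
    blockSq j c ≤ ENNReal.ofReal (5 * modeConst / ε * 2 ^ (j * (2 + ε))) *
      ∑ n ∈ block j, ‖c n‖ₑ ^ 2 := by
  have hC := modeConst_pos
  refine (blockSq_bound h0 j _ (2 ^ j * ∑ n ∈ block j, ‖c n‖ₑ ^ 2) fun i r hr => ?_).trans
    (le_of_eq ?_)
  · calc ‖∑ n ∈ block j, c n * mode j i n r‖ₑ ^ 2
        ≤ (∑ n ∈ block j, ‖c n‖ₑ * ‖(mode j i n r : ℂ)‖ₑ) ^ 2 := by
          gcongr
          refine (enorm_sum_le _ _).trans (le_of_eq ?_)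
          simp only [enorm_mul]
      _ ≤ (∑ n ∈ block j, ‖c n‖ₑ ^ 2) * ∑ n ∈ block j, ‖(mode j i n r : ℂ)‖ₑ ^ 2 := sq_sum_mul_le _ _ _
      _ ≤ (∑ n ∈ block j, ‖c n‖ₑ ^ 2) * ∑ n ∈ block j,
          ENNReal.ofReal (modeConst * 2 ^ (j * ε)) * ENNReal.ofReal (r ^ (ε - 1)) := by
          gcongr with n hn
          exact enorm_mode_sq_le h0.le h1 i hn hr.1
      _ = _ := by
          rw [Finset.sum_const, card_block, nsmul_eq_mul]
          push_cast
          ring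
  · rw [← mul_assoc]
    congr 1
    rw [← ENNReal.ofReal_ofNat 2, ← ENNReal.ofReal_pow (by norm_num), ← ENNReal.ofReal_mul (by positivity)]
    congr 1
    rw [show (j : ℝ) * (2 + ε) = j * (1 + ε) + j by ring, Real.rpow_add (by norm_num), Real.rpow_natCast]
    ring

/-- The frequencies `zₙ^{2α}` of the linear flow. -/
def freq (α : ℝ) (n : ℕ) : ℝ := besselZero n ^ (2 * α)

/-- The function with coefficients `exp (-i t zₙ^{2α}) ∫ exp (2πitξ) hₙ(ξ) dξ`, a superposition of
modulated linear solutions. -/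
def evol (α : ℝ) (h : ℕ → ℝ → ℂ) (t : ℝ) (n : ℕ) : ℂ :=
  Complex.exp (-(Complex.I * freq α n * t)) *
    ∫ ξ : ℝ, Complex.exp (2 * Real.pi * Complex.I * t * ξ) * h n ξ

/-- The weight `⟨τ⟩^{2b}` at `τ = 2πξ`. -/
def modWeight (b ξ : ℝ) : ℝ := bracket (2 * Real.pi * ξ) ^ (2 * b)

theorem bracket_pos (x : ℝ) : 0 < bracket x := Real.sqrt_pos.2 (by positivity)

theorem continuous_bracket : Continuous bracket := by unfold bracket; fun_prop

theorem modWeight_pos (b ξ : ℝ) : 0 < modWeight b ξ := Real.rpow_pos_of_pos (bracket_pos _) _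

@[fun_prop]
theorem continuous_modWeight (b : ℝ) : Continuous (modWeight b) := by
  refine Continuous.rpow_const (continuous_bracket.comp (by fun_prop)) fun ξ => Or.inl ?_
  exact (bracket_pos _).ne'

theorem modWeight_neg (b ξ : ℝ) : modWeight (-b) ξ = (modWeight b ξ)⁻¹ := by
  rw [modWeight, modWeight, mul_neg, Real.rpow_neg (bracket_pos _).le]

/-- The integral of `⟨τ⟩^{-2b}`, finite for `b > 1/2`. -/
def modConst (b : ℝ) : ℝ≥0∞ := ∫⁻ ξ, ENNReal.ofReal (modWeight (-b) ξ)

theorem modConst_lt_top {b : ℝ} (hb : 1 / 2 < b) : modConst b < ⊤ := by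
  have h : Integrable fun ξ : ℝ => (1 + ‖ξ‖ ^ 2) ^ (-(2 * b) / 2) :=
    integrable_rpow_neg_one_add_norm_sq (by simp; linarith)
  refine lt_of_le_of_lt (lintegral_mono fun ξ => ENNReal.ofReal_le_ofReal ?_) h.lintegral_lt_top
  rw [modWeight, bracket, Real.sqrt_eq_rpow, ← Real.rpow_mul (by positivity),
    show 1 / 2 * (2 * -b) = -(2 * b) / 2 by ring]
  refine Real.rpow_le_rpow_of_nonpos (by positivity) ?_ (by linarith)
  rw [Real.norm_eq_abs, sq_abs]
  have := Real.pi_gt_three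
  nlinarith [sq_nonneg ξ, mul_nonneg (sq_nonneg ξ) (sub_nonneg.2 this.le)]

/-- Cauchy-Schwarz against `⟨τ⟩^{-2b}`. -/
theorem sq_lintegral_le_modConst (b : ℝ) {f : ℝ → ℝ≥0∞} (hf : Measurable f) :
    (∫⁻ ξ, f ξ) ^ 2 ≤ modConst b * ∫⁻ ξ, ENNReal.ofReal (modWeight b ξ) * f ξ ^ 2 := by
  have h := sq_lintegral_mul_le volume
    (f := fun ξ => ENNReal.ofReal (modWeight (-b) ξ) ^ (1 / 2 : ℝ))
    (g := fun ξ => (ENNReal.ofReal (modWeight b ξ) * f ξ ^ 2) ^ (1 / 2 : ℝ))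
    (by fun_prop) (by fun_prop)
  simp_rw [rpow_half_sq] at h
  refine le_trans (le_of_eq ?_) h
  congr 1
  refine lintegral_congr fun ξ => ?_
  have hp := modWeight_pos b ξ
  rw [← ENNReal.mul_rpow_of_nonneg _ _ (by norm_num), ← mul_assoc,
    ← ENNReal.ofReal_mul (modWeight_pos _ _).le, modWeight_neg, inv_mul_cancel₀ hp.ne',
    ENNReal.ofReal_one, one_mul, sq_rpow_half]

theorem enorm_cexp_imag {z : ℂ} (h : z.re = 0) : ‖Complex.exp z‖ₑ = 1 := by
  rw [← ofReal_norm, Complex.norm_exp, h]; simp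

theorem integrable_of_modWeight {b : ℝ} (hb : 1 / 2 < b) {h : ℝ → ℂ} (hm : Measurable h)
    (hf : ∫⁻ ξ, ENNReal.ofReal (modWeight b ξ) * ‖h ξ‖ₑ ^ 2 < ⊤) : Integrable h := by
  refine ⟨hm.aestronglyMeasurable, ?_⟩
  have := (sq_lintegral_le_modConst b hm.enorm).trans_lt (ENNReal.mul_lt_top (modConst_lt_top hb) hf)
  rw [HasFiniteIntegral]
  by_contra! hc
  rw [top_le_iff.1 hc] at this
  simp at this

theorem enorm_evol_sq_le (α b : ℝ) {h : ℕ → ℝ → ℂ} (hm : ∀ n, Measurable (h n)) (t : ℝ) (n : ℕ) :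
    ‖evol α h t n‖ₑ ^ 2 ≤ modConst b * ∫⁻ ξ, ENNReal.ofReal (modWeight b ξ) * ‖h n ξ‖ₑ ^ 2 := by
  rw [evol, enorm_mul, enorm_cexp_imag (by simp), one_mul]
  refine le_trans ?_ (sq_lintegral_le_modConst b (hm n).enorm)
  gcongr
  refine (enorm_integral_le_lintegral_enorm _).trans (le_of_eq (lintegral_congr fun ξ => ?_))
  rw [enorm_mul, enorm_cexp_imag (by simp), one_mul]

theorem continuous_evol (α : ℝ) {h : ℕ → ℝ → ℂ} {n : ℕ} (hi : Integrable (h n)) :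
    Continuous fun t => evol α h t n := by
  unfold evol
  refine Continuous.mul (by fun_prop) ?_
  refine continuous_of_dominated (bound := fun ξ => ‖h n ξ‖) ?_ ?_ hi.norm ?_
  · intro t
    exact (by fun_prop : Continuous fun ξ : ℝ => Complex.exp (2 * Real.pi * Complex.I * t * ξ)).aestronglyMeasurable.mul hi.1
  · intro t
    refine Eventually.of_forall fun ξ => le_of_eq ?_
    rw [norm_mul, Complex.norm_exp]
    simp
  · exact Eventually.of_forall fun ξ => by fun_prop

/-- The square integral over `[-1, 1]` of a combination of the coefficients of `evol`: Cauchy-Schwarz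
in `ξ`, then the large sieve for each `ξ`. -/
theorem lintegral_sum_evol_le {α b : ℝ} (hα : 1 / 2 ≤ α) (hb : 1 / 2 < b) {h : ℕ → ℝ → ℂ}
    (hm : ∀ n, Measurable (h n)) (F : Finset ℕ)
    (hf : ∀ n ∈ F, ∫⁻ ξ, ENNReal.ofReal (modWeight b ξ) * ‖h n ξ‖ₑ ^ 2 < ⊤) (a : ℕ → ℂ) :
    ∫⁻ t in Icc (-1 : ℝ) 1, ‖∑ n ∈ F, evol α h t n * a n‖ₑ ^ 2 ≤
      modConst b * (ENNReal.ofReal (2 * Real.exp 1 * √Real.pi * (1 - Real.exp (-zeroGap ^ 2 / 4))⁻¹) *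
        ∑ n ∈ F, ‖a n‖ₑ ^ 2 * ∫⁻ ξ, ENNReal.ofReal (modWeight b ξ) * ‖h n ξ‖ₑ ^ 2) := by
  set L := ENNReal.ofReal (2 * Real.exp 1 * √Real.pi * (1 - Real.exp (-zeroGap ^ 2 / 4))⁻¹) with hL
  have hgap : ∀ n k : ℕ, freq α n + zeroGap * k ≤ freq α (n + k) :=
    besselZero_rpow_gap (by linarith)
  have hpt : ∀ t : ℝ, ‖∑ n ∈ F, evol α h t n * a n‖ₑ ^ 2 ≤ modConst b *
      ∫⁻ ξ, ENNReal.ofReal (modWeight b ξ) *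
        ‖∑ n ∈ F, (a n * h n ξ) * Complex.exp (-(Complex.I * freq α n * t))‖ₑ ^ 2 := by
    intro t
    refine le_trans ?_ (sq_lintegral_le_modConst b (by fun_prop))
    gcongr
    have e : ∑ n ∈ F, evol α h t n * a n = ∫ ξ : ℝ, Complex.exp (2 * Real.pi * Complex.I * t * ξ) *
        ∑ n ∈ F, (a n * h n ξ) * Complex.exp (-(Complex.I * freq α n * t)) := by
      simp_rw [Finset.mul_sum]
      rw [integral_finsetSum]
      · refine Finset.sum_congr rfl fun n _ => ?_
        rw [evol, mul_assoc, mul_comm _ (a n), ← integral_const_mul, ← integral_const_mul]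
        exact integral_congr_ae (Eventually.of_forall fun ξ => by ring)
      · intro n hn
        have := ((integrable_of_modWeight hb (hm n) (hf n hn)).bdd_mul (c := 1)
          (f := fun ξ : ℝ => Complex.exp (2 * Real.pi * Complex.I * t * ξ)) (by fun_prop)
          (Eventually.of_forall fun ξ => by rw [Complex.norm_exp]; simp)).const_mul
          (a n * Complex.exp (-(Complex.I * freq α n * t)))
        refine this.congr (Eventually.of_forall fun ξ => ?_)
        simp only
        ring
    rw [e]
    refine (enorm_integral_le_lintegral_enorm _).trans (le_of_eq (lintegral_congr fun ξ => ?_))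
    rw [enorm_mul, enorm_cexp_imag (by simp), one_mul]
  calc ∫⁻ t in Icc (-1 : ℝ) 1, ‖∑ n ∈ F, evol α h t n * a n‖ₑ ^ 2
      ≤ ∫⁻ t in Icc (-1 : ℝ) 1, modConst b * ∫⁻ ξ, ENNReal.ofReal (modWeight b ξ) *
        ‖∑ n ∈ F, (a n * h n ξ) * Complex.exp (-(Complex.I * freq α n * t))‖ₑ ^ 2 :=
        lintegral_mono fun t => hpt t
    _ = modConst b * ∫⁻ ξ, ENNReal.ofReal (modWeight b ξ) * ∫⁻ t in Icc (-1 : ℝ) 1,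
        ‖∑ n ∈ F, (a n * h n ξ) * Complex.exp (-(Complex.I * freq α n * t))‖ₑ ^ 2 := by
        rw [lintegral_const_mul' _ _ (modConst_lt_top hb).ne, lintegral_lintegral_swap]
        · congr 1
          refine lintegral_congr fun ξ => ?_
          rw [lintegral_const_mul _ (by fun_prop)]
        · have : Measurable (Function.uncurry fun (t ξ : ℝ) => ENNReal.ofReal (modWeight b ξ) *
              ‖∑ n ∈ F, (a n * h n ξ) * Complex.exp (-(Complex.I * freq α n * t))‖ₑ ^ 2) := by
            unfold Function.uncurry
            have h1 : Measurable fun p : ℝ × ℝ => ENNReal.ofReal (modWeight b p.2) := by fun_prop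
            have h2 : Measurable fun p : ℝ × ℝ =>
                ∑ n ∈ F, (a n * h n p.2) * Complex.exp (-(Complex.I * freq α n * p.1)) :=
              Finset.measurable_fun_sum _ fun n _ =>
                (((hm n).comp measurable_snd).const_mul _).mul (by fun_prop)
            exact h1.mul (h2.enorm.pow_const 2)
          exact this.aemeasurable
    _ ≤ modConst b * ∫⁻ ξ, ENNReal.ofReal (modWeight b ξ) * (L * ∑ n ∈ F, ‖a n * h n ξ‖ₑ ^ 2) := by
        gcongr with ξ
        exact lintegral_enorm_sq_sum_exp_le zeroGap_pos hgap F fun n => a n * h n ξ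
    _ = _ := by
        congr 1
        have : ∀ ξ, ENNReal.ofReal (modWeight b ξ) * (L * ∑ n ∈ F, ‖a n * h n ξ‖ₑ ^ 2) =
            L * ∑ n ∈ F, ‖a n‖ₑ ^ 2 * (ENNReal.ofReal (modWeight b ξ) * ‖h n ξ‖ₑ ^ 2) := by
          intro ξ
          rw [mul_left_comm, Finset.mul_sum]
          congr 1
          refine Finset.sum_congr rfl fun n _ => ?_
          rw [enorm_mul]; ring
        simp_rw [this]
        rw [lintegral_const_mul _ (by fun_prop), lintegral_finsetSum _ fun n _ => by fun_prop]
        congr 1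
        refine Finset.sum_congr rfl fun n _ => ?_
        rw [lintegral_const_mul _ (by fun_prop)]

/-- The constant in the local smoothing estimate. -/
def smoothConst (b ε : ℝ) : ℝ≥0∞ :=
  ENNReal.ofReal (5 * modeConst / ε) * (modConst b *
    ENNReal.ofReal (2 * Real.exp 1 * √Real.pi * (1 - Real.exp (-zeroGap ^ 2 / 4))⁻¹))

theorem smoothConst_lt_top {b : ℝ} (hb : 1 / 2 < b) (ε : ℝ) : smoothConst b ε < ⊤ :=
  ENNReal.mul_lt_top ENNReal.ofReal_lt_top
    (ENNReal.mul_lt_top (modConst_lt_top hb) ENNReal.ofReal_lt_top)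

/-- Local smoothing: in `L²` of time, the block norm costs only half a derivative (up to `ε`). -/
theorem lintegral_blockSq_evol_le {α b ε : ℝ} (hα : 1 / 2 ≤ α) (hb : 1 / 2 < b) (h0 : 0 < ε)
    (h1 : ε ≤ 1) {h : ℕ → ℝ → ℂ} (hm : ∀ n, Measurable (h n)) (j : ℕ)
    (hf : ∀ n ∈ block j, ∫⁻ ξ, ENNReal.ofReal (modWeight b ξ) * ‖h n ξ‖ₑ ^ 2 < ⊤) :
    ∫⁻ t in Icc (-1 : ℝ) 1, blockSq j (evol α h t) ≤
      smoothConst b ε * ENNReal.ofReal (2 ^ (j * (1 + ε))) *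
        ∑ n ∈ block j, ∫⁻ ξ, ENNReal.ofReal (modWeight b ξ) * ‖h n ξ‖ₑ ^ 2 := by
  have hC := modeConst_pos
  have hu : ∀ n ∈ block j, Continuous fun t => evol α h t n := fun n hn =>
    continuous_evol α (integrable_of_modWeight hb (hm n) (hf n hn))
  have hjoint : ∀ i, Continuous (Function.uncurry fun t r : ℝ =>
      ∑ n ∈ block j, evol α h t n * mode j i n r) := by
    intro i
    unfold Function.uncurry
    refine continuous_finsetSum _ fun n hn => ((hu n hn).comp continuous_fst).mul ?_
    fun_prop
  have e : ∫⁻ t in Icc (-1 : ℝ) 1, blockSq j (evol α h t) = 2 ^ j * ∑ i : Fin 5,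
      ∫⁻ r in Ioo (0 : ℝ) 1, ∫⁻ t in Icc (-1 : ℝ) 1, ‖∑ n ∈ block j, evol α h t n * mode j i n r‖ₑ ^ 2 := by
    simp only [blockSq]
    rw [lintegral_const_mul', lintegral_finsetSum]
    · congr 1
      refine Finset.sum_congr rfl fun i _ => ?_
      rw [lintegral_lintegral_swap]
      exact ((hjoint i).enorm.measurable.pow_const 2).aemeasurable
    · intro i _
      have := ((hjoint i).enorm.measurable.pow_const 2)
      exact this.lintegral_prod_right
    · exact ENNReal.pow_ne_top (by simp)
  rw [e]
  refine (blockSq_bound h0 j _ _ fun i r hr => (lintegral_sum_evol_le hα hb hm (block j) hf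
    fun n => (mode j i n r : ℂ)).trans
    (c := ENNReal.ofReal (modeConst * 2 ^ (j * ε)) * ENNReal.ofReal (r ^ (ε - 1)) * (modConst b *
    (ENNReal.ofReal (2 * Real.exp 1 * √Real.pi * (1 - Real.exp (-zeroGap ^ 2 / 4))⁻¹) *
    ∑ n ∈ block j, ∫⁻ ξ, ENNReal.ofReal (modWeight b ξ) * ‖h n ξ‖ₑ ^ 2))) ?_).trans (le_of_eq ?_)
  · rw [mul_left_comm (ENNReal.ofReal (modeConst * 2 ^ (j * ε)) * _), mul_left_comm (ENNReal.ofReal (modeConst * 2 ^ (j * ε)) * _), Finset.mul_sum (s := block j) (a := ENNReal.ofReal (modeConst * 2 ^ (j * ε)) * _)]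
    gcongr with n hn
    exact enorm_mode_sq_le h0.le h1 i hn hr.1
  · rw [smoothConst, ENNReal.ofReal_mul (p := 5 * modeConst / ε) (by positivity)]
    ring

/-! ### Admissible weights -/

/-- Weights between the `H^s` and the `H^1` scale: `w` grows at least like `n^s` and at most like `n`,
up to the constant `C`. The estimates depend on the weight only through `C`; this is what makes
them uniform in the parameter `N` of the multiplier. -/
structure IsWeight (s C : ℝ) (w : ℕ → ℝ) : Prop where
  one_le : 1 ≤ C
  pos : ∀ n, 0 < w n
  zero : 1 ≤ C * w 0
  lower : ∀ n k : ℕ, n ≤ k → w n * (((k : ℝ) + 1) / (n + 1)) ^ s ≤ C * w k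
  upper : ∀ n k : ℕ, n ≤ k → w k ≤ C * (((k : ℝ) + 1) / (n + 1)) * w n

variable {s C₀ : ℝ} {w : ℕ → ℝ}

theorem IsWeight.rpow_le (hw : IsWeight s C₀ w) (n : ℕ) : ((n : ℝ) + 1) ^ s ≤ C₀ ^ 2 * w n := by
  have h1 := hw.lower 0 n (Nat.zero_le n)
  have h2 := hw.zero
  have hC := hw.one_le
  simp only [Nat.cast_zero, zero_add, div_one] at h1
  have h3 : 0 ≤ ((n : ℝ) + 1) ^ s := by positivity
  nlinarith

theorem IsWeight.two_pow_le (hw : IsWeight s C₀ w) (hs : 0 ≤ s) {j n : ℕ} (hn : n ∈ block j) :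
    (2 : ℝ) ^ (j * s) ≤ C₀ ^ 2 * w n := by
  refine le_trans ?_ (hw.rpow_le n)
  rw [Real.rpow_mul (by norm_num), Real.rpow_natCast]
  exact Real.rpow_le_rpow (by positivity) (by exact_mod_cast (mem_block.1 hn).1) hs

theorem IsWeight.one_le_sq (hw : IsWeight s C₀ w) (hs : 0 ≤ s) (n : ℕ) : 1 ≤ C₀ ^ 4 * w n ^ 2 := by
  have h1 : 1 ≤ ((n : ℝ) + 1) ^ s := Real.one_le_rpow (by linarith [n.cast_nonneg (α := ℝ)]) hs
  have := pow_le_pow_left₀ zero_le_one (h1.trans (hw.rpow_le n)) 2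
  linarith

/-- The part of a weighted sum carried by one block. -/
theorem IsWeight.sum_block_le (hw : IsWeight s C₀ w) (hs : 0 ≤ s) (j : ℕ) (Q : ℕ → ℝ≥0∞) :
    ∑ n ∈ block j, Q n ≤
      ENNReal.ofReal (C₀ ^ 4 * 2 ^ (-(2 * s * j))) * ∑' n, ENNReal.ofReal (w n ^ 2) * Q n := by
  rw [← ENNReal.tsum_mul_left]
  refine le_trans (Finset.sum_le_sum fun n hn => ?_) (ENNReal.sum_le_tsum (block j))
  rw [← mul_assoc, ← ENNReal.ofReal_mul (by have := hw.one_le; positivity)]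
  refine le_mul_of_one_le_left zero_le ?_
  rw [ENNReal.one_le_ofReal]
  have h1 := pow_le_pow_left₀ (by positivity) (hw.two_pow_le hs hn) 2
  rw [← Real.rpow_natCast, ← Real.rpow_mul (by norm_num)] at h1
  have h2 : (0 : ℝ) < 2 ^ (2 * s * j) := by positivity
  rw [Real.rpow_neg (by norm_num)]
  have e : (j : ℝ) * s * ((2 : ℕ) : ℝ) = 2 * s * j := by push_cast; ring
  rw [e] at h1
  rw [mul_assoc, mul_comm _ (w n ^ 2), ← mul_assoc, ← div_eq_mul_inv, le_div_iff₀ h2]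
  linarith

theorem IsWeight.tsum_enorm_sq_le (hw : IsWeight s C₀ w) (hs : 0 ≤ s) (c : ℕ → ℂ) :
    ∑' n, ‖c n‖ₑ ^ 2 ≤ ENNReal.ofReal (C₀ ^ 4) * wNorm w c ^ 2 := by
  rw [wNorm_sq, ← ENNReal.tsum_mul_left]
  refine ENNReal.tsum_le_tsum fun n => ?_
  rw [← mul_assoc, ← ENNReal.ofReal_mul (by have := hw.one_le; positivity)]
  refine le_mul_of_one_le_left zero_le ?_
  rw [ENNReal.one_le_ofReal]
  exact hw.one_le_sq hs n

/-! ### Synthesis of functions on the disk -/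

theorem IsWeight.summable_smul_eigenLp (hw : IsWeight s C₀ w) (hs : 0 ≤ s) {c : ℕ → ℂ}
    (hc : wNorm w c < ⊤) : Summable fun n => c n • eigenLp n := by
  have h1 := (hw.tsum_enorm_sq_le hs c).trans_lt
    (ENNReal.mul_lt_top ENNReal.ofReal_lt_top (ENNReal.pow_lt_top hc))
  have h2 : Summable fun n => ‖c n‖ ^ 2 := by
    have := ENNReal.summable_toReal h1.ne
    simpa using this
  exact (orthonormal_eigenLp.orthogonalFamily.summable_iff_norm_sq_summable c).2 h2

/-- Restriction of a sequence to the indices below `M`. -/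
def trunc (M : ℕ) (c : ℕ → ℂ) (n : ℕ) : ℂ := if n < M then c n else 0

theorem continuous_radSum_norm (F : Finset ℕ) (c : ℕ → ℂ) :
    Continuous fun x : Plane => radSum F c ‖x‖ := by fun_prop

theorem memLp_radSum (F : Finset ℕ) (c : ℕ → ℂ) (p : ℝ≥0∞) :
    MemLp (fun x : Plane => radSum F c ‖x‖) p discMeasure := by
  refine MemLp.of_bound (continuous_radSum_norm F c).aestronglyMeasurable
    (∑ n ∈ F, ‖c n‖ * |eigConst n|) (Eventually.of_forall fun x => ?_)
  refine (norm_sum_le _ _).trans (Finset.sum_le_sum fun n _ => ?_)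
  rw [norm_mul, Complex.norm_real, Real.norm_eq_abs, eig, abs_mul]
  gcongr
  exact mul_le_of_le_one_right (abs_nonneg _) (abs_besselJ0_le _)

theorem toLp_radSum (F : Finset ℕ) (c : ℕ → ℂ) :
    (memLp_radSum F c 2).toLp _ = ∑ n ∈ F, c n • eigenLp n := by
  classical
  induction F using Finset.induction_on with
  | empty =>
    rw [Finset.sum_empty]
    refine Lp.ext ?_
    filter_upwards [(memLp_radSum ∅ c 2).coeFn_toLp, Lp.coeFn_zero ℂ 2 discMeasure] with x h1 h2
    rw [h1, h2]
    simp [radSum]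
  | insert a F ha ih =>
    rw [Finset.sum_insert ha, ← ih]
    refine Lp.ext ?_
    filter_upwards [(memLp_radSum (insert a F) c 2).coeFn_toLp, (memLp_radSum F c 2).coeFn_toLp,
      Lp.coeFn_add (c a • eigenLp a) ((memLp_radSum F c 2).toLp _),
      Lp.coeFn_smul (c a) (eigenLp a), (memLp_eigenfun a).coeFn_toLp] with x h1 h2 h3 h4 h5
    rw [h1, h3, Pi.add_apply, h2, h4, Pi.smul_apply, eigenLp, h5, eigenfun_eq, radSum,
      Finset.sum_insert ha]
    rfl

theorem synth_trunc_ae (M : ℕ) (c : ℕ → ℂ) :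
    synth (trunc M c) =ᵐ[discMeasure] fun x => radSum (Finset.range M) c ‖x‖ := by
  have h : synth (trunc M c) = ∑ n ∈ Finset.range M, c n • eigenLp n := by
    rw [synth, tsum_eq_sum (s := Finset.range M)]
    · refine Finset.sum_congr rfl fun n hn => ?_
      rw [trunc, if_pos (Finset.mem_range.1 hn)]
    · intro n hn
      rw [trunc, if_neg (by simpa using hn), zero_smul]
  rw [h, ← toLp_radSum]
  exact (memLp_radSum _ _ _).coeFn_toLp

theorem lintegral_enorm_sq_radSum (F : Finset ℕ) (c : ℕ → ℂ) :
    ∫⁻ x : Plane, ‖radSum F c ‖x‖‖ₑ ^ 2 ∂discMeasure = ∑ n ∈ F, ‖c n‖ₑ ^ 2 := by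
  have h1 : eLpNorm (fun x : Plane => radSum F c ‖x‖) 2 discMeasure ^ 2 =
      ∫⁻ x : Plane, ‖radSum F c ‖x‖‖ₑ ^ 2 ∂discMeasure := by
    have := eLpNorm_nnreal_pow_eq_lintegral (f := fun x : Plane => radSum F c ‖x‖)
      (μ := discMeasure) (p := 2) two_ne_zero
    simpa using this
  rw [← h1, ← Lp.enorm_toLp (memLp_radSum F c 2), toLp_radSum, ← ofReal_norm,
    ← ENNReal.ofReal_pow (norm_nonneg _)]
  have h2 := orthonormal_eigenLp.inner_sum c c F
  rw [inner_self_eq_norm_sq_to_K] at h2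
  have h3 : ‖∑ n ∈ F, c n • eigenLp n‖ ^ 2 = ∑ n ∈ F, ‖c n‖ ^ 2 := by
    refine Complex.ofReal_injective ?_
    have e : ∀ n, (starRingEnd ℂ) (c n) * c n = ((‖c n‖ ^ 2 : ℝ) : ℂ) := fun n => by
      rw [mul_comm, Complex.mul_conj, Complex.normSq_eq_norm_sq]
    simp_rw [e] at h2
    rw [Complex.ofReal_pow, Complex.ofReal_sum]
    exact h2
  rw [h3, ENNReal.ofReal_sum_of_nonneg fun n _ => by positivity]
  simp [ENNReal.ofReal_pow]

theorem ae_norm_mem : ∀ᵐ x : Plane ∂discMeasure, ‖x‖ ∈ Icc (0 : ℝ) 1 := by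
  rw [discMeasure]
  refine Measure.ae_smul_measure ?_ _
  filter_upwards [ae_restrict_mem Metric.isOpen_ball.measurableSet] with x hx
  exact ⟨norm_nonneg x, (mem_ball_zero_iff.1 hx).le⟩

/-! ### The embedding into `L³` -/

theorem eLpNorm_three_pow (f : Plane → ℂ) :
    eLpNorm f 3 discMeasure ^ 3 = ∫⁻ x, ‖f x‖ₑ ^ 3 ∂discMeasure := by
  have := eLpNorm_nnreal_pow_eq_lintegral (f := f) (μ := discMeasure) (p := 3) three_ne_zero
  simpa using this

/-- Interpolation of the `L³` norm of a block between `L²` and the uniform norm. -/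
theorem eLpNorm_radSum_block_le (hs : 1 / 2 ≤ s) (hw : IsWeight s C₀ w) (c : ℕ → ℂ) (j : ℕ) :
    eLpNorm (fun x : Plane => radSum (block j) c ‖x‖) 3 discMeasure ≤
      ENNReal.ofReal ((1 + 10 * modeConst * C₀ ^ 12) * (2 ^ (-(1 / 12 : ℝ))) ^ j) * wNorm w c := by
  have hC := modeConst_pos
  have hC0 := hw.one_le
  set f := fun x : Plane => radSum (block j) c ‖x‖
  set X : ℝ≥0∞ := ∑ n ∈ block j, ‖c n‖ₑ ^ 2 with hX
  set N := wNorm w c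
  have h3 : eLpNorm f 3 discMeasure ^ 3 ≤ blockNorm j c * X := by
    rw [eLpNorm_three_pow, hX, ← lintegral_enorm_sq_radSum, ← lintegral_const_mul']
    · refine lintegral_mono_ae ?_
      filter_upwards [ae_norm_mem] with x hx
      rw [pow_succ, mul_comm]
      gcongr
      exact (enorm_le_blockNorm j c hx).1
    · rw [← lt_top_iff_ne_top, blockNorm]
      refine ENNReal.rpow_lt_top_of_nonneg (by norm_num) (ne_top_of_le_ne_top ?_
        (blockSq_le one_pos le_rfl j c))
      exact ENNReal.mul_ne_top ENNReal.ofReal_ne_top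
        (ENNReal.sum_ne_top.2 fun n _ => ENNReal.pow_ne_top enorm_ne_top)
  have hXN : X ≤ ENNReal.ofReal (C₀ ^ 4 * 2 ^ (-(j : ℝ))) * N ^ 2 := by
    have h := hw.sum_block_le (by linarith) j (fun n => ‖c n‖ₑ ^ 2)
    rw [← wNorm_sq] at h
    refine h.trans ?_
    gcongr
    · norm_num
    · nlinarith [j.cast_nonneg (α := ℝ)]
  have hB : blockSq j c ≤ ENNReal.ofReal (10 * modeConst * 2 ^ (j * (5 / 2 : ℝ))) * X := by
    refine (blockSq_le (ε := 1 / 2) (by norm_num) (by norm_num) j c).trans (le_of_eq ?_)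
    congr 2
    ring_nf
  have h6 : eLpNorm f 3 discMeasure ^ 6 ≤
      ENNReal.ofReal (10 * modeConst * C₀ ^ 12 * 2 ^ (-((j : ℝ) / 2))) * N ^ 6 := by
    calc eLpNorm f 3 discMeasure ^ 6 = (eLpNorm f 3 discMeasure ^ 3) ^ 2 := by rw [← pow_mul]
      _ ≤ (blockNorm j c * X) ^ 2 := by gcongr
      _ = blockSq j c * X ^ 2 := by rw [mul_pow, blockNorm_sq]
      _ ≤ ENNReal.ofReal (10 * modeConst * 2 ^ (j * (5 / 2 : ℝ))) * X * X ^ 2 := by gcongr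
      _ = ENNReal.ofReal (10 * modeConst * 2 ^ (j * (5 / 2 : ℝ))) * X ^ 3 := by ring
      _ ≤ ENNReal.ofReal (10 * modeConst * 2 ^ (j * (5 / 2 : ℝ))) *
          (ENNReal.ofReal (C₀ ^ 4 * 2 ^ (-(j : ℝ))) * N ^ 2) ^ 3 := by gcongr
      _ = _ := by
          rw [mul_pow, ← ENNReal.ofReal_pow (by positivity), ← mul_assoc,
            ← ENNReal.ofReal_mul (by positivity), ← pow_mul]
          congr 2
          rw [mul_pow, ← pow_mul, ← Real.rpow_natCast (2 ^ (-(j : ℝ))), ← Real.rpow_mul (by norm_num)]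
          have : (2 : ℝ) ^ (-((j : ℝ) / 2)) = 2 ^ ((j : ℝ) * (5 / 2)) * 2 ^ (-(j : ℝ) * ((3 : ℕ) : ℝ)) := by
            rw [← Real.rpow_add (by norm_num)]
            congr 1
            push_cast
            ring
          rw [this]
          ring
  have h6' : eLpNorm f 3 discMeasure ^ 6 ≤
      (ENNReal.ofReal ((1 + 10 * modeConst * C₀ ^ 12) * (2 ^ (-(1 / 12 : ℝ))) ^ j) * N) ^ 6 := by
    refine h6.trans ?_
    rw [mul_pow, ← ENNReal.ofReal_pow (by positivity)]
    gcongr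
    rw [mul_pow]
    have e : (((2 : ℝ) ^ (-(1 / 12 : ℝ))) ^ j) ^ 6 = 2 ^ (-((j : ℝ) / 2)) := by
      rw [← pow_mul, ← Real.rpow_natCast, ← Real.rpow_mul (by norm_num)]
      congr 1
      push_cast
      ring
    rw [e]
    have hK : 0 ≤ 10 * modeConst * C₀ ^ 12 := by positivity
    gcongr
    have : 1 + 10 * modeConst * C₀ ^ 12 ≤ (1 + 10 * modeConst * C₀ ^ 12) ^ 6 :=
      le_self_pow₀ (by linarith) (by norm_num)
    linarith
  exact (ENNReal.pow_le_pow_left_iff (by norm_num)).1 h6'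

/-- The constant of the embedding of the weighted spaces into `L³`. -/
def embConst (C₀ : ℝ) : ℝ≥0∞ :=
  ENNReal.ofReal (1 + 10 * modeConst * C₀ ^ 12) * ∑' j : ℕ, ENNReal.ofReal ((2 ^ (-(1 / 12 : ℝ))) ^ j)

theorem embConst_lt_top (C₀ : ℝ) : embConst C₀ < ⊤ := by
  refine ENNReal.mul_lt_top ENNReal.ofReal_lt_top ?_
  have h1 : (2 : ℝ) ^ (-(1 / 12 : ℝ)) < 1 := Real.rpow_lt_one_of_one_lt_of_neg (by norm_num) (by norm_num)
  have := summable_geometric_of_lt_one (by positivity) h1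
  rw [← ENNReal.ofReal_tsum_of_nonneg (fun j => by positivity) this]
  exact ENNReal.ofReal_lt_top

theorem eLpNorm_radSum_range_le (hs : 1 / 2 ≤ s) (hw : IsWeight s C₀ w) (c : ℕ → ℂ) (J : ℕ) :
    eLpNorm (fun x : Plane => radSum (Finset.range (2 ^ J - 1)) c ‖x‖) 3 discMeasure ≤
      embConst C₀ * wNorm w c := by
  have hC := modeConst_pos
  have hC0 := hw.one_le
  have e : (fun x : Plane => radSum (Finset.range (2 ^ J - 1)) c ‖x‖) =
      ∑ j ∈ Finset.range J, fun x : Plane => radSum (block j) c ‖x‖ := by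
    ext x
    rw [Finset.sum_apply]
    exact sum_range_eq_sum_block _ J
  rw [e]
  refine (eLpNorm_sum_le (fun j _ => (continuous_radSum_norm _ c).aestronglyMeasurable)
    (by norm_num)).trans ?_
  refine (Finset.sum_le_sum fun j _ => eLpNorm_radSum_block_le hs hw c j).trans ?_
  rw [← Finset.sum_mul, embConst, ← ENNReal.tsum_mul_left]
  gcongr
  refine le_trans (le_of_eq ?_) (ENNReal.sum_le_tsum (Finset.range J))
  exact Finset.sum_congr rfl fun j _ => ENNReal.ofReal_mul (by positivity)

theorem tendsto_two_pow_sub_one : Tendsto (fun J : ℕ => 2 ^ J - 1) atTop atTop :=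
  tendsto_atTop_mono (fun J => by have := Nat.lt_two_pow_self (n := J); simp only [id]; omega)
    tendsto_id

/-- The weighted spaces embed into `L³(Θ)` when `s ≥ 1/2`; so the nonlinearity is integrable. -/
theorem IsWeight.eLpNorm_synth_le (hs : 1 / 2 ≤ s) (hw : IsWeight s C₀ w) {c : ℕ → ℂ}
    (hc : wNorm w c < ⊤) : eLpNorm (synth c) 3 discMeasure ≤ embConst C₀ * wNorm w c := by
  have h1 : Tendsto (fun J : ℕ => ∑ n ∈ Finset.range (2 ^ J - 1), c n • eigenLp n) atTop
      (𝓝 (synth c)) :=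
    ((hw.summable_smul_eigenLp (by linarith) hc).hasSum.tendsto_sum_nat).comp tendsto_two_pow_sub_one
  obtain ⟨ns, -, hns⟩ := (tendstoInMeasure_of_tendsto_Lp h1).exists_seq_tendsto_ae
  have h2 : ∀ᵐ x ∂discMeasure, ∀ J : ℕ, (∑ n ∈ Finset.range (2 ^ J - 1), c n • eigenLp n :
      Lp ℂ 2 discMeasure) x = radSum (Finset.range (2 ^ J - 1)) c ‖x‖ := by
    rw [ae_all_iff]
    intro J
    rw [← toLp_radSum]
    exact (memLp_radSum _ _ _).coeFn_toLp
  refine (Lp.eLpNorm_lim_le_liminf_eLpNorm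
    (f := fun i (x : Plane) => radSum (Finset.range (2 ^ ns i - 1)) c ‖x‖)
    (fun i => (continuous_radSum_norm _ c).aestronglyMeasurable) (synth c) ?_).trans ?_
  · filter_upwards [hns, h2] with x h3 h4
    exact h3.congr fun i => h4 _
  · exact liminf_le_of_frequently_le'
      (Frequently.of_forall fun i => eLpNorm_radSum_range_le hs hw c _)

theorem IsWeight.memLp_synth (hs : 1 / 2 ≤ s) (hw : IsWeight s C₀ w) {c : ℕ → ℂ}
    (hc : wNorm w c < ⊤) : MemLp (synth c) 3 discMeasure :=
  ⟨Lp.aestronglyMeasurable _, (hw.eLpNorm_synth_le hs hc).trans_lt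
    (ENNReal.mul_lt_top (embConst_lt_top _) hc)⟩

theorem IsWeight.synth_sub (hs : 0 ≤ s) (hw : IsWeight s C₀ w) {a b : ℕ → ℂ}
    (ha : wNorm w a < ⊤) (hb : wNorm w b < ⊤) : synth (a - b) = synth a - synth b := by
  rw [synth, synth, synth, ← (hw.summable_smul_eigenLp hs ha).tsum_sub (hw.summable_smul_eigenLp hs hb)]
  exact tsum_congr fun n => by rw [Pi.sub_apply, sub_smul]

/-! ### The trilinear form of the nonlinearity -/

/-- The coefficients of `U V̄ W`, for `U = ∑ aₙ eₙ`, `V = ∑ bₙ eₙ`, `W = ∑ cₙ eₙ`. -/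
def tri (a b c : ℕ → ℂ) (n : ℕ) : ℂ :=
  ∫ x, synth a x * (starRingEnd ℂ) (synth b x) * synth c x * (eigenfun n x) ∂discMeasure

theorem conj_eigenfun (n : ℕ) (x : Plane) : (starRingEnd ℂ) (eigenfun n x) = eigenfun n x := by
  rw [eigenfun_eq, Complex.conj_ofReal]

theorem cubic_eq_tri (c : ℕ → ℂ) : cubic c = tri c c c := by
  ext n
  refine integral_congr_ae (Eventually.of_forall fun x => ?_)
  simp only [conj_eigenfun]
  congr 2
  rw [Complex.mul_conj, Complex.normSq_eq_norm_sq]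

theorem norm_eigenfun_le (n : ℕ) (x : Plane) : ‖eigenfun n x‖ ≤ |eigConst n| := by
  rw [eigenfun_eq, Complex.norm_real, Real.norm_eq_abs, eig, abs_mul]
  exact mul_le_of_le_one_right (abs_nonneg _) (abs_besselJ0_le _)

theorem holderTriple_three : ENNReal.HolderTriple 3 3 (3 / 2) := by
  constructor
  rw [ENNReal.inv_div (by simp) (by simp), ← two_mul, div_eq_mul_inv]

theorem holderTriple_three_one : ENNReal.HolderTriple (3 / 2) 3 1 := by
  constructor
  rw [ENNReal.inv_div (by simp) (by simp), div_eq_mul_inv, inv_one]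
  have h1 : (2 : ℝ≥0∞) * 3⁻¹ + 3⁻¹ = (2 + 1) * 3⁻¹ := by ring
  rw [h1, two_add_one_eq_three, ENNReal.mul_inv_cancel (by simp) (by simp)]

theorem integrable_tri {U V W : Plane → ℂ} (hU : MemLp U 3 discMeasure) (hV : MemLp V 3 discMeasure)
    (hW : MemLp W 3 discMeasure) (n : ℕ) :
    Integrable (fun x => U x * (starRingEnd ℂ) (V x) * W x * eigenfun n x) discMeasure := by
  have := holderTriple_three
  have := holderTriple_three_one
  have h1 : MemLp (fun x => (starRingEnd ℂ) (V x)) 3 discMeasure := hV.star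
  have h2 : MemLp (U * fun x => (starRingEnd ℂ) (V x)) (3 / 2) discMeasure := h1.mul hU
  have h3 : MemLp ((U * fun x => (starRingEnd ℂ) (V x)) * W) 1 discMeasure := hW.mul h2
  rw [memLp_one_iff_integrable] at h3
  exact h3.mul_bdd (c := |eigConst n|) (memLp_eigenfun n).1
    (Eventually.of_forall (norm_eigenfun_le n))

theorem enorm_integral_tri_le {U V W : Plane → ℂ} (hU : AEStronglyMeasurable U discMeasure)
    (hV : AEStronglyMeasurable V discMeasure) (hW : AEStronglyMeasurable W discMeasure) (n : ℕ) :
    ‖∫ x, U x * (starRingEnd ℂ) (V x) * W x * eigenfun n x ∂discMeasure‖ₑ ≤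
      ENNReal.ofReal |eigConst n| * (eLpNorm U 3 discMeasure * eLpNorm V 3 discMeasure *
        eLpNorm W 3 discMeasure) := by
  have := holderTriple_three
  have := holderTriple_three_one
  have hV' : AEStronglyMeasurable (fun x => (starRingEnd ℂ) (V x)) discMeasure := hV.star
  have h1 := eLpNorm_smul_le_mul_eLpNorm (r := 3 / 2) (p := 3) (q := 3) hV' hU
  have h2 := eLpNorm_smul_le_mul_eLpNorm (r := 1) (p := 3 / 2) (q := 3) hW (hU.smul hV')
  have h3 : eLpNorm (fun x => (starRingEnd ℂ) (V x)) 3 discMeasure = eLpNorm V 3 discMeasure :=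
    eLpNorm_congr_norm_ae (Eventually.of_forall fun x => by simp)
  rw [h3] at h1
  refine (enorm_integral_le_lintegral_enorm _).trans ?_
  calc ∫⁻ x, ‖U x * (starRingEnd ℂ) (V x) * W x * eigenfun n x‖ₑ ∂discMeasure
      ≤ ∫⁻ x, ENNReal.ofReal |eigConst n| *
          ‖((U • fun x => (starRingEnd ℂ) (V x)) • W) x‖ₑ ∂discMeasure := by
        refine lintegral_mono fun x => ?_
        rw [enorm_mul, mul_comm]
        refine mul_le_mul' ?_ (le_of_eq rfl)
        rw [← ofReal_norm]
        exact ENNReal.ofReal_le_ofReal (norm_eigenfun_le n x)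
    _ = ENNReal.ofReal |eigConst n| *
          eLpNorm ((U • fun x => (starRingEnd ℂ) (V x)) • W) 1 discMeasure := by
        rw [lintegral_const_mul' _ _ ENNReal.ofReal_ne_top, eLpNorm_one_eq_lintegral_enorm]
    _ ≤ _ := by
        gcongr
        exact h2.trans (by gcongr)

/-- The constant in the pointwise bound for the coefficients of the trilinear form. -/
def triConst (C₀ : ℝ) (n : ℕ) : ℝ≥0∞ := ENNReal.ofReal |eigConst n| * embConst C₀ ^ 3

theorem triConst_lt_top (C₀ : ℝ) (n : ℕ) : triConst C₀ n < ⊤ :=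
  ENNReal.mul_lt_top ENNReal.ofReal_lt_top (ENNReal.pow_lt_top (embConst_lt_top _))

section

variable (hs : 1 / 2 ≤ s) (hw : IsWeight s C₀ w) {a b c : ℕ → ℂ}
  (ha : wNorm w a < ⊤) (hb : wNorm w b < ⊤) (hc : wNorm w c < ⊤)

include hs hw ha hb hc

theorem enorm_tri_le (n : ℕ) :
    ‖tri a b c n‖ₑ ≤ triConst C₀ n * (wNorm w a * wNorm w b * wNorm w c) := by
  refine (enorm_integral_tri_le (Lp.aestronglyMeasurable _) (Lp.aestronglyMeasurable _)
    (Lp.aestronglyMeasurable _) n).trans ?_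
  calc _ ≤ ENNReal.ofReal |eigConst n| * ((embConst C₀ * wNorm w a) * (embConst C₀ * wNorm w b) *
        (embConst C₀ * wNorm w c)) := by
        gcongr
        exacts [hw.eLpNorm_synth_le hs ha, hw.eLpNorm_synth_le hs hb, hw.eLpNorm_synth_le hs hc]
    _ = _ := by rw [triConst]; ring

theorem tri_sub_left {a' : ℕ → ℂ} (ha' : wNorm w a' < ⊤) (n : ℕ) :
    tri (a - a') b c n = tri a b c n - tri a' b c n := by
  have i1 := integrable_tri (hw.memLp_synth hs ha) (hw.memLp_synth hs hb) (hw.memLp_synth hs hc) n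
  have i2 := integrable_tri (hw.memLp_synth hs ha') (hw.memLp_synth hs hb) (hw.memLp_synth hs hc) n
  rw [tri, tri, tri, ← integral_sub i1 i2]
  refine integral_congr_ae ?_
  rw [hw.synth_sub (by linarith) ha ha']
  filter_upwards [Lp.coeFn_sub (synth a) (synth a')] with x hx
  rw [hx, Pi.sub_apply]
  ring

theorem tri_sub_middle {b' : ℕ → ℂ} (hb' : wNorm w b' < ⊤) (n : ℕ) :
    tri a (b - b') c n = tri a b c n - tri a b' c n := by
  have i1 := integrable_tri (hw.memLp_synth hs ha) (hw.memLp_synth hs hb) (hw.memLp_synth hs hc) n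
  have i2 := integrable_tri (hw.memLp_synth hs ha) (hw.memLp_synth hs hb') (hw.memLp_synth hs hc) n
  rw [tri, tri, tri, ← integral_sub i1 i2]
  refine integral_congr_ae ?_
  rw [hw.synth_sub (by linarith) hb hb']
  filter_upwards [Lp.coeFn_sub (synth b) (synth b')] with x hx
  rw [hx, Pi.sub_apply, map_sub]
  ring

theorem tri_sub_right {c' : ℕ → ℂ} (hc' : wNorm w c' < ⊤) (n : ℕ) :
    tri a b (c - c') n = tri a b c n - tri a b c' n := by
  have i1 := integrable_tri (hw.memLp_synth hs ha) (hw.memLp_synth hs hb) (hw.memLp_synth hs hc) n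
  have i2 := integrable_tri (hw.memLp_synth hs ha) (hw.memLp_synth hs hb) (hw.memLp_synth hs hc') n
  rw [tri, tri, tri, ← integral_sub i1 i2]
  refine integral_congr_ae ?_
  rw [hw.synth_sub (by linarith) hc hc']
  filter_upwards [Lp.coeFn_sub (synth c) (synth c')] with x hx
  rw [hx, Pi.sub_apply]
  ring

theorem tri_sub_tri {a' b' c' : ℕ → ℂ} (ha' : wNorm w a' < ⊤) (hb' : wNorm w b' < ⊤)
    (hc' : wNorm w c' < ⊤) : tri a b c - tri a' b' c' =
      tri (a - a') b c + tri a' (b - b') c + tri a' b' (c - c') := by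
  ext n
  rw [Pi.sub_apply, Pi.add_apply, Pi.add_apply, tri_sub_left hs hw ha hb hc ha',
    tri_sub_middle hs hw ha' hb hc hb', tri_sub_right hs hw ha' hb' hc hc']
  ring

theorem tendsto_tri {ι : Type*} {l : Filter ι} {a' b' c' : ι → ℕ → ℂ}
    (ha' : Tendsto (fun i => wNorm w (a' i - a)) l (𝓝 0))
    (hb' : Tendsto (fun i => wNorm w (b' i - b)) l (𝓝 0))
    (hc' : Tendsto (fun i => wNorm w (c' i - c)) l (𝓝 0)) (n : ℕ) :
    Tendsto (fun i => tri (a' i) (b' i) (c' i) n) l (𝓝 (tri a b c n)) := by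
  have hbd : ∀ {d : ℕ → ℂ} {d' : ι → ℕ → ℂ}, Tendsto (fun i => wNorm w (d' i - d)) l (𝓝 0) →
      ∀ᶠ i in l, wNorm w (d' i) ≤ wNorm w d + 1 := by
    intro d d' h
    filter_upwards [h.eventually (ge_mem_nhds one_pos)] with i hi
    calc wNorm w (d' i) = wNorm w (d + (d' i - d)) := by rw [add_sub_cancel]
      _ ≤ _ := (wNorm_add_le _ _ _).trans (by gcongr)
  have lt1 : ∀ {d : ℕ → ℂ}, wNorm w d < ⊤ → wNorm w d + 1 < ⊤ := fun h => by simpa using h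
  rw [tendsto_iff_edist_tendsto_0]
  have hlim : Tendsto (fun i => triConst C₀ n * (wNorm w (a' i - a) * (wNorm w b + 1) * (wNorm w c + 1)) +
      triConst C₀ n * (wNorm w a * wNorm w (b' i - b) * (wNorm w c + 1)) +
      triConst C₀ n * (wNorm w a * wNorm w b * wNorm w (c' i - c))) l (𝓝 0) := by
    have t : ∀ {f : ι → ℝ≥0∞} {K L : ℝ≥0∞}, Tendsto f l (𝓝 0) → K < ⊤ → L < ⊤ →
        Tendsto (fun i => K * (f i * L)) l (𝓝 0) := by
      intro f K L hf hK hL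
      have := ENNReal.Tendsto.const_mul (ENNReal.Tendsto.mul_const hf (Or.inr hL.ne)) (Or.inr hK.ne)
      simpa using this
    have hT := triConst_lt_top C₀ n
    have h1 := t ha' hT (ENNReal.mul_lt_top (lt1 hb) (lt1 hc))
    have h2 := t hb' hT (ENNReal.mul_lt_top ha (lt1 hc))
    have h3 := t hc' hT (ENNReal.mul_lt_top ha hb)
    have := (h1.add h2).add h3
    simp only [add_zero] at this
    refine this.congr fun i => ?_
    ring
  refine tendsto_of_tendsto_of_tendsto_of_le_of_le' tendsto_const_nhds hlim
    (Eventually.of_forall fun _ => zero_le) ?_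
  filter_upwards [hbd ha', hbd hb', hbd hc'] with i h1 h2 h3
  have ea := h1.trans_lt (lt1 ha)
  have eb := h2.trans_lt (lt1 hb)
  have ec := h3.trans_lt (lt1 hc)
  have da := (wNorm_sub_le w (a' i) a).trans_lt (ENNReal.add_lt_top.2 ⟨ea, ha⟩)
  have db := (wNorm_sub_le w (b' i) b).trans_lt (ENNReal.add_lt_top.2 ⟨eb, hb⟩)
  have dc := (wNorm_sub_le w (c' i) c).trans_lt (ENNReal.add_lt_top.2 ⟨ec, hc⟩)
  rw [edist_eq_enorm_sub, ← Pi.sub_apply, tri_sub_tri hs hw ea eb ec ha hb hc]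
  refine (enorm_add_le _ _).trans (add_le_add ((enorm_add_le _ _).trans (add_le_add ?_ ?_)) ?_)
  · exact (enorm_tri_le hs hw da eb ec n).trans (by gcongr)
  · exact (enorm_tri_le hs hw ha db ec n).trans (by gcongr)
  · exact enorm_tri_le hs hw ha hb dc n

end

theorem tendsto_wNorm_trunc_sub {c : ℕ → ℂ} (hc : wNorm w c < ⊤) :
    Tendsto (fun M => wNorm w (trunc M c - c)) atTop (𝓝 0) := by
  have h1 : ∑' n, ENNReal.ofReal (w n ^ 2) * ‖c n‖ₑ ^ 2 ≠ ⊤ := by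
    rw [← wNorm_sq]; exact (ENNReal.pow_lt_top hc).ne
  have h2 := (ENNReal.tendsto_sum_nat_add _ h1).ennrpow_const (1 / 2)
  rw [ENNReal.zero_rpow_of_pos (by norm_num)] at h2
  refine h2.congr fun M => ?_
  rw [wNorm_eq]
  congr 1
  rw [← Summable.sum_add_tsum_nat_add' (k := M)
    (f := fun n => ENNReal.ofReal (w n ^ 2) * ‖(trunc M c - c) n‖ₑ ^ 2) ENNReal.summable,
    Finset.sum_eq_zero, zero_add]
  · refine tsum_congr fun n => ?_
    simp [trunc]
  · intro n hn
    simp [trunc, Finset.mem_range.1 hn]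

/-! ### Products of radial functions -/

/-- `f` is a twice differentiable radial function vanishing on the unit circle, with radial
derivative `f₁` and Laplacian `f₂`. -/
structure IsRadial (f f₁ f₂ : ℝ → ℂ) : Prop where
  deriv : ∀ r, HasDerivAt f (f₁ r) r
  lap : ∀ r : ℝ, HasDerivAt (fun r : ℝ => r * f₁ r) (r * f₂ r) r
  cont₁ : Continuous f₁
  cont₂ : Continuous f₂
  one : f 1 = 0

theorem isRadial_radSum (F : Finset ℕ) (c : ℕ → ℂ) :
    IsRadial (radSum F c) (radSumD F c) (radSumL F c) :=
  ⟨hasDerivAt_radSum F c, hasDerivAt_mul_radSumD F c, by fun_prop, by fun_prop, radSum_one F c⟩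

namespace IsRadial

variable {f f₁ f₂ g g₁ g₂ : ℝ → ℂ}

theorem cont (hf : IsRadial f f₁ f₂) : Continuous f :=
  continuous_iff_continuousAt.2 fun r => (hf.deriv r).continuousAt

theorem conj (hf : IsRadial f f₁ f₂) : IsRadial (fun r => (starRingEnd ℂ) (f r))
    (fun r => (starRingEnd ℂ) (f₁ r)) (fun r => (starRingEnd ℂ) (f₂ r)) where
  deriv r := by
    have := (hf.deriv r).star
    exact this
  lap r := by
    have := (hf.lap r).star
    simpa using this
  cont₁ := Complex.continuous_conj.comp hf.cont₁
  cont₂ := Complex.continuous_conj.comp hf.cont₂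
  one := by rw [hf.one, map_zero]

theorem mul (hf : IsRadial f f₁ f₂) (hg : IsRadial g g₁ g₂) : IsRadial (fun r => f r * g r)
    (fun r => f₁ r * g r + f r * g₁ r) (fun r => f₂ r * g r + f r * g₂ r + 2 * (f₁ r * g₁ r)) where
  deriv r := (hf.deriv r).mul (hg.deriv r)
  lap r := by
    have := ((hf.lap r).mul (hg.deriv r)).add ((hf.deriv r).mul (hg.lap r))
    refine (this.congr_deriv ?_).congr_of_eventuallyEq (Eventually.of_forall fun x => ?_)
    · ring
    · simp only [Pi.add_apply, Pi.mul_apply]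
      ring
  cont₁ := by
    have := hf.cont; have := hg.cont; have := hf.cont₁; have := hg.cont₁
    fun_prop
  cont₂ := by
    have := hf.cont; have := hg.cont; have := hf.cont₁; have := hg.cont₁
    have := hf.cont₂; have := hg.cont₂
    fun_prop
  one := by rw [hf.one, zero_mul]

end IsRadial

theorem memLp_radial {F : ℝ → ℂ} (hF : Continuous F) (p : ℝ≥0∞) :
    MemLp (fun x : Plane => F ‖x‖) p discMeasure := by
  obtain ⟨K, hK⟩ := isCompact_Icc.exists_bound_of_continuousOn (s := Icc (0 : ℝ) 1) hF.continuousOn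
  refine MemLp.of_bound (hF.comp continuous_norm).aestronglyMeasurable K ?_
  filter_upwards [ae_norm_mem] with x hx
  exact hK _ hx

/-- The coefficients `⟨F, eₙ⟩` of a radial function. -/
def coef (F : ℝ → ℂ) (n : ℕ) : ℂ := ∫ x : Plane, F ‖x‖ * eigenfun n x ∂discMeasure

theorem coef_eq (F : ℝ → ℂ) (n : ℕ) :
    coef F n = (1 / 2 : ℝ) • ∫ r in (0 : ℝ)..1, r • (F r * eig n r) := by
  rw [coef, ← integral_radial (fun r => F r * eig n r)]
  simp_rw [eigenfun_eq]

theorem coef_add {F G : ℝ → ℂ} (hF : Continuous F) (hG : Continuous G) (n : ℕ) :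
    coef (fun r => F r + G r) n = coef F n + coef G n := by
  rw [coef, coef, coef, ← integral_add]
  · simp_rw [add_mul]
  all_goals
    refine Integrable.mul_bdd (c := |eigConst n|) ?_ (memLp_eigenfun n).1
      (Eventually.of_forall (norm_eigenfun_le n))
    first
      | exact memLp_one_iff_integrable.1 (memLp_radial hF 1)
      | exact memLp_one_iff_integrable.1 (memLp_radial hG 1)

theorem coef_sum {F : ℕ → ℝ → ℂ} (hF : ∀ j, Continuous (F j)) (J n : ℕ) :
    coef (fun r => ∑ j ∈ Finset.range J, F j r) n = ∑ j ∈ Finset.range J, coef (F j) n := by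
  induction J with
  | zero => simp [coef]
  | succ J ih =>
    simp_rw [Finset.sum_range_succ]
    rw [coef_add (by fun_prop) (hF J), ih]

/-- Green's formula: there are no boundary terms. -/
theorem IsRadial.coef_lap {f f₁ f₂ : ℝ → ℂ} (hf : IsRadial f f₁ f₂) (n : ℕ) :
    coef f₂ n = -((besselZero n ^ 2 : ℝ) : ℂ) * coef f n := by
  have hc := hf.cont
  have hc2 := hf.cont₂
  have h1 : ∫ r in (0 : ℝ)..1, (r • (f₂ r * eig n r) + ((besselZero n ^ 2 : ℝ) : ℂ) * r • (f r * eig n r)) = 0 := by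
    rw [intervalIntegral.integral_eq_sub_of_hasDerivAt
      (f := fun r : ℝ => (r * f₁ r) * eig n r - f r * ((r * eigD n r : ℝ) : ℂ))]
    · simp [eig_one, hf.one]
    · intro r _
      have := ((hf.lap r).mul (hasDerivAt_eig n r).ofReal_comp).sub
        ((hf.deriv r).mul (hasDerivAt_mul_eigD n r).ofReal_comp)
      refine this.congr_deriv ?_
      simp only [Complex.real_smul]
      push_cast
      ring
    · exact Continuous.intervalIntegrable (by fun_prop) _ _
  rw [intervalIntegral.integral_add (Continuous.intervalIntegrable (by fun_prop) _ _)
    (Continuous.intervalIntegrable (by fun_prop) _ _), intervalIntegral.integral_const_mul] at h1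
  rw [coef_eq, coef_eq, eq_neg_of_add_eq_zero_left h1, mul_smul_comm, smul_neg, neg_mul, smul_neg]

/-- `‖∇f‖² ≤ ‖Δf‖ ‖f‖`, by Green's identity and the Cauchy-Schwarz inequality. -/
theorem IsRadial.lintegral_deriv_sq_le {f f₁ f₂ : ℝ → ℂ} (hf : IsRadial f f₁ f₂) :
    ∫⁻ x : Plane, ‖f₁ ‖x‖‖ₑ ^ 2 ∂discMeasure ≤
      (∫⁻ x : Plane, ‖f₂ ‖x‖‖ₑ ^ 2 ∂discMeasure) ^ (1 / 2 : ℝ) *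
        (∫⁻ x : Plane, ‖f ‖x‖‖ₑ ^ 2 ∂discMeasure) ^ (1 / 2 : ℝ) := by
  have hc := hf.cont
  have hc1 := hf.cont₁
  have hc2 := hf.cont₂
  have h1 : ∫ r in (0 : ℝ)..1, (r • ((‖f₁ r‖ ^ 2 : ℝ) : ℂ) + r • (f₂ r * (starRingEnd ℂ) (f r))) = 0 := by
    rw [intervalIntegral.integral_eq_sub_of_hasDerivAt
      (f := fun r : ℝ => (r * f₁ r) * (starRingEnd ℂ) (f r))]
    · simp [hf.one]
    · intro r _
      refine ((hf.lap r).mul (hf.conj.deriv r)).congr_deriv ?_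
      have : ((‖f₁ r‖ ^ 2 : ℝ) : ℂ) = f₁ r * (starRingEnd ℂ) (f₁ r) := by
        rw [Complex.mul_conj, Complex.normSq_eq_norm_sq]
      rw [this]
      simp only [Complex.real_smul]
      ring
    · have := hf.conj.cont
      exact Continuous.intervalIntegrable (by fun_prop) _ _
  have hcc := hf.conj.cont
  rw [intervalIntegral.integral_add (Continuous.intervalIntegrable (by fun_prop) _ _)
    (Continuous.intervalIntegrable (by fun_prop) _ _)] at h1
  have h2 : ((∫ x : Plane, ‖f₁ ‖x‖‖ ^ 2 ∂discMeasure : ℝ) : ℂ) =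
      -∫ x : Plane, f₂ ‖x‖ * (starRingEnd ℂ) (f ‖x‖) ∂discMeasure := by
    rw [← integral_complex_ofReal, integral_radial (fun r => ((‖f₁ r‖ ^ 2 : ℝ) : ℂ)),
      integral_radial (fun r => f₂ r * (starRingEnd ℂ) (f r)), eq_neg_of_add_eq_zero_left h1, smul_neg]
  have h3 : ∫⁻ x : Plane, ‖f₁ ‖x‖‖ₑ ^ 2 ∂discMeasure =
      ‖((∫ x : Plane, ‖f₁ ‖x‖‖ ^ 2 ∂discMeasure : ℝ) : ℂ)‖ₑ := by
    rw [← ofReal_norm, Complex.norm_real, Real.norm_eq_abs,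
      abs_of_nonneg (integral_nonneg fun x => by positivity), ofReal_integral_eq_lintegral_ofReal]
    · refine lintegral_congr fun x => ?_
      rw [ENNReal.ofReal_pow (norm_nonneg _), ofReal_norm]
    · exact (memLp_radial hc1 2).integrable_norm_pow two_ne_zero
    · exact Eventually.of_forall fun x => by positivity
  rw [h3, h2, enorm_neg]
  refine (enorm_integral_le_lintegral_enorm _).trans (le_trans (le_of_eq ?_)
    (lintegral_mul_le_sqrt _ (by fun_prop) (by fun_prop)))
  refine lintegral_congr fun x => ?_
  rw [enorm_mul]
  congr 1
  rw [← ofReal_norm, RCLike.norm_conj, ofReal_norm]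

/-- Bessel's inequality. -/
theorem tsum_coef_sq_le {F : ℝ → ℂ} (hF : Continuous F) :
    ∑' n, ‖coef F n‖ₑ ^ 2 ≤ ∫⁻ x : Plane, ‖F ‖x‖‖ₑ ^ 2 ∂discMeasure := by
  have hm := memLp_radial hF 2
  have hin : ∀ n, inner ℂ (eigenLp n) (hm.toLp _) = coef F n := by
    intro n
    rw [L2.inner_def, coef]
    refine integral_congr_ae ?_
    filter_upwards [hm.coeFn_toLp, (memLp_eigenfun n).coeFn_toLp] with x h1 h2
    rw [eigenLp, h1, h2]
    simp [conj_eigenfun]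
  have h1 := orthonormal_eigenLp.tsum_inner_products_le (hm.toLp _)
  have h2 := orthonormal_eigenLp.inner_products_summable (hm.toLp _)
  simp_rw [hin] at h1 h2
  have h3 := ENNReal.ofReal_le_ofReal h1
  rw [ENNReal.ofReal_tsum_of_nonneg (fun n => by positivity) h2] at h3
  simp only [ENNReal.ofReal_pow (norm_nonneg _), ofReal_norm] at h3
  refine h3.trans (le_of_eq ?_)
  rw [Lp.enorm_toLp]
  have := eLpNorm_nnreal_pow_eq_lintegral (f := fun x : Plane => F ‖x‖)
      (μ := discMeasure) (p := 2) two_ne_zero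
  simpa using this

/-- Uniform bounds at frequency `2^j` on `[0, 1]` for a function, its derivative and Laplacian. -/
def SupBound (j : ℕ) (A : ℝ≥0∞) (g g₁ g₂ : ℝ → ℂ) : Prop :=
  ∀ r ∈ Icc (0 : ℝ) 1, ‖g r‖ₑ ≤ A ∧ ‖g₁ r‖ₑ ≤ 2 ^ j * A ∧ ‖g₂ r‖ₑ ≤ 4 ^ j * A

theorem add_add_sq_le_enn (a b c : ℝ≥0∞) : (a + b + c) ^ 2 ≤ 3 * (a ^ 2 + b ^ 2 + c ^ 2) := by
  have := sq_sum_mul_le (Finset.univ : Finset (Fin 3)) (fun _ => 1) ![a, b, c]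
  simpa [Fin.sum_univ_three, one_add_one_eq_two, two_add_one_eq_three] using this

/-- The constant in `tsum_coef_mul_mul_le`. -/
def prodConst : ℝ := 1 + zeroGap⁻¹ ^ 4 * (3 * (14 ^ 4 + 16 * 14 ^ 2 + 16))

/-- The coefficients of a product of one factor at frequency `2^j` in `L²` and two bounded factors of
frequencies at most `2^j` decay beyond the frequency `2^j`. -/
theorem tsum_coef_mul_mul_le {f f₁ f₂ g g₁ g₂ h h₁ h₂ : ℝ → ℂ} (hf : IsRadial f f₁ f₂)
    (hg : IsRadial g g₁ g₂) (hh : IsRadial h h₁ h₂) (j : ℕ) {A B X : ℝ≥0∞}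
    (hA : SupBound j A g g₁ g₂) (hB : SupBound j B h h₁ h₂)
    (hX : ∫⁻ x : Plane, ‖f ‖x‖‖ₑ ^ 2 ∂discMeasure ≤ X)
    (hX2 : ∫⁻ x : Plane, ‖f₂ ‖x‖‖ₑ ^ 2 ∂discMeasure ≤ 14 ^ 4 * 16 ^ j * X) :
    ∑' n : ℕ, ENNReal.ofReal (max 1 (((n : ℝ) + 1) / 2 ^ j) ^ 4) * ‖coef (fun r => f r * g r * h r) n‖ₑ ^ 2 ≤
      ENNReal.ofReal prodConst * ((A * B) ^ 2 * X) := by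
  have hgap := zeroGap_pos
  have hT := (hf.mul hg).mul hh
  have cf := hf.cont
  have cf1 := hf.cont₁
  have cf2 := hf.cont₂
  have mf : Measurable fun x : Plane => f ‖x‖ := cf.measurable.comp measurable_norm
  have mf1 : Measurable fun x : Plane => f₁ ‖x‖ := cf1.measurable.comp measurable_norm
  have mf2 : Measurable fun x : Plane => f₂ ‖x‖ := cf2.measurable.comp measurable_norm
  have ef := mf.enorm.pow_const 2
  have ef1 := mf1.enorm.pow_const 2
  have ef2 := mf2.enorm.pow_const 2
  -- the gradient, by interpolation; `14` is the ratio of the zeros of a block to `2^j`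
  have hX1 : ∫⁻ x : Plane, ‖f₁ ‖x‖‖ₑ ^ 2 ∂discMeasure ≤ 14 ^ 2 * 4 ^ j * X := by
    have h3 : (14 : ℝ≥0∞) ^ 4 * 16 ^ j * X * X = (14 ^ 2 * 4 ^ j * X) ^ 2 := by
      have h16 : (16 : ℝ≥0∞) ^ j = 4 ^ j * 4 ^ j := by rw [← mul_pow]; norm_num
      rw [h16]
      ring
    refine hf.lintegral_deriv_sq_le.trans ?_
    rw [← ENNReal.mul_rpow_of_nonneg _ _ (by norm_num)]
    refine rpow_half_le ?_
    rw [← h3]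
    gcongr
  -- Bessel's inequality for the product
  have hS0 : ∑' n, ‖coef (fun r => f r * g r * h r) n‖ₑ ^ 2 ≤ (A * B) ^ 2 * X := by
    refine (tsum_coef_sq_le hT.cont).trans ?_
    refine le_trans ?_ (mul_le_mul_right hX ((A * B) ^ 2))
    rw [← lintegral_const_mul _ ef]
    refine lintegral_mono_ae ?_
    filter_upwards [ae_norm_mem] with x hx
    rw [← mul_pow, enorm_mul, enorm_mul]
    have h1 := (hA _ hx).1
    have h2 := (hB _ hx).1
    calc (‖f ‖x‖‖ₑ * ‖g ‖x‖‖ₑ * ‖h ‖x‖‖ₑ) ^ 2 ≤ (‖f ‖x‖‖ₑ * A * B) ^ 2 := by gcongr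
      _ = _ := by ring
  -- Bessel's inequality for the Laplacian of the product, whose coefficients are `-zₙ²` times those of
  -- the product; the Laplacian is expanded by the Leibniz rule
  have hS2 : ∑' n, ENNReal.ofReal (besselZero n ^ 4) * ‖coef (fun r => f r * g r * h r) n‖ₑ ^ 2 ≤
      3 * (14 ^ 4 + 16 * 14 ^ 2 + 16) * 16 ^ j * ((A * B) ^ 2 * X) := by
    have h1 : ∀ n, ENNReal.ofReal (besselZero n ^ 4) * ‖coef (fun r => f r * g r * h r) n‖ₑ ^ 2 =
        ‖coef (fun r => (f₂ r * g r + f r * g₂ r + 2 * (f₁ r * g₁ r)) * h r + f r * g r * h₂ r +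
          2 * ((f₁ r * g r + f r * g₁ r) * h₁ r)) n‖ₑ ^ 2 := by
      intro n
      rw [hT.coef_lap, enorm_mul, mul_pow, enorm_neg]
      congr 1
      rw [← ofReal_norm, Complex.norm_real, Real.norm_eq_abs, abs_of_nonneg (by positivity),
        ← ENNReal.ofReal_pow (by positivity)]
      congr 1
      ring
    simp_rw [h1]
    refine (tsum_coef_sq_le hT.cont₂).trans ?_
    have e2 : ‖(2 : ℂ)‖ₑ = 2 := by rw [← ofReal_norm]; simp
    have hpt : ∀ x : Plane, ‖x‖ ∈ Icc (0 : ℝ) 1 →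
        ‖(f₂ ‖x‖ * g ‖x‖ + f ‖x‖ * g₂ ‖x‖ + 2 * (f₁ ‖x‖ * g₁ ‖x‖)) * h ‖x‖ + f ‖x‖ * g ‖x‖ * h₂ ‖x‖ +
          2 * ((f₁ ‖x‖ * g ‖x‖ + f ‖x‖ * g₁ ‖x‖) * h₁ ‖x‖)‖ₑ ^ 2 ≤
        (3 * (A * B) ^ 2) * (‖f₂ ‖x‖‖ₑ ^ 2 + 16 * 4 ^ j * ‖f₁ ‖x‖‖ₑ ^ 2 + 16 * 16 ^ j * ‖f ‖x‖‖ₑ ^ 2) := by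
      intro x hx
      obtain ⟨a0, a1, a2⟩ := hA _ hx
      obtain ⟨b0, b1, b2⟩ := hB _ hx
      have h16 : (16 : ℝ≥0∞) ^ j = (4 ^ j) ^ 2 := by rw [← pow_mul, mul_comm j 2, pow_mul]; norm_num
      have h4 : (4 : ℝ≥0∞) ^ j = 2 ^ j * 2 ^ j := by rw [← mul_pow]; norm_num
      calc _ ≤ ((‖f₂ ‖x‖‖ₑ * A + ‖f ‖x‖‖ₑ * (4 ^ j * A) + 2 * (‖f₁ ‖x‖‖ₑ * (2 ^ j * A))) * B +
            ‖f ‖x‖‖ₑ * A * (4 ^ j * B) +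
            2 * ((‖f₁ ‖x‖‖ₑ * A + ‖f ‖x‖‖ₑ * (2 ^ j * A)) * (2 ^ j * B))) ^ 2 := by
            gcongr
            refine (enorm_add_le _ _).trans (add_le_add ((enorm_add_le _ _).trans (add_le_add ?_ ?_)) ?_)
            · rw [enorm_mul]
              gcongr
              refine (enorm_add_le _ _).trans (add_le_add ((enorm_add_le _ _).trans (add_le_add ?_ ?_)) ?_)
              · rw [enorm_mul]; gcongr
              · rw [enorm_mul]; gcongr
              · rw [enorm_mul, enorm_mul, e2]; gcongr
            · rw [enorm_mul, enorm_mul]; gcongr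
            · rw [enorm_mul, enorm_mul, e2]
              gcongr
              refine (enorm_add_le _ _).trans (add_le_add ?_ ?_)
              · rw [enorm_mul]; gcongr
              · rw [enorm_mul]; gcongr
        _ = (A * B) ^ 2 * (‖f₂ ‖x‖‖ₑ + 4 * 2 ^ j * ‖f₁ ‖x‖‖ₑ + 4 * 4 ^ j * ‖f ‖x‖‖ₑ) ^ 2 := by
            rw [h4]; ring
        _ ≤ (A * B) ^ 2 * (3 * (‖f₂ ‖x‖‖ₑ ^ 2 + (4 * 2 ^ j * ‖f₁ ‖x‖‖ₑ) ^ 2 +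
              (4 * 4 ^ j * ‖f ‖x‖‖ₑ) ^ 2)) := by
            gcongr
            exact add_add_sq_le_enn _ _ _
        _ = _ := by
            rw [h16, h4]; ring
    calc _ ≤ ∫⁻ x : Plane, (3 * (A * B) ^ 2) * (‖f₂ ‖x‖‖ₑ ^ 2 + 16 * 4 ^ j * ‖f₁ ‖x‖‖ₑ ^ 2 +
          16 * 16 ^ j * ‖f ‖x‖‖ₑ ^ 2) ∂discMeasure := by
          refine lintegral_mono_ae ?_
          filter_upwards [ae_norm_mem] with x hx
          exact hpt x hx
      _ = (3 * (A * B) ^ 2) * ((∫⁻ x : Plane, ‖f₂ ‖x‖‖ₑ ^ 2 ∂discMeasure) +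
          16 * 4 ^ j * (∫⁻ x : Plane, ‖f₁ ‖x‖‖ₑ ^ 2 ∂discMeasure) +
          16 * 16 ^ j * ∫⁻ x : Plane, ‖f ‖x‖‖ₑ ^ 2 ∂discMeasure) := by
          have e1 : Measurable fun x : Plane => 16 * 4 ^ j * ‖f₁ ‖x‖‖ₑ ^ 2 := ef1.const_mul _
          have e2 : Measurable fun x : Plane => 16 * 16 ^ j * ‖f ‖x‖‖ₑ ^ 2 := ef.const_mul _
          rw [lintegral_const_mul _ (by fun_prop), lintegral_add_left (by fun_prop),
            lintegral_add_left ef2, lintegral_const_mul _ ef1, lintegral_const_mul _ ef]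
      _ ≤ (3 * (A * B) ^ 2) * (14 ^ 4 * 16 ^ j * X + 16 * 4 ^ j * (14 ^ 2 * 4 ^ j * X) +
          16 * 16 ^ j * X) := by gcongr
      _ = _ := by
          have h16 : (16 : ℝ≥0∞) ^ j = 4 ^ j * 4 ^ j := by rw [← mul_pow]; norm_num
          rw [h16]; ring
  -- `n + 1` is at most a multiple of `zₙ`, so the weight is controlled by the two sums
  have hmax : ∀ n : ℕ, ENNReal.ofReal (max 1 (((n : ℝ) + 1) / 2 ^ j) ^ 4) ≤
      1 + ENNReal.ofReal (zeroGap⁻¹ ^ 4 / 16 ^ j) * ENNReal.ofReal (besselZero n ^ 4) := by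
    intro n
    rw [← ENNReal.ofReal_mul (by positivity), ← ENNReal.ofReal_one,
      ← ENNReal.ofReal_add zero_le_one (by positivity)]
    refine ENNReal.ofReal_le_ofReal ?_
    have hp : 0 ≤ zeroGap⁻¹ ^ 4 / 16 ^ j * besselZero n ^ 4 := by positivity
    rcases max_cases (1 : ℝ) (((n : ℝ) + 1) / 2 ^ j) with ⟨h1, -⟩ | ⟨h1, -⟩ <;> rw [h1]
    · linarith
    · have h2 : ((n : ℝ) + 1) ≤ zeroGap⁻¹ * besselZero n := by
        rw [← div_eq_inv_mul, le_div_iff₀ hgap, mul_comm]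
        exact mul_le_besselZero n
      have h16 : (16 : ℝ) ^ j = (2 ^ j) ^ 4 := by rw [← pow_mul, mul_comm j 4, pow_mul]; norm_num
      have : (((n : ℝ) + 1) / 2 ^ j) ^ 4 ≤ zeroGap⁻¹ ^ 4 / 16 ^ j * besselZero n ^ 4 := by
        rw [h16, div_mul_eq_mul_div, ← mul_pow, ← div_pow]
        gcongr
      linarith
  calc _ ≤ ∑' n, (‖coef (fun r => f r * g r * h r) n‖ₑ ^ 2 + ENNReal.ofReal (zeroGap⁻¹ ^ 4 / 16 ^ j) *
        (ENNReal.ofReal (besselZero n ^ 4) * ‖coef (fun r => f r * g r * h r) n‖ₑ ^ 2)) := by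
        refine ENNReal.tsum_le_tsum fun n => ?_
        rw [← mul_assoc]
        refine (mul_le_mul_left (hmax n) _).trans (le_of_eq ?_)
        ring
    _ ≤ (A * B) ^ 2 * X + ENNReal.ofReal (zeroGap⁻¹ ^ 4 / 16 ^ j) *
        (3 * (14 ^ 4 + 16 * 14 ^ 2 + 16) * 16 ^ j * ((A * B) ^ 2 * X)) := by
        rw [ENNReal.tsum_add, ENNReal.tsum_mul_left]
        gcongr
    _ = _ := by
        rw [prodConst, ENNReal.ofReal_add zero_le_one (by positivity), ENNReal.ofReal_one, add_mul, one_mul]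
        congr 1
        rw [← mul_assoc]
        congr 1
        have e1 : (3 * (14 ^ 4 + 16 * 14 ^ 2 + 16) * 16 ^ j : ℝ≥0∞) =
            ENNReal.ofReal (3 * (14 ^ 4 + 16 * 14 ^ 2 + 16) * 16 ^ j) := by
          rw [ENNReal.ofReal_mul (by norm_num), ENNReal.ofReal_pow (by norm_num)]
          norm_num
        rw [e1, ← ENNReal.ofReal_mul (by positivity)]
        congr 1
        field_simp

/-! ### The product estimate -/

theorem three_quarters_pow_sq_le (m : ℕ) : ((4 / 3 : ℝ) ^ m) ^ 2 ≤ 2 ^ m := by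
  rw [← pow_mul, mul_comm, pow_mul]
  exact pow_le_pow_left₀ (by norm_num) (by norm_num) m

/-- Away from its own frequency the weight is dominated by the decay of the coefficients of a function
at frequency `2^j`. -/
theorem IsWeight.div_le (hs : 1 / 2 ≤ s) (hw : IsWeight s C₀ w) (n j : ℕ) :
    w n ≤ 2 * C₀ * (3 / 4) ^ (max (Nat.log 2 (n + 1)) j - min (Nat.log 2 (n + 1)) j) *
      (w (2 ^ j - 1) * max 1 (((n : ℝ) + 1) / 2 ^ j) ^ 2) := by
  have hC := hw.one_le
  have hW := hw.pos (2 ^ j - 1)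
  have hcast : (((2 ^ j - 1 : ℕ) : ℝ) + 1) = 2 ^ j := by
    rw [Nat.cast_sub Nat.one_le_two_pow]; push_cast; ring
  set k := Nat.log 2 (n + 1) with hk
  have hk1 : 2 ^ k ≤ n + 1 := Nat.pow_log_le_self 2 (by omega)
  have hk2 : n + 1 < 2 ^ (k + 1) := Nat.lt_pow_succ_log_self (by norm_num) _
  have hn0 : (0 : ℝ) < (n : ℝ) + 1 := by positivity
  rcases le_or_gt (2 ^ j) (n + 1) with h | h
  · have hjk : j ≤ k := by
      by_contra hlt
      have : 2 ^ (k + 1) ≤ 2 ^ j := Nat.pow_le_pow_right (by norm_num) (by omega)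
      omega
    rw [max_eq_left hjk, min_eq_right hjk]
    have h1 := hw.upper (2 ^ j - 1) n (by omega)
    rw [hcast] at h1
    set y := ((n : ℝ) + 1) / 2 ^ j with hy
    have hy2 : (2 : ℝ) ^ (k - j) ≤ y := by
      rw [hy, le_div_iff₀ (by positivity), ← pow_add, Nat.sub_add_cancel hjk]
      exact_mod_cast hk1
    have hy1 : 1 ≤ y := (one_le_pow₀ (by norm_num)).trans hy2
    rw [max_eq_right hy1]
    have h3 : 1 ≤ (3 / 4 : ℝ) ^ (k - j) * y := by
      calc (1 : ℝ) ≤ (3 / 2) ^ (k - j) := one_le_pow₀ (by norm_num)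
        _ = (3 / 4) ^ (k - j) * 2 ^ (k - j) := by rw [← mul_pow]; norm_num
        _ ≤ _ := by gcongr
    calc w n ≤ C₀ * y * w (2 ^ j - 1) := h1
      _ ≤ C₀ * y * w (2 ^ j - 1) * (2 * ((3 / 4 : ℝ) ^ (k - j) * y)) :=
          le_mul_of_one_le_right (by positivity) (by linarith)
      _ = _ := by ring
  · have hjk : k < j := by
      by_contra hlt
      have : 2 ^ j ≤ 2 ^ k := Nat.pow_le_pow_right (by norm_num) (by omega)
      omega
    rw [max_eq_right hjk.le, min_eq_left hjk.le]
    have h1 := hw.lower n (2 ^ j - 1) (by omega)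
    rw [hcast] at h1
    set y := (2 : ℝ) ^ j / ((n : ℝ) + 1) with hy
    have hy2 : (2 : ℝ) ^ (j - k - 1) ≤ y := by
      rw [hy, le_div_iff₀ hn0]
      have : ((n : ℝ) + 1) ≤ 2 ^ (k + 1) := by exact_mod_cast hk2.le
      calc (2 : ℝ) ^ (j - k - 1) * ((n : ℝ) + 1) ≤ 2 ^ (j - k - 1) * 2 ^ (k + 1) := by gcongr
        _ = 2 ^ j := by rw [← pow_add]; congr 1; omega
    have hy1 : 1 ≤ y := (one_le_pow₀ (by norm_num)).trans hy2
    have hys : (4 / 3 : ℝ) ^ (j - k - 1) ≤ y ^ s := by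
      calc (4 / 3 : ℝ) ^ (j - k - 1) ≤ Real.sqrt y :=
            Real.le_sqrt_of_sq_le ((three_quarters_pow_sq_le _).trans hy2)
        _ = y ^ (1 / 2 : ℝ) := Real.sqrt_eq_rpow y
        _ ≤ y ^ s := Real.rpow_le_rpow_of_exponent_le hy1 hs
    have hm : 1 ≤ max 1 (((n : ℝ) + 1) / 2 ^ j) ^ 2 := one_le_pow₀ (le_max_left _ _)
    have h4 : (1 : ℝ) ≤ 2 * ((3 / 4) ^ (j - k) * (4 / 3) ^ (j - k - 1)) := by
      have : j - k = (j - k - 1) + 1 := by omega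
      nth_rewrite 1 [this]
      rw [pow_succ]
      have e : (3 / 4 : ℝ) ^ (j - k - 1) * (4 / 3) ^ (j - k - 1) = 1 := by
        rw [← mul_pow]; norm_num
      nlinarith
    have h5 : 1 ≤ 2 * ((3 / 4) ^ (j - k) * y ^ s) := h4.trans (by gcongr)
    have hwn := hw.pos n
    calc w n ≤ w n * (2 * ((3 / 4) ^ (j - k) * y ^ s)) := le_mul_of_one_le_right hwn.le h5
      _ = 2 * (3 / 4) ^ (j - k) * (w n * y ^ s) := by ring
      _ ≤ 2 * (3 / 4) ^ (j - k) * (C₀ * w (2 ^ j - 1)) := by gcongr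
      _ ≤ 2 * (3 / 4) ^ (j - k) * (C₀ * w (2 ^ j - 1)) * max 1 (((n : ℝ) + 1) / 2 ^ j) ^ 2 :=
          le_mul_of_one_le_right (by positivity) hm
      _ = _ := by ring

/-- Almost orthogonality of functions at different frequencies. -/
theorem IsWeight.wNorm_sum_sq_le (hs : 1 / 2 ≤ s) (hw : IsWeight s C₀ w) (t : ℕ → ℕ → ℂ) (J : ℕ) :
    wNorm w (fun n => ∑ j ∈ Finset.range J, t j n) ^ 2 ≤ ENNReal.ofReal (32 * C₀ ^ 2) *
      ∑ j ∈ Finset.range J, ENNReal.ofReal (w (2 ^ j - 1) ^ 2) *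
        ∑' n : ℕ, ENNReal.ofReal (max 1 (((n : ℝ) + 1) / 2 ^ j) ^ 4) * ‖t j n‖ₑ ^ 2 := by
  have hC := hw.one_le
  simp_rw [← ENNReal.tsum_mul_left]
  rw [wNorm_sq, ← Summable.tsum_finsetSum fun _ _ => ENNReal.summable, ← ENNReal.tsum_mul_left]
  refine ENNReal.tsum_le_tsum fun n => ?_
  have hwn := hw.pos n
  set W : ℕ → ℝ := fun j => w (2 ^ j - 1) with hW
  set M : ℕ → ℝ := fun j => max 1 (((n : ℝ) + 1) / 2 ^ j) with hM
  have hM0 : ∀ j, 0 < M j := fun j => one_pos.trans_le (le_max_left _ _)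
  have hW0 : ∀ j, 0 < W j := fun j => hw.pos _
  -- Cauchy-Schwarz with the weights `ρ j`, which decay geometrically in the distance of `j` from
  -- `log₂ (n + 1)`: below by the growth of `w`, above because `w` grows slower than `M²`
  set ρ : ℕ → ℝ := fun j => w n / (W j * M j ^ 2) with hρ
  have hden : ∀ j, 0 < W j * M j ^ 2 := fun j => mul_pos (hW0 j) (pow_pos (hM0 j) 2)
  have hρ0 : ∀ j, 0 ≤ ρ j := fun j => div_nonneg hwn.le (hden j).le
  have hρ1 : ∀ j, ρ j ≤ 2 * C₀ * (3 / 4) ^ (max (Nat.log 2 (n + 1)) j - min (Nat.log 2 (n + 1)) j) :=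
    fun j => (div_le_iff₀ (hden j)).2 (hw.div_le hs n j)
  have hρ2 : ∀ j, ρ j ≤ 2 * C₀ := fun j => (hρ1 j).trans
    (mul_le_of_le_one_right (by positivity) (pow_le_one₀ (by norm_num) (by norm_num)))
  have hρ3 : ∑ j ∈ Finset.range J, ρ j ≤ 16 * C₀ := by
    refine (Finset.sum_le_sum fun j _ => hρ1 j).trans ?_
    rw [← Finset.mul_sum]
    have := sum_pow_dist_le (ρ := 3 / 4) (by norm_num) (by norm_num) (Finset.range J) (Nat.log 2 (n + 1))
    norm_num at this
    nlinarith
  have key : w n ^ 2 * ‖∑ j ∈ Finset.range J, t j n‖ ^ 2 ≤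
      32 * C₀ ^ 2 * ∑ j ∈ Finset.range J, W j ^ 2 * (M j ^ 4 * ‖t j n‖ ^ 2) := by
    have h1 : w n * ‖∑ j ∈ Finset.range J, t j n‖ ≤ ∑ j ∈ Finset.range J, w n * ‖t j n‖ := by
      rw [← Finset.mul_sum]
      gcongr
      exact norm_sum_le _ _
    have h2 := Finset.sum_sq_le_sum_mul_sum_of_sq_le_mul (Finset.range J)
      (r := fun j => w n * ‖t j n‖) (f := ρ) (g := fun j => ρ j * (W j ^ 2 * (M j ^ 4 * ‖t j n‖ ^ 2)))
      (fun j _ => hρ0 j) (fun j _ => mul_nonneg (hρ0 j) (by positivity)) (fun j _ => by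
        have e : w n = ρ j * (W j * M j ^ 2) := (div_mul_cancel₀ _ (hden j).ne').symm
        calc (w n * ‖t j n‖) ^ 2 = (ρ j * (W j * M j ^ 2) * ‖t j n‖) ^ 2 := by rw [← e]
          _ ≤ _ := le_of_eq (by ring))
    calc w n ^ 2 * ‖∑ j ∈ Finset.range J, t j n‖ ^ 2
        = (w n * ‖∑ j ∈ Finset.range J, t j n‖) ^ 2 := by ring
      _ ≤ (∑ j ∈ Finset.range J, w n * ‖t j n‖) ^ 2 := by gcongr
      _ ≤ _ := h2
      _ ≤ (16 * C₀) * ∑ j ∈ Finset.range J, (2 * C₀) * (W j ^ 2 * (M j ^ 4 * ‖t j n‖ ^ 2)) := by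
          gcongr with j _
          · exact Finset.sum_nonneg fun j _ => mul_nonneg (hρ0 j) (by positivity)
          · exact hρ2 j
      _ = _ := by rw [← Finset.mul_sum]; ring
  have h3 := ENNReal.ofReal_le_ofReal key
  rw [ENNReal.ofReal_mul (by positivity), ENNReal.ofReal_mul (by positivity),
    ENNReal.ofReal_sum_of_nonneg fun j _ => by positivity, ENNReal.ofReal_pow (norm_nonneg _),
    ofReal_norm] at h3
  refine h3.trans (le_of_eq ?_)
  congr 1
  refine Finset.sum_congr rfl fun j _ => ?_
  rw [ENNReal.ofReal_mul (by positivity), ENNReal.ofReal_mul (by have := hM0 j; positivity),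
    ENNReal.ofReal_pow (norm_nonneg _), ofReal_norm]

theorem IsWeight.sum_block_sq_le (hs : 0 ≤ s) (hw : IsWeight s C₀ w) (c : ℕ → ℂ) (J : ℕ) :
    ∑ j ∈ Finset.range J, ENNReal.ofReal (w (2 ^ j - 1) ^ 2) * ∑ n ∈ block j, ‖c n‖ₑ ^ 2 ≤
      ENNReal.ofReal (C₀ ^ 2) * wNorm w c ^ 2 := by
  have hC := hw.one_le
  rw [wNorm_sq]
  refine le_trans ?_ (mul_le_mul_right (ENNReal.sum_le_tsum (Finset.range (2 ^ J - 1))) _)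
  rw [sum_range_eq_sum_block, Finset.mul_sum]
  refine Finset.sum_le_sum fun j _ => ?_
  rw [Finset.mul_sum, Finset.mul_sum]
  refine Finset.sum_le_sum fun n hn => ?_
  rw [← mul_assoc, ← ENNReal.ofReal_mul (by positivity)]
  gcongr
  have hjn : 2 ^ j - 1 ≤ n := by have := (mem_block.1 hn).1; omega
  have h1 := hw.lower (2 ^ j - 1) n hjn
  have h2 : (1 : ℝ) ≤ (((n : ℝ) + 1) / (((2 ^ j - 1 : ℕ) : ℝ) + 1)) ^ s := by
    refine Real.one_le_rpow ?_ hs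
    rw [one_le_div (by positivity)]
    exact_mod_cast Nat.add_le_add_right hjn 1
  have hW := hw.pos (2 ^ j - 1)
  rw [← mul_pow]
  gcongr
  nlinarith

/-- The sum of the block norms; it bounds the supremum of `∑ cₙ eₙ`. -/
def supNorm (c : ℕ → ℂ) : ℝ≥0∞ := ∑' j, blockNorm j c

/-- Bernstein: low frequency parts have derivatives bounded by powers of `2^j`, uniformly on the disk. -/
theorem supBound_radSum (c : ℕ → ℂ) {i j : ℕ} (hij : i ≤ j + 1) :
    SupBound j (supNorm c) (radSum (Finset.range (2 ^ i - 1)) c)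
      (radSumD (Finset.range (2 ^ i - 1)) c) (radSumL (Finset.range (2 ^ i - 1)) c) := by
  intro r hr
  have gen : ∀ (f : ℕ → ℂ) (K : ℝ≥0∞), 1 ≤ K →
      (∀ l, ‖∑ n ∈ block l, f n‖ₑ ≤ K ^ l * blockNorm l c) →
      ‖∑ n ∈ Finset.range (2 ^ i - 1), f n‖ₑ ≤ K ^ j * supNorm c := by
    intro f K hK h
    rw [sum_range_eq_sum_block]
    refine (enorm_sum_le _ _).trans ?_
    calc ∑ l ∈ Finset.range i, ‖∑ n ∈ block l, f n‖ₑ ≤ ∑ l ∈ Finset.range i, K ^ j * blockNorm l c := by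
          refine Finset.sum_le_sum fun l hl => (h l).trans ?_
          have hl' : l ≤ j := by have := Finset.mem_range.1 hl; omega
          gcongr
      _ ≤ K ^ j * supNorm c := by
          rw [← Finset.mul_sum]
          gcongr
          exact ENNReal.sum_le_tsum _
  refine ⟨?_, gen _ 2 (by norm_num) fun l => (enorm_le_blockNorm l c hr).2.1,
    gen _ 4 (by norm_num) fun l => (enorm_le_blockNorm l c hr).2.2⟩
  simpa [radSum] using gen (fun n => c n * eig n r) 1 le_rfl fun l => by
    simpa [radSum] using (enorm_le_blockNorm l c hr).1

theorem SupBound.conj {j : ℕ} {A : ℝ≥0∞} {g g₁ g₂ : ℝ → ℂ} (h : SupBound j A g g₁ g₂) :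
    SupBound j A (fun r => (starRingEnd ℂ) (g r)) (fun r => (starRingEnd ℂ) (g₁ r))
      (fun r => (starRingEnd ℂ) (g₂ r)) := by
  have e : ∀ z : ℂ, ‖(starRingEnd ℂ) z‖ₑ = ‖z‖ₑ := fun z => by
    rw [← ofReal_norm, RCLike.norm_conj, ofReal_norm]
  intro r hr
  simpa only [e] using h r hr

theorem lintegral_radSumL_block_le (j : ℕ) (c : ℕ → ℂ) :
    ∫⁻ x : Plane, ‖radSumL (block j) c ‖x‖‖ₑ ^ 2 ∂discMeasure ≤
      14 ^ 4 * 16 ^ j * ∑ n ∈ block j, ‖c n‖ₑ ^ 2 := by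
  have e : radSumL (block j) c = radSum (block j) fun n => -((besselZero n ^ 2 : ℝ) : ℂ) * c n := by
    ext r
    refine Finset.sum_congr rfl fun n _ => ?_
    push_cast
    ring
  rw [e, lintegral_enorm_sq_radSum, Finset.mul_sum]
  refine Finset.sum_le_sum fun n hn => ?_
  rw [enorm_mul, mul_pow]
  gcongr
  have hz := besselZero_pos n
  rw [enorm_neg, ← ofReal_norm, Complex.norm_real, Real.norm_eq_abs, abs_of_nonneg (by positivity),
    ← ENNReal.ofReal_pow (by positivity), ← ENNReal.ofReal_ofNat 14, ← ENNReal.ofReal_ofNat 16,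
    ← ENNReal.ofReal_pow (by norm_num), ← ENNReal.ofReal_pow (by norm_num),
    ← ENNReal.ofReal_mul (by norm_num)]
  refine ENNReal.ofReal_le_ofReal ?_
  have h16 : (16 : ℝ) ^ j = (2 ^ j) ^ 4 := by rw [← pow_mul, mul_comm j 4, pow_mul]; norm_num
  rw [h16, ← mul_pow, ← pow_mul]
  exact pow_le_pow_left₀ hz.le (besselZero_le_block hn) 4

/-- The constant of the product estimate. -/
def productConst (C₀ : ℝ) : ℝ≥0∞ := ENNReal.ofReal (32 * C₀ ^ 4 * prodConst) ^ (1 / 2 : ℝ)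

theorem productConst_lt_top (C₀ : ℝ) : productConst C₀ < ⊤ :=
  ENNReal.rpow_lt_top_of_nonneg (by norm_num) ENNReal.ofReal_ne_top

/-- Sum over dyadic frequencies `j` of products in which the factor `f j` is the `j`-th block of
`∑ cₙ eₙ`. -/
theorem IsWeight.wNorm_sum_coef_le (hs : 1 / 2 ≤ s) (hw : IsWeight s C₀ w) (c : ℕ → ℂ)
    {f f₁ f₂ g g₁ g₂ h h₁ h₂ : ℕ → ℝ → ℂ} (hf : ∀ j, IsRadial (f j) (f₁ j) (f₂ j))
    (hg : ∀ j, IsRadial (g j) (g₁ j) (g₂ j)) (hh : ∀ j, IsRadial (h j) (h₁ j) (h₂ j)) {A B : ℝ≥0∞}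
    (hA : ∀ j, SupBound j A (g j) (g₁ j) (g₂ j)) (hB : ∀ j, SupBound j B (h j) (h₁ j) (h₂ j))
    (hX : ∀ j r, ‖f j r‖ₑ = ‖radSum (block j) c r‖ₑ)
    (hX2 : ∀ j r, ‖f₂ j r‖ₑ = ‖radSumL (block j) c r‖ₑ) (J : ℕ) :
    wNorm w (fun n => ∑ j ∈ Finset.range J, coef (fun r => f j r * g j r * h j r) n) ≤
      productConst C₀ * (A * B * wNorm w c) := by
  have hC := hw.one_le
  have hp : 0 ≤ prodConst := by have := zeroGap_pos; unfold prodConst; positivity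
  rw [← sq_le_sq_enn, mul_pow, productConst, rpow_half_sq]
  refine (hw.wNorm_sum_sq_le hs _ J).trans ?_
  calc _ ≤ ENNReal.ofReal (32 * C₀ ^ 2) * ∑ j ∈ Finset.range J, ENNReal.ofReal (w (2 ^ j - 1) ^ 2) *
        (ENNReal.ofReal prodConst * ((A * B) ^ 2 * ∑ n ∈ block j, ‖c n‖ₑ ^ 2)) := by
        gcongr with j _
        refine tsum_coef_mul_mul_le (hf j) (hg j) (hh j) j (hA j) (hB j) ?_ ?_
        · simp_rw [hX, lintegral_enorm_sq_radSum]; exact le_rfl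
        · simp_rw [hX2]; exact lintegral_radSumL_block_le j c
    _ = ENNReal.ofReal (32 * C₀ ^ 2) * (ENNReal.ofReal prodConst * ((A * B) ^ 2 *
        ∑ j ∈ Finset.range J, ENNReal.ofReal (w (2 ^ j - 1) ^ 2) * ∑ n ∈ block j, ‖c n‖ₑ ^ 2)) := by
        rw [Finset.mul_sum, Finset.mul_sum, Finset.mul_sum, Finset.mul_sum]
        exact Finset.sum_congr rfl fun j _ => by ring
    _ ≤ ENNReal.ofReal (32 * C₀ ^ 2) * (ENNReal.ofReal prodConst * ((A * B) ^ 2 *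
        (ENNReal.ofReal (C₀ ^ 2) * wNorm w c ^ 2))) := by
        gcongr
        exact hw.sum_block_sq_le (by linarith) c J
    _ = _ := by
        have e : 32 * C₀ ^ 4 * prodConst = 32 * C₀ ^ 2 * prodConst * C₀ ^ 2 := by ring
        rw [e, ENNReal.ofReal_mul (p := 32 * C₀ ^ 2 * prodConst) (by positivity),
          ENNReal.ofReal_mul (p := 32 * C₀ ^ 2) (by positivity)]
        ring

/-- The product of truncations, telescoped over the dyadic truncations. -/
theorem wNorm_tri_trunc_le (hs : 1 / 2 ≤ s) (hw : IsWeight s C₀ w) (a b c : ℕ → ℂ) (J : ℕ) :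
    wNorm w (tri (trunc (2 ^ J - 1) a) (trunc (2 ^ J - 1) b) (trunc (2 ^ J - 1) c)) ≤
      productConst C₀ * (supNorm b * supNorm c * wNorm w a + supNorm a * supNorm c * wNorm w b +
        supNorm a * supNorm b * wNorm w c) := by
  set S : ℕ → (ℕ → ℂ) → ℝ → ℂ := fun j a r => radSum (Finset.range (2 ^ j - 1)) a r with hS
  set D : ℕ → (ℕ → ℂ) → ℝ → ℂ := fun j a r => radSum (block j) a r with hD
  have hstep : ∀ j a r, S (j + 1) a r = S j a r + D j a r := by
    intro j a r
    simp only [hS, hD, radSum, sum_range_eq_sum_block, Finset.sum_range_succ]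
  have hSc : ∀ j a, Continuous (S j a) := fun j a => continuous_radSum _ _
  have hDc : ∀ j a, Continuous (D j a) := fun j a => continuous_radSum _ _
  have hS0 : ∀ a r, S 0 a r = 0 := fun a r => by simp [hS, radSum]
  -- in each term of the telescoping sum one factor is a block, the others are low frequency parts
  set T₁ : ℕ → ℝ → ℂ := fun j r => D j a r * (starRingEnd ℂ) (S (j + 1) b r) * S (j + 1) c r with hT₁
  set T₂ : ℕ → ℝ → ℂ := fun j r => (starRingEnd ℂ) (D j b r) * S j a r * S (j + 1) c r with hT₂
  set T₃ : ℕ → ℝ → ℂ := fun j r => D j c r * S j a r * (starRingEnd ℂ) (S j b r) with hT₃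
  have cc : ∀ {F : ℝ → ℂ}, Continuous F → Continuous fun r => (starRingEnd ℂ) (F r) :=
    fun h => Complex.continuous_conj.comp h
  have c₁ : ∀ j, Continuous (T₁ j) := fun j => ((hDc _ _).mul (cc (hSc _ _))).mul (hSc _ _)
  have c₂ : ∀ j, Continuous (T₂ j) := fun j => ((cc (hDc _ _)).mul (hSc _ _)).mul (hSc _ _)
  have c₃ : ∀ j, Continuous (T₃ j) := fun j => ((hDc _ _).mul (hSc _ _)).mul (cc (hSc _ _))
  have htel : ∀ r, S J a r * (starRingEnd ℂ) (S J b r) * S J c r =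
      ∑ j ∈ Finset.range J, (T₁ j r + T₂ j r + T₃ j r) := by
    intro r
    have : ∀ j, T₁ j r + T₂ j r + T₃ j r =
        S (j + 1) a r * (starRingEnd ℂ) (S (j + 1) b r) * S (j + 1) c r -
          S j a r * (starRingEnd ℂ) (S j b r) * S j c r := by
      intro j
      simp only [hT₁, hT₂, hT₃, hstep, map_add]
      ring
    simp_rw [this]
    rw [Finset.sum_range_sub (fun j => S j a r * (starRingEnd ℂ) (S j b r) * S j c r)]
    simp [hS0]
  have htri : tri (trunc (2 ^ J - 1) a) (trunc (2 ^ J - 1) b) (trunc (2 ^ J - 1) c) =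
      (fun n => ∑ j ∈ Finset.range J, coef (T₁ j) n) + (fun n => ∑ j ∈ Finset.range J, coef (T₂ j) n) +
        fun n => ∑ j ∈ Finset.range J, coef (T₃ j) n := by
    ext n
    have h1 : tri (trunc (2 ^ J - 1) a) (trunc (2 ^ J - 1) b) (trunc (2 ^ J - 1) c) n =
        coef (fun r => ∑ j ∈ Finset.range J, (T₁ j r + T₂ j r + T₃ j r)) n := by
      refine integral_congr_ae ?_
      filter_upwards [synth_trunc_ae (2 ^ J - 1) a, synth_trunc_ae (2 ^ J - 1) b,
        synth_trunc_ae (2 ^ J - 1) c] with x ha hb hc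
      rw [ha, hb, hc, ← htel]
    rw [h1, coef_sum (F := fun j r => T₁ j r + T₂ j r + T₃ j r) fun j => ((c₁ j).add (c₂ j)).add (c₃ j), Pi.add_apply, Pi.add_apply,
      ← Finset.sum_add_distrib, ← Finset.sum_add_distrib]
    refine Finset.sum_congr rfl fun j _ => ?_
    rw [coef_add (F := fun r => T₁ j r + T₂ j r) ((c₁ j).add (c₂ j)) (c₃ j), coef_add (c₁ j) (c₂ j)]
  have e : ∀ z : ℂ, ‖(starRingEnd ℂ) z‖ₑ = ‖z‖ₑ := fun z => by
    rw [← ofReal_norm, RCLike.norm_conj, ofReal_norm]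
  rw [htri, mul_add, mul_add]
  refine (wNorm_add_le _ _ _).trans (add_le_add ((wNorm_add_le _ _ _).trans (add_le_add ?_ ?_)) ?_)
  · exact hw.wNorm_sum_coef_le hs a (fun j => isRadial_radSum _ _)
      (fun j => (isRadial_radSum _ _).conj) (fun j => isRadial_radSum _ _)
      (fun j => (supBound_radSum b le_rfl).conj) (fun j => supBound_radSum c le_rfl)
      (fun _ _ => rfl) (fun _ _ => rfl) J
  · exact hw.wNorm_sum_coef_le hs b (fun j => (isRadial_radSum _ _).conj)
      (fun j => isRadial_radSum _ _) (fun j => isRadial_radSum _ _)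
      (fun j => supBound_radSum a (Nat.le_succ _)) (fun j => supBound_radSum c le_rfl)
      (fun _ _ => e _) (fun _ _ => e _) J
  · exact hw.wNorm_sum_coef_le hs c (fun j => isRadial_radSum _ _)
      (fun j => isRadial_radSum _ _) (fun j => (isRadial_radSum _ _).conj)
      (fun j => supBound_radSum a (Nat.le_succ _)) (fun j => (supBound_radSum b (Nat.le_succ _)).conj)
      (fun _ _ => rfl) (fun _ _ => rfl) J

/-- The tame product estimate: `L²` based norm of one factor, uniform norms of the other two. -/
theorem wNorm_tri_le (hs : 1 / 2 ≤ s) (hw : IsWeight s C₀ w) {a b c : ℕ → ℂ}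
    (ha : wNorm w a < ⊤) (hb : wNorm w b < ⊤) (hc : wNorm w c < ⊤) :
    wNorm w (tri a b c) ≤
      productConst C₀ * (supNorm b * supNorm c * wNorm w a + supNorm a * supNorm c * wNorm w b +
        supNorm a * supNorm b * wNorm w c) := by
  refine wNorm_le_of_tendsto (a := fun J => tri (trunc (2 ^ J - 1) a) (trunc (2 ^ J - 1) b)
    (trunc (2 ^ J - 1) c)) (fun n => ?_) (Eventually.of_forall fun J => wNorm_tri_trunc_le hs hw a b c J)
  exact tendsto_tri hs hw ha hb hc ((tendsto_wNorm_trunc_sub ha).comp tendsto_two_pow_sub_one)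
    ((tendsto_wNorm_trunc_sub hb).comp tendsto_two_pow_sub_one)
    ((tendsto_wNorm_trunc_sub hc).comp tendsto_two_pow_sub_one) n

/-! ### Integrability in time of the nonlinearity -/

/-- The norm of `f` in `L^q(E)`. -/
def lqNorm (q : ℝ) (E : Set ℝ) (f : ℝ → ℝ≥0∞) : ℝ≥0∞ := (∫⁻ t in E, f t ^ q) ^ (1 / q)

section

variable {q : ℝ} {E : Set ℝ} {f g : ℝ → ℝ≥0∞}

theorem lqNorm_mono_ae (hq : 0 ≤ q) (h : ∀ᵐ t ∂volume.restrict E, f t ≤ g t) :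
    lqNorm q E f ≤ lqNorm q E g := by
  refine ENNReal.rpow_le_rpow (lintegral_mono_ae ?_) (by positivity)
  filter_upwards [h] with t ht
  exact ENNReal.rpow_le_rpow ht hq

theorem lqNorm_mono (hq : 0 ≤ q) (h : ∀ t, f t ≤ g t) : lqNorm q E f ≤ lqNorm q E g :=
  lqNorm_mono_ae hq (Eventually.of_forall h)

theorem lqNorm_mono_set {F : Set ℝ} (hq : 0 ≤ q) (h : E ⊆ F) : lqNorm q E f ≤ lqNorm q F f :=
  ENNReal.rpow_le_rpow (lintegral_mono_set h) (by positivity)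

theorem lqNorm_rpow (hq : 0 < q) : lqNorm q E f ^ q = ∫⁻ t in E, f t ^ q := by
  rw [lqNorm, ← ENNReal.rpow_mul, one_div_mul_cancel hq.ne', ENNReal.rpow_one]

theorem lqNorm_le_of_rpow_le (hq : 0 < q) {M : ℝ≥0∞} (h : ∫⁻ t in E, f t ^ q ≤ M ^ q) :
    lqNorm q E f ≤ M := by
  rw [← ENNReal.rpow_le_rpow_iff hq, lqNorm_rpow hq]
  exact h

theorem lqNorm_const_mul (hq : 0 < q) {c : ℝ≥0∞} (hc : c ≠ ⊤) :
    lqNorm q E (fun t => c * f t) = c * lqNorm q E f := by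
  rw [lqNorm, lqNorm]
  simp_rw [ENNReal.mul_rpow_of_nonneg _ _ hq.le]
  rw [lintegral_const_mul' _ _ (ENNReal.rpow_ne_top_of_nonneg hq.le hc),
    ENNReal.mul_rpow_of_nonneg _ _ (by positivity), ← ENNReal.rpow_mul, mul_one_div_cancel hq.ne',
    ENNReal.rpow_one]

theorem lqNorm_add_le (hq : 1 ≤ q) (hf : AEMeasurable f (volume.restrict E))
    (hg : AEMeasurable g (volume.restrict E)) :
    lqNorm q E (fun t => f t + g t) ≤ lqNorm q E f + lqNorm q E g :=
  ENNReal.lintegral_Lp_add_le hf hg hq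

theorem lqNorm_sum_le (hq : 1 ≤ q) {f : ℕ → ℝ → ℝ≥0∞}
    (hf : ∀ j, AEMeasurable (f j) (volume.restrict E)) (J : ℕ) :
    lqNorm q E (fun t => ∑ j ∈ Finset.range J, f j t) ≤ ∑ j ∈ Finset.range J, lqNorm q E (f j) := by
  induction J with
  | zero => simp [lqNorm, ENNReal.zero_rpow_of_pos (one_pos.trans_le hq),
      ENNReal.zero_rpow_of_pos (inv_pos.2 (one_pos.trans_le hq))]
  | succ J ih =>
    simp_rw [Finset.sum_range_succ]
    refine (lqNorm_add_le hq ?_ (hf J)).trans (add_le_add ih le_rfl)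
    exact Finset.aemeasurable_fun_sum _ fun j _ => hf j

theorem lqNorm_tsum_le (hq : 1 ≤ q) {f : ℕ → ℝ → ℝ≥0∞}
    (hf : ∀ j, AEMeasurable (f j) (volume.restrict E)) :
    lqNorm q E (fun t => ∑' j, f j t) ≤ ∑' j, lqNorm q E (f j) := by
  have hq0 := one_pos.trans_le hq
  refine lqNorm_le_of_rpow_le hq0 ?_
  have e : ∀ t, (∑' j, f j t) ^ q = ⨆ J : ℕ, (∑ j ∈ Finset.range J, f j t) ^ q := by
    intro t
    rw [ENNReal.tsum_eq_iSup_nat]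
    exact (ENNReal.orderIsoRpow q hq0).map_iSup _
  simp_rw [e]
  rw [lintegral_iSup' (fun J => (Finset.aemeasurable_fun_sum _ fun j _ => hf j).pow_const _)]
  · refine iSup_le fun J => ?_
    rw [← lqNorm_rpow hq0]
    refine ENNReal.rpow_le_rpow ((lqNorm_sum_le hq hf J).trans (ENNReal.sum_le_tsum _)) hq0.le
  · refine Eventually.of_forall fun t => ?_
    intro i k hik
    refine ENNReal.rpow_le_rpow ?_ hq0.le
    exact Finset.sum_le_sum_of_subset (Finset.range_mono hik)

theorem lqNorm_mul_le (hq : 0 < q) (hf : AEMeasurable f (volume.restrict E))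
    (hg : AEMeasurable g (volume.restrict E)) :
    lqNorm q E (fun t => f t * g t) ≤ lqNorm (2 * q) E f * lqNorm (2 * q) E g := by
  refine lqNorm_le_of_rpow_le hq ?_
  simp_rw [ENNReal.mul_rpow_of_nonneg _ _ hq.le]
  refine (lintegral_mul_le_sqrt _ (hf.pow_const _) (hg.pow_const _)).trans (le_of_eq ?_)
  have e : ∀ x : ℝ≥0∞, (x ^ q) ^ 2 = x ^ (2 * q) := fun x => by
    rw [← ENNReal.rpow_two, ← ENNReal.rpow_mul, mul_comm]
  simp_rw [e]
  rw [lqNorm, lqNorm, ← ENNReal.rpow_mul, ← ENNReal.rpow_mul]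
  congr 2 <;> field_simp

/-- Interpolation between the integral and the supremum. -/
theorem lintegral_rpow_le_of_le {θ : ℝ} {M : ℝ≥0∞} (h0 : 0 ≤ θ) (h1 : θ ≤ 1) (hq : 1 - θ ≤ q)
    (hf : AEMeasurable f (volume.restrict E)) (hM : ∀ t, f t ≤ M) :
    ∫⁻ t in E, f t ^ q ≤ M ^ (q - 1 + θ) * (volume E ^ θ * (∫⁻ t in E, f t) ^ (1 - θ)) := by
  have h2 : ∫⁻ t in E, f t ^ (1 - θ) ≤ volume E ^ θ * (∫⁻ t in E, f t) ^ (1 - θ) := by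
    have := ENNReal.lintegral_mul_norm_pow_le (μ := volume.restrict E) (f := fun _ => 1) (g := f)
      aemeasurable_const hf h0 (sub_nonneg.2 h1) (by ring)
    simpa using this
  refine le_trans ?_ (mul_le_mul_right h2 _)
  rw [← lintegral_const_mul'' _ (hf.pow_const _)]
  refine lintegral_mono fun t => ?_
  have : q = (q - 1 + θ) + (1 - θ) := by ring
  nth_rewrite 1 [this]
  rw [ENNReal.rpow_add_of_nonneg _ _ (by linarith) (by linarith)]
  gcongr
  · linarith
  · exact hM t

end

/-- The norm of the profile of `evol α h` which corresponds to the `X^{w,b}` norm. -/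
def modNorm (b : ℝ) (w : ℕ → ℝ) (h : ℕ → ℝ → ℂ) : ℝ≥0∞ :=
  (∑' n, ENNReal.ofReal (w n ^ 2) * ∫⁻ ξ, ENNReal.ofReal (modWeight b ξ) * ‖h n ξ‖ₑ ^ 2) ^ (1 / 2 : ℝ)

theorem modNorm_sq (b : ℝ) (w : ℕ → ℝ) (h : ℕ → ℝ → ℂ) : modNorm b w h ^ 2 =
    ∑' n, ENNReal.ofReal (w n ^ 2) * ∫⁻ ξ, ENNReal.ofReal (modWeight b ξ) * ‖h n ξ‖ₑ ^ 2 :=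
  rpow_half_sq _

theorem lintegral_lt_top_of_modNorm {b : ℝ} (hw : IsWeight s C₀ w) {h : ℕ → ℝ → ℂ}
    (hK : modNorm b w h < ⊤) (n : ℕ) :
    ∫⁻ ξ, ENNReal.ofReal (modWeight b ξ) * ‖h n ξ‖ₑ ^ 2 < ⊤ := by
  have h1 : ∑' n, ENNReal.ofReal (w n ^ 2) * ∫⁻ ξ, ENNReal.ofReal (modWeight b ξ) * ‖h n ξ‖ₑ ^ 2 < ⊤ := by
    rw [← modNorm_sq]; exact ENNReal.pow_lt_top hK
  have h2 := (ENNReal.le_tsum n).trans_lt h1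
  refine ENNReal.lt_top_of_mul_ne_top_right h2.ne ?_
  have := hw.pos n
  simp only [ne_eq, ENNReal.ofReal_eq_zero, not_le]
  positivity

theorem wNorm_evol_sq_le (α b : ℝ) {h : ℕ → ℝ → ℂ} (hm : ∀ n, Measurable (h n)) (t : ℝ) :
    wNorm w (evol α h t) ^ 2 ≤ modConst b * modNorm b w h ^ 2 := by
  rw [wNorm_sq, modNorm_sq, ← ENNReal.tsum_mul_left]
  refine ENNReal.tsum_le_tsum fun n => ?_
  rw [mul_left_comm]
  gcongr
  exact enorm_evol_sq_le α b hm t n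

theorem wNorm_evol_le (α b : ℝ) {h : ℕ → ℝ → ℂ} (hm : ∀ n, Measurable (h n)) (t : ℝ) :
    wNorm w (evol α h t) ≤ modConst b ^ (1 / 2 : ℝ) * modNorm b w h := by
  rw [← sq_le_sq_enn, mul_pow, rpow_half_sq]
  exact wNorm_evol_sq_le α b hm t

section

variable {α b : ℝ} {h : ℕ → ℝ → ℂ}

theorem measurable_blockNorm_evol (hb : 1 / 2 < b) (hw : IsWeight s C₀ w)
    (hm : ∀ n, Measurable (h n)) (hK : modNorm b w h < ⊤) (j : ℕ) :
    Measurable fun t => blockNorm j (evol α h t) := by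
  have hu : ∀ n, Continuous fun t => evol α h t n := fun n =>
    continuous_evol α (integrable_of_modWeight hb (hm n) (lintegral_lt_top_of_modNorm hw hK n))
  unfold blockNorm blockSq
  refine Measurable.pow_const (Measurable.const_mul (Finset.measurable_fun_sum _ fun i _ => ?_) _) _
  have hj : Continuous (Function.uncurry fun t r : ℝ =>
      ∑ n ∈ block j, evol α h t n * mode j i n r) := by
    unfold Function.uncurry
    refine continuous_finsetSum _ fun n _ => ((hu n).comp continuous_fst).mul ?_
    fun_prop
  have := hj.enorm.measurable.pow_const 2
  exact this.lintegral_prod_right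

/-- The constant in `lqNorm_blockNorm_evol_le`. -/
def timeConst (C₀ b q θ ε : ℝ) : ℝ≥0∞ :=
  (ENNReal.ofReal (5 * modeConst / ε * C₀ ^ 4) * modConst b) ^ (q - 1 + θ) *
    (smoothConst b ε * ENNReal.ofReal (C₀ ^ 4)) ^ (1 - θ)

/-- The block norm, uniformly in time. -/
theorem blockSq_evol_le (hs : 0 ≤ s) (hw : IsWeight s C₀ w)
    (hm : ∀ n, Measurable (h n)) {ε : ℝ} (h0 : 0 < ε) (h1 : ε ≤ 1) (j : ℕ) (t : ℝ) :
    blockSq j (evol α h t) ≤ ENNReal.ofReal (5 * modeConst / ε * C₀ ^ 4) * modConst b *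
      ENNReal.ofReal (2 ^ ((2 + ε - 2 * s) * j)) * modNorm b w h ^ 2 := by
  have hC := modeConst_pos
  have hC0 := hw.one_le
  refine (blockSq_le h0 h1 j _).trans ?_
  calc _ ≤ ENNReal.ofReal (5 * modeConst / ε * 2 ^ (j * (2 + ε))) *
        ∑ n ∈ block j, modConst b * ∫⁻ ξ, ENNReal.ofReal (modWeight b ξ) * ‖h n ξ‖ₑ ^ 2 := by
        gcongr
        exact enorm_evol_sq_le α b hm t _
    _ ≤ ENNReal.ofReal (5 * modeConst / ε * 2 ^ (j * (2 + ε))) * (modConst b *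
        (ENNReal.ofReal (C₀ ^ 4 * 2 ^ (-(2 * s * j))) * modNorm b w h ^ 2)) := by
        rw [← Finset.mul_sum, modNorm_sq]
        gcongr
        exact hw.sum_block_le hs j _
    _ = _ := by
        have e : (2 : ℝ) ^ ((2 + ε - 2 * s) * j) = 2 ^ (j * (2 + ε)) * 2 ^ (-(2 * s * j)) := by
          rw [← Real.rpow_add (by norm_num)]; congr 1; ring
        rw [e, ENNReal.ofReal_mul (p := 5 * modeConst / ε) (by positivity),
          ENNReal.ofReal_mul (p := 5 * modeConst / ε) (by positivity),
          ENNReal.ofReal_mul (p := C₀ ^ 4) (by positivity), ENNReal.ofReal_mul (by positivity)]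
        ring

/-- Local smoothing for a profile of finite `X^{w,b}` norm. -/
theorem lintegral_blockSq_evol_le' (hα : 1 / 2 ≤ α) (hb : 1 / 2 < b) (hs : 0 ≤ s)
    (hw : IsWeight s C₀ w) (hm : ∀ n, Measurable (h n)) (hK : modNorm b w h < ⊤)
    {ε : ℝ} (h0 : 0 < ε) (h1 : ε ≤ 1) (j : ℕ) {E : Set ℝ} (hE : E ⊆ Icc (-1) 1) :
    ∫⁻ t in E, blockSq j (evol α h t) ≤ smoothConst b ε * ENNReal.ofReal (C₀ ^ 4) *
      ENNReal.ofReal (2 ^ ((1 + ε - 2 * s) * j)) * modNorm b w h ^ 2 := by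
  refine (lintegral_mono_set hE).trans ((lintegral_blockSq_evol_le hα hb h0 h1 hm j
    fun n _ => lintegral_lt_top_of_modNorm hw hK n).trans ?_)
  calc _ ≤ smoothConst b ε * ENNReal.ofReal (2 ^ (j * (1 + ε))) *
        (ENNReal.ofReal (C₀ ^ 4 * 2 ^ (-(2 * s * j))) * modNorm b w h ^ 2) := by
        rw [modNorm_sq]
        gcongr
        exact hw.sum_block_le hs j _
    _ = _ := by
        have e : (2 : ℝ) ^ ((1 + ε - 2 * s) * j) = 2 ^ (j * (1 + ε)) * 2 ^ (-(2 * s * j)) := by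
          rw [← Real.rpow_add (by norm_num)]; congr 1; ring
        rw [e, ENNReal.ofReal_mul (p := C₀ ^ 4) (by have := hw.one_le; positivity),
          ENNReal.ofReal_mul (by positivity)]
        ring

/-- Interpolation between the bound uniform in time and local smoothing in `L²` of time; what is not
needed for integrability gives a power of the measure of `E`. -/
theorem lqNorm_blockNorm_evol_le (hα : 1 / 2 ≤ α) (hb : 1 / 2 < b) (hs : 0 ≤ s)
    (hw : IsWeight s C₀ w) (hm : ∀ n, Measurable (h n)) (hK : modNorm b w h < ⊤) {q θ ε : ℝ}
    (hq : 1 ≤ q) (hθ0 : 0 ≤ θ) (hθ1 : θ ≤ 1) (h0 : 0 < ε) (h1 : ε ≤ 1) (j : ℕ) {E : Set ℝ}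
    (hE : E ⊆ Icc (-1) 1) :
    lqNorm (2 * q) E (fun t => blockNorm j (evol α h t)) ≤ timeConst C₀ b q θ ε ^ (1 / (2 * q)) *
      ENNReal.ofReal (2 ^ ((2 * q * (1 - s) - 1 + θ + ε * q) / (2 * q))) ^ j *
        (volume E ^ (θ / (2 * q)) * modNorm b w h) := by
  have hq0 : 0 < 2 * q := by linarith
  refine lqNorm_le_of_rpow_le hq0 ?_
  have e1 : ∀ t, blockNorm j (evol α h t) ^ (2 * q) = blockSq j (evol α h t) ^ q := fun t => by
    rw [ENNReal.rpow_mul, ENNReal.rpow_two, blockNorm_sq]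
  have hmeas : Measurable fun t => blockSq j (evol α h t) := by
    simp_rw [← blockNorm_sq]
    exact (measurable_blockNorm_evol hb hw hm hK j).pow_const 2
  simp_rw [e1]
  -- `q - 1 + θ` powers of the uniform bound, `1 - θ` powers of local smoothing, `θ` powers of the measure
  refine (lintegral_rpow_le_of_le hθ0 hθ1 (by linarith) hmeas.aemeasurable
    (fun t => blockSq_evol_le (b := b) hs hw hm h0 h1 j t)).trans ?_
  have h2 := lintegral_blockSq_evol_le' hα hb hs hw hm hK h0 h1 j hE
  refine (mul_le_mul_right (mul_le_mul_right (ENNReal.rpow_le_rpow h2 (sub_nonneg.2 hθ1)) _) _).trans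
    (le_of_eq ?_)
  have hx : 0 ≤ q - 1 + θ := by linarith
  have hy : 0 ≤ 1 - θ := by linarith
  set K := modNorm b w h
  set D₁ := ENNReal.ofReal (5 * modeConst / ε * C₀ ^ 4) * modConst b with hD₁
  set D₂ := smoothConst b ε * ENNReal.ofReal (C₀ ^ 4) with hD₂
  have eK : (K ^ 2) ^ (q - 1 + θ) * (K ^ 2) ^ (1 - θ) = K ^ (2 * q) := by
    rw [← ENNReal.rpow_add_of_nonneg _ _ hx hy, ← ENNReal.rpow_two, ← ENNReal.rpow_mul]
    congr 1; ring
  have e2 : ENNReal.ofReal (2 ^ ((2 + ε - 2 * s) * j)) ^ (q - 1 + θ) *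
      ENNReal.ofReal (2 ^ ((1 + ε - 2 * s) * j)) ^ (1 - θ) =
      (ENNReal.ofReal (2 ^ ((2 * q * (1 - s) - 1 + θ + ε * q) / (2 * q))) ^ j) ^ (2 * q) := by
    rw [ENNReal.ofReal_rpow_of_nonneg (by positivity) hx, ENNReal.ofReal_rpow_of_nonneg (by positivity) hy,
      ← ENNReal.ofReal_mul (by positivity), ← ENNReal.ofReal_pow (Real.rpow_nonneg zero_le_two _),
      ENNReal.ofReal_rpow_of_nonneg (by positivity) hq0.le, ← Real.rpow_natCast,
      ← Real.rpow_mul zero_le_two, ← Real.rpow_mul zero_le_two, ← Real.rpow_mul zero_le_two,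
      ← Real.rpow_mul zero_le_two, ← Real.rpow_add two_pos]
    congr 2
    field_simp
    ring
  rw [ENNReal.mul_rpow_of_nonneg _ _ hx, ENNReal.mul_rpow_of_nonneg _ _ hx,
    ENNReal.mul_rpow_of_nonneg _ _ hy, ENNReal.mul_rpow_of_nonneg _ _ hy,
    ENNReal.mul_rpow_of_nonneg _ _ hq0.le, ENNReal.mul_rpow_of_nonneg _ _ hq0.le,
    ENNReal.mul_rpow_of_nonneg _ _ hq0.le, ← e2, ← eK, ← ENNReal.rpow_mul, ← ENNReal.rpow_mul,
    one_div_mul_cancel hq0.ne', ENNReal.rpow_one, div_mul_cancel₀ _ hq0.ne', timeConst]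
  ring

/-- The constant in `lqNorm_supNorm_evol_le`. -/
def supConst (s C₀ b q θ ε : ℝ) : ℝ≥0∞ := timeConst C₀ b q θ ε ^ (1 / (2 * q)) *
  ∑' j : ℕ, ENNReal.ofReal (2 ^ ((2 * q * (1 - s) - 1 + θ + ε * q) / (2 * q))) ^ j

theorem supConst_lt_top (hb : 1 / 2 < b) {q θ ε : ℝ} (hq : 1 ≤ q) (hθ0 : 0 ≤ θ) (hθ1 : θ ≤ 1)
    (hε : 2 * q * (1 - s) - 1 + θ + ε * q < 0) : supConst s C₀ b q θ ε < ⊤ := by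
  refine ENNReal.mul_lt_top (ENNReal.rpow_lt_top_of_nonneg (by positivity) ?_) ?_
  · refine ENNReal.mul_ne_top (ENNReal.rpow_ne_top_of_nonneg (by linarith) ?_)
      (ENNReal.rpow_ne_top_of_nonneg (by linarith) ?_)
    · exact ENNReal.mul_ne_top ENNReal.ofReal_ne_top (modConst_lt_top hb).ne
    · exact ENNReal.mul_ne_top (smoothConst_lt_top hb ε).ne ENNReal.ofReal_ne_top
  · have h1 : (2 : ℝ) ^ ((2 * q * (1 - s) - 1 + θ + ε * q) / (2 * q)) < 1 :=
      Real.rpow_lt_one_of_one_lt_of_neg (by norm_num) (div_neg_of_neg_of_pos hε (by linarith))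
    have := summable_geometric_of_lt_one (by positivity) h1
    simp_rw [← ENNReal.ofReal_pow (Real.rpow_nonneg zero_le_two _)]
    rw [← ENNReal.ofReal_tsum_of_nonneg (fun j => by positivity) this]
    exact ENNReal.ofReal_lt_top

/-- The uniform norm in space is integrable in time, with a gain of a power of the length of the
time interval. -/
theorem lqNorm_supNorm_evol_le (hα : 1 / 2 ≤ α) (hb : 1 / 2 < b) (hs : 0 ≤ s)
    (hw : IsWeight s C₀ w) (hm : ∀ n, Measurable (h n)) (hK : modNorm b w h < ⊤) {q θ ε : ℝ}
    (hq : 1 ≤ q) (hθ0 : 0 ≤ θ) (hθ1 : θ ≤ 1) (h0 : 0 < ε) (h1 : ε ≤ 1) {E : Set ℝ}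
    (hE : E ⊆ Icc (-1) 1) :
    lqNorm (2 * q) E (fun t => supNorm (evol α h t)) ≤
      supConst s C₀ b q θ ε * (volume E ^ (θ / (2 * q)) * modNorm b w h) := by
  refine (lqNorm_tsum_le (by linarith)
    fun j => (measurable_blockNorm_evol hb hw hm hK j).aemeasurable).trans ?_
  rw [supConst, ← ENNReal.tsum_mul_left, ← ENNReal.tsum_mul_right]
  exact ENNReal.tsum_le_tsum fun j => lqNorm_blockNorm_evol_le hα hb hs hw hm hK hq hθ0 hθ1 h0 h1 j hE

/-- The constant in the time estimate of the nonlinearity. -/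
def nonlinConst (s C₀ b q θ ε : ℝ) : ℝ≥0∞ :=
  3 * (productConst C₀ * (modConst b ^ (1 / 2 : ℝ) * supConst s C₀ b q θ ε ^ 2))

theorem nonlinConst_lt_top (hb : 1 / 2 < b) {q θ ε : ℝ} (hq : 1 ≤ q) (hθ0 : 0 ≤ θ) (hθ1 : θ ≤ 1)
    (hε : 2 * q * (1 - s) - 1 + θ + ε * q < 0) : nonlinConst s C₀ b q θ ε < ⊤ :=
  ENNReal.mul_lt_top (by simp) (ENNReal.mul_lt_top (productConst_lt_top _)
    (ENNReal.mul_lt_top (ENNReal.rpow_lt_top_of_nonneg (by norm_num) (modConst_lt_top hb).ne)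
      (ENNReal.pow_lt_top (supConst_lt_top hb hq hθ0 hθ1 hε))))

theorem measurable_supNorm_evol (hb : 1 / 2 < b) (hw : IsWeight s C₀ w)
    (hm : ∀ n, Measurable (h n)) (hK : modNorm b w h < ⊤) :
    Measurable fun t => supNorm (evol α h t) :=
  Measurable.tsum fun j => measurable_blockNorm_evol hb hw hm hK j

/-- The nonlinear estimate: the trilinear form maps `X^{w,b}` into `L^q` in time of the weighted space,
with a gain for short sets of times. -/
theorem lqNorm_tri_evol_le (hα : 1 / 2 ≤ α) (hb : 1 / 2 < b) (hs : 1 / 2 ≤ s)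
    (hw : IsWeight s C₀ w) {h k l : ℕ → ℝ → ℂ} (hm : ∀ n, Measurable (h n))
    (km : ∀ n, Measurable (k n)) (lm : ∀ n, Measurable (l n)) (hK : modNorm b w h < ⊤)
    (kK : modNorm b w k < ⊤) (lK : modNorm b w l < ⊤) {q θ ε : ℝ}
    (hq : 1 ≤ q) (hθ0 : 0 ≤ θ) (hθ1 : θ ≤ 1) (h0 : 0 < ε) (h1 : ε ≤ 1) {E : Set ℝ}
    (hE : E ⊆ Icc (-1) 1) :
    lqNorm q E (fun t => wNorm w (tri (evol α h t) (evol α k t) (evol α l t))) ≤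
      nonlinConst s C₀ b q θ ε * (volume E ^ (θ / q) * (modNorm b w h * modNorm b w k * modNorm b w l)) := by
  have hmc : modConst b ^ (1 / 2 : ℝ) < ⊤ :=
    ENNReal.rpow_lt_top_of_nonneg (by norm_num) (modConst_lt_top hb).ne
  have hfin : ∀ {h : ℕ → ℝ → ℂ}, (∀ n, Measurable (h n)) → modNorm b w h < ⊤ → ∀ t,
      wNorm w (evol α h t) < ⊤ := fun hm hK t =>
    (wNorm_evol_le α b hm t).trans_lt (ENNReal.mul_lt_top hmc hK)
  have mA : ∀ {h : ℕ → ℝ → ℂ}, (∀ n, Measurable (h n)) → modNorm b w h < ⊤ →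
      Measurable fun t => supNorm (evol α h t) := fun hm hK => measurable_supNorm_evol hb hw hm hK
  have two : ∀ {h k : ℕ → ℝ → ℂ}, (∀ n, Measurable (h n)) → modNorm b w h < ⊤ →
      (∀ n, Measurable (k n)) → modNorm b w k < ⊤ → ∀ L : ℝ≥0∞, L < ⊤ →
      lqNorm q E (fun t => modConst b ^ (1 / 2 : ℝ) * L * (supNorm (evol α h t) * supNorm (evol α k t))) ≤
      modConst b ^ (1 / 2 : ℝ) * supConst s C₀ b q θ ε ^ 2 *
        (volume E ^ (θ / q) * (modNorm b w h * modNorm b w k * L)) := by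
    intro h k hm hK km kK L hL
    rw [lqNorm_const_mul (by linarith) (ENNReal.mul_lt_top hmc hL).ne]
    have e : volume E ^ (θ / q) = volume E ^ (θ / (2 * q)) * volume E ^ (θ / (2 * q)) := by
      rw [← ENNReal.rpow_add_of_nonneg _ _ (by positivity) (by positivity)]
      congr 1
      field_simp
      ring
    calc _ ≤ modConst b ^ (1 / 2 : ℝ) * L *
          ((supConst s C₀ b q θ ε * (volume E ^ (θ / (2 * q)) * modNorm b w h)) *
          (supConst s C₀ b q θ ε * (volume E ^ (θ / (2 * q)) * modNorm b w k))) := by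
          gcongr
          refine (lqNorm_mul_le (by linarith) (mA hm hK).aemeasurable (mA km kK).aemeasurable).trans ?_
          gcongr
          · exact lqNorm_supNorm_evol_le hα hb (by linarith) hw hm hK hq hθ0 hθ1 h0 h1 hE
          · exact lqNorm_supNorm_evol_le hα hb (by linarith) hw km kK hq hθ0 hθ1 h0 h1 hE
      _ = _ := by rw [e]; ring
  have hpt : ∀ t, wNorm w (tri (evol α h t) (evol α k t) (evol α l t)) ≤ productConst C₀ *
      (modConst b ^ (1 / 2 : ℝ) * modNorm b w h * (supNorm (evol α k t) * supNorm (evol α l t)) +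
        modConst b ^ (1 / 2 : ℝ) * modNorm b w k * (supNorm (evol α h t) * supNorm (evol α l t)) +
        modConst b ^ (1 / 2 : ℝ) * modNorm b w l * (supNorm (evol α h t) * supNorm (evol α k t))) := by
    intro t
    refine (wNorm_tri_le hs hw (hfin hm hK t) (hfin km kK t) (hfin lm lK t)).trans ?_
    rw [mul_comm _ (wNorm w (evol α h t)), mul_comm _ (wNorm w (evol α k t)),
      mul_comm _ (wNorm w (evol α l t))]
    gcongr
    exacts [wNorm_evol_le α b hm t, wNorm_evol_le α b km t, wNorm_evol_le α b lm t]
  have m1 := (mA km kK).mul (mA lm lK)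
  have m2 := (mA hm hK).mul (mA lm lK)
  have m3 := (mA hm hK).mul (mA km kK)
  refine (lqNorm_mono (by linarith) hpt).trans ?_
  rw [lqNorm_const_mul (by linarith) (productConst_lt_top _).ne, nonlinConst]
  have step := (lqNorm_add_le (E := E) hq (((m1.const_mul (modConst b ^ (1 / 2 : ℝ) * modNorm b w h)).add
    (m2.const_mul (modConst b ^ (1 / 2 : ℝ) * modNorm b w k))).aemeasurable)
    (m3.const_mul (modConst b ^ (1 / 2 : ℝ) * modNorm b w l)).aemeasurable).trans
    (add_le_add_left (lqNorm_add_le (E := E) hq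
      (m1.const_mul (modConst b ^ (1 / 2 : ℝ) * modNorm b w h)).aemeasurable
      (m2.const_mul (modConst b ^ (1 / 2 : ℝ) * modNorm b w k)).aemeasurable) _)
  refine (mul_le_mul_right (step.trans (add_le_add (add_le_add (two km kK lm lK _ hK)
    (two hm hK lm lK _ kK)) (two hm hK km kK _ lK))) _).trans (le_of_eq ?_)
  ring

end

/-! ### The Fourier transform of square integrable functions -/

theorem continuous_fourier_of_integrable {f : ℝ → ℂ} (hf : Integrable f) : Continuous (𝓕 f) :=
  VectorFourier.fourierIntegral_continuous Real.continuous_fourierChar (by fun_prop) hf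

/-- On `L¹ ∩ L²` the Fourier transform of `L²` is given by the Fourier integral. -/
theorem fourier_toLp_ae {f : ℝ → ℂ} (h2 : MemLp f 2) (h1 : Integrable f) :
    (𝓕 (h2.toLp f) : Lp ℂ 2 (volume : Measure ℝ)) =ᵐ[volume] 𝓕 f := by
  refine ae_eq_of_integral_contDiff_smul_eq
    ((Lp.memLp _).locallyIntegrable one_le_two)
    (continuous_fourier_of_integrable h1).locallyIntegrable ?_
  intro g g_smooth g_cpt
  have hg₁ : HasCompactSupport (Complex.ofRealCLM ∘ g) := g_cpt.comp_left rfl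
  have hg₂ : ContDiff ℝ ∞ (Complex.ofRealCLM ∘ g) := by fun_prop
  set G := hg₁.toSchwartzMap hg₂ with hG
  have e1 := congrArg (fun T => T G) (Lp.fourier_toTemperedDistribution_eq (h2.toLp f))
  simp only [TemperedDistribution.fourier_apply, Lp.toTemperedDistribution_apply] at e1
  have e2 : ∫ x, (𝓕 G) x • (h2.toLp f) x = ∫ x, (𝓕 G) x • f x := by
    refine integral_congr_ae ?_
    filter_upwards [h2.coeFn_toLp] with x hx
    rw [hx]
  have e3 : ∫ x, (𝓕 G) x • f x = ∫ x, G x • 𝓕 f x := by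
    have := VectorFourier.integral_fourierIntegral_smul_eq_flip (μ := volume) (ν := volume)
      (L := innerₗ ℝ) Real.continuous_fourierChar (by fun_prop) (f := (G : ℝ → ℂ)) (g := f)
      G.integrable h1
    rw [SchwartzMap.fourier_coe]
    refine this.trans ?_
    rw [flip_innerₗ]
    rfl
  have e4 : ∀ x, G x = ((g x : ℝ) : ℂ) := fun x => by simp [hG]
  rw [e2, e3] at e1
  simp only [e4, Complex.coe_smul] at e1
  exact e1.symm

theorem fourierInv_toLp_ae {f : ℝ → ℂ} (h2 : MemLp f 2) (h1 : Integrable f) :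
    (𝓕⁻ (h2.toLp f) : Lp ℂ 2 (volume : Measure ℝ)) =ᵐ[volume] 𝓕⁻ f := by
  have hneg : MeasurePreserving (fun x : ℝ => -x) volume volume := Measure.measurePreserving_neg _
  have hc : Continuous (𝓕⁻ f) := by
    have : 𝓕⁻ f = fun x => 𝓕 f (-x) := funext fun x => Real.fourierInv_eq_fourier_neg f x
    rw [this]
    exact (continuous_fourier_of_integrable h1).comp continuous_neg
  refine ae_eq_of_integral_contDiff_smul_eq
    ((Lp.memLp _).locallyIntegrable one_le_two) hc.locallyIntegrable ?_
  intro g g_smooth g_cpt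
  have hg₁ : HasCompactSupport (Complex.ofRealCLM ∘ g) := g_cpt.comp_left rfl
  have hg₂ : ContDiff ℝ ∞ (Complex.ofRealCLM ∘ g) := by fun_prop
  set G := hg₁.toSchwartzMap hg₂ with hG
  have e1 := congrArg (fun T => T G) (Lp.fourierInv_toTemperedDistribution_eq (h2.toLp f))
  simp only [TemperedDistribution.fourierInv_apply, Lp.toTemperedDistribution_apply] at e1
  have e2 : ∫ x, (𝓕⁻ G) x • (h2.toLp f) x = ∫ x, (𝓕⁻ G) x • f x := by
    refine integral_congr_ae ?_
    filter_upwards [h2.coeFn_toLp] with x hx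
    rw [hx]
  have e3 : ∫ x, (𝓕⁻ G) x • f x = ∫ x, G x • 𝓕⁻ f x := by
    have := VectorFourier.integral_fourierIntegral_smul_eq_flip (μ := volume) (ν := volume)
      (L := -innerₗ ℝ) Real.continuous_fourierChar (by fun_prop) (f := (G : ℝ → ℂ)) (g := f)
      G.integrable h1
    rw [SchwartzMap.fourierInv_coe]
    refine Eq.trans ?_ (this.trans ?_)
    · rfl
    · congr 1
      ext x
      simp only [VectorFourier.fourierIntegral, Real.fourierInv_eq]
      congr 2
      ext y
      simp [mul_comm]
  have e4 : ∀ x, G x = ((g x : ℝ) : ℂ) := fun x => by simp [hG]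
  rw [e2, e3] at e1
  simp only [e4, Complex.coe_smul] at e1
  exact e1.symm

theorem lintegral_enorm_sq_Lp (F : Lp ℂ 2 (volume : Measure ℝ)) :
    ∫⁻ x, ‖F x‖ₑ ^ 2 = ‖F‖ₑ ^ 2 := by
  have := eLpNorm_nnreal_pow_eq_lintegral (f := F) (μ := volume) (p := 2) two_ne_zero
  rw [Lp.enorm_def]
  simpa using this.symm

/-- Plancherel's theorem for integrable functions. -/
theorem lintegral_fourier_sq_le {f : ℝ → ℂ} (h1 : Integrable f) :
    ∫⁻ ξ, ‖𝓕 f ξ‖ₑ ^ 2 ≤ ∫⁻ t, ‖f t‖ₑ ^ 2 := by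
  have e : eLpNorm f 2 volume ^ 2 = ∫⁻ t, ‖f t‖ₑ ^ 2 := by
    have := eLpNorm_nnreal_pow_eq_lintegral (f := f) (μ := volume) (p := 2) two_ne_zero
    simpa using this
  rcases eq_or_ne (∫⁻ t, ‖f t‖ₑ ^ 2) ⊤ with h | h
  · rw [h]; exact le_top
  · have h2 : MemLp f 2 := by
      refine ⟨h1.1, lt_top_iff_ne_top.2 fun h3 => h ?_⟩
      rw [← e, h3]; simp
    have h4 : ∫⁻ ξ, ‖𝓕 f ξ‖ₑ ^ 2 = ∫⁻ ξ, ‖(𝓕 (h2.toLp f) : Lp ℂ 2 (volume : Measure ℝ)) ξ‖ₑ ^ 2 := by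
      refine lintegral_congr_ae ?_
      filter_upwards [fourier_toLp_ae h2 h1] with ξ hξ
      rw [hξ]
    rw [h4, lintegral_enorm_sq_Lp, ← e, ← Lp.enorm_toLp h2, ← ofReal_norm, ← ofReal_norm,
      Lp.norm_fourier_eq]

/-! ### The restriction norms in terms of profiles -/

theorem fourier_modulate (l : ℝ) (f : ℝ → ℂ) (ξ : ℝ) :
    𝓕 (fun t : ℝ => Complex.exp (-(Complex.I * l * t)) * f t) ξ = 𝓕 f (ξ + l / (2 * Real.pi)) := by
  rw [Real.fourier_real_eq_integral_exp_smul, Real.fourier_real_eq_integral_exp_smul]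
  congr 1
  ext t
  rw [smul_eq_mul, smul_eq_mul, ← mul_assoc, ← Complex.exp_add]
  congr 2
  have := Complex.ofReal_ne_zero.2 Real.pi_ne_zero
  push_cast
  field_simp
  ring

/-- Undoing the free flow turns the `X^{σ,b}` norm into a weighted norm of the Fourier transform. -/
theorem xsbNorm_eq_modNorm (α σ b : ℝ) {f : ℕ → ℝ → ℂ} (h2 : ∀ n, MemLp (f n) 2)
    (h1 : ∀ n, Integrable (f n)) :
    xsbNorm α σ b (fun t n => Complex.exp (-(Complex.I * freq α n * t)) * f n t) =
      modNorm b (fun n => bracket (besselZero n) ^ σ) (fun n => 𝓕 (f n)) := by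
  have hexp : ∀ n, Continuous fun t : ℝ => Complex.exp (-(Complex.I * freq α n * t)) := fun n => by
    fun_prop
  have hn : ∀ (n : ℕ) (t : ℝ), ‖Complex.exp (-(Complex.I * freq α n * t)) * f n t‖ = ‖f n t‖ := by
    intro n t
    rw [norm_mul, Complex.norm_exp]; simp
  have H2 : ∀ n, MemLp (fun t : ℝ => Complex.exp (-(Complex.I * freq α n * t)) * f n t) 2 := fun n =>
    (h2 n).congr_norm ((hexp n).aestronglyMeasurable.mul (h2 n).1)
      (Eventually.of_forall fun t => (hn n t).symm)
  have H1 : ∀ n, Integrable (fun t : ℝ => Complex.exp (-(Complex.I * freq α n * t)) * f n t) := fun n =>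
    (h1 n).congr' ((hexp n).aestronglyMeasurable.mul (h1 n).1)
      (Eventually.of_forall fun t => (hn n t).symm)
  rw [xsbNorm, dif_pos H2, modNorm]
  congr 1
  refine tsum_congr fun n => ?_
  rw [← lintegral_const_mul' _ _ ENNReal.ofReal_ne_top, ← lintegral_add_right_eq_self
    (fun ξ => ENNReal.ofReal ((bracket (besselZero n) ^ σ) ^ 2) *
      (ENNReal.ofReal (modWeight b ξ) * ‖𝓕 (f n) ξ‖ₑ ^ 2)) (freq α n / (2 * Real.pi))]
  refine lintegral_congr_ae ?_
  filter_upwards [fourier_toLp_ae (H2 n) (H1 n)] with ξ hξ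
  rw [hξ, fourier_modulate, ← mul_assoc, ← ENNReal.ofReal_mul (by have := bracket_pos (besselZero n); positivity)]
  congr 2
  rw [mul_comm, ← Real.rpow_mul_natCast (bracket_pos _).le, modWeight]
  congr 2
  · ring
  · rw [freq]
    have := Real.pi_ne_zero
    field_simp

/-- Functions in `X^{σ,b}`, `b > 1/2`, are superpositions of modulated linear solutions. -/
theorem exists_evol_of_xsbNorm {α σ b : ℝ} (hb : 1 / 2 < b) {V : ℝ → ℕ → ℂ}
    (hV : xsbNorm α σ b V < ⊤) : ∃ h : ℕ → ℝ → ℂ, (∀ n, Measurable (h n)) ∧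
      modNorm b (fun n => bracket (besselZero n) ^ σ) h = xsbNorm α σ b V ∧
      ∀ n, ∀ᵐ t, V t n = evol α h t n := by
  have hM : ∀ n, MemLp (fun t => V t n) 2 (volume : Measure ℝ) := by
    by_contra hc
    rw [xsbNorm, dif_neg hc] at hV
    exact lt_irrefl _ hV
  set F : ℕ → Lp ℂ 2 (volume : Measure ℝ) := fun n => 𝓕 ((hM n).toLp (fun t => V t n)) with hF
  set h : ℕ → ℝ → ℂ := fun n ξ => F n (ξ - freq α n / (2 * Real.pi)) with hh
  have hm : ∀ n, Measurable (h n) := fun n =>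
    (Lp.stronglyMeasurable (F n)).measurable.comp (measurable_id.sub_const _)
  have hnorm : modNorm b (fun n => bracket (besselZero n) ^ σ) h = xsbNorm α σ b V := by
    rw [xsbNorm, dif_pos hM, modNorm]
    congr 1
    refine tsum_congr fun n => ?_
    rw [← lintegral_const_mul' _ _ ENNReal.ofReal_ne_top, ← lintegral_sub_right_eq_self
      (fun ξ => ENNReal.ofReal (bracket (2 * Real.pi * ξ + besselZero n ^ (2 * α)) ^ (2 * b) *
          bracket (besselZero n) ^ (2 * σ)) * ‖F n ξ‖ₑ ^ 2) (freq α n / (2 * Real.pi))]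
    refine lintegral_congr fun ξ => ?_
    rw [hh, ← mul_assoc, ← ENNReal.ofReal_mul (by have := bracket_pos (besselZero n); positivity)]
    congr 2
    rw [mul_comm, ← Real.rpow_mul_natCast (bracket_pos _).le, modWeight]
    congr 2
    · rw [freq]
      have := Real.pi_ne_zero
      field_simp
      ring_nf
    · push_cast; ring
  refine ⟨h, hm, hnorm, fun n => ?_⟩
  have hfin : ∫⁻ ξ, ENNReal.ofReal (modWeight b ξ) * ‖h n ξ‖ₑ ^ 2 < ⊤ := by
    rw [← hnorm] at hV
    have h1 : ∑' n, ENNReal.ofReal ((bracket (besselZero n) ^ σ) ^ 2) *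
        ∫⁻ ξ, ENNReal.ofReal (modWeight b ξ) * ‖h n ξ‖ₑ ^ 2 < ⊤ := by
      rw [← modNorm_sq (w := fun n => bracket (besselZero n) ^ σ)]; exact ENNReal.pow_lt_top hV
    have h2 := (ENNReal.le_tsum n).trans_lt h1
    refine ENNReal.lt_top_of_mul_ne_top_right h2.ne ?_
    have := bracket_pos (besselZero n)
    simp only [ne_eq, ENNReal.ofReal_eq_zero, not_le]
    positivity
  have hi : Integrable (h n) := integrable_of_modWeight hb (hm n) hfin
  have hFi : Integrable (F n) := by
    have := hi.comp_add_right (freq α n / (2 * Real.pi))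
    refine this.congr (Eventually.of_forall fun ξ => ?_)
    simp [hh]
  have h3 := fourierInv_toLp_ae (Lp.memLp (F n)) hFi
  rw [Lp.toLp_coeFn] at h3
  have h4 : 𝓕⁻ (F n) = (hM n).toLp (fun t => V t n) := FourierTransform.fourierInv_fourier_eq _
  rw [h4] at h3
  filter_upwards [h3, (hM n).coeFn_toLp] with t ht1 ht2
  rw [← ht2, ht1, Real.fourierInv_eq', evol, ← integral_const_mul,
    ← integral_add_right_eq_self (fun ξ : ℝ => Complex.exp (-(Complex.I * freq α n * t)) *
      (Complex.exp (2 * Real.pi * Complex.I * t * ξ) * h n ξ)) (freq α n / (2 * Real.pi))]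
  congr 1
  ext ξ
  rw [hh, smul_eq_mul, ← mul_assoc, ← Complex.exp_add]
  simp only [add_sub_cancel_right]
  congr 2
  have := Complex.ofReal_ne_zero.2 Real.pi_ne_zero
  simp
  field_simp
  ring

/-! ### Estimates for forced linear equations -/

theorem lintegral_le_lqNorm {q : ℝ} (hq : 1 ≤ q) {E : Set ℝ} (hE : volume E ≤ 1) {f : ℝ → ℝ≥0∞}
    (hf : AEMeasurable f (volume.restrict E)) : ∫⁻ t in E, f t ≤ lqNorm q E f := by
  have hq0 := one_pos.trans_le hq
  have h := ENNReal.lintegral_mul_norm_pow_le (μ := volume.restrict E) (f := fun _ => 1)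
    (g := fun t => f t ^ q) (p := 1 - 1 / q) (q := 1 / q) aemeasurable_const (hf.pow_const q)
    (by rw [sub_nonneg, div_le_one hq0]; exact hq) (by positivity) (by ring)
  have e : ∀ t, (f t ^ q) ^ (1 / q) = f t := fun t => by
    rw [← ENNReal.rpow_mul, mul_one_div_cancel hq0.ne', ENNReal.rpow_one]
  simp only [ENNReal.one_rpow, one_mul, e, lintegral_const, Measure.restrict_apply_univ] at h
  refine h.trans (mul_le_of_le_one_left zero_le ?_)
  exact ENNReal.rpow_le_one hE (by rw [sub_nonneg, div_le_one hq0]; exact hq)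

theorem fourier_add' {f g : ℝ → ℂ} (hf : Integrable f) (hg : Integrable g) (ξ : ℝ) :
    𝓕 (fun t => f t + g t) ξ = 𝓕 f ξ + 𝓕 g ξ := by
  simp only [Real.fourier_eq]
  rw [← integral_add]
  · simp only [smul_add]
  · exact (Real.fourierIntegral_convergent_iff ξ).2 hf
  · exact (Real.fourierIntegral_convergent_iff ξ).2 hg

section

variable {G : ℝ → ℕ → ℂ} {q : ℝ}

/-- Plancherel's theorem for the small values of `G`, the trivial bound for the large ones. -/
theorem lintegral_Icc_sum_fourier_le (hq1 : 1 ≤ q) (hq2 : q ≤ 2) (hm : ∀ n, Measurable fun t => G t n)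
    (hi : ∀ n, Integrable fun t => G t n) {T : ℝ} (hT : 0 < T) {M : ℝ≥0∞}
    (hM : ∫⁻ t, wNorm w (G t) ^ q ≤ M ^ q) :
    ∫⁻ ξ in Icc (-T) T, ∑' n, ENNReal.ofReal (w n ^ 2) * ‖𝓕 (fun t => G t n) ξ‖ₑ ^ 2 ≤
      6 * ENNReal.ofReal (T ^ (2 / q - 1)) * M ^ 2 := by
  have hq0 := one_pos.trans_le hq1
  rcases eq_or_ne M ⊤ with hMt | hMt
  · rw [hMt, ENNReal.top_pow two_ne_zero, ENNReal.mul_top]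
    · exact le_top
    · have : (0 : ℝ) < T ^ (2 / q - 1) := by positivity
      simp [this]
  have hNm : Measurable fun t => wNorm w (G t) := by
    simp_rw [wNorm_eq]
    exact (Measurable.tsum fun n => (((hm n).enorm.pow_const 2).const_mul _)).pow_const _
  set L : ℝ≥0∞ := ENNReal.ofReal (T ^ (1 / q)) * M with hL
  have hT0 : (0 : ℝ) < T ^ (1 / q) := by positivity
  -- the part of `G` below the level `L = T^{1/q} M` is treated by Plancherel, the part above by the
  -- uniform bound of the Fourier transform; at this level both contribute equally
  set A : Set ℝ := {t | wNorm w (G t) ≤ L} with hA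
  have hAm : MeasurableSet A := measurableSet_le hNm measurable_const
  set Gl : ℝ → ℕ → ℂ := fun t n => A.indicator (fun t => G t n) t with hGl
  set Gh : ℝ → ℕ → ℂ := fun t n => Aᶜ.indicator (fun t => G t n) t with hGh
  have il : ∀ n, Integrable fun t => Gl t n := fun n => (hi n).indicator hAm
  have ih : ∀ n, Integrable fun t => Gh t n := fun n => (hi n).indicator hAm.compl
  have hsplit : ∀ n ξ, 𝓕 (fun t => G t n) ξ = 𝓕 (fun t => Gl t n) ξ + 𝓕 (fun t => Gh t n) ξ := by
    intro n ξ
    rw [← fourier_add' (il n) (ih n)]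
    have : (fun t => G t n) = fun t => Gl t n + Gh t n :=
      funext fun t => (Set.indicator_self_add_compl_apply A (fun t => G t n) t).symm
    rw [this]
  have hwl : ∀ t, wNorm w (Gl t) = A.indicator (fun t => wNorm w (G t)) t := by
    intro t
    by_cases ht : t ∈ A
    · simp only [hGl, indicator_of_mem ht]
    · simp only [hGl, indicator_of_notMem ht]
      exact wNorm_zero w
  have hwh : ∀ t, wNorm w (Gh t) = Aᶜ.indicator (fun t => wNorm w (G t)) t := by
    intro t
    by_cases ht : t ∈ Aᶜ
    · simp only [hGh, indicator_of_mem ht]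
    · simp only [hGh, indicator_of_notMem ht]
      exact wNorm_zero w
  have low : ∫⁻ ξ, ∑' n, ENNReal.ofReal (w n ^ 2) * ‖𝓕 (fun t => Gl t n) ξ‖ₑ ^ 2 ≤
      ENNReal.ofReal (T ^ (2 / q - 1)) * M ^ 2 := by
    have hmF : ∀ n, Measurable fun ξ => ‖𝓕 (fun t => Gl t n) ξ‖ₑ ^ 2 := fun n =>
      (continuous_fourier_of_integrable (il n)).enorm.measurable.pow_const 2
    calc _ = ∑' n, ENNReal.ofReal (w n ^ 2) * ∫⁻ ξ, ‖𝓕 (fun t => Gl t n) ξ‖ₑ ^ 2 := by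
          rw [lintegral_tsum fun n => ((hmF n).const_mul _).aemeasurable]
          exact tsum_congr fun n => lintegral_const_mul _ (hmF n)
      _ ≤ ∑' n, ENNReal.ofReal (w n ^ 2) * ∫⁻ t, ‖Gl t n‖ₑ ^ 2 := by
          refine ENNReal.tsum_le_tsum fun n => ?_
          exact mul_le_mul_right (lintegral_fourier_sq_le (il n)) _
      _ = ∫⁻ t, wNorm w (Gl t) ^ 2 := by
          have hmG : ∀ n, Measurable fun t => ‖Gl t n‖ₑ ^ 2 := fun n =>
            (((hm n).indicator hAm).enorm).pow_const 2
          simp_rw [wNorm_sq]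
          rw [lintegral_tsum fun n => ((hmG n).const_mul _).aemeasurable]
          exact tsum_congr fun n => (lintegral_const_mul _ (hmG n)).symm
      _ ≤ ∫⁻ t, L ^ (2 - q) * wNorm w (G t) ^ q := by
          refine lintegral_mono fun t => ?_
          rw [hwl]
          by_cases ht : t ∈ A
          · rw [indicator_of_mem ht, ← ENNReal.rpow_two]
            have e : (2 : ℝ) = (2 - q) + q := by ring
            nth_rewrite 1 [e]
            rw [ENNReal.rpow_add_of_nonneg _ _ (by linarith) hq0.le]
            exact mul_le_mul_left (ENNReal.rpow_le_rpow ht (by linarith)) _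
          · rw [indicator_of_notMem ht]; simp
      _ ≤ L ^ (2 - q) * M ^ q := by
          rw [lintegral_const_mul _ (hNm.pow_const q)]
          gcongr
      _ = _ := by
          have h2q : 0 ≤ 2 - q := by linarith
          rw [hL, ENNReal.mul_rpow_of_nonneg _ _ h2q, mul_assoc,
            ← ENNReal.rpow_add_of_nonneg _ _ h2q hq0.le, ENNReal.ofReal_rpow_of_nonneg hT0.le h2q,
            ← Real.rpow_mul hT.le, sub_add_cancel, ENNReal.rpow_two]
          congr 3
          field_simp
  have high : ∀ ξ, ∑' n, ENNReal.ofReal (w n ^ 2) * ‖𝓕 (fun t => Gh t n) ξ‖ₑ ^ 2 ≤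
      ENNReal.ofReal (T ^ (2 / q - 2)) * M ^ 2 := by
    intro ξ
    have h1 : wNorm w (fun n => 𝓕 (fun t => Gh t n) ξ) ≤ ∫⁻ t, wNorm w (Gh t) := by
      simp only [Real.fourier_real_eq_integral_exp_smul]
      refine (wNorm_integral_le fun n => ?_).trans (le_of_eq (lintegral_congr fun t => ?_))
      · exact (by fun_prop : Continuous fun v : ℝ =>
          Complex.exp (↑(-2 * Real.pi * v * ξ) * Complex.I)).aestronglyMeasurable.smul (ih n).1
      · refine wNorm_congr_norm fun n => ?_
        rw [norm_smul, Complex.norm_exp]; simp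
    have h2 : ∫⁻ t, wNorm w (Gh t) ≤ ENNReal.ofReal (T ^ (1 / q - 1)) * M := by
      calc ∫⁻ t, wNorm w (Gh t) ≤ ∫⁻ t, L ^ (1 - q) * wNorm w (G t) ^ q := by
            refine lintegral_mono fun t => ?_
            rw [hwh]
            by_cases ht : t ∈ Aᶜ
            · rw [indicator_of_mem ht]
              have ht' : L < wNorm w (G t) := not_le.1 ht
              rcases eq_or_ne (wNorm w (G t)) ⊤ with h | h
              · rw [h, ENNReal.top_rpow_of_pos hq0, ENNReal.mul_top]
                rw [Ne, ENNReal.rpow_eq_zero_iff]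
                rintro (⟨h3, h4⟩ | ⟨h3, -⟩)
                · linarith
                · exact ENNReal.mul_ne_top ENNReal.ofReal_ne_top hMt h3
              · have h0 : wNorm w (G t) ≠ 0 := (zero_le.trans_lt ht').ne'
                calc wNorm w (G t) = wNorm w (G t) ^ (1 - q) * wNorm w (G t) ^ q := by
                      rw [← ENNReal.rpow_add _ _ h0 h, sub_add_cancel, ENNReal.rpow_one]
                  _ ≤ _ := by
                      refine mul_le_mul_left ?_ _
                      rw [show 1 - q = -(q - 1) by ring, ENNReal.rpow_neg, ENNReal.rpow_neg]
                      exact ENNReal.inv_le_inv.2 (ENNReal.rpow_le_rpow ht'.le (by linarith))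
            · rw [indicator_of_notMem ht]; exact zero_le
        _ ≤ L ^ (1 - q) * M ^ q := by
            rw [lintegral_const_mul _ (hNm.pow_const q)]
            gcongr
        _ = _ := by
            rcases eq_or_ne M 0 with h0 | h0
            · rw [h0, ENNReal.zero_rpow_of_pos hq0, mul_zero, mul_zero]
            · rw [hL, ENNReal.mul_rpow_of_ne_top ENNReal.ofReal_ne_top hMt, mul_assoc,
                ← ENNReal.rpow_add _ _ h0 hMt, sub_add_cancel, ENNReal.rpow_one,
                ENNReal.ofReal_rpow_of_pos hT0, ← Real.rpow_mul hT.le]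
              congr 3
              field_simp
    have h3 := pow_le_pow_left' (h1.trans h2) 2
    rw [wNorm_sq, mul_pow, ← ENNReal.ofReal_pow (by positivity), ← Real.rpow_mul_natCast hT.le] at h3
    refine h3.trans (le_of_eq ?_)
    congr 3
    push_cast
    ring
  calc ∫⁻ ξ in Icc (-T) T, ∑' n, ENNReal.ofReal (w n ^ 2) * ‖𝓕 (fun t => G t n) ξ‖ₑ ^ 2
      ≤ ∫⁻ ξ in Icc (-T) T, 2 * ((∑' n, ENNReal.ofReal (w n ^ 2) * ‖𝓕 (fun t => Gl t n) ξ‖ₑ ^ 2) +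
          ENNReal.ofReal (T ^ (2 / q - 2)) * M ^ 2) := by
        refine lintegral_mono fun ξ => ?_
        refine le_trans ?_ (mul_le_mul_right (add_le_add_right (high ξ) _) 2)
        rw [← ENNReal.tsum_add, ← ENNReal.tsum_mul_left]
        refine ENNReal.tsum_le_tsum fun n => ?_
        rw [← mul_add, mul_left_comm, hsplit]
        gcongr
        exact (pow_le_pow_left' (enorm_add_le _ _) 2).trans (add_sq_le_enn _ _)
    _ = 2 * ((∫⁻ ξ in Icc (-T) T, ∑' n, ENNReal.ofReal (w n ^ 2) * ‖𝓕 (fun t => Gl t n) ξ‖ₑ ^ 2) +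
          ENNReal.ofReal (T ^ (2 / q - 2)) * M ^ 2 * ENNReal.ofReal (T - -T)) := by
        rw [lintegral_const_mul' _ _ (by simp), lintegral_add_right _ measurable_const,
          setLIntegral_const, Real.volume_Icc]
    _ ≤ 2 * (ENNReal.ofReal (T ^ (2 / q - 1)) * M ^ 2 +
          ENNReal.ofReal (T ^ (2 / q - 2)) * M ^ 2 * ENNReal.ofReal (T - -T)) := by
        gcongr
        exact (setLIntegral_le_lintegral _ _).trans low
    _ = _ := by
        have e : T ^ (2 / q - 2) * (T - -T) = 2 * T ^ (2 / q - 1) := by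
          rw [show 2 / q - 1 = (2 / q - 2) + 1 by ring, Real.rpow_add_one hT.ne']; ring
        rw [mul_right_comm (ENNReal.ofReal (T ^ (2 / q - 2))), ← ENNReal.ofReal_mul (by positivity), e,
          ENNReal.ofReal_mul zero_le_two, ENNReal.ofReal_ofNat]
        ring

/-- The constant in `lintegral_modWeight_sum_fourier_le`. -/
def dualConst (b q : ℝ) : ℝ≥0∞ := ∑' k : ℕ, 12 * ENNReal.ofReal (2 ^ (2 / q - 1 - (2 - 2 * b))) ^ k

theorem dualConst_lt_top {b : ℝ} (h : 2 / q - 1 - (2 - 2 * b) < 0) : dualConst b q < ⊤ := by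
  have h1 : (2 : ℝ) ^ (2 / q - 1 - (2 - 2 * b)) < 1 := Real.rpow_lt_one_of_one_lt_of_neg (by norm_num) h
  have := summable_geometric_of_lt_one (by positivity) h1
  rw [dualConst, ENNReal.tsum_mul_left]
  simp_rw [← ENNReal.ofReal_pow (Real.rpow_nonneg zero_le_two _)]
  rw [← ENNReal.ofReal_tsum_of_nonneg (fun j => by positivity) this]
  exact ENNReal.mul_lt_top (by simp) ENNReal.ofReal_lt_top

/-- Dyadic bound for `⟨τ⟩^{2(b-1)}`. -/
theorem modWeight_sub_one_le {b : ℝ} (hb : 1 / 2 < b) (hb1 : b < 1) (ξ : ℝ) :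
    ∃ k : ℕ, ξ ∈ Icc (-(2 : ℝ) ^ k) (2 ^ k) ∧ modWeight (b - 1) ξ ≤ 2 * (2 ^ (-(2 - 2 * b))) ^ k := by
  have hex : ∃ k : ℕ, |ξ| ≤ 2 ^ k := by
    obtain ⟨k, hk⟩ := pow_unbounded_of_one_lt |ξ| (one_lt_two (α := ℝ))
    exact ⟨k, hk.le⟩
  classical
  set k := Nat.find hex with hk
  have hk1 : |ξ| ≤ 2 ^ k := Nat.find_spec hex
  refine ⟨k, abs_le.1 hk1, ?_⟩
  have hneg : 2 * (b - 1) ≤ 0 := by linarith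
  have hmono : ∀ y : ℝ, 0 < y → y ≤ bracket (2 * Real.pi * ξ) → modWeight (b - 1) ξ ≤ y ^ (2 * (b - 1)) :=
    fun y hy h => Real.rpow_le_rpow_of_nonpos hy h hneg
  rcases Nat.eq_zero_or_pos k with h0 | h0
  · rw [h0, pow_zero, mul_one]
    refine (hmono 1 one_pos ?_).trans (by rw [Real.one_rpow]; norm_num)
    exact Real.le_sqrt_of_sq_le (by nlinarith [sq_nonneg (2 * Real.pi * ξ)])
  · have h2 : 2 ^ (k - 1) < |ξ| := not_le.1 (Nat.find_min hex (by omega))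
    have h3 : (2 : ℝ) ^ (k - 1) ≤ bracket (2 * Real.pi * ξ) := by
      refine Real.le_sqrt_of_sq_le ?_
      have h4 : ((2 : ℝ) ^ (k - 1)) ^ 2 ≤ |ξ| ^ 2 := pow_le_pow_left₀ (by positivity) h2.le 2
      rw [sq_abs] at h4
      have := Real.pi_gt_three
      nlinarith [sq_nonneg ξ, mul_nonneg (sq_nonneg ξ) (sub_nonneg.2 this.le)]
    refine (hmono _ (by positivity) h3).trans ?_
    have h5 : (2 : ℝ) ^ (k - 1) = 2 ^ k / 2 := by
      obtain ⟨m, hm⟩ := Nat.exists_eq_succ_of_ne_zero h0.ne'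
      rw [hm, Nat.succ_sub_one, pow_succ]; ring
    rw [h5, Real.div_rpow (by positivity) zero_le_two, ← Real.rpow_natCast, ← Real.rpow_mul zero_le_two,
      ← Real.rpow_natCast, ← Real.rpow_mul zero_le_two, div_eq_mul_inv, ← Real.rpow_neg zero_le_two,
      mul_comm]
    have e : (k : ℝ) * (2 * (b - 1)) = -(2 - 2 * b) * k := by ring
    rw [e]
    gcongr
    calc (2 : ℝ) ^ (-(2 * (b - 1))) ≤ 2 ^ (1 : ℝ) :=
          Real.rpow_le_rpow_of_exponent_le one_le_two (by linarith)
      _ = 2 := Real.rpow_one 2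

/-- The embedding of `L^q` in time into the dual space with weight `⟨τ⟩^{2b-2}`. -/
theorem lintegral_modWeight_sum_fourier_le {b : ℝ} (hb : 1 / 2 < b) (hb1 : b < 1) (hq1 : 1 ≤ q)
    (hq2 : q ≤ 2) (hm : ∀ n, Measurable fun t => G t n)
    (hi : ∀ n, Integrable fun t => G t n) {M : ℝ≥0∞} (hM : ∫⁻ t, wNorm w (G t) ^ q ≤ M ^ q) :
    ∫⁻ ξ, ENNReal.ofReal (modWeight (b - 1) ξ) *
      ∑' n, ENNReal.ofReal (w n ^ 2) * ‖𝓕 (fun t => G t n) ξ‖ₑ ^ 2 ≤ dualConst b q * M ^ 2 := by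
  set Q : ℝ → ℝ≥0∞ := fun ξ => ∑' n, ENNReal.ofReal (w n ^ 2) * ‖𝓕 (fun t => G t n) ξ‖ₑ ^ 2 with hQ
  have hQm : Measurable Q := Measurable.tsum fun n =>
    ((continuous_fourier_of_integrable (hi n)).enorm.measurable.pow_const 2).const_mul _
  have hpt : ∀ ξ, ENNReal.ofReal (modWeight (b - 1) ξ) * Q ξ ≤
      ∑' k : ℕ, ENNReal.ofReal (2 * (2 ^ (-(2 - 2 * b))) ^ k) *
        (Icc (-(2 : ℝ) ^ k) (2 ^ k)).indicator Q ξ := by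
    intro ξ
    obtain ⟨k, hk1, hk2⟩ := modWeight_sub_one_le hb hb1 ξ
    refine le_trans ?_ (ENNReal.le_tsum k)
    rw [indicator_of_mem hk1]
    gcongr
  refine (lintegral_mono hpt).trans ?_
  rw [lintegral_tsum fun k => ((hQm.indicator measurableSet_Icc).const_mul _).aemeasurable, dualConst,
    ← ENNReal.tsum_mul_right]
  refine ENNReal.tsum_le_tsum fun k => ?_
  rw [lintegral_const_mul _ (hQm.indicator measurableSet_Icc), lintegral_indicator measurableSet_Icc]
  refine (mul_le_mul_right (lintegral_Icc_sum_fourier_le hq1 hq2 hm hi (by positivity) hM) _).trans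
    (le_of_eq ?_)
  rw [← ENNReal.ofReal_pow (by positivity), ENNReal.ofReal_mul zero_le_two, ENNReal.ofReal_ofNat]
  have e : ((2 : ℝ) ^ (2 / q - 1 - (2 - 2 * b))) ^ k =
      (2 ^ (-(2 - 2 * b))) ^ k * ((2 : ℝ) ^ k) ^ (2 / q - 1) := by
    rw [← Real.rpow_natCast, ← Real.rpow_natCast, ← Real.rpow_natCast, ← Real.rpow_mul zero_le_two,
      ← Real.rpow_mul zero_le_two, ← Real.rpow_mul zero_le_two, ← Real.rpow_add two_pos]
    congr 1
    ring
  rw [e, ENNReal.ofReal_mul (p := (2 ^ (-(2 - 2 * b))) ^ k) (by positivity)]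
  ring

end

/-! ### Cutoffs in time -/

/-- A smooth cutoff, equal to `1` on `[-1/2, 1/2]` and supported in `[-1, 1]`. -/
def timeBump : ContDiffBump (0 : ℝ) := ⟨1 / 2, 1, by norm_num, by norm_num⟩

theorem timeBump_contDiff : ContDiff ℝ ∞ timeBump := timeBump.contDiff

theorem continuous_deriv_timeBump : Continuous (deriv timeBump) :=
  timeBump_contDiff.continuous_deriv (by simp)

theorem timeBump_one {t : ℝ} (ht : t ∈ Icc (-(1 / 2) : ℝ) (1 / 2)) : timeBump t = 1 :=
  timeBump.one_of_mem_closedBall (by rw [Real.closedBall_eq_Icc]; simpa [timeBump] using ht)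

theorem timeBump_zero {t : ℝ} (ht : t ∉ Icc (-1 : ℝ) 1) : timeBump t = 0 := by
  refine timeBump.zero_of_le_dist ?_
  rw [mem_Icc, ← abs_le, not_le] at ht
  rw [Real.dist_eq, sub_zero]
  exact ht.le

theorem deriv_timeBump_zero {t : ℝ} (ht : t ∉ Icc (-1 : ℝ) 1) : deriv timeBump t = 0 := by
  have : (timeBump : ℝ → ℝ) =ᶠ[𝓝 t] fun _ => 0 := by
    filter_upwards [isClosed_Icc.isOpen_compl.mem_nhds ht] with y hy
    exact timeBump_zero hy
  rw [this.deriv_eq, deriv_const]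

theorem exists_bumpConst : ∃ D : ℝ, 0 ≤ D ∧ ∀ t, |deriv timeBump t| ≤ D := by
  obtain ⟨D, hD⟩ := isCompact_Icc.exists_bound_of_continuousOn (s := Icc (-1 : ℝ) 1)
    continuous_deriv_timeBump.continuousOn
  refine ⟨max D 0, le_max_right _ _, fun t => ?_⟩
  by_cases ht : t ∈ Icc (-1 : ℝ) 1
  · exact (hD t ht).trans (le_max_left _ _)
  · rw [deriv_timeBump_zero ht, abs_zero]; exact le_max_right _ _

/-- A bound for the derivative of the cutoff. -/
def bumpConst : ℝ := exists_bumpConst.choose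

theorem abs_deriv_timeBump_le (t : ℝ) : |deriv timeBump t| ≤ bumpConst :=
  exists_bumpConst.choose_spec.2 t

section

variable {c : ℂ} {G : ℝ → ℂ}

/-- Integration by parts for the Fourier transform of a cut off primitive. -/
theorem fourier_timeBump_mul (hG : Integrable G) {S : Set ℝ} (hS : S.Countable)
    (hc : ∀ t ∉ S, ContinuousAt G t) (h0 : ∀ t ∉ Icc (-(1 / 2) : ℝ) (1 / 2), G t = 0) (ξ : ℝ) :
    (2 * Real.pi * Complex.I * ξ) * 𝓕 (fun t => (timeBump t : ℂ) * (c + ∫ x in (0 : ℝ)..t, G x)) ξ =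
      𝓕 (fun t => ((deriv timeBump t : ℝ) : ℂ) * (c + ∫ x in (0 : ℝ)..t, G x)) ξ + 𝓕 G ξ := by
  set P : ℝ → ℂ := fun t => c + ∫ x in (0 : ℝ)..t, G x with hP
  have hPc : Continuous P :=
    continuous_const.add (intervalIntegral.continuous_primitive (fun a b => hG.intervalIntegrable) 0)
  have hPd : ∀ t ∉ S, HasDerivAt P (G t) t := fun t ht =>
    (intervalIntegral.integral_hasDerivAt_right hG.intervalIntegrable
      hG.1.stronglyMeasurableAtFilter (hc t ht)).const_add c
  have hbc : Continuous timeBump := timeBump_contDiff.continuous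
  have hbd : ∀ t, HasDerivAt (fun t => (timeBump t : ℂ)) ((deriv timeBump t : ℝ) : ℂ) t := fun t =>
    ((timeBump_contDiff.differentiable (by simp) t).hasDerivAt).ofReal_comp
  have hdc := continuous_deriv_timeBump
  set e : ℝ → ℂ := fun t => Complex.exp (↑(-2 * Real.pi * t * ξ) * Complex.I) with he
  have hec : Continuous e := by fun_prop
  have hed : ∀ t, HasDerivAt e (e t * -(2 * Real.pi * Complex.I * ξ)) t := by
    intro t
    have h1 : HasDerivAt (fun t : ℝ => (((-2 * Real.pi * t * ξ : ℝ) : ℂ)) * Complex.I)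
        (((-2 * Real.pi * 1 * ξ : ℝ) : ℂ) * Complex.I) t :=
      (((hasDerivAt_id t).const_mul (-2 * Real.pi)).mul_const ξ).ofReal_comp.mul_const Complex.I
    refine h1.cexp.congr_deriv ?_
    push_cast
    simp only [he]
    push_cast
    ring
  have hGi : Integrable fun t => e t * G t :=
    hG.bdd_mul (c := 1) hec.aestronglyMeasurable
      (Eventually.of_forall fun t => by rw [Complex.norm_exp]; simp)
  have supp : ∀ f : ℝ → ℂ, (∀ t ∉ Icc (-1 : ℝ) 1, f t = 0) → ∫ t, f t = ∫ t in (-2 : ℝ)..2, f t := by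
    intro f hf
    refine (intervalIntegral.integral_eq_integral_of_support_subset fun t ht => ?_).symm
    by_contra hc
    refine ht (hf t fun h => hc ⟨?_, ?_⟩)
    · linarith [h.1]
    · linarith [h.2]
  have h0' : ∀ t ∉ Icc (-1 : ℝ) 1, G t = 0 := fun t ht => h0 t fun h =>
    ht ⟨by linarith [h.1], by linarith [h.2]⟩
  have hbG : ∀ t, (timeBump t : ℂ) * G t = G t := by
    intro t
    by_cases ht : t ∈ Icc (-(1 / 2) : ℝ) (1 / 2)
    · rw [timeBump_one ht, Complex.ofReal_one, one_mul]
    · rw [h0 t ht, mul_zero]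
  have key := integral_eq_of_hasDerivAt_off_countable_of_le
    (fun t => e t * ((timeBump t : ℂ) * P t))
    (fun t => -(2 * Real.pi * Complex.I * ξ) * (e t * ((timeBump t : ℂ) * P t)) +
      (e t * (((deriv timeBump t : ℝ) : ℂ) * P t) + e t * G t)) (a := -2) (b := 2) (by norm_num) hS
    (by fun_prop) (fun t ht => by
      refine ((hed t).mul ((hbd t).mul (hPd t ht.2))).congr_deriv ?_
      simp only [Pi.mul_apply]
      rw [hbG]; ring)
    (((by fun_prop : Continuous fun t => -(2 * Real.pi * Complex.I * ξ) *
      (e t * ((timeBump t : ℂ) * P t))).intervalIntegrable _ _).add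
      (((by fun_prop : Continuous fun t => e t * (((deriv timeBump t : ℝ) : ℂ) * P t)).intervalIntegrable _ _).add
      hGi.intervalIntegrable))
  have z1 : timeBump (2 : ℝ) = 0 := timeBump_zero (by norm_num)
  have z2 : timeBump (-2 : ℝ) = 0 := timeBump_zero (by norm_num)
  rw [intervalIntegral.integral_add ((by fun_prop : Continuous fun t => -(2 * Real.pi * Complex.I * ξ) *
      (e t * ((timeBump t : ℂ) * P t))).intervalIntegrable _ _)
      (((by fun_prop : Continuous fun t => e t * (((deriv timeBump t : ℝ) : ℂ) * P t)).intervalIntegrable _ _).add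
      hGi.intervalIntegrable), intervalIntegral.integral_add
      ((by fun_prop : Continuous fun t => e t * (((deriv timeBump t : ℝ) : ℂ) * P t)).intervalIntegrable _ _)
      hGi.intervalIntegrable, intervalIntegral.integral_const_mul, z1, z2] at key
  simp only [Complex.ofReal_zero, zero_mul, mul_zero, sub_zero] at key
  rw [Real.fourier_real_eq_integral_exp_smul, Real.fourier_real_eq_integral_exp_smul,
    Real.fourier_real_eq_integral_exp_smul]
  simp only [smul_eq_mul]
  rw [supp _ fun t ht => ?_, supp _ fun t ht => ?_, supp _ fun t ht => ?_]
  · linear_combination -key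
  · rw [h0' t ht, mul_zero]
  · rw [deriv_timeBump_zero ht]; simp
  · rw [timeBump_zero ht]; simp

/-- Integration in time gains one power of `⟨τ⟩`: scalar form of the linear estimate. -/
theorem lintegral_modWeight_fourier_timeBump_le {b : ℝ} (hb1 : b ≤ 1) (hG : Integrable G)
    {S : Set ℝ} (hS : S.Countable) (hc : ∀ t ∉ S, ContinuousAt G t)
    (h0 : ∀ t ∉ Icc (-(1 / 2) : ℝ) (1 / 2), G t = 0) :
    ∫⁻ ξ, ENNReal.ofReal (modWeight b ξ) *
        ‖𝓕 (fun t => (timeBump t : ℂ) * (c + ∫ x in (0 : ℝ)..t, G x)) ξ‖ₑ ^ 2 ≤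
      ENNReal.ofReal (2 + 4 * bumpConst ^ 2) * (‖c‖ₑ + ∫⁻ t, ‖G t‖ₑ) ^ 2 +
        2 * ∫⁻ ξ, ENNReal.ofReal (modWeight (b - 1) ξ) * ‖𝓕 G ξ‖ₑ ^ 2 := by
  set P : ℝ → ℂ := fun t => c + ∫ x in (0 : ℝ)..t, G x with hP
  have hPc : Continuous P :=
    continuous_const.add (intervalIntegral.continuous_primitive (fun a b => hG.intervalIntegrable) 0)
  have hbc : Continuous timeBump := timeBump_contDiff.continuous
  have hdc := continuous_deriv_timeBump
  set B : ℝ≥0∞ := ‖c‖ₑ + ∫⁻ t, ‖G t‖ₑ with hB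
  have hPB : ∀ t, ‖P t‖ₑ ≤ B := by
    intro t
    refine (enorm_add_le _ _).trans (add_le_add le_rfl ?_)
    rw [← ofReal_norm, intervalIntegral.norm_intervalIntegral_eq, ofReal_norm]
    exact (enorm_integral_le_lintegral_enorm _).trans (setLIntegral_le_lintegral _ _)
  have hcomp : ∀ g : ℝ → ℝ, Continuous g → (∀ t ∉ Icc (-1 : ℝ) 1, g t = 0) →
      Integrable fun t => (g t : ℂ) * P t := by
    intro g hg hg0
    refine Continuous.integrable_of_hasCompactSupport (by fun_prop) ?_
    refine HasCompactSupport.intro (K := Icc (-1 : ℝ) 1) isCompact_Icc fun t ht => ?_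
    rw [hg0 t ht, Complex.ofReal_zero, zero_mul]
  have hsq : ∀ (g : ℝ → ℝ) (D : ℝ), Continuous g → (∀ t ∉ Icc (-1 : ℝ) 1, g t = 0) →
      (∀ t, |g t| ≤ D) → ∫⁻ ξ, ‖𝓕 (fun t => (g t : ℂ) * P t) ξ‖ₑ ^ 2 ≤
        ENNReal.ofReal (2 * D ^ 2) * B ^ 2 := by
    intro g D hg hg0 hgD
    have hD : 0 ≤ D := (abs_nonneg _).trans (hgD 0)
    refine (lintegral_fourier_sq_le (hcomp g hg hg0)).trans ?_
    calc ∫⁻ t, ‖(g t : ℂ) * P t‖ₑ ^ 2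
        ≤ ∫⁻ t, (Icc (-1 : ℝ) 1).indicator (fun _ => ENNReal.ofReal (D ^ 2) * B ^ 2) t := by
          refine lintegral_mono fun t => ?_
          by_cases ht : t ∈ Icc (-1 : ℝ) 1
          · rw [indicator_of_mem ht, enorm_mul, mul_pow]
            gcongr
            · rw [← ofReal_norm, Complex.norm_real, ← ENNReal.ofReal_pow (norm_nonneg _)]
              exact ENNReal.ofReal_le_ofReal (pow_le_pow_left₀ (norm_nonneg _) (hgD t) 2)
            · exact hPB t
          · rw [indicator_of_notMem ht, hg0 t ht]; simp
      _ = _ := by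
          rw [lintegral_indicator measurableSet_Icc, setLIntegral_const, Real.volume_Icc,
            mul_right_comm, ← ENNReal.ofReal_mul (by positivity)]
          congr 2
          ring
  have hpt : ∀ ξ, ENNReal.ofReal (modWeight b ξ) * ‖𝓕 (fun t => (timeBump t : ℂ) * P t) ξ‖ₑ ^ 2 ≤
      ‖𝓕 (fun t => (timeBump t : ℂ) * P t) ξ‖ₑ ^ 2 + (2 * ‖𝓕 (fun t => ((deriv timeBump t : ℝ) : ℂ) * P t) ξ‖ₑ ^ 2 +
        2 * (ENNReal.ofReal (modWeight (b - 1) ξ) * ‖𝓕 G ξ‖ₑ ^ 2)) := by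
    intro ξ
    have h1 := fourier_timeBump_mul (c := c) hG hS hc h0 ξ
    set x := 𝓕 (fun t => (timeBump t : ℂ) * P t) ξ
    set y := 𝓕 (fun t => ((deriv timeBump t : ℝ) : ℂ) * P t) ξ
    set z := 𝓕 G ξ
    have hW0 := modWeight_pos (b - 1) ξ
    have hbr : 1 ≤ bracket (2 * Real.pi * ξ) :=
      Real.le_sqrt_of_sq_le (by nlinarith [sq_nonneg (2 * Real.pi * ξ)])
    have hW1 : modWeight (b - 1) ξ ≤ 1 :=
      Real.rpow_le_one_of_one_le_of_nonpos hbr (by linarith)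
    have hWb : modWeight b ξ = modWeight (b - 1) ξ * (1 + (2 * Real.pi * ξ) ^ 2) := by
      have e1 : 2 * b = 2 * (b - 1) + (2 : ℕ) := by push_cast; ring
      have e2 : bracket (2 * Real.pi * ξ) ^ 2 = 1 + (2 * Real.pi * ξ) ^ 2 :=
        Real.sq_sqrt (by positivity)
      rw [modWeight, e1, Real.rpow_add_natCast (bracket_pos _).ne', e2, modWeight]
    have h2 : (2 * Real.pi * ξ) ^ 2 * ‖x‖ ^ 2 ≤ 2 * ‖y‖ ^ 2 + 2 * ‖z‖ ^ 2 := by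
      have h3 : ‖2 * Real.pi * Complex.I * ξ * x‖ = |2 * Real.pi * ξ| * ‖x‖ := by
        rw [norm_mul]
        congr 1
        rw [← Real.norm_eq_abs, ← Complex.norm_real]
        simp
      have h4 : |2 * Real.pi * ξ| * ‖x‖ ≤ ‖y‖ + ‖z‖ := by
        rw [← h3, h1]; exact norm_add_le _ _
      have h5 := pow_le_pow_left₀ (by positivity) h4 2
      rw [mul_pow, sq_abs] at h5
      nlinarith [sq_nonneg (‖y‖ - ‖z‖)]
    have h6 : modWeight b ξ * ‖x‖ ^ 2 ≤ ‖x‖ ^ 2 + (2 * ‖y‖ ^ 2 + 2 * (modWeight (b - 1) ξ * ‖z‖ ^ 2)) := by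
      rw [hWb]
      nlinarith [mul_le_mul_of_nonneg_left h2 hW0.le, mul_le_mul_of_nonneg_right hW1 (sq_nonneg ‖x‖),
        mul_le_mul_of_nonneg_right hW1 (sq_nonneg ‖y‖)]
    have h7 := ENNReal.ofReal_le_ofReal h6
    rw [ENNReal.ofReal_mul (modWeight_pos _ _).le, ENNReal.ofReal_add (by positivity) (by positivity),
      ENNReal.ofReal_add (by positivity) (by positivity), ENNReal.ofReal_mul zero_le_two,
      ENNReal.ofReal_mul zero_le_two, ENNReal.ofReal_mul hW0.le] at h7
    simpa only [ENNReal.ofReal_pow (norm_nonneg _), ofReal_norm, ENNReal.ofReal_ofNat] using h7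
  have b1 := hsq (fun t => timeBump t) 1 hbc (fun t ht => timeBump_zero ht) fun t => by
    rw [abs_of_nonneg timeBump.nonneg]; exact timeBump.le_one
  have b2 := hsq (deriv timeBump) bumpConst hdc (fun t ht => deriv_timeBump_zero ht)
    abs_deriv_timeBump_le
  have m1 : Measurable fun ξ => ‖𝓕 (fun t => (timeBump t : ℂ) * P t) ξ‖ₑ ^ 2 :=
    (continuous_fourier_of_integrable (hcomp _ hbc fun t ht => timeBump_zero ht)).enorm.measurable.pow_const 2
  have m2 : Measurable fun ξ => ‖𝓕 (fun t => ((deriv timeBump t : ℝ) : ℂ) * P t) ξ‖ₑ ^ 2 :=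
    (continuous_fourier_of_integrable (hcomp _ hdc fun t ht => deriv_timeBump_zero ht)).enorm.measurable.pow_const 2
  refine (lintegral_mono hpt).trans ?_
  rw [lintegral_add_left m1, lintegral_add_left (m2.const_mul 2), lintegral_const_mul' _ _ (by simp),
    lintegral_const_mul' _ _ (by simp), ← add_assoc]
  refine add_le_add ((add_le_add b1 (mul_le_mul_right b2 2)).trans (le_of_eq ?_)) le_rfl
  rw [← mul_assoc, ← add_mul, ← ENNReal.ofReal_ofNat 2, ← ENNReal.ofReal_mul zero_le_two,
    ← ENNReal.ofReal_add (by positivity) (by positivity)]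
  congr 2
  ring

end

/-- The constant in `modNorm_duhamel_le`. -/
def duhamelConst (b q : ℝ) : ℝ≥0∞ :=
  (ENNReal.ofReal (2 + 4 * bumpConst ^ 2) * 2 + 2 * dualConst b q) ^ (1 / 2 : ℝ)

theorem duhamelConst_lt_top {b q : ℝ} (h : 2 / q - 1 - (2 - 2 * b) < 0) : duhamelConst b q < ⊤ :=
  ENNReal.rpow_lt_top_of_nonneg (by norm_num) (ENNReal.add_lt_top.2
    ⟨ENNReal.mul_lt_top ENNReal.ofReal_lt_top (by simp), ENNReal.mul_lt_top (by simp)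
      (dualConst_lt_top h)⟩).ne

/-- The energy estimate in `X^{w,b}` for a forced linear equation. -/
theorem modNorm_duhamel_le {b q : ℝ} (hb : 1 / 2 < b) (hb1 : b < 1) (hq1 : 1 ≤ q) (hq2 : q ≤ 2)
    {c : ℕ → ℂ} {G : ℝ → ℕ → ℂ} (hm : ∀ n, Measurable fun t => G t n)
    (hi : ∀ n, Integrable fun t => G t n) {S : Set ℝ} (hS : S.Countable)
    (hc : ∀ n, ∀ t ∉ S, ContinuousAt (fun t => G t n) t)
    (h0 : ∀ t ∉ Icc (-(1 / 2) : ℝ) (1 / 2), G t = 0) {M : ℝ≥0∞} (hM : lqNorm q univ (fun t => wNorm w (G t)) ≤ M) :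
    modNorm b w (fun n => 𝓕 (fun t => (timeBump t : ℂ) * (c n + ∫ x in (0 : ℝ)..t, G x n))) ≤
      duhamelConst b q * (wNorm w c + M) := by
  have hq0 := one_pos.trans_le hq1
  have hM' : ∫⁻ t, wNorm w (G t) ^ q ≤ M ^ q := by
    have := ENNReal.rpow_le_rpow hM hq0.le
    rwa [lqNorm_rpow hq0, setLIntegral_univ] at this
  have h0n : ∀ n, ∀ t ∉ Icc (-(1 / 2) : ℝ) (1 / 2), G t n = 0 := fun n t ht => by rw [h0 t ht]; rfl
  have hNm : AEMeasurable (fun t => wNorm w (G t)) :=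
    measurable_wNorm fun n => (hm n).aestronglyMeasurable
  have hG1 : ∫⁻ t, wNorm w (G t) ≤ M := by
    have e : ∫⁻ t, wNorm w (G t) = ∫⁻ t in Icc (-(1 / 2) : ℝ) (1 / 2), wNorm w (G t) := by
      refine (setLIntegral_eq_of_support_subset ?_).symm
      intro t ht
      by_contra hc
      exact ht (by show wNorm w (G t) = 0; rw [h0 t hc]; exact wNorm_zero w)
    rw [e]
    refine (lintegral_le_lqNorm hq1 ?_ hNm.restrict).trans
      ((lqNorm_mono_set hq0.le (subset_univ _)).trans hM)
    rw [Real.volume_Icc]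
    norm_num
  have hQm : ∀ n, Measurable fun ξ => ‖𝓕 (fun t => G t n) ξ‖ₑ ^ 2 := fun n =>
    (continuous_fourier_of_integrable (hi n)).enorm.measurable.pow_const 2
  have hWm : Measurable fun ξ => ENNReal.ofReal (modWeight (b - 1) ξ) := by fun_prop
  have hmm : ∀ n, Measurable fun ξ => ENNReal.ofReal (modWeight (b - 1) ξ) *
      (ENNReal.ofReal (w n ^ 2) * ‖𝓕 (fun t => G t n) ξ‖ₑ ^ 2) :=
    fun n => hWm.mul ((hQm n).const_mul _)
  rw [← sq_le_sq_enn, modNorm_sq, mul_pow, duhamelConst, rpow_half_sq]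
  calc _ ≤ ∑' n, ENNReal.ofReal (w n ^ 2) *
        (ENNReal.ofReal (2 + 4 * bumpConst ^ 2) * (‖c n‖ₑ + ∫⁻ t, ‖G t n‖ₑ) ^ 2 +
        2 * ∫⁻ ξ, ENNReal.ofReal (modWeight (b - 1) ξ) * ‖𝓕 (fun t => G t n) ξ‖ₑ ^ 2) :=
        ENNReal.tsum_le_tsum fun n => mul_le_mul_right
          (lintegral_modWeight_fourier_timeBump_le hb1.le (hi n) hS (hc n) (h0n n)) _
    _ = ENNReal.ofReal (2 + 4 * bumpConst ^ 2) *
          (∑' n, ENNReal.ofReal (w n ^ 2) * (‖c n‖ₑ + ∫⁻ t, ‖G t n‖ₑ) ^ 2) +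
        2 * ∫⁻ ξ, ENNReal.ofReal (modWeight (b - 1) ξ) *
          ∑' n, ENNReal.ofReal (w n ^ 2) * ‖𝓕 (fun t => G t n) ξ‖ₑ ^ 2 := by
        simp_rw [mul_add]
        rw [ENNReal.tsum_add]
        congr 1
        · rw [← ENNReal.tsum_mul_left]
          exact tsum_congr fun n => by ring
        · simp_rw [← ENNReal.tsum_mul_left]
          rw [lintegral_tsum fun n => (hmm n).aemeasurable,
            ← ENNReal.tsum_mul_left]
          refine tsum_congr fun n => ?_
          rw [mul_left_comm, ← lintegral_const_mul' _ _ ENNReal.ofReal_ne_top]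
          congr 1
          exact lintegral_congr fun ξ => by ring
    _ ≤ ENNReal.ofReal (2 + 4 * bumpConst ^ 2) * (2 * (wNorm w c + M) ^ 2) +
        2 * (dualConst b q * (wNorm w c + M) ^ 2) := by
        gcongr
        · calc _ ≤ ∑' n, ENNReal.ofReal (w n ^ 2) * (2 * (‖c n‖ₑ ^ 2 + (∫⁻ t, ‖G t n‖ₑ) ^ 2)) :=
                ENNReal.tsum_le_tsum fun n => mul_le_mul_right (add_sq_le_enn _ _) _
            _ = 2 * (wNorm w c ^ 2 + ∑' n, (∫⁻ t, ‖(w n : ℂ) * G t n‖ₑ) ^ 2) := by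
                rw [wNorm_sq, ← ENNReal.tsum_add, ← ENNReal.tsum_mul_left]
                refine tsum_congr fun n => ?_
                have : ∫⁻ t, ‖(w n : ℂ) * G t n‖ₑ = ‖(w n : ℂ)‖ₑ * ∫⁻ t, ‖G t n‖ₑ := by
                  simp_rw [enorm_mul]
                  rw [lintegral_const_mul' _ _ enorm_ne_top]
                have e2 : ENNReal.ofReal (w n ^ 2) = ‖(w n : ℂ)‖ₑ ^ 2 := by
                  rw [← ofReal_norm, Complex.norm_real, ← ENNReal.ofReal_pow (norm_nonneg _),
                    Real.norm_eq_abs, sq_abs]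
                rw [this, e2]
                ring
            _ ≤ 2 * (wNorm w c ^ 2 + M ^ 2) := by
                gcongr
                refine (tsum_sq_lintegral_le fun n => ((hm n).const_mul _).enorm.aemeasurable).trans ?_
                gcongr
                refine le_trans (le_of_eq (lintegral_congr fun t => ?_)) hG1
                rw [wNorm_eq]
                congr 1
                refine tsum_congr fun n => ?_
                rw [enorm_mul, mul_pow]
                congr 1
                rw [← ofReal_norm, Complex.norm_real, ← ENNReal.ofReal_pow (norm_nonneg _),
                  Real.norm_eq_abs, sq_abs]
            _ ≤ 2 * (wNorm w c + M) ^ 2 := by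
                gcongr
                rw [add_sq]
                exact add_le_add (le_self_add) le_rfl
        · exact (lintegral_modWeight_sum_fourier_le hb hb1 hq1 hq2 hm hi hM').trans
            (by gcongr; exact le_add_self)
    _ = _ := by ring

/-! ### Duhamel's formula in the spaces `X^{s,b}` -/

/-- The function `S(t) (c + ∫₀ᵗ H)`, where `S` is the free flow and `H` the forcing seen in the
frame moving with it. -/
def duhamel (α : ℝ) (c : ℕ → ℂ) (H : ℝ → ℕ → ℂ) (t : ℝ) (n : ℕ) : ℂ :=
  Complex.exp (-(Complex.I * freq α n * t)) * (c n + ∫ x in (0 : ℝ)..t, H x n)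

/-- The cut off primitive of `1_J H`; its Fourier transform is a profile of `duhamel` on `J`. -/
def cutPrimitive (c : ℕ → ℂ) (J : Set ℝ) (H : ℝ → ℕ → ℂ) (n : ℕ) (t : ℝ) : ℂ :=
  (timeBump t : ℂ) * (c n + ∫ x in (0 : ℝ)..t, J.indicator H x n)

/-- The time profile of Duhamel's formula with forcing `1_J H`. -/
def profile (c : ℕ → ℂ) (J : Set ℝ) (H : ℝ → ℕ → ℂ) (n : ℕ) : ℝ → ℂ := 𝓕 (cutPrimitive c J H n)

theorem indicator_apply_coord (J : Set ℝ) (H : ℝ → ℕ → ℂ) (t : ℝ) (n : ℕ) :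
    J.indicator H t n = J.indicator (fun t => H t n) t := by
  by_cases ht : t ∈ J <;> simp [ht]

section

variable {c : ℕ → ℂ} {H : ℝ → ℕ → ℂ} {l r : ℝ}

theorem integrable_indicator_coord (hH : ∀ n, ContinuousOn (fun t => H t n) (Icc l r)) (n : ℕ) :
    Integrable fun t => (Icc l r).indicator H t n := by
  simp_rw [indicator_apply_coord]
  exact (integrable_indicator_iff measurableSet_Icc).2 ((hH n).integrableOn_Icc)

theorem continuous_cutPrimitive (hH : ∀ n, ContinuousOn (fun t => H t n) (Icc l r)) (n : ℕ) :
    Continuous (cutPrimitive c (Icc l r) H n) := by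
  have h1 : Continuous timeBump := timeBump_contDiff.continuous
  have h2 : Continuous fun t => ∫ x in (0 : ℝ)..t, (Icc l r).indicator H x n :=
    intervalIntegral.continuous_primitive
      (fun a b => (integrable_indicator_coord hH n).intervalIntegrable) 0
  unfold cutPrimitive
  fun_prop

theorem hasCompactSupport_cutPrimitive (J : Set ℝ) (n : ℕ) :
    HasCompactSupport (cutPrimitive c J H n) := by
  refine HasCompactSupport.intro (K := Icc (-1 : ℝ) 1) isCompact_Icc fun t ht => ?_
  rw [cutPrimitive, timeBump_zero ht, Complex.ofReal_zero, zero_mul]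

theorem cutPrimitive_eq (hl : -(1 / 2) ≤ l) (hl0 : l ≤ 0) (hr0 : 0 ≤ r) (hr : r ≤ 1 / 2) {t : ℝ}
    (ht : t ∈ Icc l r) (n : ℕ) :
    cutPrimitive c (Icc l r) H n t = c n + ∫ x in (0 : ℝ)..t, H x n := by
  rw [cutPrimitive, timeBump_one ⟨hl.trans ht.1, ht.2.trans hr⟩, Complex.ofReal_one, one_mul]
  congr 1
  refine intervalIntegral.integral_congr fun x hx => ?_
  have hx' : x ∈ Icc l r := ordConnected_Icc.uIcc_subset ⟨hl0, hr0⟩ ht hx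
  show (Icc l r).indicator H x n = H x n
  rw [indicator_of_mem hx']

theorem measurable_profile (hH : ∀ n, ContinuousOn (fun t => H t n) (Icc l r)) (n : ℕ) :
    Measurable (profile c (Icc l r) H n) :=
  (continuous_fourier_of_integrable ((continuous_cutPrimitive hH n).integrable_of_hasCompactSupport
    (hasCompactSupport_cutPrimitive _ n))).measurable

/-- Linear estimate on an interval: data in the weighted space and forcing in `L^q` of time give a
profile in `X^{w,b}`. -/
theorem modNorm_profile_le {b q : ℝ} (hb : 1 / 2 < b) (hb1 : b < 1) (hq1 : 1 ≤ q) (hq2 : q ≤ 2)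
    (hl : -(1 / 2) ≤ l) (hr : r ≤ 1 / 2)
    (hH : ∀ n, ContinuousOn (fun t => H t n) (Icc l r)) :
    modNorm b w (profile c (Icc l r) H) ≤
      duhamelConst b q * (wNorm w c + lqNorm q (Icc l r) fun t => wNorm w (H t)) := by
  have hm : ∀ n, Measurable fun t => (Icc l r).indicator H t n := by
    intro n
    simp_rw [indicator_apply_coord]
    rw [← piecewise_eq_indicator]
    exact (hH n).measurable_piecewise continuousOn_const measurableSet_Icc
  refine modNorm_duhamel_le (G := (Icc l r).indicator H) hb hb1 hq1 hq2 hm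
    (integrable_indicator_coord hH) (S := {l, r}) (by simp) (fun n t ht => ?_) (fun t ht => ?_) ?_
  · simp_rw [indicator_apply_coord]
    have hfr : t ∉ frontier (Icc l r) := by
      intro h
      by_cases hlr : l ≤ r
      · rw [frontier_Icc hlr] at h; exact ht h
      · rw [Icc_eq_empty hlr, frontier_empty] at h; exact h
    by_cases h : t ∈ Icc l r
    · have hn : Icc l r ∈ 𝓝 t := by
        rw [mem_interior_iff_mem_nhds.symm]
        by_contra h'
        exact hfr ⟨subset_closure h, h'⟩
      refine ((hH n).continuousAt hn).congr ?_
      filter_upwards [hn] with x hx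
      rw [indicator_of_mem hx]
    · refine (continuousAt_const (y := (0 : ℂ))).congr ?_
      filter_upwards [isClosed_Icc.isOpen_compl.mem_nhds h] with x hx
      rw [indicator_of_notMem hx]
  · exact indicator_of_notMem (fun h => ht ⟨hl.trans h.1, h.2.trans hr⟩) _
  · refine lqNorm_le_of_rpow_le (by linarith) ?_
    rw [lqNorm_rpow (by linarith), setLIntegral_univ, ← lintegral_indicator measurableSet_Icc]
    refine lintegral_mono fun t => ?_
    by_cases h : t ∈ Icc l r
    · simp [h]
    · simp only [indicator_of_notMem h, wNorm_zero]
      rw [ENNReal.zero_rpow_of_pos (by linarith)]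

/-- On the interval, the evolution of the profile is Duhamel's formula. -/
theorem evol_profile {α b : ℝ} (hb : 1 / 2 < b) (hw : IsWeight s C₀ w)
    (hl : -(1 / 2) ≤ l) (hl0 : l ≤ 0) (hr0 : 0 ≤ r) (hr : r ≤ 1 / 2)
    (hH : ∀ n, ContinuousOn (fun t => H t n) (Icc l r))
    (hK : modNorm b w (profile c (Icc l r) H) < ⊤) {t : ℝ} (ht : t ∈ Icc l r) :
    evol α (profile c (Icc l r) H) t = duhamel α c H t := by
  funext n
  have hc := continuous_cutPrimitive (c := c) hH n
  have hi : Integrable (cutPrimitive c (Icc l r) H n) := hc.integrable_of_hasCompactSupport (hasCompactSupport_cutPrimitive _ n)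
  have hf := integrable_of_modWeight hb (measurable_profile hH n)
    (lintegral_lt_top_of_modNorm hw hK n)
  have key := congrFun (hc.fourierInv_fourier_eq hi hf) t
  rw [cutPrimitive_eq hl hl0 hr0 hr ht, Real.fourierInv_eq'] at key
  rw [evol, duhamel, ← key]
  congr 1
  refine integral_congr_ae (Eventually.of_forall fun ξ => ?_)
  simp only [smul_eq_mul, profile]
  congr 2
  simp
  ring

/-- Duhamel's formula on a time interval extends to an element of `X^{σ,b}`. -/
theorem xsbNorm_evol_profile {α σ b : ℝ} (μ : ℕ → ℝ)
    (hμ : ∀ n, w n = |μ n| * bracket (besselZero n) ^ σ)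
    (hH : ∀ n, ContinuousOn (fun t => H t n) (Icc l r)) :
    xsbNorm α σ b (fun t n => (μ n : ℂ) * (Complex.exp (-(Complex.I * freq α n * t)) *
      cutPrimitive c (Icc l r) H n t)) = modNorm b w (profile c (Icc l r) H) := by
  have hc := fun n => (continuous_cutPrimitive (c := c) hH n).const_smul (μ n : ℂ)
  have hs : ∀ n, HasCompactSupport ((μ n : ℂ) • cutPrimitive c (Icc l r) H n) := fun n =>
    (hasCompactSupport_cutPrimitive _ n).smul_left
  have e := xsbNorm_eq_modNorm α σ b (fun n => (hc n).memLp_of_hasCompactSupport (hs n))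
    fun n => (hc n).integrable_of_hasCompactSupport (hs n)
  have e1 : (fun (t : ℝ) n => (μ n : ℂ) * (Complex.exp (-(Complex.I * freq α n * t)) *
      cutPrimitive c (Icc l r) H n t)) = fun (t : ℝ) n =>
        Complex.exp (-(Complex.I * freq α n * t)) *
          ((μ n : ℂ) • cutPrimitive c (Icc l r) H n) t := by
    funext t n
    simp only [Pi.smul_apply, smul_eq_mul]
    ring
  rw [e1]
  refine e.trans ?_
  rw [modNorm, modNorm]
  congr 1
  refine tsum_congr fun n => ?_
  have e2 : ∀ ξ, 𝓕 ((μ n : ℂ) • cutPrimitive c (Icc l r) H n) ξ =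
      μ n * profile c (Icc l r) H n ξ := by
    intro ξ
    rw [profile, Real.fourier_real_eq_integral_exp_smul, Real.fourier_real_eq_integral_exp_smul,
      ← integral_const_mul]
    refine integral_congr_ae (Eventually.of_forall fun t => ?_)
    simp only [Pi.smul_apply, smul_eq_mul]
    ring
  rw [← lintegral_const_mul' _ _ ENNReal.ofReal_ne_top,
    ← lintegral_const_mul' _ _ ENNReal.ofReal_ne_top]
  refine lintegral_congr fun ξ => ?_
  rw [e2, enorm_mul, mul_pow, hμ n, mul_pow, sq_abs, ENNReal.ofReal_mul (sq_nonneg _),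
    ← ofReal_norm (μ n : ℂ), Complex.norm_real, ← ENNReal.ofReal_pow (norm_nonneg _),
    Real.norm_eq_abs, sq_abs]
  ring

end

/-! ### Continuity of the linear evolution -/

/-- The linear evolution of a profile in `X^{w,b}`, `b > 1/2`, is continuous in the `w`-norm. -/
theorem tendsto_wNorm_evol_sub (α : ℝ) {b : ℝ} (hb : 1 / 2 < b) (hw : IsWeight s C₀ w) {h : ℕ → ℝ → ℂ}
    (hm : ∀ n, Measurable (h n)) (hK : modNorm b w h < ⊤) (t : ℝ) :
    Tendsto (fun t' => wNorm w (evol α h t' - evol α h t)) (𝓝 t) (𝓝 0) := by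
  have hi := fun n => integrable_of_modWeight hb (hm n) (lintegral_lt_top_of_modNorm hw hK n)
  set Q : ℕ → ℝ≥0∞ := fun n => ∫⁻ ξ, ENNReal.ofReal (modWeight b ξ) * ‖h n ξ‖ₑ ^ 2 with hQ
  set F : ℝ → ℕ → ℝ≥0∞ := fun t' n =>
    ENNReal.ofReal (w n ^ 2) * ‖(evol α h t' - evol α h t) n‖ₑ ^ 2 with hF
  have hdom : ∀ t' n, F t' n ≤ 4 * modConst b * (ENNReal.ofReal (w n ^ 2) * Q n) := by
    intro t' n
    have h1 : ‖(evol α h t' - evol α h t) n‖ₑ ^ 2 ≤ 2 * (modConst b * Q n + modConst b * Q n) := by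
      refine (pow_le_pow_left' (enorm_sub_le) 2).trans ((add_sq_le_enn _ _).trans ?_)
      gcongr
      · exact enorm_evol_sq_le α b hm t' n
      · exact enorm_evol_sq_le α b hm t n
    calc F t' n ≤ ENNReal.ofReal (w n ^ 2) * (2 * (modConst b * Q n + modConst b * Q n)) := by
          exact mul_le_mul_right h1 _
      _ = _ := by ring
  have hfin : ∫⁻ n, 4 * modConst b * (ENNReal.ofReal (w n ^ 2) * Q n) ∂Measure.count ≠ ⊤ := by
    rw [lintegral_count, ENNReal.tsum_mul_left, ← modNorm_sq]
    exact (ENNReal.mul_lt_top (ENNReal.mul_lt_top (by simp) (modConst_lt_top hb))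
      (ENNReal.pow_lt_top hK)).ne
  have h1 : Tendsto (fun t' => ∫⁻ n, F t' n ∂Measure.count) (𝓝 t) (𝓝 (∫⁻ _ : ℕ, 0 ∂Measure.count)) := by
    refine tendsto_lintegral_filter_of_dominated_convergence _
      (Eventually.of_forall fun t' => measurable_of_countable _)
      (Eventually.of_forall fun t' => Eventually.of_forall (hdom t')) hfin
      (Eventually.of_forall fun n => ?_)
    have hc : Continuous fun t' => ENNReal.ofReal (w n ^ 2) * ‖(evol α h t' - evol α h t) n‖ₑ ^ 2 := by
      refine ENNReal.continuous_const_mul ENNReal.ofReal_ne_top |>.comp ?_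
      have := continuous_evol α (hi n)
      exact (ENNReal.continuous_pow 2).comp ((this.sub continuous_const).enorm)
    have := hc.tendsto t
    simpa [hF] using this
  rw [lintegral_zero] at h1
  have h2 := h1.ennrpow_const (1 / 2)
  rw [ENNReal.zero_rpow_of_pos (by norm_num)] at h2
  refine h2.congr fun t' => ?_
  rw [lintegral_count, wNorm_eq]

/-! ### Functions with a profile in `X^{w,b}`, and the cubic forcing -/

/-- The ranges of the parameters for which the linear and trilinear estimates hold. -/
structure Admissible (α s C₀ b q θ ε : ℝ) (w : ℕ → ℝ) : Prop where
  half_le_α : 1 / 2 ≤ α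
  half_le_s : 1 / 2 ≤ s
  half_lt_b : 1 / 2 < b
  b_lt_one : b < 1
  one_le_q : 1 ≤ q
  q_le_two : q ≤ 2
  θ_nonneg : 0 ≤ θ
  θ_le_one : θ ≤ 1
  ε_pos : 0 < ε
  ε_le_one : ε ≤ 1
  weight : IsWeight s C₀ w

/-- At almost every time in `E`, the function `u` is the linear evolution of a profile whose
`X^{w,b}` norm is at most `K`. -/
def Represented (α b : ℝ) (w : ℕ → ℝ) (E : Set ℝ) (u : ℝ → ℕ → ℂ) (K : ℝ≥0∞) : Prop :=
  ∃ h : ℕ → ℝ → ℂ, (∀ n, Measurable (h n)) ∧ modNorm b w h ≤ K ∧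
    ∀ᵐ t ∂volume.restrict E, u t = evol α h t

theorem Represented.mono {α b : ℝ} {E F : Set ℝ} {u : ℝ → ℕ → ℂ} {K L : ℝ≥0∞}
    (h : Represented α b w E u K) (hF : F ⊆ E) (hL : K ≤ L) : Represented α b w F u L := by
  obtain ⟨k, hm, hK, he⟩ := h
  exact ⟨k, hm, hK.trans hL, ae_restrict_of_ae_restrict_of_subset hF he⟩

section

variable {α b q θ ε : ℝ} {E : Set ℝ} {u v z : ℝ → ℕ → ℂ} {K L M : ℝ≥0∞}

theorem Represented.lqNorm_tri_le (hA : Admissible α s C₀ b q θ ε w)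
    (hu : Represented α b w E u K) (hv : Represented α b w E v L) (hz : Represented α b w E z M)
    (hK : K < ⊤) (hL : L < ⊤) (hM : M < ⊤) (hE : E ⊆ Icc (-1) 1) :
    lqNorm q E (fun t => wNorm w (tri (u t) (v t) (z t))) ≤
      nonlinConst s C₀ b q θ ε * (volume E ^ (θ / q) * (K * L * M)) := by
  obtain ⟨h, hm, hK', hu⟩ := hu
  obtain ⟨k, km, kK', hv⟩ := hv
  obtain ⟨l, lm, lK', hz⟩ := hz
  have hq := one_pos.trans_le hA.one_le_q
  refine (lqNorm_mono_ae (g := fun t => wNorm w (tri (evol α h t) (evol α k t) (evol α l t)))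
    hq.le ?_).trans ((lqNorm_tri_evol_le hA.half_le_α hA.half_lt_b hA.half_le_s
    hA.weight hm km lm (hK'.trans_lt hK) (kK'.trans_lt hL) (lK'.trans_lt hM) hA.one_le_q
    hA.θ_nonneg hA.θ_le_one hA.ε_pos hA.ε_le_one hE).trans (by gcongr))
  filter_upwards [hu, hv, hz] with t h1 h2 h3
  rw [h1, h2, h3]

theorem Represented.wNorm_le (hu : Represented α b w E u K) :
    ∀ᵐ t ∂volume.restrict E, wNorm w (u t) ≤ modConst b ^ (1 / 2 : ℝ) * K := by
  obtain ⟨h, hm, hK', hu⟩ := hu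
  filter_upwards [hu] with t ht
  rw [ht]
  exact (wNorm_evol_le α b hm t).trans (by gcongr)

/-- The cubic forcing in the frame moving with the free flow. -/
def force (α : ℝ) (u : ℝ → ℕ → ℂ) (t : ℝ) (n : ℕ) : ℂ :=
  -Complex.I * Complex.exp (Complex.I * freq α n * t) * cubic (u t) n

theorem wNorm_force_sub (α : ℝ) (u v : ℝ → ℕ → ℂ) (t : ℝ) :
    wNorm w (force α u t - force α v t) = wNorm w (cubic (u t) - cubic (v t)) := by
  refine wNorm_congr_norm fun n => ?_
  have : ‖Complex.exp (Complex.I * freq α n * t)‖ = 1 := by rw [Complex.norm_exp]; simp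
  simp only [Pi.sub_apply, force, ← mul_sub]
  rw [norm_mul, norm_mul, this]
  simp

theorem wNorm_force (α : ℝ) (u : ℝ → ℕ → ℂ) (t : ℝ) :
    wNorm w (force α u t) = wNorm w (cubic (u t)) := by
  refine wNorm_congr_norm fun n => ?_
  have : ‖Complex.exp (Complex.I * freq α n * t)‖ = 1 := by rw [Complex.norm_exp]; simp
  simp only [force]
  rw [norm_mul, norm_mul, this]
  simp

/-- Continuity of a curve in the space of sequences with finite `w`-norm. -/
structure WContinuousOn (w : ℕ → ℝ) (u : ℝ → ℕ → ℂ) (J : Set ℝ) : Prop where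
  finite : ∀ t ∈ J, wNorm w (u t) < ⊤
  tendsto : ∀ t ∈ J, Tendsto (fun t' => wNorm w (u t' - u t)) (𝓝[J] t) (𝓝 0)

theorem WContinuousOn.mono {J J' : Set ℝ} (h : WContinuousOn w u J) (hJ : J' ⊆ J) :
    WContinuousOn w u J' :=
  ⟨fun t ht => h.finite t (hJ ht), fun t ht => (h.tendsto t (hJ ht)).mono_left
    (nhdsWithin_mono t hJ)⟩

theorem WContinuousOn.continuousOn_cubic (hs : 1 / 2 ≤ s) (hw : IsWeight s C₀ w) {J : Set ℝ}
    (h : WContinuousOn w u J) (n : ℕ) : ContinuousOn (fun t => cubic (u t) n) J := by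
  intro t ht
  have hf := h.finite t ht
  have ht := h.tendsto t ht
  simp only [ContinuousWithinAt, cubic_eq_tri]
  exact tendsto_tri hs hw hf hf hf ht ht ht n

theorem WContinuousOn.continuousOn_force (α : ℝ) (hs : 1 / 2 ≤ s) (hw : IsWeight s C₀ w) {J : Set ℝ}
    (h : WContinuousOn w u J) (n : ℕ) : ContinuousOn (fun t => force α u t n) J :=
  ((by fun_prop : Continuous fun t : ℝ => -Complex.I * Complex.exp (Complex.I * freq α n * t)).continuousOn).mul
    (h.continuousOn_cubic hs hw n)

theorem wContinuousOn_evol (α : ℝ) (hb : 1 / 2 < b) (hw : IsWeight s C₀ w) {h : ℕ → ℝ → ℂ}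
    (hm : ∀ n, Measurable (h n)) (hK : modNorm b w h < ⊤) {J : Set ℝ} (hu : ∀ t ∈ J, u t = evol α h t) :
    WContinuousOn w u J := by
  constructor
  · intro t ht
    rw [hu t ht]
    exact (wNorm_evol_le α b hm t).trans_lt (ENNReal.mul_lt_top
      (ENNReal.rpow_lt_top_of_nonneg (by norm_num) (modConst_lt_top hb).ne) hK)
  · intro t ht
    refine ((tendsto_wNorm_evol_sub α hb hw hm hK t).mono_left nhdsWithin_le_nhds).congr' ?_
    filter_upwards [self_mem_nhdsWithin] with t' ht'
    rw [hu t ht, hu t' ht']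

/-- Integral form of the equation on `J`, for `w`-continuous `u`. -/
structure IsMild (α : ℝ) (w : ℕ → ℝ) (c : ℕ → ℂ) (J : Set ℝ) (u : ℝ → ℕ → ℂ) : Prop extends
    WContinuousOn w u J where
  eq_duhamel : ∀ t ∈ J, u t = duhamel α c (force α u) t

theorem IsMild.mono {c : ℕ → ℂ} {J J' : Set ℝ} (h : IsMild α w c J u) (hJ : J' ⊆ J) :
    IsMild α w c J' u :=
  ⟨h.toWContinuousOn.mono hJ, fun t ht => h.eq_duhamel t (hJ ht)⟩

theorem cubic_sub_cubic (hs : 1 / 2 ≤ s) (hw : IsWeight s C₀ w) {a c : ℕ → ℂ} (ha : wNorm w a < ⊤)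
    (hc : wNorm w c < ⊤) :
    cubic a - cubic c = tri (a - c) a a + tri c (a - c) a + tri c c (a - c) := by
  rw [cubic_eq_tri, cubic_eq_tri, tri_sub_tri hs hw ha ha ha hc hc hc]

theorem Represented.aemeasurable_tri (hA : Admissible α s C₀ b q θ ε w)
    (hu : Represented α b w E u K) (hv : Represented α b w E v L) (hz : Represented α b w E z M)
    (hK : K < ⊤) (hL : L < ⊤) (hM : M < ⊤) :
    AEMeasurable (fun t => wNorm w (tri (u t) (v t) (z t))) (volume.restrict E) := by
  obtain ⟨h, hm, hK', hu⟩ := hu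
  obtain ⟨k, km, kK', hv⟩ := hv
  obtain ⟨l, lm, lK', hz⟩ := hz
  have hw := hA.weight
  have hb := hA.half_lt_b
  have key : ∀ n, Continuous fun t => tri (evol α h t) (evol α k t) (evol α l t) n := by
    intro n
    refine continuous_iff_continuousAt.2 fun t => ?_
    have hh := wContinuousOn_evol (J := univ) α hb hw hm (hK'.trans_lt hK) fun _ _ => rfl
    have kk := wContinuousOn_evol (J := univ) α hb hw km (kK'.trans_lt hL) fun _ _ => rfl
    have ll := wContinuousOn_evol (J := univ) α hb hw lm (lK'.trans_lt hM) fun _ _ => rfl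
    exact tendsto_tri hA.half_le_s hw (hh.finite t trivial) (kk.finite t trivial)
      (ll.finite t trivial) (by simpa using hh.tendsto t trivial)
      (by simpa using kk.tendsto t trivial) (by simpa using ll.tendsto t trivial) n
  have m : AEMeasurable (fun t => wNorm w (tri (evol α h t) (evol α k t) (evol α l t)))
      (volume.restrict E) := measurable_wNorm fun n => (key n).aestronglyMeasurable
  refine m.congr ?_
  filter_upwards [hu, hv, hz] with t h1 h2 h3
  rw [h1, h2, h3]

theorem Represented.lqNorm_cubic_le (hA : Admissible α s C₀ b q θ ε w)
    (hu : Represented α b w E u K) (hK : K < ⊤) (hE : E ⊆ Icc (-1) 1) :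
    lqNorm q E (fun t => wNorm w (cubic (u t))) ≤
      nonlinConst s C₀ b q θ ε * volume E ^ (θ / q) * K ^ 3 := by
  simp_rw [cubic_eq_tri]
  exact (hu.lqNorm_tri_le hA hu hu hK hK hK hE).trans (le_of_eq (by ring))

/-- On a short set of times the cubic forcing is a contraction on bounded sets of profiles. -/
theorem lqNorm_cubic_sub_le (hA : Admissible α s C₀ b q θ ε w)
    (hu : Represented α b w E u K) (hv : Represented α b w E v K)
    (hz : Represented α b w E (fun t => u t - v t) M)
    (hK : K < ⊤) (hM : M < ⊤) (hE : E ⊆ Icc (-1) 1) :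
    lqNorm q E (fun t => wNorm w (cubic (u t) - cubic (v t))) ≤
      3 * nonlinConst s C₀ b q θ ε * volume E ^ (θ / q) * K ^ 2 * M := by
  have hq := one_pos.trans_le hA.one_le_q
  have m1 := hz.aemeasurable_tri hA hu hu hM hK hK
  have m2 := hv.aemeasurable_tri hA hz hu hK hM hK
  have m3 := hv.aemeasurable_tri hA hv hz hK hK hM
  have fin : modConst b ^ (1 / 2 : ℝ) * K < ⊤ := ENNReal.mul_lt_top
    (ENNReal.rpow_lt_top_of_nonneg (by norm_num) (modConst_lt_top hA.half_lt_b).ne) hK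
  calc _ ≤ lqNorm q E fun t => (wNorm w (tri (u t - v t) (u t) (u t)) +
        wNorm w (tri (v t) (u t - v t) (u t))) + wNorm w (tri (v t) (v t) (u t - v t)) := by
        refine lqNorm_mono_ae hq.le ?_
        filter_upwards [hu.wNorm_le, hv.wNorm_le] with t h1 h2
        rw [cubic_sub_cubic hA.half_le_s hA.weight (h1.trans_lt fin) (h2.trans_lt fin)]
        exact (wNorm_add_le _ _ _).trans (add_le_add (wNorm_add_le _ _ _) le_rfl)
    _ ≤ nonlinConst s C₀ b q θ ε * (volume E ^ (θ / q) * (M * K * K)) +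
        nonlinConst s C₀ b q θ ε * (volume E ^ (θ / q) * (K * M * K)) +
        nonlinConst s C₀ b q θ ε * (volume E ^ (θ / q) * (K * K * M)) := by
        refine (lqNorm_add_le hA.one_le_q (m1.add m2) m3).trans (add_le_add
          ((lqNorm_add_le hA.one_le_q m1 m2).trans (add_le_add ?_ ?_)) ?_)
        · exact hz.lqNorm_tri_le hA hu hu hM hK hK hE
        · exact hv.lqNorm_tri_le hA hz hu hK hM hK hE
        · exact hv.lqNorm_tri_le hA hv hz hK hK hM hE
    _ = _ := by ring

/-- Duhamel's formula produces functions with profiles. -/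
theorem represented_duhamel (hA : Admissible α s C₀ b q θ ε w) (hD : duhamelConst b q < ⊤)
    {c : ℕ → ℂ} {H : ℝ → ℕ → ℂ} {l r : ℝ} (hl : -(1 / 2) ≤ l) (hl0 : l ≤ 0) (hr0 : 0 ≤ r)
    (hr : r ≤ 1 / 2) (hH : ∀ n, ContinuousOn (fun t => H t n) (Icc l r)) (hc : wNorm w c < ⊤)
    (hM : lqNorm q (Icc l r) (fun t => wNorm w (H t)) < ⊤) :
    (∀ n, Measurable (profile c (Icc l r) H n)) ∧
    modNorm b w (profile c (Icc l r) H) ≤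
      duhamelConst b q * (wNorm w c + lqNorm q (Icc l r) fun t => wNorm w (H t)) ∧
    modNorm b w (profile c (Icc l r) H) < ⊤ ∧
    ∀ t ∈ Icc l r, duhamel α c H t = evol α (profile c (Icc l r) H) t := by
  have h1 := modNorm_profile_le (c := c) (w := w) hA.half_lt_b hA.b_lt_one hA.one_le_q hA.q_le_two hl hr hH
  have h2 := h1.trans_lt (ENNReal.mul_lt_top hD (ENNReal.add_lt_top.2 ⟨hc, hM⟩))
  exact ⟨measurable_profile hH, h1, h2, fun t ht =>
    (evol_profile hA.half_lt_b hA.weight hl hl0 hr0 hr hH h2 ht).symm⟩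

theorem duhamel_sub (α : ℝ) {c d : ℕ → ℂ} {H G : ℝ → ℕ → ℂ} {l r : ℝ} (hl0 : l ≤ 0) (hr0 : 0 ≤ r)
    (hH : ∀ n, ContinuousOn (fun t => H t n) (Icc l r))
    (hG : ∀ n, ContinuousOn (fun t => G t n) (Icc l r)) {t : ℝ} (ht : t ∈ Icc l r) :
    duhamel α c H t - duhamel α d G t = duhamel α (c - d) (fun t => H t - G t) t := by
  funext n
  have hsub : uIcc 0 t ⊆ Icc l r := ordConnected_Icc.uIcc_subset ⟨hl0, hr0⟩ ht
  simp only [duhamel, Pi.sub_apply]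
  rw [intervalIntegral.integral_sub ((hH n).mono hsub).intervalIntegrable
    ((hG n).mono hsub).intervalIntegrable]
  ring

/-- If `x ≤ a + y x` with `y ≤ 1/2` and `x` finite, then `x ≤ 2 a`. -/
theorem le_two_mul_of_absorb {x a y : ℝ≥0∞} (hx : x < ⊤) (hy : y ≤ 1 / 2) (h : x ≤ a + y * x) :
    x ≤ 2 * a := by
  rcases eq_or_ne a ⊤ with rfl | ha
  · simp
  lift x to ℝ≥0 using hx.ne
  lift a to ℝ≥0 using ha
  lift y to ℝ≥0 using (hy.trans_lt (by simp)).ne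
  have hy' : (y : ℝ) ≤ 1 / 2 := by
    have : (y : ℝ≥0∞) ≤ ((1 / 2 : ℝ≥0) : ℝ≥0∞) := by
      refine hy.trans (le_of_eq ?_)
      rw [ENNReal.coe_div (by norm_num)]; simp
    exact_mod_cast this
  have h' : (x : ℝ) ≤ a + y * x := by exact_mod_cast h
  have : (x : ℝ) ≤ 2 * a := by nlinarith [x.2]
  exact_mod_cast this

/-- Two solutions of the integral equation with profiles which agree outside a short set of times
`E`: their difference has a profile controlled by the difference of the data. -/
theorem represented_sub (hA : Admissible α s C₀ b q θ ε w) (hD : duhamelConst b q < ⊤)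
    (hN : nonlinConst s C₀ b q θ ε < ⊤) {c d : ℕ → ℂ} {l r : ℝ} (hl : -(1 / 2) ≤ l) (hl0 : l ≤ 0)
    (hr0 : 0 ≤ r) (hr : r ≤ 1 / 2) (hc : wNorm w c < ⊤) (hd : wNorm w d < ⊤)
    (hu : IsMild α w c (Icc l r) u) (hv : IsMild α w d (Icc l r) v)
    (ru : Represented α b w (Icc l r) u K) (rv : Represented α b w (Icc l r) v K) (hK : K < ⊤)
    (hE : E ⊆ Icc l r) (hEm : MeasurableSet E) (heq : ∀ t ∈ Icc l r \ E, u t = v t)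
    (hsmall : duhamelConst b q * (3 * nonlinConst s C₀ b q θ ε * volume E ^ (θ / q) * K ^ 2) ≤ 1 / 2) :
    (∀ n, Measurable (profile (c - d) (Icc l r) (fun t => force α u t - force α v t) n)) ∧
    modNorm b w (profile (c - d) (Icc l r) fun t => force α u t - force α v t) ≤
      2 * duhamelConst b q * wNorm w (c - d) ∧
    ∀ t ∈ Icc l r, u t - v t = duhamel α (c - d) (fun t => force α u t - force α v t) t ∧
      u t - v t = evol α (profile (c - d) (Icc l r) fun t => force α u t - force α v t) t := by
  have hq := one_pos.trans_le hA.one_le_q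
  have hI : Icc l r ⊆ Icc (-1) 1 := Icc_subset_Icc (by linarith) (by linarith)
  have fu := hu.continuousOn_force α hA.half_le_s hA.weight
  have fv := hv.continuousOn_force α hA.half_le_s hA.weight
  have fuv : ∀ n, ContinuousOn (fun t => (force α u t - force α v t) n) (Icc l r) := fun n =>
    (fu n).sub (fv n)
  have mm : ∀ {f : ℝ → ℕ → ℂ}, (∀ n, ContinuousOn (fun t => f t n) (Icc l r)) →
      AEMeasurable (fun t => wNorm w (f t)) (volume.restrict (Icc l r)) := fun hf =>
    measurable_wNorm fun n => (hf n).aestronglyMeasurable measurableSet_Icc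
  have fin : ∀ {f : ℝ → ℕ → ℂ}, Represented α b w (Icc l r) f K →
      lqNorm q (Icc l r) (fun t => wNorm w (force α f t)) < ⊤ := by
    intro f hf
    simp_rw [wNorm_force]
    refine (hf.lqNorm_cubic_le hA hK hI).trans_lt (ENNReal.mul_lt_top (ENNReal.mul_lt_top hN
      (ENNReal.rpow_lt_top_of_nonneg (div_nonneg hA.θ_nonneg hq.le) ?_)) (ENNReal.pow_lt_top hK))
    rw [Real.volume_Icc]
    exact ENNReal.ofReal_ne_top
  have hM : lqNorm q (Icc l r) (fun t => wNorm w (force α u t - force α v t)) < ⊤ := by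
    refine (lqNorm_mono hq.le fun t => wNorm_sub_le w _ _).trans_lt ?_
    exact (lqNorm_add_le hA.one_le_q (mm fu) (mm fv)).trans_lt
      (ENNReal.add_lt_top.2 ⟨fin ru, fin rv⟩)
  have hcd : wNorm w (c - d) < ⊤ :=
    (wNorm_sub_le w _ _).trans_lt (ENNReal.add_lt_top.2 ⟨hc, hd⟩)
  obtain ⟨p1, p2, p3, p4⟩ := represented_duhamel (α := α) hA hD hl hl0 hr0 hr fuv hcd hM
  set x := modNorm b w (profile (c - d) (Icc l r) fun t => force α u t - force α v t) with hx
  have hdu : ∀ t ∈ Icc l r,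
      u t - v t = duhamel α (c - d) (fun t => force α u t - force α v t) t := fun t ht => by
    rw [← duhamel_sub α hl0 hr0 fu fv ht, ← hu.eq_duhamel t ht, ← hv.eq_duhamel t ht]
  have rz : Represented α b w E (fun t => u t - v t) x := by
    refine ⟨_, p1, le_rfl, ?_⟩
    filter_upwards [ae_restrict_mem hEm] with t ht
    rw [hdu t (hE ht), p4 t (hE ht)]
  have hEq : lqNorm q (Icc l r) (fun t => wNorm w (force α u t - force α v t)) ≤
      lqNorm q E (fun t => wNorm w (cubic (u t) - cubic (v t))) := by
    simp_rw [wNorm_force_sub]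
    refine lqNorm_le_of_rpow_le hq ?_
    rw [lqNorm_rpow hq, ← lintegral_indicator measurableSet_Icc, ← lintegral_indicator hEm]
    refine lintegral_mono fun t => ?_
    by_cases h : t ∈ E
    · rw [indicator_of_mem h, indicator_of_mem (hE h)]
    · by_cases h' : t ∈ Icc l r
      · rw [indicator_of_notMem h, indicator_of_mem h', heq t ⟨h', h⟩, sub_self, wNorm_zero,
          ENNReal.zero_rpow_of_pos hq]
      · rw [indicator_of_notMem h, indicator_of_notMem h']
  refine ⟨p1, ?_, fun t ht => ⟨hdu t ht, (hdu t ht).trans (p4 t ht)⟩⟩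
  rw [mul_assoc]
  refine le_two_mul_of_absorb p3 hsmall (p2.trans ?_)
  rw [mul_add, mul_assoc (duhamelConst b q)]
  gcongr
  exact hEq.trans (lqNorm_cubic_sub_le hA (ru.mono hE le_rfl) (rv.mono hE le_rfl) rz hK p3
    (hE.trans hI))

end

/-! ### Uniqueness and existence for the integral equation -/

theorem IsWeight.eq_zero_of_wNorm (hw : IsWeight s C₀ w) {c : ℕ → ℂ} (h : wNorm w c = 0) : c = 0 := by
  funext n
  have h1 := enorm_le_wNorm w c n
  rw [h, nonpos_iff_eq_zero, enorm_eq_zero, mul_eq_zero, Complex.ofReal_eq_zero] at h1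
  exact h1.resolve_left (hw.pos n).ne'

theorem exists_small_time {D : ℝ≥0∞} (hD : D < ⊤) {κ : ℝ} (hκ : 0 < κ) :
    ∃ η : ℝ, 0 < η ∧ D * ENNReal.ofReal (2 * η) ^ κ ≤ 1 / 2 := by
  have h1 : Tendsto (fun η : ℝ => D * ENNReal.ofReal (2 * η) ^ κ) (𝓝[>] 0) (𝓝 0) := by
    have h2 : Tendsto (fun η : ℝ => ENNReal.ofReal (2 * η)) (𝓝[>] 0) (𝓝 0) := by
      have : Continuous fun η : ℝ => ENNReal.ofReal (2 * η) :=
        ENNReal.continuous_ofReal.comp (continuous_const.mul continuous_id)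
      simpa using (this.tendsto 0).mono_left nhdsWithin_le_nhds
    have h3 := (ENNReal.Tendsto.const_mul (a := D) (h2.ennrpow_const κ) (Or.inr hD.ne))
    rwa [ENNReal.zero_rpow_of_pos hκ, mul_zero] at h3
  obtain ⟨η, h, hη⟩ := ((h1.eventually_le_const (u := 1 / 2) (by simp)).and
    self_mem_nhdsWithin).exists
  exact ⟨η, hη, h⟩

section

variable {α b q θ ε : ℝ} {u v : ℝ → ℕ → ℂ} {K : ℝ≥0∞} {c : ℕ → ℂ} {l r : ℝ}

/-- Unconditional on the length of the interval: the contraction argument is repeated on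
successive short intervals. -/
theorem IsMild.unique (hA : Admissible α s C₀ b q θ ε w) (hθ : 0 < θ) (hD : duhamelConst b q < ⊤)
    (hN : nonlinConst s C₀ b q θ ε < ⊤) (hl : -(1 / 2) ≤ l) (hl0 : l ≤ 0)
    (hr0 : 0 ≤ r) (hr : r ≤ 1 / 2) (hc : wNorm w c < ⊤)
    (hu : IsMild α w c (Icc l r) u) (hv : IsMild α w c (Icc l r) v)
    (ru : Represented α b w (Icc l r) u K) (rv : Represented α b w (Icc l r) v K) (hK : K < ⊤) :
    EqOn u v (Icc l r) := by
  have hq := one_pos.trans_le hA.one_le_q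
  obtain ⟨η, hη, hsmall⟩ := exists_small_time
    (D := duhamelConst b q * (3 * nonlinConst s C₀ b q θ ε * K ^ 2))
    (ENNReal.mul_lt_top hD (ENNReal.mul_lt_top (ENNReal.mul_lt_top (by simp) hN)
      (ENNReal.pow_lt_top hK))) (div_pos hθ hq)
  -- `u` and `v` agree for `|t| ≤ k η` by induction on `k`: in the step, the difference of the
  -- nonlinearities lives on two intervals of length at most `η`, so it can be absorbed
  have key : ∀ k : ℕ, ∀ t ∈ Icc l r, |t| ≤ k * η → u t = v t := by
    intro k
    induction k with
    | zero =>
      intro t ht h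
      have h0 : t = 0 := by simpa using h
      subst h0
      rw [hu.eq_duhamel 0 ht, hv.eq_duhamel 0 ht]
      funext n
      simp [duhamel]
    | succ k ih =>
      intro t ht hk
      push_cast at hk
      set J : Set ℝ := Icc (max l (-((k + 1) * η))) (min r ((k + 1) * η)) with hJ
      have hkη : 0 ≤ ((k : ℝ) + 1) * η := by positivity
      have hJs : J ⊆ Icc l r := Icc_subset_Icc (le_max_left _ _) (min_le_left _ _)
      set E : Set ℝ := J \ Icc (-(k * η)) (k * η) with hE
      have hvol : volume E ≤ ENNReal.ofReal (2 * η) := by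
        have hsub : E ⊆ Icc (-((k + 1) * η)) (-(k * η)) ∪ Icc (k * η) ((k + 1) * η) := by
          rintro x ⟨hx, hx'⟩
          have h1 := (le_max_right _ _).trans hx.1
          have h2 := hx.2.trans (min_le_right _ _)
          rcases le_total x 0 with h | h
          · refine Or.inl ⟨h1, ?_⟩
            by_contra hc
            exact hx' ⟨(not_le.1 hc).le, h.trans (by positivity)⟩
          · refine Or.inr ⟨?_, h2⟩
            by_contra hc
            exact hx' ⟨le_trans (neg_nonpos.2 (by positivity)) h, (not_le.1 hc).le⟩
        refine (measure_mono hsub).trans ((measure_union_le _ _).trans (le_of_eq ?_))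
        rw [Real.volume_Icc, Real.volume_Icc, ← ENNReal.ofReal_add (by linarith) (by linarith)]
        congr 1
        ring
      have hmem : t ∈ J := ⟨max_le ht.1 (abs_le.1 hk).1, le_min ht.2 (abs_le.1 hk).2⟩
      obtain ⟨p1, p2, p3⟩ := represented_sub (E := E) (d := c) hA hD hN (hl.trans (le_max_left _ _))
        (max_le hl0 (neg_nonpos.2 hkη)) (le_min hr0 hkη) ((min_le_left _ _).trans hr) hc hc
        (hu.mono hJs) (hv.mono hJs) (ru.mono hJs le_rfl) (rv.mono hJs le_rfl) hK sdiff_subset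
        (measurableSet_Icc.diff measurableSet_Icc) (fun x hx => by
          have hx1 := hx.1
          have hx2 : x ∈ Icc (-(k * η)) (k * η) := by
            by_contra h
            exact hx.2 ⟨hx1, h⟩
          exact ih x (hJs hx1) (abs_le.2 hx2)) (by
          refine le_trans ?_ hsmall
          calc _ ≤ duhamelConst b q * (3 * nonlinConst s C₀ b q θ ε *
                  ENNReal.ofReal (2 * η) ^ (θ / q) * K ^ 2) := by
                gcongr
            _ = _ := by ring)
      rw [show wNorm w (c - c) = 0 by rw [sub_self, wNorm_zero], mul_zero, nonpos_iff_eq_zero] at p2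
      have h3 := wNorm_evol_le (w := w) α b p1 t
      rw [p2, mul_zero, nonpos_iff_eq_zero, ← (p3 t hmem).2] at h3
      exact sub_eq_zero.1 (hA.weight.eq_zero_of_wNorm h3)
  intro t ht
  obtain ⟨k, hk⟩ := exists_nat_ge (|t| / η)
  exact key k t ht ((div_le_iff₀ hη).1 hk)

/-- The Picard iterates of the integral equation on `J`. -/
def picard (α : ℝ) (c : ℕ → ℂ) (J : Set ℝ) : ℕ → ℝ → ℕ → ℂ
  | 0 => fun _ => 0
  | k + 1 => fun t => evol α (profile c J (force α (picard α c J k))) t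

/-- As `Represented`, but at every time in `J`. -/
def RepresentedOn (α b : ℝ) (w : ℕ → ℝ) (J : Set ℝ) (u : ℝ → ℕ → ℂ) (K : ℝ≥0∞) : Prop :=
  ∃ h : ℕ → ℝ → ℂ, (∀ n, Measurable (h n)) ∧ modNorm b w h ≤ K ∧ ∀ t ∈ J, u t = evol α h t

theorem RepresentedOn.represented {J : Set ℝ} (hJ : MeasurableSet J) (h : RepresentedOn α b w J u K) :
    Represented α b w J u K := by
  obtain ⟨h, hm, hK, he⟩ := h
  exact ⟨h, hm, hK, by filter_upwards [ae_restrict_mem hJ] with t ht using he t ht⟩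

theorem RepresentedOn.wContinuousOn {J : Set ℝ} (hb : 1 / 2 < b) (hw : IsWeight s C₀ w)
    (h : RepresentedOn α b w J u K) (hK : K < ⊤) : WContinuousOn w u J := by
  obtain ⟨h, hm, hK', he⟩ := h
  exact wContinuousOn_evol α hb hw hm (hK'.trans_lt hK) he

theorem RepresentedOn.wNorm_le {J : Set ℝ} (h : RepresentedOn α b w J u K) {t : ℝ} (ht : t ∈ J) :
    wNorm w (u t) ≤ modConst b ^ (1 / 2 : ℝ) * K := by
  obtain ⟨h, hm, hK', he⟩ := h
  rw [he t ht]
  exact (wNorm_evol_le α b hm t).trans (by gcongr)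

/-- The data-to-profile map preserves the ball of radius `2 D ‖c‖`. -/
theorem modNorm_profile_force_le (hA : Admissible α s C₀ b q θ ε w) (hD : duhamelConst b q < ⊤)
    (hl : -(1 / 2) ≤ l) (hl0 : l ≤ 0)
    (hr0 : 0 ≤ r) (hr : r ≤ 1 / 2) (hc : wNorm w c < ⊤) (hKe : K = 2 * duhamelConst b q * wNorm w c)
    (hsmall : duhamelConst b q *
      (3 * nonlinConst s C₀ b q θ ε * volume (Icc l r) ^ (θ / q) * K ^ 2) ≤ 1 / 2)
    (hH : ∀ n, ContinuousOn (fun t => force α u t n) (Icc l r))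
    (hM : lqNorm q (Icc l r) (fun t => wNorm w (cubic (u t))) ≤
      nonlinConst s C₀ b q θ ε * volume (Icc l r) ^ (θ / q) * K ^ 3)
    (hM' : lqNorm q (Icc l r) (fun t => wNorm w (cubic (u t))) < ⊤) :
    (∀ n, Measurable (profile c (Icc l r) (force α u) n)) ∧
    modNorm b w (profile c (Icc l r) (force α u)) ≤ K ∧
    ∀ t ∈ Icc l r, duhamel α c (force α u) t = evol α (profile c (Icc l r) (force α u)) t := by
  obtain ⟨p1, p2, -, p4⟩ := represented_duhamel (α := α) hA hD hl hl0 hr0 hr hH hc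
    (by simp_rw [wNorm_force]; exact hM')
  refine ⟨p1, p2.trans ?_, p4⟩
  simp_rw [wNorm_force]
  have hh : (1 / 2 : ℝ≥0∞) * K = duhamelConst b q * wNorm w c := by
    rw [hKe, ← mul_assoc, ← mul_assoc, one_div, ENNReal.inv_mul_cancel (by simp) (by simp), one_mul]
  calc _ ≤ duhamelConst b q * wNorm w c + duhamelConst b q *
        (nonlinConst s C₀ b q θ ε * volume (Icc l r) ^ (θ / q) * K ^ 3) := by
        rw [mul_add]; gcongr
    _ ≤ duhamelConst b q * wNorm w c + duhamelConst b q *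
        (3 * nonlinConst s C₀ b q θ ε * volume (Icc l r) ^ (θ / q) * K ^ 2) * K := by
        refine add_le_add le_rfl ?_
        calc _ = 1 * (duhamelConst b q *
              (nonlinConst s C₀ b q θ ε * volume (Icc l r) ^ (θ / q) * K ^ 3)) := by ring
          _ ≤ 3 * (duhamelConst b q *
              (nonlinConst s C₀ b q θ ε * volume (Icc l r) ^ (θ / q) * K ^ 3)) := by
              gcongr; norm_num
          _ = _ := by ring
    _ ≤ duhamelConst b q * wNorm w c + 1 / 2 * K := by gcongr
    _ = K := by rw [← hh, ← add_mul, ENNReal.add_halves, one_mul]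

end

section

variable {α b q θ ε : ℝ} {K : ℝ≥0∞} {c : ℕ → ℂ} {l r : ℝ}

/-- The Picard iterates stay in the ball of radius `K`, and successive differences are halved. -/
theorem picard_succ_eq (hA : Admissible α s C₀ b q θ ε w) (hD : duhamelConst b q < ⊤)
    (hN : nonlinConst s C₀ b q θ ε < ⊤) (hl : -(1 / 2) ≤ l) (hl0 : l ≤ 0)
    (hr0 : 0 ≤ r) (hr : r ≤ 1 / 2) (hc : wNorm w c < ⊤) (hKe : K = 2 * duhamelConst b q * wNorm w c)
    (hsmall : duhamelConst b q *
      (3 * nonlinConst s C₀ b q θ ε * volume (Icc l r) ^ (θ / q) * K ^ 2) ≤ 1 / 2) (k : ℕ) :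
    RepresentedOn α b w (Icc l r) (picard α c (Icc l r) k) K ∧
    RepresentedOn α b w (Icc l r) (picard α c (Icc l r) (k + 1)) K ∧
    (∀ t ∈ Icc l r, picard α c (Icc l r) (k + 1) t =
      duhamel α c (force α (picard α c (Icc l r) k)) t) ∧
    RepresentedOn α b w (Icc l r)
      (fun t => picard α c (Icc l r) (k + 1) t - picard α c (Icc l r) k t) (K * (1 / 2) ^ k) := by
  have hq := one_pos.trans_le hA.one_le_q
  have hb := hA.half_lt_b
  have hw := hA.weight
  have hI : Icc l r ⊆ Icc (-1) 1 := Icc_subset_Icc (by linarith) (by linarith)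
  have hK : K < ⊤ := by
    rw [hKe]; exact ENNReal.mul_lt_top (ENNReal.mul_lt_top (by simp) hD) hc
  have hV : volume (Icc l r) ^ (θ / q) < ⊤ := by
    refine ENNReal.rpow_lt_top_of_nonneg (div_nonneg hA.θ_nonneg hq.le) ?_
    rw [Real.volume_Icc]
    exact ENNReal.ofReal_ne_top
  have step : ∀ k, RepresentedOn α b w (Icc l r) (picard α c (Icc l r) k) K →
      RepresentedOn α b w (Icc l r) (picard α c (Icc l r) (k + 1)) K ∧
      ∀ t ∈ Icc l r, picard α c (Icc l r) (k + 1) t =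
        duhamel α c (force α (picard α c (Icc l r) k)) t := by
    intro k hk
    have h1 := (hk.represented measurableSet_Icc).lqNorm_cubic_le hA hK hI
    obtain ⟨p1, p2, p3⟩ := modNorm_profile_force_le hA hD hl hl0 hr0 hr hc hKe hsmall
      ((hk.wContinuousOn hb hw hK).continuousOn_force α hA.half_le_s hw) h1
      (h1.trans_lt (ENNReal.mul_lt_top (ENNReal.mul_lt_top hN hV) (ENNReal.pow_lt_top hK)))
    exact ⟨⟨_, p1, p2, fun _ _ => rfl⟩, fun t ht => (p3 t ht).symm⟩
  have h0 : RepresentedOn α b w (Icc l r) (picard α c (Icc l r) 0) K := by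
    refine ⟨0, fun n => measurable_const, ?_, fun t _ => ?_⟩
    · simp [modNorm]
    · funext n
      simp [picard, evol]
  have all : ∀ k, RepresentedOn α b w (Icc l r) (picard α c (Icc l r) k) K := fun k => by
    induction k with
    | zero => exact h0
    | succ k ih => exact (step k ih).1
  refine ⟨all k, all (k + 1), (step k (all k)).2, ?_⟩
  induction k with
  | zero =>
    obtain ⟨h, hm, hK', he⟩ := all 1
    refine ⟨h, hm, by simpa using hK', fun t ht => ?_⟩
    rw [← he t ht]
    simp [picard]
  | succ k ih =>
    set u := picard α c (Icc l r) (k + 1) with hu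
    set v := picard α c (Icc l r) k with hv
    have ru := (all (k + 1)).represented measurableSet_Icc
    have rv := (all k).represented measurableSet_Icc
    have fu := ((all (k + 1)).wContinuousOn hb hw hK).continuousOn_force α hA.half_le_s hw
    have fv := ((all k).wContinuousOn hb hw hK).continuousOn_force α hA.half_le_s hw
    have fuv : ∀ n, ContinuousOn (fun t => (force α u t - force α v t) n) (Icc l r) := fun n =>
      (fu n).sub (fv n)
    have hKk : K * (1 / 2) ^ k < ⊤ := ENNReal.mul_lt_top hK (ENNReal.pow_lt_top (by simp))
    have h1 := lqNorm_cubic_sub_le hA ru rv (ih.represented measurableSet_Icc) hK hKk hI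
    have h2 : lqNorm q (Icc l r) (fun t => wNorm w (cubic (u t) - cubic (v t))) < ⊤ :=
      h1.trans_lt (ENNReal.mul_lt_top (ENNReal.mul_lt_top (ENNReal.mul_lt_top
        (ENNReal.mul_lt_top (by simp) hN) hV) (ENNReal.pow_lt_top hK)) hKk)
    obtain ⟨p1, p2, -, p4⟩ := represented_duhamel (α := α) (w := w) (c := c - c) hA hD hl hl0 hr0 hr
      fuv (by rw [sub_self, wNorm_zero]; simp) (by simp_rw [wNorm_force_sub]; exact h2)
    refine ⟨_, p1, p2.trans ?_, fun t ht => ?_⟩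
    · simp_rw [wNorm_force_sub]
      rw [show wNorm w (c - c) = 0 by rw [sub_self, wNorm_zero], zero_add]
      calc _ ≤ duhamelConst b q * (3 * nonlinConst s C₀ b q θ ε * volume (Icc l r) ^ (θ / q) * K ^ 2) *
            (K * (1 / 2) ^ k) := by rw [mul_assoc]; gcongr
        _ ≤ 1 / 2 * (K * (1 / 2) ^ k) := by gcongr
        _ = K * (1 / 2) ^ (k + 1) := by ring
    · rw [← p4 t ht, ← duhamel_sub α hl0 hr0 fu fv ht]
      exact congrArg₂ (· - ·) ((step (k + 1) (all (k + 1))).2 t ht) ((step k (all k)).2 t ht)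

/-- Existence for the integral equation on a short interval, by Picard iteration. -/
theorem exists_isMild (hA : Admissible α s C₀ b q θ ε w) (hD : duhamelConst b q < ⊤)
    (hN : nonlinConst s C₀ b q θ ε < ⊤) (hl : -(1 / 2) ≤ l) (hl0 : l ≤ 0)
    (hr0 : 0 ≤ r) (hr : r ≤ 1 / 2) (hc : wNorm w c < ⊤) (hKe : K = 2 * duhamelConst b q * wNorm w c)
    (hsmall : duhamelConst b q *
      (3 * nonlinConst s C₀ b q θ ε * volume (Icc l r) ^ (θ / q) * K ^ 2) ≤ 1 / 2) :
    ∃ u, IsMild α w c (Icc l r) u ∧ (∀ n, ContinuousOn (fun t => force α u t n) (Icc l r)) ∧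
      modNorm b w (profile c (Icc l r) (force α u)) ≤ K ∧
      RepresentedOn α b w (Icc l r) u K := by
  have hq := one_pos.trans_le hA.one_le_q
  have hb := hA.half_lt_b
  have hw := hA.weight
  have hs := hA.half_le_s
  have hI : Icc l r ⊆ Icc (-1) 1 := Icc_subset_Icc (by linarith) (by linarith)
  have hK : K < ⊤ := by
    rw [hKe]; exact ENNReal.mul_lt_top (ENNReal.mul_lt_top (by simp) hD) hc
  have hV : volume (Icc l r) ^ (θ / q) < ⊤ := by
    refine ENNReal.rpow_lt_top_of_nonneg (div_nonneg hA.θ_nonneg hq.le) ?_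
    rw [Real.volume_Icc]
    exact ENNReal.ofReal_ne_top
  set p := picard α c (Icc l r) with hp
  have P := picard_succ_eq hA hD hN hl hl0 hr0 hr hc hKe hsmall
  set B : ℝ≥0∞ := modConst b ^ (1 / 2 : ℝ) * K with hB
  have hBt : B < ⊤ := ENNReal.mul_lt_top
    (ENNReal.rpow_lt_top_of_nonneg (by norm_num) (modConst_lt_top hb).ne) hK
  have hstep : ∀ k, ∀ t ∈ Icc l r, wNorm w (p (k + 1) t - p k t) ≤ B * (1 / 2) ^ k := fun k t ht =>
    ((P k).2.2.2.wNorm_le ht).trans (le_of_eq (by rw [hB, mul_assoc]))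
  have hpB : ∀ k, ∀ t ∈ Icc l r, wNorm w (p k t) ≤ B := fun k t ht => (P k).1.wNorm_le ht
  -- the extra term is the tail of the geometric series; with it the induction on `i` closes
  have hcau : ∀ k, ∀ t ∈ Icc l r, ∀ i, wNorm w (p (k + i) t - p k t) + 2 * B * (1 / 2) ^ (k + i) ≤
      2 * B * (1 / 2) ^ k := by
    intro k t ht i
    induction i with
    | zero => simp
    | succ i ih =>
      have e : p (k + (i + 1)) t - p k t = (p (k + i + 1) t - p (k + i) t) + (p (k + i) t - p k t) := by
        rw [add_assoc]; abel
      rw [e]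
      refine le_trans ?_ ih
      have hhalf : (2 : ℝ≥0∞) * (1 / 2) = 1 := by
        rw [one_div, ENNReal.mul_inv_cancel (by simp) (by simp)]
      calc _ ≤ (B * (1 / 2) ^ (k + i) + wNorm w (p (k + i) t - p k t)) +
            2 * B * (1 / 2) ^ (k + (i + 1)) := by
            refine add_le_add ((wNorm_add_le _ _ _).trans ?_) le_rfl
            exact add_le_add (hstep _ t ht) le_rfl
        _ = wNorm w (p (k + i) t - p k t) + (1 + 2 * (1 / 2)) * (B * (1 / 2) ^ (k + i)) := by
            rw [← add_assoc k i 1, pow_succ]; ring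
        _ = _ := by rw [hhalf]; ring
  have hcau' : ∀ k, ∀ t ∈ Icc l r, ∀ i, wNorm w (p (k + i) t - p k t) ≤ 2 * B * (1 / 2) ^ k :=
    fun k t ht i => le_self_add.trans (hcau k t ht i)
  have hlim : ∀ t n, ∃ x, t ∈ Icc l r → Tendsto (fun k => p k t n) atTop (𝓝 x) := by
    intro t n
    by_cases ht : t ∈ Icc l r
    · have hC : CauchySeq fun k => p k t n := by
        refine cauchySeq_of_le_geometric (1 / 2) ((w n)⁻¹ * B.toReal) (by norm_num) fun k => ?_
        have h1 := (enorm_le_wNorm w (p (k + 1) t - p k t) n).trans (hstep k t ht)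
        have h2 := ENNReal.toReal_mono (ENNReal.mul_lt_top hBt
          (ENNReal.pow_lt_top (by simp))).ne h1
        rw [toReal_enorm, norm_mul, Complex.norm_real, Real.norm_of_nonneg (hw.pos n).le,
          ENNReal.toReal_mul, ENNReal.toReal_pow] at h2
        rw [dist_comm, dist_eq_norm, mul_assoc, ← div_eq_inv_mul, le_div_iff₀ (hw.pos n), mul_comm]
        simpa using h2
      obtain ⟨x, hx⟩ := cauchySeq_tendsto_of_complete hC
      exact ⟨x, fun _ => hx⟩
    · exact ⟨0, fun h => (ht h).elim⟩
  choose U hU using hlim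
  have hUk : ∀ k, ∀ t ∈ Icc l r, wNorm w (U t - p k t) ≤ 2 * B * (1 / 2) ^ k := by
    intro k t ht
    refine wNorm_le_of_tendsto (a := fun j => p j t - p k t) (fun n => ?_) ?_
    · exact (hU t n ht).sub_const _
    · filter_upwards [eventually_ge_atTop k] with j hj
      obtain ⟨i, rfl⟩ := Nat.exists_eq_add_of_le hj
      exact hcau' k t ht i
  have hgeo : Tendsto (fun k : ℕ => 2 * B * (1 / 2 : ℝ≥0∞) ^ k) atTop (𝓝 0) := by
    have := ENNReal.Tendsto.const_mul (a := 2 * B)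
      (ENNReal.tendsto_pow_atTop_nhds_zero_of_lt_one (r := 1 / 2) (by
        rw [one_div]; exact ENNReal.inv_lt_one.2 (by norm_num)))
      (Or.inr (ENNReal.mul_lt_top (by simp) hBt).ne)
    simpa using this
  have hUt : ∀ t ∈ Icc l r, Tendsto (fun k => wNorm w (p k t - U t)) atTop (𝓝 0) := by
    intro t ht
    refine tendsto_of_tendsto_of_tendsto_of_le_of_le tendsto_const_nhds hgeo (fun _ => zero_le)
      fun k => ?_
    show wNorm w (p k t - U t) ≤ _
    rw [wNorm_sub_comm]
    exact hUk k t ht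
  have hUB : ∀ t ∈ Icc l r, wNorm w (U t) ≤ B := fun t ht =>
    wNorm_le_of_tendsto (fun n => hU t n ht) (Eventually.of_forall fun k => hpB k t ht)
  have hcont : WContinuousOn w U (Icc l r) := by
    refine ⟨fun t ht => (hUB t ht).trans_lt hBt, fun t ht => ?_⟩
    rw [ENNReal.tendsto_nhds_zero]
    intro e he
    have he3 : 0 < e / 3 := ENNReal.div_pos he.ne' (by simp)
    obtain ⟨k, hk⟩ := (hgeo.eventually_le_const he3).exists
    have h1 := ((P k).1.wContinuousOn hb hw hK).tendsto t ht
    rw [ENNReal.tendsto_nhds_zero] at h1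
    filter_upwards [h1 _ he3, self_mem_nhdsWithin] with t' h2 ht'
    have e1 : U t' - U t = (U t' - p k t') + (p k t' - p k t) + (p k t - U t) := by abel
    rw [e1]
    calc _ ≤ e / 3 + e / 3 + e / 3 := by
          refine (wNorm_add_le _ _ _).trans (add_le_add ((wNorm_add_le _ _ _).trans
            (add_le_add ((hUk k t' ht').trans hk) h2)) ?_)
          rw [wNorm_sub_comm]
          exact (hUk k t ht).trans hk
      _ = e := ENNReal.add_thirds e
  have hcub : ∀ t ∈ Icc l r, ∀ n, Tendsto (fun k => cubic (p k t) n) atTop (𝓝 (cubic (U t) n)) := by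
    intro t ht n
    simp only [cubic_eq_tri]
    have hf := hcont.finite t ht
    exact tendsto_tri hs hw hf hf hf (hUt t ht) (hUt t ht) (hUt t ht) n
  have hforce := hcont.continuousOn_force α hs hw
  have hmild : IsMild α w c (Icc l r) U := by
    refine ⟨hcont, fun t ht => ?_⟩
    funext n
    refine tendsto_nhds_unique ((hU t n ht).comp (tendsto_add_atTop_nat 1)) ?_
    have hsub : uIcc 0 t ⊆ Icc l r := ordConnected_Icc.uIcc_subset ⟨hl0, hr0⟩ ht
    have h1 : Tendsto (fun k => ∫ x in (0 : ℝ)..t, force α (p k) x n) atTop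
        (𝓝 (∫ x in (0 : ℝ)..t, force α U x n)) := by
      refine intervalIntegral.tendsto_integral_filter_of_dominated_convergence
        (fun _ => (triConst C₀ n * (B * B * B)).toReal) (Eventually.of_forall fun k => ?_)
        (Eventually.of_forall fun k => Eventually.of_forall fun x hx => ?_)
        intervalIntegrable_const (Eventually.of_forall fun x hx => ?_)
      · have := (((P k).1.wContinuousOn hb hw hK).continuousOn_force α hs hw n).mono hsub
        exact (this.mono uIoc_subset_uIcc).aestronglyMeasurable measurableSet_uIoc
      · have hx' := hsub (uIoc_subset_uIcc hx)
        have hfp := (hpB k x hx').trans_lt hBt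
        have h2 : ‖force α (p k) x n‖ = ‖cubic (p k x) n‖ := by
          have : ‖Complex.exp (Complex.I * freq α n * x)‖ = 1 := by rw [Complex.norm_exp]; simp
          rw [force, norm_mul, norm_mul, this]
          simp
        rw [h2, cubic_eq_tri, ← toReal_enorm]
        refine ENNReal.toReal_mono (ENNReal.mul_lt_top (triConst_lt_top _ _)
          (ENNReal.mul_lt_top (ENNReal.mul_lt_top hBt hBt) hBt)).ne
          ((enorm_tri_le hs hw hfp hfp hfp n).trans ?_)
        have := hpB k x hx'
        gcongr
      · exact (hcub x (hsub (uIoc_subset_uIcc hx)) n).const_mul _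
    have h2 := (h1.const_add (c n)).const_mul (Complex.exp (-(Complex.I * freq α n * t)))
    refine h2.congr fun k => ?_
    exact (congrFun ((P k).2.2.1 t ht) n).symm
  -- the iterates converge only pointwise in time, so the bound for the nonlinearity of the limit is
  -- obtained from Fatou's lemma
  have hM : lqNorm q (Icc l r) (fun t => wNorm w (cubic (U t))) ≤
      nonlinConst s C₀ b q θ ε * volume (Icc l r) ^ (θ / q) * K ^ 3 := by
    refine lqNorm_le_of_rpow_le hq ?_
    calc _ ≤ ∫⁻ t in Icc l r, liminf (fun k => wNorm w (cubic (p k t)) ^ q) atTop := by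
          refine setLIntegral_mono' measurableSet_Icc fun t ht => ?_
          have h1 := wNorm_le_liminf (w := w) (hcub t ht)
          refine (ENNReal.rpow_le_rpow h1 hq.le).trans (le_of_eq ?_)
          exact (ENNReal.orderIsoRpow q hq).liminf_apply
      _ ≤ liminf (fun k => ∫⁻ t in Icc l r, wNorm w (cubic (p k t)) ^ q) atTop := by
          refine lintegral_liminf_le' fun k => ?_
          have hr := (P k).1.represented measurableSet_Icc
          have := hr.aemeasurable_tri hA hr hr hK hK hK
          simp only [cubic_eq_tri]
          exact this.pow_const q
      _ ≤ _ := by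
          refine (liminf_le_liminf (v := fun _ => (nonlinConst s C₀ b q θ ε *
            volume (Icc l r) ^ (θ / q) * K ^ 3) ^ q) (Eventually.of_forall fun k => ?_)).trans
            (liminf_const _).le
          have h1 := ((P k).1.represented measurableSet_Icc).lqNorm_cubic_le hA hK hI
          have h2 := ENNReal.rpow_le_rpow h1 hq.le
          rwa [lqNorm_rpow hq] at h2
  obtain ⟨p1, p2, p3⟩ := modNorm_profile_force_le hA hD hl hl0 hr0 hr hc hKe hsmall hforce hM
    (hM.trans_lt (ENNReal.mul_lt_top (ENNReal.mul_lt_top hN hV) (ENNReal.pow_lt_top hK)))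
  exact ⟨U, hmild, hforce, p2, _, p1, p2, fun t ht => (hmild.eq_duhamel t ht).trans (p3 t ht)⟩

end

/-! ### The multiplier `I_N` as a weight -/

section

variable {α N : ℝ} {m : ℝ → ℝ}

/-- Up to a factor `2` the symbol of `I_N` is `max(1, ξ/N)^{s-α}`. -/
theorem IsIMultiplier.bounds (hm : IsIMultiplier α s N m) (hN : 1 ≤ N) (hsα : s ≤ α)
    (h1 : α - s ≤ 1) {ξ : ℝ} (hξ : 0 ≤ ξ) :
    (max 1 (ξ / N)) ^ (s - α) ≤ 2 * m ξ ∧ m ξ ≤ 2 * (max 1 (ξ / N)) ^ (s - α) := by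
  have hN0 : 0 < N := one_pos.trans_le hN
  have hξa : |ξ| = ξ := abs_of_nonneg hξ
  rcases le_total ξ N with h | h
  · have e : max 1 (ξ / N) = 1 := max_eq_left ((div_le_one hN0).2 h)
    rw [e, Real.one_rpow, hm.low ξ (hξa.symm ▸ h)]
    norm_num
  · have e : max 1 (ξ / N) = ξ / N := max_eq_right ((one_le_div hN0).2 h)
    rw [e]
    have hpos : 0 < ξ / N := div_pos (hN0.trans_le h) hN0
    rcases le_total (2 * N) ξ with h2 | h2
    · rw [hm.high ξ (hξa.symm ▸ h2), abs_of_pos hpos]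
      have := Real.rpow_pos_of_pos hpos (s - α)
      constructor <;> linarith
    · obtain ⟨h3, h4⟩ := hm.mid ξ (hξa.symm ▸ h) (hξa.symm ▸ h2)
      have hhalf : (1 : ℝ) / 2 ≤ 2 ^ (s - α) := by
        have : (2 : ℝ) ^ (-1 : ℝ) ≤ 2 ^ (s - α) :=
          Real.rpow_le_rpow_of_exponent_le one_le_two (by linarith)
        rwa [Real.rpow_neg_one, ← one_div] at this
      have h5 : (ξ / N) ^ (s - α) ≤ 1 :=
        Real.rpow_le_one_of_one_le_of_nonpos ((one_le_div hN0).2 h) (by linarith)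
      have h6 : (2 : ℝ) ^ (s - α) ≤ (ξ / N) ^ (s - α) :=
        Real.rpow_le_rpow_of_nonpos hpos ((div_le_iff₀ hN0).2 h2) (by linarith)
      constructor <;> linarith

theorem IsIMultiplier.pos (hm : IsIMultiplier α s N m) (hN : 1 ≤ N) (hsα : s ≤ α)
    (h1 : α - s ≤ 1) {ξ : ℝ} (hξ : 0 ≤ ξ) : 0 < m ξ := by
  have h2 := (hm.bounds hN hsα h1 hξ).1
  have h3 : 0 < (max 1 (ξ / N)) ^ (s - α) :=
    Real.rpow_pos_of_pos (lt_of_lt_of_le one_pos (le_max_left _ _)) _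
  linarith

theorem le_bracket (x : ℝ) : x ≤ bracket x := Real.le_sqrt_of_sq_le (by linarith)

theorem bracket_le {x : ℝ} (hx : 1 ≤ x) : bracket x ≤ 2 * x := by
  rw [bracket, Real.sqrt_le_left (by linarith)]
  nlinarith

theorem rpow_le_bracket_rpow (hα : 0 ≤ α) {x : ℝ} (hx : 0 ≤ x) : x ^ α ≤ bracket x ^ α :=
  Real.rpow_le_rpow hx (le_bracket x) hα

theorem bracket_rpow_le (hα0 : 0 ≤ α) (hα : α ≤ 1) {x : ℝ} (hx : 1 ≤ x) :
    bracket x ^ α ≤ 2 * x ^ α := by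
  refine (Real.rpow_le_rpow (bracket_pos x).le (bracket_le hx) hα0).trans ?_
  rw [Real.mul_rpow zero_le_two (by linarith)]
  gcongr
  exact Real.rpow_le_self_of_one_le one_le_two hα

/-- The weight `m(zₙ) ⟨zₙ⟩^α`, for which `‖u‖_w` is comparable to `‖I u‖_{H^α}`. -/
def iWeight (α : ℝ) (m : ℝ → ℝ) (n : ℕ) : ℝ := m (besselZero n) * bracket (besselZero n) ^ α

/-- A constant for the growth of the weights `iWeight`, uniform in `N`. -/
def iWeightConst : ℝ := 56 / zeroGap

/-- The weight of `I_N` satisfies the growth conditions with a constant independent of `N`. -/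
theorem isWeight_iWeight (hm : IsIMultiplier α s N m) (hN : 1 ≤ N) (hs0 : 0 ≤ s) (hsα : s ≤ α)
    (hα : α ≤ 1) : IsWeight s iWeightConst (iWeight α m) := by
  have hg := zeroGap_pos
  have hg1 := zeroGap_le_one
  have hN0 : 0 < N := one_pos.trans_le hN
  have hα0 : 0 ≤ α := hs0.trans hsα
  have h1 : α - s ≤ 1 := by linarith
  have hz : ∀ n, 1 ≤ besselZero n := one_le_besselZero
  have hz0 : ∀ n, 0 < besselZero n := besselZero_pos
  -- `iWeight` is comparable to `P n = max(1, zₙ/N)^{s-α} zₙ^α`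
  set P : ℕ → ℝ := fun n => (max 1 (besselZero n / N)) ^ (s - α) * besselZero n ^ α with hP
  have hmax : ∀ n, 0 < max 1 (besselZero n / N) := fun n =>
    lt_of_lt_of_le one_pos (le_max_left _ _)
  have hPpos : ∀ n, 0 < P n := fun n =>
    mul_pos (Real.rpow_pos_of_pos (hmax n) _) (Real.rpow_pos_of_pos (hz0 n) _)
  have hlow : ∀ n, P n ≤ 2 * iWeight α m n := by
    intro n
    have a1 := (hm.bounds hN hsα h1 (hz0 n).le).1
    have a2 := rpow_le_bracket_rpow hα0 (hz0 n).le
    show (max 1 (besselZero n / N)) ^ (s - α) * besselZero n ^ α ≤ _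
    rw [iWeight, ← mul_assoc]
    have : 0 < m (besselZero n) := hm.pos hN hsα h1 (hz0 n).le
    gcongr
    exact (Real.rpow_pos_of_pos (hz0 n) _).le
  have hupp : ∀ n, iWeight α m n ≤ 4 * P n := by
    intro n
    have a1 := (hm.bounds hN hsα h1 (hz0 n).le).2
    have a2 := bracket_rpow_le hα0 hα (hz n)
    calc iWeight α m n ≤ (2 * (max 1 (besselZero n / N)) ^ (s - α)) * (2 * besselZero n ^ α) :=
          mul_le_mul a1 a2 (Real.rpow_pos_of_pos (bracket_pos _) _).le
            (mul_pos two_pos (Real.rpow_pos_of_pos (hmax n) _)).le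
      _ = 4 * P n := by rw [hP]; ring
  have hratio : ∀ n k, n ≤ k → 1 ≤ besselZero k / besselZero n := fun n k hnk =>
    (one_le_div (hz0 n)).2 (strictMono_besselZero.monotone hnk)
  have hPupper : ∀ n k, n ≤ k → P k ≤ besselZero k / besselZero n * P n := by
    intro n k hnk
    have hle := strictMono_besselZero.monotone hnk
    have a1 : (max 1 (besselZero k / N)) ^ (s - α) ≤ (max 1 (besselZero n / N)) ^ (s - α) :=
      Real.rpow_le_rpow_of_nonpos (hmax n) (max_le_max le_rfl (by gcongr)) (by linarith)
    have a2 : besselZero k ^ α = (besselZero k / besselZero n) ^ α * besselZero n ^ α := by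
      rw [← Real.mul_rpow (by linarith [hratio n k hnk]) (hz0 n).le, div_mul_cancel₀ _ (hz0 n).ne']
    have a3 := Real.rpow_le_self_of_one_le (hratio n k hnk) hα
    have b1 := Real.rpow_pos_of_pos (hmax n) (s - α)
    have b2 := Real.rpow_pos_of_pos (hz0 n) α
    calc P k = (max 1 (besselZero k / N)) ^ (s - α) *
          ((besselZero k / besselZero n) ^ α * besselZero n ^ α) := by rw [hP, ← a2]
      _ ≤ (max 1 (besselZero n / N)) ^ (s - α) *
          ((besselZero k / besselZero n) * besselZero n ^ α) := by
          gcongr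
          exact mul_nonneg (Real.rpow_nonneg (by linarith [hratio n k hnk]) _) b2.le
      _ = _ := by rw [hP]; ring
  have hPlower : ∀ n k, n ≤ k → (besselZero k / besselZero n) ^ s * P n ≤ P k := by
    intro n k hnk
    have hr := hratio n k hnk
    have hr0 : 0 < besselZero k / besselZero n := by linarith
    have a1 : ((besselZero k / besselZero n) * max 1 (besselZero n / N)) ^ (s - α) ≤
        (max 1 (besselZero k / N)) ^ (s - α) := by
      refine Real.rpow_le_rpow_of_nonpos (hmax k) (max_le ?_ ?_) (by linarith)
      · exact le_trans (by simpa using hr) (mul_le_mul_of_nonneg_left (le_max_left _ _) hr0.le)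
      · refine le_trans (le_of_eq ?_) (mul_le_mul_of_nonneg_left (le_max_right _ _) hr0.le)
        field_simp [(hz0 n).ne']
    have a2 : besselZero k ^ α = (besselZero k / besselZero n) ^ α * besselZero n ^ α := by
      rw [← Real.mul_rpow hr0.le (hz0 n).le, div_mul_cancel₀ _ (hz0 n).ne']
    have a3 : (besselZero k / besselZero n) ^ s =
        (besselZero k / besselZero n) ^ (s - α) * (besselZero k / besselZero n) ^ α := by
      rw [← Real.rpow_add hr0]; ring_nf
    rw [Real.mul_rpow hr0.le (hmax n).le] at a1
    have b2 := Real.rpow_pos_of_pos (hz0 n) α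
    have b3 := Real.rpow_pos_of_pos hr0 α
    calc _ = ((besselZero k / besselZero n) ^ (s - α) * (max 1 (besselZero n / N)) ^ (s - α)) *
          ((besselZero k / besselZero n) ^ α * besselZero n ^ α) := by rw [a3, hP]; ring
      _ ≤ (max 1 (besselZero k / N)) ^ (s - α) *
          ((besselZero k / besselZero n) ^ α * besselZero n ^ α) := by gcongr
      _ = P k := by rw [← a2]
  have hC : 0 < iWeightConst := div_pos (by norm_num) hg
  have hw0 : ∀ n, 0 < iWeight α m n := fun n => by linarith [hlow n, hPpos n]
  refine ⟨?_, hw0, ?_, ?_, ?_⟩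
  · rw [iWeightConst, le_div_iff₀ hg]; linarith
  · have a1 : (1 : ℝ) ≤ P 0 := by
      have hmle : max 1 (besselZero 0 / N) ≤ besselZero 0 :=
        max_le (hz 0) (div_le_self (hz0 0).le hN)
      calc (1 : ℝ) ≤ besselZero 0 ^ s := Real.one_le_rpow (hz 0) hs0
        _ = besselZero 0 ^ (s - α) * besselZero 0 ^ α := by
            rw [← Real.rpow_add (hz0 0)]; ring_nf
        _ ≤ P 0 := by
            show _ ≤ (max 1 (besselZero 0 / N)) ^ (s - α) * besselZero 0 ^ α
            have := Real.rpow_le_rpow_of_nonpos (hmax 0) hmle (by linarith : s - α ≤ 0)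
            have b2 := Real.rpow_pos_of_pos (hz0 0) α
            gcongr
    have a2 : (2 : ℝ) ≤ iWeightConst := by rw [iWeightConst, le_div_iff₀ hg]; linarith
    nlinarith [hlow 0, hw0 0]
  · intro n k hnk
    have hr := hratio n k hnk
    have hr0 : 0 < besselZero k / besselZero n := by linarith
    have a1 : ((k : ℝ) + 1) / (n + 1) ≤ 7 / zeroGap * (besselZero k / besselZero n) := by
      rw [div_mul_div_comm, div_le_div_iff₀ (by positivity) (mul_pos hg (hz0 n))]
      nlinarith [mul_le_mul (besselZero_le n) (mul_le_besselZero k) (by positivity) (by positivity)]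
    have h7 : 1 ≤ 7 / zeroGap := by rw [le_div_iff₀ hg]; linarith
    have a2 : (((k : ℝ) + 1) / (n + 1)) ^ s ≤ 7 / zeroGap * (besselZero k / besselZero n) ^ s := by
      refine (Real.rpow_le_rpow (by positivity) a1 hs0).trans ?_
      rw [Real.mul_rpow (by linarith) hr0.le]
      have b1 := Real.rpow_pos_of_pos hr0 s
      gcongr
      exact Real.rpow_le_self_of_one_le h7 (hsα.trans hα)
    calc _ ≤ (4 * P n) * (7 / zeroGap * (besselZero k / besselZero n) ^ s) :=
          mul_le_mul (hupp n) a2 (by positivity) (by linarith [hPpos n])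
      _ = 28 / zeroGap * ((besselZero k / besselZero n) ^ s * P n) := by ring
      _ ≤ 28 / zeroGap * (2 * iWeight α m k) := by
          exact mul_le_mul_of_nonneg_left ((hPlower n k hnk).trans (hlow k)) (by positivity)
      _ = _ := by rw [iWeightConst]; ring
  · intro n k hnk
    have a1 : besselZero k / besselZero n ≤ 7 / zeroGap * (((k : ℝ) + 1) / (n + 1)) := by
      rw [div_mul_div_comm, div_le_div_iff₀ (hz0 n) (mul_pos hg (by positivity))]
      nlinarith [mul_le_mul (besselZero_le k) (mul_le_besselZero n) (by positivity) (by positivity)]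
    calc iWeight α m k ≤ 4 * P k := hupp k
      _ ≤ 4 * (7 / zeroGap * (((k : ℝ) + 1) / (n + 1)) * (2 * iWeight α m n)) := by
          gcongr
          exact (hPupper n k hnk).trans (mul_le_mul a1 (hlow n) (hPpos n).le (by positivity))
      _ = _ := by rw [iWeightConst]; ring

/-! ### Comparison of norms -/

theorem wNorm_le_mul {w w' : ℕ → ℝ} {a b : ℕ → ℂ} {C : ℝ}
    (h : ∀ n, ‖(w n : ℂ) * a n‖ ≤ C * ‖(w' n : ℂ) * b n‖) :
    wNorm w a ≤ ENNReal.ofReal C * wNorm w' b :=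
  eLpNorm_le_mul_eLpNorm_of_ae_le_mul (Eventually.of_forall h) 2

theorem hsNorm_eq_wNorm (σ : ℝ) (c : ℕ → ℂ) : hsNorm σ c = wNorm (fun n => besselZero n ^ σ) c := by
  rw [hsNorm, wNorm_eq]
  congr 1
  refine tsum_congr fun n => ?_
  rw [← Real.rpow_natCast (besselZero n ^ σ), ← Real.rpow_mul (besselZero_pos n).le, mul_comm 2 σ]
  norm_cast

theorem hsNorm_iOp_le (hα : 0 ≤ α) (c : ℕ → ℂ) : hsNorm α (iOp m c) ≤ wNorm (iWeight α m) c := by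
  rw [hsNorm_eq_wNorm]
  have := wNorm_le_mul (w := fun n => besselZero n ^ α) (w' := iWeight α m) (a := iOp m c) (b := c)
    (C := 1) fun n => by
      rw [iOp, iWeight, one_mul, norm_mul, norm_mul, norm_mul, Complex.norm_real, Complex.norm_real,
        Complex.norm_real, norm_mul]
      have a1 := rpow_le_bracket_rpow hα (besselZero_pos n).le
      have a2 := Real.rpow_pos_of_pos (besselZero_pos n) α
      have a3 := Real.rpow_pos_of_pos (bracket_pos (besselZero n)) α
      rw [Real.norm_of_nonneg a2.le, Real.norm_of_nonneg a3.le, ← mul_assoc,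
        mul_comm (besselZero n ^ α)]
      gcongr
  simpa using this

theorem wNorm_iWeight_le (hα0 : 0 ≤ α) (hα : α ≤ 1) (c : ℕ → ℂ) :
    wNorm (iWeight α m) c ≤ 2 * hsNorm α (iOp m c) := by
  rw [hsNorm_eq_wNorm]
  have := wNorm_le_mul (w' := fun n => besselZero n ^ α) (w := iWeight α m) (b := iOp m c) (a := c)
    (C := 2) fun n => by
      rw [iOp, iWeight, norm_mul, norm_mul, norm_mul, Complex.norm_real, Complex.norm_real,
        Complex.norm_real, norm_mul]
      have a1 := bracket_rpow_le hα0 hα (one_le_besselZero n)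
      have a2 := Real.rpow_pos_of_pos (besselZero_pos n) α
      have a3 := Real.rpow_pos_of_pos (bracket_pos (besselZero n)) α
      rw [Real.norm_of_nonneg a2.le, Real.norm_of_nonneg a3.le]
      calc ‖m (besselZero n)‖ * bracket (besselZero n) ^ α * ‖c n‖
          ≤ ‖m (besselZero n)‖ * (2 * besselZero n ^ α) * ‖c n‖ := by gcongr
        _ = _ := by ring
  simpa using this

theorem hsNorm_le_iOp (hm : IsIMultiplier α s N m) (hN : 1 ≤ N) (hsα : s ≤ α)
    (h1 : α - s ≤ 1) (c : ℕ → ℂ) : hsNorm s c ≤ 2 * hsNorm α (iOp m c) := by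
  rw [hsNorm_eq_wNorm, hsNorm_eq_wNorm]
  have := wNorm_le_mul (w := fun n => besselZero n ^ s) (w' := fun n => besselZero n ^ α)
    (b := iOp m c) (a := c) (C := 2) fun n => by
      have hz := one_le_besselZero n
      have hz0 := besselZero_pos n
      have hmp := hm.pos hN hsα h1 hz0.le
      have a1 := (hm.bounds hN hsα h1 hz0.le).1
      have a2 : besselZero n ^ (s - α) ≤ (max 1 (besselZero n / N)) ^ (s - α) :=
        Real.rpow_le_rpow_of_nonpos (lt_of_lt_of_le one_pos (le_max_left _ _))
          (max_le hz (div_le_self hz0.le hN)) (by linarith)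
      have a3 : besselZero n ^ s = besselZero n ^ (s - α) * besselZero n ^ α := by
        rw [← Real.rpow_add hz0]; ring_nf
      have a4 := Real.rpow_pos_of_pos hz0 α
      have a5 := Real.rpow_pos_of_pos hz0 s
      rw [iOp, norm_mul, norm_mul, norm_mul, Complex.norm_real, Complex.norm_real,
        Complex.norm_real, Real.norm_of_nonneg a5.le, Real.norm_of_nonneg a4.le,
        Real.norm_of_nonneg hmp.le, a3]
      calc _ ≤ (2 * m (besselZero n)) * besselZero n ^ α * ‖c n‖ := by
            gcongr
            exact a2.trans a1
        _ = _ := by ring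
  simpa using this

theorem hsNorm_iOp_le_rpow_mul (hm : IsIMultiplier α s N m) (hN : 1 ≤ N) (hsα : s ≤ α)
    (h1 : α - s ≤ 1) (c : ℕ → ℂ) :
    hsNorm α (iOp m c) ≤ ENNReal.ofReal (2 * N ^ (α - s)) * hsNorm s c := by
  rw [hsNorm_eq_wNorm, hsNorm_eq_wNorm]
  refine wNorm_le_mul fun n => ?_
  have hN0 : 0 < N := one_pos.trans_le hN
  have hz0 := besselZero_pos n
  have hmp := hm.pos hN hsα h1 hz0.le
  have a1 := (hm.bounds hN hsα h1 hz0.le).2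
  have a2 : (max 1 (besselZero n / N)) ^ (s - α) ≤ (besselZero n / N) ^ (s - α) :=
    Real.rpow_le_rpow_of_nonpos (div_pos hz0 hN0) (le_max_right _ _) (by linarith)
  have a3 : (besselZero n / N) ^ (s - α) * besselZero n ^ α = N ^ (α - s) * besselZero n ^ s := by
    rw [Real.div_rpow hz0.le hN0.le, div_mul_eq_mul_div, ← Real.rpow_add hz0,
      show s - α = -(α - s) by ring, Real.rpow_neg hN0.le, div_inv_eq_mul, mul_comm]
    ring_nf
  have a4 := Real.rpow_pos_of_pos hz0 α
  have a5 := Real.rpow_pos_of_pos hz0 s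
  rw [iOp, norm_mul, norm_mul, norm_mul, Complex.norm_real, Complex.norm_real,
    Complex.norm_real, Real.norm_of_nonneg a5.le, Real.norm_of_nonneg a4.le,
    Real.norm_of_nonneg hmp.le]
  calc _ = m (besselZero n) * (besselZero n ^ α * ‖c n‖) := by ring
    _ ≤ (2 * (besselZero n / N) ^ (s - α)) * (besselZero n ^ α * ‖c n‖) := by
        gcongr
        linarith
    _ = 2 * ((besselZero n / N) ^ (s - α) * besselZero n ^ α) * ‖c n‖ := by ring
    _ = _ := by rw [a3]; ring

end

/-! ### Solutions of the modified equation -/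

section

variable {α : ℝ} {m : ℝ → ℝ} {c : ℕ → ℂ} {l r : ℝ} {u : ℝ → ℕ → ℂ}

theorem iOp_sub (m : ℝ → ℝ) (a b : ℕ → ℂ) : iOp m a - iOp m b = iOp m (a - b) := by
  funext n
  simp only [Pi.sub_apply, iOp, mul_sub]

theorem iOp_injective (hm : ∀ n, 0 < m (besselZero n)) {a b : ℕ → ℂ} (h : iOp m a = iOp m b) :
    a = b := by
  funext n
  have := congrFun h n
  exact mul_left_cancel₀ (Complex.ofReal_ne_zero.2 (hm n).ne') this

theorem cexp_neg_mul_cexp (z : ℂ) : Complex.exp (-z) * Complex.exp z = 1 := by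
  rw [← Complex.exp_add, neg_add_cancel, Complex.exp_zero]

/-- The differential and the integral form of the equation agree. -/
theorem IsSolution.isMild (hs : 1 / 2 ≤ s) (hα0 : 0 ≤ α) (hα : α ≤ 1)
    (hw : IsWeight s C₀ (iWeight α m)) (hm : ∀ n, 0 < m (besselZero n)) (hl0 : l ≤ 0) (hr0 : 0 ≤ r)
    (h : IsSolution α m c (Icc l r) u) : IsMild α (iWeight α m) c (Icc l r) u := by
  have hcont : WContinuousOn (iWeight α m) u (Icc l r) := by
    refine ⟨fun t ht => (wNorm_iWeight_le hα0 hα _).trans_lt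
      (ENNReal.mul_lt_top (by simp) (h.finite t ht)), fun t ht => ?_⟩
    have h1 := ENNReal.Tendsto.const_mul (a := 2) (h.continuous t ht) (Or.inr (by simp))
    rw [mul_zero] at h1
    refine tendsto_of_tendsto_of_tendsto_of_le_of_le tendsto_const_nhds h1 (fun _ => zero_le)
      fun t' => ?_
    show wNorm (iWeight α m) (u t' - u t) ≤ 2 * hsNorm α (iOp m (u t') - iOp m (u t))
    rw [iOp_sub]
    exact wNorm_iWeight_le hα0 hα _
  refine ⟨hcont, fun t ht => ?_⟩
  funext n
  have hsub : uIcc 0 t ⊆ Icc l r := ordConnected_Icc.uIcc_subset ⟨hl0, hr0⟩ ht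
  have hmn : (m (besselZero n) : ℂ) ≠ 0 := Complex.ofReal_ne_zero.2 (hm n).ne'
  have hy : ∀ x ∈ Icc l r, HasDerivWithinAt (fun x : ℝ => Complex.exp (Complex.I * freq α n * x) * u x n)
      (force α u x n) (Icc l r) x := by
    intro x hx
    obtain ⟨d, hd, heq⟩ := h.equation x hx n
    change Complex.I * d - (freq α n : ℂ) * (m (besselZero n) * u x n) =
      m (besselZero n) * cubic (u x) n at heq
    have hu : HasDerivWithinAt (fun x => u x n) ((m (besselZero n) : ℂ)⁻¹ * d) (Icc l r) x := by
      refine (hd.const_mul (m (besselZero n) : ℂ)⁻¹).congr (fun y _ => ?_) ?_ <;>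
        · rw [iOp, inv_mul_cancel_left₀ hmn]
    have he : HasDerivAt (fun x : ℝ => Complex.exp (Complex.I * freq α n * x))
        (Complex.exp (Complex.I * freq α n * x) * (Complex.I * freq α n)) x := by
      have h1 : HasDerivAt (fun x : ℝ => Complex.I * freq α n * (x : ℂ)) (Complex.I * freq α n) x := by
        simpa using (Complex.ofRealCLM.hasDerivAt (x := x)).const_mul (Complex.I * freq α n)
      exact h1.cexp
    refine (he.hasDerivWithinAt.mul hu).congr_deriv ?_
    rw [force]
    have hd' : (m (besselZero n) : ℂ)⁻¹ * d = -Complex.I * (freq α n * u x n + cubic (u x) n) := by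
      rw [inv_mul_eq_iff_eq_mul₀ hmn]
      linear_combination -Complex.I * heq + d * Complex.I_mul_I
    rw [hd']
    ring
  have hint := intervalIntegral.integral_eq_sub_of_hasDeriv_right (a := 0) (b := t)
    (f := fun x : ℝ => Complex.exp (Complex.I * freq α n * x) * u x n) (f' := fun x => force α u x n)
    (fun x hx => ((hy x (hsub hx)).mono hsub).continuousWithinAt)
    (fun x hx => by
      have hn : Icc l r ∈ 𝓝 x := Filter.mem_of_superset (Icc_mem_nhds hx.1 hx.2) hsub
      exact ((hy x (hsub (Ioo_subset_Icc_self hx))).hasDerivAt hn).hasDerivWithinAt)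
    ((hcont.continuousOn_force α hs hw n).mono hsub).intervalIntegrable
  have h0 : u 0 = c := iOp_injective hm h.initial
  rw [duhamel, hint, h0]
  have he := cexp_neg_mul_cexp (Complex.I * freq α n * t)
  simp only [Complex.ofReal_zero, mul_zero, Complex.exp_zero, one_mul]
  linear_combination -(u t n) * he

/-- A continuous solution of the integral equation solves the equation for each coefficient. -/
theorem IsMild.isSolution (hs : 1 / 2 ≤ s) (hα0 : 0 ≤ α)
    (hw : IsWeight s C₀ (iWeight α m)) (hl0 : l ≤ 0) (hr0 : 0 ≤ r)
    (h : IsMild α (iWeight α m) c (Icc l r) u) : IsSolution α m c (Icc l r) u := by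
  have h0 : (0 : ℝ) ∈ Icc l r := ⟨hl0, hr0⟩
  refine ⟨fun t ht => (hsNorm_iOp_le hα0 _).trans_lt (h.finite t ht), fun t ht => ?_,
    fun t ht => hw.memLp_synth hs (h.finite t ht), fun t ht n => ?_, ?_⟩
  · refine tendsto_of_tendsto_of_tendsto_of_le_of_le tendsto_const_nhds (h.tendsto t ht)
      (fun _ => zero_le) fun t' => ?_
    show hsNorm α (iOp m (u t') - iOp m (u t)) ≤ _
    rw [iOp_sub]
    exact hsNorm_iOp_le hα0 _
  · have hsub : uIcc 0 t ⊆ Icc l r := ordConnected_Icc.uIcc_subset h0 ht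
    have hf := h.continuousOn_force α hs hw n
    have : Fact (t ∈ Icc l r) := ⟨ht⟩
    have hP : HasDerivWithinAt (fun t => c n + ∫ x in (0 : ℝ)..t, force α u x n) (force α u t n)
        (Icc l r) t :=
      (intervalIntegral.integral_hasDerivWithinAt_right (hf.mono hsub).intervalIntegrable
        (hf.stronglyMeasurableAtFilter_nhdsWithin measurableSet_Icc t) (hf t ht)).const_add (c n)
    have he : HasDerivAt (fun x : ℝ => Complex.exp (-(Complex.I * freq α n * x)))
        (Complex.exp (-(Complex.I * freq α n * t)) * -(Complex.I * freq α n)) t := by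
      have h1 : HasDerivAt (fun x : ℝ => Complex.I * freq α n * (x : ℂ)) (Complex.I * freq α n) t := by
        simpa using (Complex.ofRealCLM.hasDerivAt (x := t)).const_mul (Complex.I * freq α n)
      exact h1.neg.cexp
    refine ⟨_, ((he.hasDerivWithinAt.mul hP).const_mul (m (besselZero n) : ℂ)).congr
      (fun x hx => ?_) ?_, ?_⟩
    · rw [iOp, h.eq_duhamel x hx]; rfl
    · rw [iOp, h.eq_duhamel t ht]; rfl
    · have hu : u t n = Complex.exp (-(Complex.I * freq α n * t)) *
          (c n + ∫ x in (0 : ℝ)..t, force α u x n) := congrFun (h.eq_duhamel t ht) n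
      have hee := cexp_neg_mul_cexp (Complex.I * freq α n * t)
      have hF : Complex.exp (-(Complex.I * freq α n * t)) * force α u t n =
          -Complex.I * cubic (u t) n := by
        rw [force]
        linear_combination -Complex.I * cubic (u t) n * hee
      show Complex.I * _ - (freq α n : ℂ) * (m (besselZero n) * u t n) =
        m (besselZero n) * cubic (u t) n
      rw [hF, hu]
      linear_combination (-(m (besselZero n) : ℂ) * cubic (u t) n - m (besselZero n) *
        freq α n * Complex.exp (-(Complex.I * freq α n * t)) *
          (c n + ∫ x in (0 : ℝ)..t, force α u x n)) * Complex.I_mul_I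
  · have : u 0 = c := by
      rw [h.eq_duhamel 0 h0]
      funext n
      simp [duhamel]
    rw [this]

/-- A function with finite restriction norm has a profile. -/
theorem exists_represented_of_xsbNormOn {b : ℝ} (hb : 1 / 2 < b) (hm : ∀ n, 0 < m (besselZero n))
    {J : Set ℝ} (hJ : MeasurableSet J)
    (h : xsbNormOn J α α b (fun t => iOp m (u t)) < ⊤) :
    ∃ K, K < ⊤ ∧ Represented α b (iWeight α m) J u K := by
  rw [xsbNormOn, iInf_lt_iff] at h
  obtain ⟨V, hV⟩ := h
  rw [iInf_lt_iff] at hV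
  obtain ⟨hVu, hV⟩ := hV
  obtain ⟨k, km, kn, ke⟩ := exists_evol_of_xsbNorm hb hV
  have hmn : ∀ n, (m (besselZero n) : ℂ) ≠ 0 := fun n => Complex.ofReal_ne_zero.2 (hm n).ne'
  refine ⟨_, hV, fun n ξ => (m (besselZero n) : ℂ)⁻¹ * k n ξ, fun n => (km n).const_mul _, ?_, ?_⟩
  · rw [← kn, modNorm, modNorm]
    refine le_of_eq ?_
    congr 1
    refine tsum_congr fun n => ?_
    rw [← lintegral_const_mul' _ _ ENNReal.ofReal_ne_top,
      ← lintegral_const_mul' _ _ ENNReal.ofReal_ne_top]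
    refine lintegral_congr fun ξ => ?_
    have e : ENNReal.ofReal (m (besselZero n) ^ 2) * ‖(m (besselZero n) : ℂ)⁻¹‖ₑ ^ 2 = 1 := by
      rw [ENNReal.ofReal_pow (hm n).le, ← mul_pow, ← ofReal_norm, norm_inv, Complex.norm_real,
        Real.norm_of_nonneg (hm n).le, ← ENNReal.ofReal_mul (hm n).le,
        mul_inv_cancel₀ (hm n).ne', ENNReal.ofReal_one, one_pow]
    rw [iWeight, mul_pow, ENNReal.ofReal_mul (sq_nonneg _), enorm_mul, mul_pow]
    calc _ = (ENNReal.ofReal (m (besselZero n) ^ 2) * ‖(m (besselZero n) : ℂ)⁻¹‖ₑ ^ 2) *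
          (ENNReal.ofReal ((bracket (besselZero n) ^ α) ^ 2) *
            (ENNReal.ofReal (modWeight b ξ) * ‖k n ξ‖ₑ ^ 2)) := by ring
      _ = _ := by rw [e, one_mul]
  · filter_upwards [ae_restrict_mem hJ, ae_restrict_of_ae (ae_all_iff.2 ke)] with t ht h
    funext n
    have h1 : evol α k t n = m (besselZero n) * u t n := by
      rw [← h n, hVu ht]; rfl
    have h2 : evol α (fun n ξ => (m (besselZero n) : ℂ)⁻¹ * k n ξ) t n =
        (m (besselZero n) : ℂ)⁻¹ * evol α k t n := by
      have h3 : ∫ ξ : ℝ, Complex.exp (2 * Real.pi * Complex.I * t * ξ) *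
          ((m (besselZero n) : ℂ)⁻¹ * k n ξ) = (m (besselZero n) : ℂ)⁻¹ *
          ∫ ξ : ℝ, Complex.exp (2 * Real.pi * Complex.I * t * ξ) * k n ξ := by
        rw [← integral_const_mul]
        refine integral_congr_ae (Eventually.of_forall fun ξ => ?_)
        exact mul_left_comm (Complex.exp (2 * Real.pi * Complex.I * t * ξ)) _ _
      rw [evol, evol, h3, mul_left_comm]
    rw [h2, h1, inv_mul_cancel_left₀ (hmn n)]

/-- A solution of Duhamel's formula has restriction norm at most the norm of its profile. -/
theorem xsbNormOn_duhamel_le {b : ℝ} (hm : ∀ n, 0 < m (besselZero n)) {H : ℝ → ℕ → ℂ}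
    (hl : -(1 / 2) ≤ l) (hl0 : l ≤ 0) (hr0 : 0 ≤ r) (hr : r ≤ 1 / 2)
    (hH : ∀ n, ContinuousOn (fun t => H t n) (Icc l r)) {J : Set ℝ} (hJ : J ⊆ Icc l r)
    (hu : ∀ t ∈ J, u t = duhamel α c H t) :
    xsbNormOn J α α b (fun t => iOp m (u t)) ≤ modNorm b (iWeight α m) (profile c (Icc l r) H) := by
  rw [← xsbNorm_evol_profile (α := α) (σ := α) (fun n => m (besselZero n)) (fun n => by
    rw [iWeight, abs_of_pos (hm n)]) hH, xsbNormOn]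
  refine iInf₂_le (_ : ℝ → ℕ → ℂ) fun t ht => ?_
  funext n
  show (m (besselZero n) : ℂ) * (Complex.exp (-(Complex.I * freq α n * t)) *
    cutPrimitive c (Icc l r) H n t) = m (besselZero n) * u t n
  rw [hu t ht, duhamel, cutPrimitive_eq hl hl0 hr0 hr (hJ ht)]

end

/-! ### The choice of the exponents and of the time of existence -/

/-- The exponents `q = 1/(2-2b)` and `θ = q (1 + 2b - 4 b(s))`, with `ε` small. -/
theorem exists_exponents {s α bs : ℝ} (hs : 1 / 2 < s) (hsα : s < α) (hα : α ≤ 1)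
    (hbs : 1 / 4 + 1 / 2 * (1 - s) < bs) (hbs' : bs < 1 / 2) :
    ∃ b₀ : ℝ, 1 / 2 < b₀ ∧ ∀ b : ℝ, 1 / 2 < b → b < b₀ → ∃ q θ ε : ℝ, 0 < θ ∧
      θ / q = 1 + 2 * b - 4 * bs ∧ duhamelConst b q < ⊤ ∧
      ∀ C₀ : ℝ, nonlinConst s C₀ b q θ ε < ⊤ ∧
        ∀ w, IsWeight s C₀ w → Admissible α s C₀ b q θ ε w := by
  set γ : ℝ := bs - (1 / 4 + 1 / 2 * (1 - s)) with hγ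
  have hγ0 : 0 < γ := by linarith
  refine ⟨1 / 2 + min γ (1 / 4) / 2, by have := lt_min hγ0 (by norm_num : (0 : ℝ) < 1 / 4); linarith,
    fun b hb hb' => ?_⟩
  have hx1 : b - 1 / 2 < γ / 2 := by have := min_le_left γ (1 / 4); linarith
  have hx2 : b < 5 / 8 := by have := min_le_right γ (1 / 4); linarith
  set q : ℝ := (2 - 2 * b)⁻¹ with hq
  have hd : 0 < 2 - 2 * b := by linarith
  have hq0 : 0 < q := inv_pos.2 hd
  have hqd : q * (2 - 2 * b) = 1 := inv_mul_cancel₀ hd.ne'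
  set κ : ℝ := 1 + 2 * b - 4 * bs with hκ
  have hκ0 : 0 < κ := by linarith
  have hq1 : 1 ≤ q := (one_le_inv₀ hd).2 (by linarith)
  have hq2 : q ≤ 2 := by nlinarith
  have hneg : 2 * (1 - s) - (2 - 2 * b) + κ < 0 := by linarith
  -- the slack `ρ > 0` in the sum over dyadic blocks leaves room for the loss `ε`
  set ρ : ℝ := -(2 * (1 - s) - (2 - 2 * b) + κ) with hρ
  set ε : ℝ := min 1 (ρ / 2) with hε
  have hε0 : 0 < ε := lt_min one_pos (by linarith)
  have hερ : ε ≤ ρ / 2 := min_le_right _ _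
  have hθ0 : 0 < q * κ := mul_pos hq0 hκ0
  have hθ1 : q * κ ≤ 1 := by
    rw [← hqd]
    exact mul_le_mul_of_nonneg_left (by linarith) hq0.le
  refine ⟨q, q * κ, ε, hθ0, mul_div_cancel_left₀ _ hq0.ne', ?_, fun C₀ => ⟨?_, fun w hw => ?_⟩⟩
  · refine duhamelConst_lt_top ?_
    rw [hq, div_inv_eq_mul]
    linarith
  · refine nonlinConst_lt_top hb hq1 hθ0.le hθ1 ?_
    have e : 2 * q * (1 - s) - 1 + q * κ + ε * q = q * (ε - ρ) := by
      rw [hρ]; linear_combination hqd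
    rw [e]
    exact mul_neg_of_pos_of_neg hq0 (by linarith)
  · exact ⟨by linarith, hs.le, hb, by linarith, hq1, hq2, hθ0.le, hθ1, hε0, min_le_left _ _, hw⟩

theorem ofReal_rpow_mul_sq {κ R : ℝ} (hκ : 0 < κ) (hR : 1 ≤ R) :
    ENNReal.ofReal (R ^ (-(2 / κ))) ^ κ * ENNReal.ofReal R ^ 2 = 1 := by
  have hR0 : 0 < R := one_pos.trans_le hR
  rw [ENNReal.ofReal_rpow_of_pos (Real.rpow_pos_of_pos hR0 _), ← ENNReal.ofReal_pow hR0.le,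
    ← ENNReal.ofReal_mul (by positivity), ← Real.rpow_mul hR0.le, ← Real.rpow_natCast,
    ← Real.rpow_add hR0]
  rw [show -(2 / κ) * κ + ((2 : ℕ) : ℝ) = 0 by
    rw [neg_mul, div_mul_cancel₀ _ hκ.ne']; norm_num, Real.rpow_zero, ENNReal.ofReal_one]

/-- The smallness condition for the contraction at time `δ = c R^{-p}`. -/
theorem small_of_time {A D K : ℝ≥0∞} {κ η R δ l r : ℝ} (hκ : 0 < κ)
    (hη : 48 * A * D ^ 3 * ENNReal.ofReal (2 * η) ^ κ ≤ 1 / 2) (hη0 : 0 ≤ η) (hR : 1 ≤ R)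
    (hδ : δ ≤ η * R ^ (-(2 / κ))) (hl : -δ ≤ l) (hr : r ≤ δ) (hK : K ≤ 4 * D * ENNReal.ofReal R) :
    D * (3 * A * volume (Icc l r) ^ κ * K ^ 2) ≤ 1 / 2 := by
  have hR0 : 0 < R := one_pos.trans_le hR
  have hv : volume (Icc l r) ≤ ENNReal.ofReal (2 * η) * ENNReal.ofReal (R ^ (-(2 / κ))) := by
    rw [Real.volume_Icc, ← ENNReal.ofReal_mul (by linarith)]
    exact ENNReal.ofReal_le_ofReal (by linarith)
  calc _ ≤ D * (3 * A * (ENNReal.ofReal (2 * η) * ENNReal.ofReal (R ^ (-(2 / κ)))) ^ κ *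
        (4 * D * ENNReal.ofReal R) ^ 2) := by gcongr
    _ = 48 * A * D ^ 3 * ENNReal.ofReal (2 * η) ^ κ *
        (ENNReal.ofReal (R ^ (-(2 / κ))) ^ κ * ENNReal.ofReal R ^ 2) := by
        rw [ENNReal.mul_rpow_of_nonneg _ _ hκ.le]; ring
    _ ≤ 1 / 2 := by rw [ofReal_rpow_mul_sq hκ hR, mul_one]; exact hη

/-- The lower bound for the time of existence in terms of the size of the data in `H^s`. -/
theorem time_lower_bound {c C N x y p σ : ℝ} (hc : 0 < c) (hp : 0 ≤ p) (hσ : 0 ≤ σ) (hN : 1 ≤ N)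
    (hC : 2 ^ p / c ≤ C) (h : x ≤ 2 * N ^ σ * y) :
    C⁻¹ * (max 1 y) ^ (-p) * N ^ (-(p * σ)) ≤ c * (max 1 x) ^ (-p) := by
  have hN0 : 0 < N := one_pos.trans_le hN
  have hy : 0 < max 1 y := lt_of_lt_of_le one_pos (le_max_left _ _)
  have hx : 0 < max 1 x := lt_of_lt_of_le one_pos (le_max_left _ _)
  have hNσ : 1 ≤ N ^ σ := Real.one_le_rpow hN hσ
  have h1 : max 1 x ≤ 2 * N ^ σ * max 1 y := by
    refine max_le ?_ (h.trans (by gcongr; exact le_max_right _ _))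
    nlinarith [le_max_left 1 y]
  have h2 : (2 * N ^ σ * max 1 y) ^ (-p) ≤ (max 1 x) ^ (-p) :=
    Real.rpow_le_rpow_of_nonpos hx h1 (by linarith)
  rw [Real.mul_rpow (by positivity) hy.le, Real.mul_rpow zero_le_two (by positivity),
    ← Real.rpow_mul hN0.le, Real.rpow_neg zero_le_two] at h2
  have h3 : C⁻¹ ≤ c * (2 ^ p)⁻¹ := by
    rw [← div_eq_mul_inv, ← inv_div]
    exact inv_anti₀ (by positivity) hC
  calc _ ≤ (c * (2 ^ p)⁻¹) * (max 1 y) ^ (-p) * N ^ (-(p * σ)) := by gcongr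
    _ = c * ((2 ^ p)⁻¹ * N ^ (σ * -p) * (max 1 y) ^ (-p)) := by
        rw [show σ * -p = -(p * σ) by ring]; ring
    _ ≤ _ := by gcongr

theorem Represented.Icc_of_Ioo {α b : ℝ} {l r : ℝ} {u : ℝ → ℕ → ℂ} {K : ℝ≥0∞}
    (h : Represented α b w (Ioo l r) u K) : Represented α b w (Icc l r) u K := by
  obtain ⟨k, hm, hK, he⟩ := h
  exact ⟨k, hm, hK, by rwa [← restrict_Ioo_eq_restrict_Icc]⟩

/-! ### Local well-posedness -/

/-- Existence on `[-c R^{-p}, c R^{-p}]` for data of size at most `R`. -/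
theorem exists_isMild_of_le {α s b q θ ε κ η δ R : ℝ} {m : ℝ → ℝ} {c : ℕ → ℂ}
    (hA : Admissible α s iWeightConst b q θ ε (iWeight α m)) (hα : α ≤ 1) (hκ0 : 0 < κ)
    (hκ : θ / q = κ) (hD : duhamelConst b q < ⊤) (hN : nonlinConst s iWeightConst b q θ ε < ⊤)
    (hη : 48 * nonlinConst s iWeightConst b q θ ε * duhamelConst b q ^ 3 *
      ENNReal.ofReal (2 * η) ^ κ ≤ 1 / 2) (hη0 : 0 ≤ η) (hR : 1 ≤ R) (hδ0 : 0 ≤ δ)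
    (hδ1 : δ ≤ 1 / 2) (hδ : δ ≤ η * R ^ (-(2 / κ))) (hc : hsNorm α (iOp m c) ≤ ENNReal.ofReal R) :
    ∃ u, IsMild α (iWeight α m) c (Icc (-δ) δ) u ∧
      (∀ n, ContinuousOn (fun t => force α u t n) (Icc (-δ) δ)) ∧
      modNorm b (iWeight α m) (profile c (Icc (-δ) δ) (force α u)) ≤
        4 * duhamelConst b q * hsNorm α (iOp m c) ∧
      RepresentedOn α b (iWeight α m) (Icc (-δ) δ) u (4 * duhamelConst b q * ENNReal.ofReal R) := by
  have hα0 : 0 ≤ α := by linarith [hA.half_le_α]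
  have hcw := wNorm_iWeight_le (m := m) hα0 hα c
  have hK : 2 * duhamelConst b q * wNorm (iWeight α m) c ≤
      4 * duhamelConst b q * hsNorm α (iOp m c) := by
    calc _ ≤ 2 * duhamelConst b q * (2 * hsNorm α (iOp m c)) := by gcongr
      _ = _ := by ring
  have hKR : 2 * duhamelConst b q * wNorm (iWeight α m) c ≤
      4 * duhamelConst b q * ENNReal.ofReal R := hK.trans (by gcongr)
  have hcf : wNorm (iWeight α m) c < ⊤ :=
    hcw.trans_lt (ENNReal.mul_lt_top (by simp) (hc.trans_lt ENNReal.ofReal_lt_top))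
  obtain ⟨u, h1, h2, h3, h, hm, h4, h5⟩ := exists_isMild (l := -δ) (r := δ) hA hD hN (by linarith)
    (by linarith) hδ0 hδ1 hcf rfl (by
      rw [hκ]; exact small_of_time hκ0 hη hη0 hR hδ le_rfl le_rfl hKR)
  exact ⟨u, h1, h2, h3.trans hK, h, hm, h4.trans hKR, h5⟩

end DiskFNLS

end

theorem proposition4p1 (α s : ℝ) (hs : 1 / 2 < s) (hsα : s < α) (hα : α ≤ 1)
    -- `bs` is `b(s) = 1/4 + (1-s)/2 +`
    (bs : ℝ) (hbs : 1 / 4 + 1 / 2 * (1 - s) < bs) (hbs' : bs < 1 / 2) :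
    ∃ b₀ : ℝ, 1 / 2 < b₀ ∧ ∀ b : ℝ, 1 / 2 < b → b < b₀ →
    ∃ c C : ℝ, 0 < c ∧ 0 < C ∧
    ∀ N : ℝ, 1 ≤ N → ∀ m : ℝ → ℝ, IsIMultiplier α s N m →
      -- sizes, existence with bounds, uniqueness
      (∀ u₀ : ℕ → ℂ, hsNorm α (iOp m u₀) < ⊤ →
        hsNorm s u₀ < ⊤ ∧
        hsNorm α (iOp m u₀) ≤ ENNReal.ofReal (C * N ^ (α - s)) * hsNorm s u₀ ∧
        ∀ δ : ℝ, δ = c * (max 1 (hsNorm α (iOp m u₀)).toReal) ^ (-(2 / (1 + 2 * b - 4 * bs))) →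
          C⁻¹ * (max 1 (hsNorm s u₀).toReal) ^ (-(2 / (1 + 2 * b - 4 * bs))) *
            N ^ (-(2 * (α - s) / (1 + 2 * b - 4 * bs))) ≤ δ ∧
          ∃ u : ℝ → ℕ → ℂ,
            IsSolution α m u₀ (Icc (-δ) δ) u ∧
            xsbNormOn (Ioo (-δ) δ) α α b (fun t => iOp m (u t)) ≤
              ENNReal.ofReal C * hsNorm α (iOp m u₀) ∧
            ∀ v : ℝ → ℕ → ℂ, IsSolution α m u₀ (Icc 0 δ) v →
              xsbNormOn (Icc 0 δ) α α b (fun t => iOp m (v t)) < ⊤ →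
              EqOn v u (Icc 0 δ)) ∧
      -- Lipschitz dependence on the data, on every ball `‖I u₀‖_{H^α} ≤ R`
      (∀ R : ℝ, 1 ≤ R → ∀ δ : ℝ, δ = c * R ^ (-(2 / (1 + 2 * b - 4 * bs))) →
        ∀ u₀ v₀ : ℕ → ℂ, hsNorm α (iOp m u₀) ≤ ENNReal.ofReal R →
          hsNorm α (iOp m v₀) ≤ ENNReal.ofReal R →
        ∀ u v : ℝ → ℕ → ℂ,
          IsSolution α m u₀ (Icc (-δ) δ) u → IsSolution α m v₀ (Icc (-δ) δ) v →
          xsbNormOn (Ioo (-δ) δ) α α b (fun t => iOp m (u t)) < ⊤ →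
          xsbNormOn (Ioo (-δ) δ) α α b (fun t => iOp m (v t)) < ⊤ →
          xsbNormOn (Ioo (-δ) δ) α α b (fun t => iOp m (u t) - iOp m (v t)) ≤
            ENNReal.ofReal C * hsNorm α (iOp m u₀ - iOp m v₀) ∧
          ∀ t ∈ Icc (-δ) δ, hsNorm α (iOp m (u t) - iOp m (v t)) ≤
            ENNReal.ofReal C * hsNorm α (iOp m u₀ - iOp m v₀)) := by
  obtain ⟨b₀, hb₀, H⟩ := exists_exponents hs hsα hα hbs hbs'
  refine ⟨b₀, hb₀, fun b hb hb' => ?_⟩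
  obtain ⟨q, θ, ε, hθ, hκ, hD, hNA⟩ := H b hb hb'
  obtain ⟨hA0, hadm⟩ := hNA iWeightConst
  have hκ0 : 0 < 1 + 2 * b - 4 * bs := by linarith
  have hα0 : 0 ≤ α := by linarith
  set κ : ℝ := 1 + 2 * b - 4 * bs with hκd
  have hM : modConst b ^ (1 / 2 : ℝ) < ⊤ :=
    ENNReal.rpow_lt_top_of_nonneg (by norm_num) (modConst_lt_top hb).ne
  obtain ⟨η, hη, hηs⟩ := exists_small_time
    (D := 48 * nonlinConst s iWeightConst b q θ ε * duhamelConst b q ^ 3)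
    (ENNReal.mul_lt_top (ENNReal.mul_lt_top (by simp) hA0) (ENNReal.pow_lt_top hD)) hκ0
  set D := duhamelConst b q with hDd
  set E := modConst b ^ (1 / 2 : ℝ) with hEd
  set c : ℝ := min η (1 / 2) with hc
  have hc0 : 0 < c := lt_min hη (by norm_num)
  have hp0 : 0 < 2 / κ := div_pos two_pos hκ0
  set C : ℝ := 2 + 2 ^ (2 / κ) / c + 4 * D.toReal + 4 * D.toReal * E.toReal with hC
  have hp2 : 0 < (2 : ℝ) ^ (2 / κ) / c := div_pos (Real.rpow_pos_of_pos two_pos _) hc0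
  have hDr : 0 ≤ D.toReal := ENNReal.toReal_nonneg
  have hDE : 0 ≤ D.toReal * E.toReal := mul_nonneg hDr ENNReal.toReal_nonneg
  have hC1 : 4 * D ≤ ENNReal.ofReal C := by
    rw [← ENNReal.ofReal_toReal hD.ne, ← ENNReal.ofReal_ofNat 4, ← ENNReal.ofReal_mul (by norm_num)]
    exact ENNReal.ofReal_le_ofReal (by linarith)
  have hC2 : 4 * D * E ≤ ENNReal.ofReal C := by
    rw [← ENNReal.ofReal_toReal hD.ne, ← ENNReal.ofReal_toReal hM.ne, ← ENNReal.ofReal_ofNat 4,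
      ← ENNReal.ofReal_mul (by norm_num), ← ENNReal.ofReal_mul (by positivity)]
    exact ENNReal.ofReal_le_ofReal (by linarith)
  refine ⟨c, C, hc0, by linarith, fun N hN m hm => ?_⟩
  have hN0 : 0 < N := one_pos.trans_le hN
  have hw := isWeight_iWeight hm hN (by linarith) hsα.le hα
  have hA := hadm _ hw
  have hmp : ∀ n, 0 < m (besselZero n) := fun n =>
    hm.pos hN hsα.le (by linarith) (besselZero_pos n).le
  -- the times of existence are in the range of the linear estimates
  have hδ : ∀ {R δ : ℝ}, 1 ≤ R → δ = c * R ^ (-(2 / κ)) →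
      0 ≤ δ ∧ δ ≤ 1 / 2 ∧ δ ≤ η * R ^ (-(2 / κ)) := by
    intro R δ hR hδ
    have h1 : 0 < R ^ (-(2 / κ)) := Real.rpow_pos_of_pos (one_pos.trans_le hR) _
    have h2 : R ^ (-(2 / κ)) ≤ 1 := Real.rpow_le_one_of_one_le_of_nonpos hR (by linarith)
    have h3 : c ≤ 1 / 2 := min_le_right _ _
    have h4 : c ≤ η := min_le_left _ _
    subst hδ
    exact ⟨by positivity, by nlinarith, by gcongr⟩
  refine ⟨fun u₀ hu₀ => ⟨?_, ?_, fun δ hδe => ⟨?_, ?_⟩⟩, fun R hR δ hδe u₀ v₀ hu₀ hv₀ u v hu hv fu fv => ?_⟩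
  · exact (hsNorm_le_iOp hm hN hsα.le (by linarith) u₀).trans_lt (ENNReal.mul_lt_top (by simp) hu₀)
  · refine (hsNorm_iOp_le_rpow_mul hm hN hsα.le (by linarith) u₀).trans ?_
    gcongr
    linarith
  · have hfin : hsNorm s u₀ < ⊤ :=
      (hsNorm_le_iOp hm hN hsα.le (by linarith) u₀).trans_lt (ENNReal.mul_lt_top (by simp) hu₀)
    have h1 := ENNReal.toReal_mono (ENNReal.mul_lt_top ENNReal.ofReal_lt_top hfin).ne
      (hsNorm_iOp_le_rpow_mul hm hN hsα.le (by linarith) u₀)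
    rw [ENNReal.toReal_mul, ENNReal.toReal_ofReal (by positivity)] at h1
    have h2 := time_lower_bound (C := C) hc0 hp0.le (by linarith : 0 ≤ α - s) hN (by linarith) h1
    rw [hδe, show 2 * (α - s) / κ = 2 / κ * (α - s) by ring]
    exact h2
  · have hR : 1 ≤ max 1 (hsNorm α (iOp m u₀)).toReal := le_max_left _ _
    obtain ⟨hδ0, hδ1, hδ2⟩ := hδ hR hδe
    obtain ⟨u, h1, h2, h3, h4⟩ := exists_isMild_of_le hA hα hκ0 hκ hD hA0 hηs hη.le hR hδ0 hδ1 hδ2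
      (by
        rw [← ENNReal.ofReal_toReal hu₀.ne]
        exact ENNReal.ofReal_le_ofReal (by simp))
    refine ⟨u, h1.isSolution hs.le hα0 hw (by linarith) hδ0, ?_, fun v hv fv => ?_⟩
    · refine (xsbNormOn_duhamel_le (α := α) hmp (by linarith) (by linarith) hδ0 hδ1 h2
        Ioo_subset_Icc_self fun t ht => h1.eq_duhamel t (Ioo_subset_Icc_self ht)).trans (h3.trans ?_)
      gcongr
    · have hsub : Icc 0 δ ⊆ Icc (-δ) δ := Icc_subset_Icc (by linarith) le_rfl
      obtain ⟨K, hK, rv⟩ := exists_represented_of_xsbNormOn hb hmp measurableSet_Icc fv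
      have hKm : max (4 * D * ENNReal.ofReal (max 1 (hsNorm α (iOp m u₀)).toReal)) K < ⊤ :=
        max_lt (ENNReal.mul_lt_top (ENNReal.mul_lt_top (by simp) hD) ENNReal.ofReal_lt_top) hK
      refine IsMild.unique (l := 0) (r := δ) hA hθ hD hA0 (by norm_num) le_rfl hδ0 hδ1 ?_
        (hv.isMild hs.le hα0 hα hw hmp le_rfl hδ0) (h1.mono hsub) (rv.mono Subset.rfl (le_max_right _ _))
        ((h4.represented measurableSet_Icc).mono hsub (le_max_left _ _)) hKm
      exact (wNorm_iWeight_le hα0 hα u₀).trans_lt (ENNReal.mul_lt_top (by simp) hu₀)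
  · obtain ⟨hδ0, hδ1, hδ2⟩ := hδ hR hδe
    -- by uniqueness a solution with finite norm is the one constructed, hence of size `O(R)`
    have hrep : ∀ {f₀ : ℕ → ℂ} {f : ℝ → ℕ → ℂ}, hsNorm α (iOp m f₀) ≤ ENNReal.ofReal R →
        IsSolution α m f₀ (Icc (-δ) δ) f →
        xsbNormOn (Ioo (-δ) δ) α α b (fun t => iOp m (f t)) < ⊤ →
        wNorm (iWeight α m) f₀ < ⊤ ∧ IsMild α (iWeight α m) f₀ (Icc (-δ) δ) f ∧
        Represented α b (iWeight α m) (Icc (-δ) δ) f (4 * D * ENNReal.ofReal R) := by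
      intro f₀ f hf₀ hf ff
      have hfin : wNorm (iWeight α m) f₀ < ⊤ := (wNorm_iWeight_le hα0 hα f₀).trans_lt
        (ENNReal.mul_lt_top (by simp) (hf₀.trans_lt ENNReal.ofReal_lt_top))
      obtain ⟨g, h1, -, -, h4⟩ := exists_isMild_of_le hA hα hκ0 hκ hD hA0 hηs hη.le hR hδ0 hδ1 hδ2 hf₀
      obtain ⟨K, hK, rf⟩ := exists_represented_of_xsbNormOn hb hmp measurableSet_Ioo ff
      have hKm : max (4 * D * ENNReal.ofReal R) K < ⊤ :=
        max_lt (ENNReal.mul_lt_top (ENNReal.mul_lt_top (by simp) hD) ENNReal.ofReal_lt_top) hK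
      have hf' := hf.isMild hs.le hα0 hα hw hmp (by linarith) hδ0
      have heq := IsMild.unique (l := -δ) (r := δ) hA hθ hD hA0 (by linarith) (by linarith) hδ0 hδ1
        hfin hf' h1 (rf.Icc_of_Ioo.mono Subset.rfl (le_max_right _ _))
        ((h4.represented measurableSet_Icc).mono Subset.rfl (le_max_left _ _)) hKm
      obtain ⟨h, hhm, hhK, hh⟩ := h4
      exact ⟨hfin, hf', RepresentedOn.represented measurableSet_Icc
        ⟨h, hhm, hhK, fun t ht => (heq ht).trans (hh t ht)⟩⟩
    obtain ⟨cu, mu, ru⟩ := hrep hu₀ hu fu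
    obtain ⟨cv, mv, rv⟩ := hrep hv₀ hv fv
    have hKf : 4 * D * ENNReal.ofReal R < ⊤ :=
      ENNReal.mul_lt_top (ENNReal.mul_lt_top (by simp) hD) ENNReal.ofReal_lt_top
    obtain ⟨p1, p2, p3⟩ := represented_sub (E := Icc (-δ) δ) (l := -δ) (r := δ) hA hD hA0
      (by linarith) (by linarith) hδ0 hδ1 cu cv mu mv ru rv hKf Subset.rfl measurableSet_Icc
      (fun t ht => (ht.2 ht.1).elim) (by
        rw [hκ]; exact small_of_time hκ0 hηs hη.le hR hδ2 le_rfl le_rfl le_rfl)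
    have p4 : modNorm b (iWeight α m)
        (profile (u₀ - v₀) (Icc (-δ) δ) fun t => force α u t - force α v t) ≤
        4 * D * hsNorm α (iOp m u₀ - iOp m v₀) := by
      refine p2.trans ?_
      rw [iOp_sub]
      calc _ ≤ 2 * D * (2 * hsNorm α (iOp m (u₀ - v₀))) := by
            gcongr
            exact wNorm_iWeight_le hα0 hα _
        _ = _ := by ring
    constructor
    · have hcts : ∀ n, ContinuousOn (fun t => (force α u t - force α v t) n) (Icc (-δ) δ) := fun n =>
        (mu.continuousOn_force α hs.le hw n).sub (mv.continuousOn_force α hs.le hw n)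
      have h1 := xsbNormOn_duhamel_le (α := α) (b := b) (u := fun t => u t - v t) hmp (by linarith)
        (by linarith) hδ0 hδ1 hcts Ioo_subset_Icc_self
        fun t ht => (p3 t (Ioo_subset_Icc_self ht)).1
      simp_rw [iOp_sub m (u _) (v _)]
      refine h1.trans (p4.trans ?_)
      gcongr
    · intro t ht
      rw [iOp_sub m (u t) (v t)]
      refine (hsNorm_iOp_le hα0 _).trans ?_
      rw [(p3 t ht).2]
      calc _ ≤ E * (4 * D * hsNorm α (iOp m u₀ - iOp m v₀)) :=
            (wNorm_evol_le α b p1 t).trans (by gcongr)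
        _ = 4 * D * E * hsNorm α (iOp m u₀ - iOp m v₀) := by ring
        _ ≤ _ := by gcongr
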